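/- **Conventions.** A metric signature $\mathcal L=(\mathcal S,\mathcal P,a,\Delta)$ has a set $\mathcal S$ of sorts, a set $\mathcal P$ of predicate symbols, an arity function $a:\mathcal P\to\mathcal S^{<\omega}$, and for each $P\in\mathcal P$ a continuous modulus $\Delta_P:[0,1]\to[0,1]$ with $\Delta_P(0)=0$. In an $\mathcal L$-structure $\mathfrak A$ each sort $O^{\mathfrak A}$ is a non-empty complete metric space of diameter $\le 1$, and each $P^{\mathfrak A}$ is a $[0,1]$-valued function on the product of its argument sorts with $|P(\bar x)-P(\bar y)|\le\Delta_P(\delta)$ whenever $\max_i d(x_i,y_i)\le\delta\le 1$. Restricted formulas are built from predicates and metrics by the connectives $0,\,1,\,x/2,\,x\dotdiv y$ and the quantifiers $\sup,\inf$. A formula is an expression $\sum_{n<\omega}2^{-(n+1)}\varphi_n$ with $\varphi_n$ restricted formulas having altogether finitely many free variables; it is computable if the sequence of codes of the $\varphi_n$ is. A theory is a set of conditions $\varphi=0$ with $\varphi$ a sentence. For a designated home sort $H$ and $0<r\le1$, $C_{\mathcal L,r}$ is the class of $\mathcal L$-structures with $\operatorname{diam}(H^{\mathfrak A})\ge r$.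 An imaginary of a class of structures is a sort obtained by finitely many of the following operations, given by formulas that do not depend on the structure: append a product of sorts $\prod_{i<n}O_i$, $0<n\le\omega$ (metric $\max_i d_i$ for finite $n$, $\sup_i2^{-i}d_i$ for $n=\omega$) with the projection predicates $d(x_i,y)$; append a non-empty definable subset of a sort with the inclusion predicate $d(x,y)$; append the (completed) quotient of a sort by a definable pseudo-metric $\rho$ with the quotient predicate $\rho(x,y)$. For a sequence $\mathscr S=(O_n)_{n<\omega}$ of sorts, the *countable metric disjoint union* is $U^{\mathfrak A}=\{\ast\}\cup\bigsqcup_{n<\omega}O_n^{\mathfrak A}$ with $d(x,y)=2^{-n}d_{O_n}(x,y)$ for $x,y\in O_n$, $d(x,z)=|2^{-n}-2^{-m}|$ for $x\in O_n$, $z\in O_m$, $n\ne m$, and $d(x,\ast)=2^{-n}$ for $x\in O_n$. Its predicates are $d(\cdot,\ast)$ and, for every $P\in\mathcal P$ and all indices $n_1,\dots,n_k$ with $a(P)=(O_{n_1},\dots,O_{n_k})$, the extension of $P$ from $O_{n_1}\times\dots\times O_{n_k}$ to $U^k$ by the value $1$. Let $\mathcal L_{\mathscr S}$ be the one-sorted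 signature with these symbols, with the modulus $t\mapsto t$ for $d(\cdot,\ast)$ and $t\mapsto\min\{\max\{\Delta_P(\min\{2^Nt,1\}),2^{N+1}t\},1\}$ for the extension of $P$, where $N=\max_i n_i$. "Uniformly computable from" given data means: computed by one oracle algorithm from any name of the data (a name of a signature whose sorts and predicate symbols are natural numbers consists of the characteristic functions of these two sets, the arity function, and the moduli as functions on $[0,1]$; a name of a presentation of a structure consists of approximations of the distances and predicate values on dense sequences). In particular, if the data are computable, so is the output. **Proposition.** (i) For every $\mathfrak A$, the function $d$ is a metric on $U^{\mathfrak A}$, and it is complete. (ii) The predicates of $U^{\mathfrak A}$ are uniformly continuous, with the moduli of $\mathcal L_{\mathscr S}$, so that $U^{\mathfrak A}$ is an $\mathcal L_{\mathscr S}$-structure; $d(\cdot,\ast)$ is $1$-Lipschitz. For every $P$, all indices as above, and every $K$ there is $K'$ such that in every $\mathfrak A$ in which $P$ is $K$-Lipschitz, the extension of $P$ is $K'$-Lipschitz; moreover, if $\Delta_P(t)\le Kt$ for all $t$, then the modulus of the extension at $t$ is at most $K't$ for all $t$. (iii) For all $\mathcal L$, $H$, $\mathscr S$ and $0<r\le1$,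 there are an imaginary $Y$ of $C_{\mathcal L,r}$ and formulas in the corresponding expansion such that, for every $\mathfrak A\in C_{\mathcal L,r}$, $Y^{\mathfrak A}$ is isometric to $U^{\mathfrak A}$ by an isometry that takes the values of these formulas to those of the predicates of $U^{\mathfrak A}$. All formulas involved are uniformly computable from $\mathcal L$ (with $H$), $\mathscr S$ and $r$. The map of presentations $\mathfrak A\mapsto U^{\mathfrak A}$ is uniformly computable from $\mathcal L$ and $\mathscr S$; if these are computable, it is a computable map. (iv) For every $n$, the distance to $O_n\subseteq U$ is given in all $U^{\mathfrak A}$ by one $\mathcal L_{\mathscr S}$-formula, uniformly computable from $\mathcal L$ and $\mathscr S$. For the imaginary $Y$ and the isometries in (iii), the distance to $O_n\subseteq Y$ is given by a formula of the expansion, and the bijection $f$ from the sort $O_n$ onto the subset $O_n$ of $Y$ is definable, i.e. $d_Y(f(x),y)$ is given by a formula of the expansion. These formulas do not depend on $\mathfrak A\in C_{\mathcal L,r}$ and are uniformly computable from $\mathcal L$ (with $H$), $\mathscr S$ and $r$. (v) Suppose that the sorts $O_n$ are pairwise distinct and $O_0=H$. Then there are an $\mathcal L_{\mathscr S}$-theory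 $T_{\mathscr S}$ and an $\mathcal L_{\mathscr S}$-sentence $\Xi_{\mathscr S}$ such that, for every $r\in(0,1]$, an $\mathcal L_{\mathscr S}$-structure is a model of $T_{\mathscr S}\cup\{\Xi_{\mathscr S}\ge r\}$ if and only if it is isomorphic to $U^{\mathfrak A}$ for some $\mathfrak A\in C_{\mathcal L,r}$. The signature $\mathcal L_{\mathscr S}$ is uniformly computable from $\mathcal L$ and $\mathscr S$, and $T_{\mathscr S}$ can be taken as a sequence of conditions that is uniformly computable from $\mathcal L$ and $\mathscr S$. -/

import Mathlib

universe u v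

namespace MetricLogic

/-! ## Sorts, vocabularies, signatures -/

/-- A possible interpretation of a sort: a non-empty complete metric space of diameter at
most one. -/
structure MSort : Type (u + 1) where
  carrier : Type u
  metric : MetricSpace carrier
  complete : CompleteSpace carrier
  nonempty : Nonempty carrier
  dist_le_one : ∀ x y : carrier, dist x y ≤ 1

instance : CoeSort MSort.{u} (Type u) := ⟨MSort.carrier⟩

attribute [instance] MSort.metric MSort.complete MSort.nonempty

/-- A many-sorted purely relational vocabulary. The predicate symbol `p` takes `ar p` arguments,
the `i`-th of which has sort `dom p i`. -/
structure Vocab : Type (v + 1) where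
  Sorts : Type v
  Preds : Type v
  ar : Preds → ℕ
  dom : (p : Preds) → Fin (ar p) → Sorts

/-- A metric signature: a vocabulary together with, for each predicate symbol, a syntactic
modulus of uniform continuity `[0,1] → [0,1]`. -/
structure MetricSignature : Type (v + 1) extends Vocab.{v} where
  modulus : Preds → unitInterval → unitInterval
  modulus_continuous : ∀ p, Continuous (modulus p)
  modulus_zero : ∀ p, modulus p 0 = 0

/-- An interpretation of a vocabulary: sorts are complete metric spaces of diameter at most one,
predicates are `[0,1]`-valued. (Moduli of uniform continuity are imposed in `LStructure`.) -/
structure PreStructure (V : Vocab.{v}) : Type (max v (u + 1)) where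
  sort : V.Sorts → MSort.{u}
  pred : (p : V.Preds) → (∀ i, sort (V.dom p i)) → ℝ
  pred_mem : ∀ p x, pred p x ∈ Set.Icc (0 : ℝ) 1

/-- Every predicate has its syntactic modulus as a modulus of uniform continuity, with respect to
the maximum metric on tuples. -/
def PreStructure.Respects (L : MetricSignature.{v}) (A : PreStructure.{u, v} L.toVocab) : Prop :=
  ∀ (p : L.Preds) (δ : unitInterval) (x y : ∀ i, A.sort (L.dom p i)),
    (∀ i, dist (x i) (y i) ≤ (δ : ℝ)) → |A.pred p x - A.pred p y| ≤ (L.modulus p δ : ℝ)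

/-- Structures for a metric signature. -/
structure LStructure (L : MetricSignature.{v}) : Type (max v (u + 1))
    extends PreStructure.{u, v} L.toVocab where
  respects : toPreStructure.Respects L

/-- Isomorphism of interpretations of a vocabulary. -/
def Isomorphic {V : Vocab.{v}} (A B : PreStructure.{u, v} V) : Prop :=
  ∃ e : ∀ s, A.sort s ≃ᵢ B.sort s,
    ∀ (p : V.Preds) (x : ∀ i, A.sort (V.dom p i)), B.pred p (fun i => e _ (x i)) = A.pred p x

/-- Membership in the class `C_{L,r}`, where `H` is the designated home sort. -/
def InClass {L : MetricSignature.{v}} (H : L.Sorts) (r : ℝ) (A : LStructure.{u, v} L) : Prop :=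
  r ≤ Metric.diam (Set.univ : Set (A.sort H))

/-! ## Formulas -/

/-- Restricted formulas: the connectives are `0`, `1`, `x / 2` and truncated subtraction. The
variables are the pairs `(s, i)`, with `s` a sort and `i` a natural number. -/
inductive RFormula (V : Vocab.{v}) : Type v
  | zero : RFormula V
  | one : RFormula V
  | half : RFormula V → RFormula V
  | sub : RFormula V → RFormula V → RFormula V
  | dist : V.Sorts → ℕ → ℕ → RFormula V
  | pred : (p : V.Preds) → (Fin (V.ar p) → ℕ) → RFormula V
  | sup : V.Sorts → ℕ → RFormula V → RFormula V
  | inf : V.Sorts → ℕ → RFormula V → RFormula V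

/-- Free variables. -/
def RFormula.free {V : Vocab.{v}} : RFormula V → Set (V.Sorts × ℕ)
  | .zero => ∅
  | .one => ∅
  | .half φ => φ.free
  | .sub φ ψ => φ.free ∪ ψ.free
  | .dist s i j => {(s, i), (s, j)}
  | .pred p idx => Set.range fun i => (V.dom p i, idx i)
  | .sup s i φ => φ.free \ {(s, i)}
  | .inf s i φ => φ.free \ {(s, i)}

/-- Assignments of values to all variables. -/
def PreStructure.Val {V : Vocab.{v}} (A : PreStructure.{u, v} V) : Type (max u v) :=
  ∀ s, ℕ → A.sort s

open Classical in
/-- Change the value of the variable `(s, i)` to `a`. -/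
noncomputable def PreStructure.Val.upd {V : Vocab.{v}} {A : PreStructure.{u, v} V} (w : A.Val)
    (s : V.Sorts) (i : ℕ) (a : A.sort s) : A.Val :=
  fun t j => if h : s = t ∧ i = j then h.1 ▸ a else w t j

/-- An arbitrary assignment. -/
noncomputable def PreStructure.base {V : Vocab.{v}} (A : PreStructure.{u, v} V) : A.Val :=
  fun s _ => Classical.choice (A.sort s).nonempty

/-- Value of a restricted formula. -/
noncomputable def RFormula.eval {V : Vocab.{v}} (A : PreStructure.{u, v} V) :
    RFormula V → A.Val → ℝ
  | .zero, _ => 0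
  | .one, _ => 1
  | .half φ, w => φ.eval A w / 2
  | .sub φ ψ, w => max (φ.eval A w - ψ.eval A w) 0
  | .dist s i j, w => Dist.dist (w s i) (w s j)
  | .pred p idx, w => A.pred p fun i => w (V.dom p i) (idx i)
  | .sup s i φ, w => ⨆ a : A.sort s, φ.eval A (w.upd s i a)
  | .inf s i φ, w => ⨅ a : A.sort s, φ.eval A (w.upd s i a)

/-- The expression `∑ n, 2 ^ -(n+1) * φ n`, for a sequence of restricted formulas `φ`. Wherever
such a sequence is used, its free variables are confined to a finite set by `Formula.FreeIn`, so
that only finitary formulas occur. -/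
abbrev Formula (V : Vocab.{v}) : Type v := ℕ → RFormula V

/-- Value of a formula. -/
noncomputable def Formula.eval {V : Vocab.{v}} (A : PreStructure.{u, v} V) (φ : Formula V)
    (w : A.Val) : ℝ :=
  ∑' n, (1 / 2 : ℝ) ^ (n + 1) * (φ n).eval A w

/-- All free variables of `φ` belong to `F`. -/
def Formula.FreeIn {V : Vocab.{v}} (φ : Formula V) (F : Set (V.Sorts × ℕ)) : Prop :=
  ∀ n, (φ n).free ⊆ F

theorem RFormula.eval_mem {V : Vocab.{v}} (A : PreStructure.{u, v} V) (φ : RFormula V) :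
    ∀ w : A.Val, φ.eval A w ∈ Set.Icc (0 : ℝ) 1 := by
  induction φ with
  | zero => intro w; simp [RFormula.eval]
  | one => intro w; simp [RFormula.eval]
  | half φ ih =>
    intro w
    have := ih w
    simp only [RFormula.eval, Set.mem_Icc] at *
    constructor <;> linarith
  | sub φ ψ ih ih' =>
    intro w
    have h1 := ih w
    have h2 := ih' w
    simp only [RFormula.eval, Set.mem_Icc] at *
    exact ⟨le_max_right _ _, max_le (by linarith) zero_le_one⟩
  | dist s i j => intro w; exact ⟨dist_nonneg, (A.sort s).dist_le_one _ _⟩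
  | pred p idx => intro w; exact A.pred_mem _ _
  | sup s i φ ih =>
    intro w
    exact ⟨Real.iSup_nonneg fun a => (ih _).1, ciSup_le fun a => (ih _).2⟩
  | inf s i φ ih =>
    intro w
    refine ⟨Real.iInf_nonneg fun a => (ih _).1, ?_⟩
    have a : A.sort s := Classical.choice (A.sort s).nonempty
    exact (ciInf_le ⟨0, by rintro _ ⟨b, rfl⟩; exact (ih _).1⟩ a).trans (ih _).2

theorem Formula.eval_mem {V : Vocab.{v}} (A : PreStructure.{u, v} V) (φ : Formula V)
    (w : A.Val) : φ.eval A w ∈ Set.Icc (0 : ℝ) 1 := by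
  have hs : HasSum (fun n : ℕ => (1 / 2 : ℝ) ^ (n + 1)) 1 := by
    have := hasSum_geometric_two.mul_right (1 / 2 : ℝ)
    simpa [pow_succ] using this
  have h0 : ∀ n, 0 ≤ (1 / 2 : ℝ) ^ (n + 1) * (φ n).eval A w := fun n =>
    mul_nonneg (by positivity) ((φ n).eval_mem A w).1
  have h1 : ∀ n, (1 / 2 : ℝ) ^ (n + 1) * (φ n).eval A w ≤ (1 / 2 : ℝ) ^ (n + 1) := fun n =>
    mul_le_of_le_one_right (by positivity) ((φ n).eval_mem A w).2
  refine ⟨tsum_nonneg h0, ?_⟩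
  rw [← hs.tsum_eq]
  exact (Summable.of_nonneg_of_le h0 h1 hs.summable).tsum_le_tsum h1 hs.summable

/-- Value of a formula in the variable `(o, 0)` at `x`. -/
noncomputable def Formula.val₁ {V : Vocab.{v}} (A : PreStructure.{u, v} V) (φ : Formula V)
    (o : V.Sorts) (x : A.sort o) : ℝ :=
  φ.eval A (A.base.upd o 0 x)

/-- Value of a formula in the variables `(o, 0)` and `(o, 1)` at `x` and `y`. -/
noncomputable def Formula.val₂ {V : Vocab.{v}} (A : PreStructure.{u, v} V) (φ : Formula V)
    (o : V.Sorts) (x y : A.sort o) : ℝ :=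
  φ.eval A ((A.base.upd o 0 x).upd o 1 y)

/-! ## Building new sorts -/

/-- A non-empty finite product, with the maximum metric. -/
noncomputable def MSort.finProd {n : ℕ} (X : Fin (n + 1) → MSort.{u}) : MSort.{u} where
  carrier := ∀ i, X i
  metric := inferInstance
  complete := inferInstance
  nonempty := inferInstance
  dist_le_one x y := (dist_pi_le_iff zero_le_one).2 fun i => (X i).dist_le_one _ _

/-- The metric `sup_i 2 ^ -i * d_i` on a countably infinite product. -/
@[reducible] noncomputable def MSort.omegaMetric (X : ℕ → MSort.{u}) :
    MetricSpace (∀ i, X i) :=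
  have hb : ∀ x y : ∀ i, X i,
      BddAbove (Set.range fun i => (1 / 2 : ℝ) ^ i * dist (x i) (y i)) := fun _ _ =>
    ⟨1, by
      rintro _ ⟨i, rfl⟩
      exact mul_le_one₀ (pow_le_one₀ (by norm_num) (by norm_num)) dist_nonneg
        ((X i).dist_le_one _ _)⟩
  { dist := fun x y => ⨆ i, (1 / 2 : ℝ) ^ i * dist (x i) (y i)
    dist_self := fun x => by simp
    dist_comm := fun x y => by simp only [dist_comm]
    dist_triangle := fun x y z => by
      refine ciSup_le fun i => ?_
      have h1 := le_ciSup (hb x y) i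
      have h2 := le_ciSup (hb y z) i
      have h3 := mul_le_mul_of_nonneg_left (dist_triangle (x i) (y i) (z i))
        (by positivity : (0 : ℝ) ≤ (1 / 2 : ℝ) ^ i)
      linarith
    eq_of_dist_eq_zero := fun {x y} h => by
      funext i
      have h1 := le_ciSup (hb x y) i
      have h0 : (1 / 2 : ℝ) ^ i * dist (x i) (y i) ≤ 0 := h1.trans (le_of_eq h)
      have hp : (0 : ℝ) < (1 / 2 : ℝ) ^ i := by positivity
      exact dist_le_zero.1 (by nlinarith [dist_nonneg (x := x i) (y := y i)]) }

theorem MSort.omega_le (X : ℕ → MSort.{u}) (x y : ∀ i, X i) (i : ℕ) :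
    (1 / 2 : ℝ) ^ i * dist (x i) (y i) ≤ (MSort.omegaMetric X).dist x y :=
  le_ciSup (f := fun i => (1 / 2 : ℝ) ^ i * dist (x i) (y i))
    ⟨1, by
      rintro _ ⟨i, rfl⟩
      exact mul_le_one₀ (pow_le_one₀ (by norm_num) (by norm_num)) dist_nonneg
        ((X i).dist_le_one _ _)⟩ i

theorem MSort.omega_complete (X : ℕ → MSort.{u}) :
    @CompleteSpace (∀ i, X i)
      (MSort.omegaMetric X).toPseudoMetricSpace.toUniformSpace := by
  let _ := MSort.omegaMetric X
  refine Metric.complete_of_cauchySeq_tendsto fun u hu => ?_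
  have hp : ∀ i : ℕ, (0 : ℝ) < (1 / 2 : ℝ) ^ i := fun i => by positivity
  have hc : ∀ i, CauchySeq fun n => u n i := fun i => by
    rw [Metric.cauchySeq_iff] at hu ⊢
    intro ε hε
    obtain ⟨N, hN⟩ := hu ((1 / 2 : ℝ) ^ i * ε) (mul_pos (hp i) hε)
    refine ⟨N, fun m hm n hn => ?_⟩
    have h1 := (MSort.omega_le X (u m) (u n) i).trans_lt (hN m hm n hn)
    exact lt_of_mul_lt_mul_left h1 (hp i).le
  choose a ha using fun i => cauchySeq_tendsto_of_complete (hc i)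
  refine ⟨a, ?_⟩
  rw [Metric.tendsto_atTop]
  rw [Metric.cauchySeq_iff] at hu
  intro ε hε
  obtain ⟨N, hN⟩ := hu (ε / 2) (half_pos hε)
  refine ⟨N, fun n hn => ?_⟩
  refine lt_of_le_of_lt (?_ : _ ≤ ε / 2) (half_lt_self hε)
  refine ciSup_le fun i => ?_
  have ht : Filter.Tendsto (fun m => (1 / 2 : ℝ) ^ i * dist (u n i) (u m i)) Filter.atTop
      (nhds ((1 / 2 : ℝ) ^ i * dist (u n i) (a i))) :=
    (tendsto_const_nhds.dist (ha i)).const_mul _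
  refine le_of_tendsto ht ?_
  filter_upwards [Filter.eventually_ge_atTop N] with m hm
  exact (MSort.omega_le X (u n) (u m) i).trans (hN n hn m hm).le

/-- A countably infinite product, with the metric `sup_i 2 ^ -i * d_i`. -/
noncomputable def MSort.omegaProd (X : ℕ → MSort.{u}) : MSort.{u} where
  carrier := ∀ i, X i
  metric := MSort.omegaMetric X
  complete := MSort.omega_complete X
  nonempty := inferInstance
  dist_le_one x y := ciSup_le fun i =>
    mul_le_one₀ (pow_le_one₀ (by norm_num) (by norm_num)) dist_nonneg ((X i).dist_le_one _ _)

/-- `φ` is the distance predicate of a non-empty closed set (which is then its zero set). -/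
def IsDistPred (X : MSort.{u}) (φ : X → ℝ) : Prop :=
  {x | φ x = 0}.Nonempty ∧ ∀ x, φ x = Metric.infDist x {x | φ x = 0}

/-- The zero set of a distance predicate, with the restricted metric. -/
noncomputable def MSort.subset (X : MSort.{u}) (φ : X → ℝ) (h : IsDistPred X φ) : MSort.{u} where
  carrier := {x : X // φ x = 0}
  metric := inferInstance
  complete := by
    have hc : IsClosed {x : X | φ x = 0} := by
      have h2 : φ = fun x => Metric.infDist x {x | φ x = 0} := funext h.2
      have h3 : Continuous φ := by
        rw [h2]
        exact Metric.continuous_infDist_pt _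
      exact isClosed_eq h3 continuous_const
    exact hc.completeSpace_coe
  nonempty := h.1.to_subtype
  dist_le_one x y := X.dist_le_one _ _

/-- `ρ` is a `[0,1]`-valued pseudo-metric. -/
structure IsPseudoMetric (X : MSort.{u}) (ρ : X → X → ℝ) : Prop where
  self : ∀ x, ρ x x = 0
  symm : ∀ x y, ρ x y = ρ y x
  triangle : ∀ x y z, ρ x z ≤ ρ x y + ρ y z
  mem : ∀ x y, ρ x y ∈ Set.Icc (0 : ℝ) 1

/-- The space `X` with its metric replaced by the pseudo-metric `ρ`. -/
def PseudoCopy (X : MSort.{u}) (ρ : X → X → ℝ) (_ : IsPseudoMetric X ρ) : Type u := X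

noncomputable instance (X : MSort.{u}) (ρ : X → X → ℝ) (h : IsPseudoMetric X ρ) :
    PseudoMetricSpace (PseudoCopy X ρ h) where
  dist := ρ
  dist_self := h.self
  dist_comm := h.symm
  dist_triangle := h.triangle

/-- The quotient `X / ρ`: the metric completion of the set of `ρ`-classes. -/
noncomputable def MSort.quot (X : MSort.{u}) (ρ : X → X → ℝ) (h : IsPseudoMetric X ρ) :
    MSort.{u} where
  carrier := UniformSpace.Completion (PseudoCopy X ρ h)
  metric := inferInstance
  complete := inferInstance
  nonempty := X.nonempty.map fun x =>
    ((show PseudoCopy X ρ h from x : PseudoCopy X ρ h) : UniformSpace.Completion _)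
  dist_le_one x y := by
    refine UniformSpace.Completion.induction_on₂ x y ?_ fun a b => ?_
    · exact isClosed_le continuous_dist continuous_const
    · rw [UniformSpace.Completion.dist_eq]
      exact (h.mem a b).2

/-- The quotient map `x ↦ [x]`. -/
noncomputable def MSort.cls (X : MSort.{u}) (ρ : X → X → ℝ) (h : IsPseudoMetric X ρ) (x : X) : X.quot ρ h :=
  ((show PseudoCopy X ρ h from x : PseudoCopy X ρ h) : UniformSpace.Completion _)

/-! ## Imaginary expansions -/

/-- One imaginary expansion: append a finite product sort, a countably infinite product sort, a
definable set, or a quotient by a definable pseudo-metric. -/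
inductive Step (V : Vocab.{v}) : Type v
  | finProd : (n : ℕ) → (Fin (n + 1) → V.Sorts) → Step V
  | omegaProd : (ℕ → V.Sorts) → Step V
  | defSet : V.Sorts → Formula V → Step V
  | quot : V.Sorts → Formula V → Step V

/-- Indices of the new predicate symbols: projections, the inclusion, the quotient predicate. -/
def Step.NewPred {V : Vocab.{v}} : Step V → Type
  | .finProd n _ => Fin (n + 1)
  | .omegaProd _ => ℕ
  | .defSet _ _ => Unit
  | .quot _ _ => Unit

/-- Argument sorts of the new, binary, predicate symbols; `none` is the new sort. -/
def Step.newDom {V : Vocab.{v}} : (st : Step V) → st.NewPred → Fin 2 → Option V.Sorts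
  | .finProd _ o, i => fun k => match k with | 0 => none | 1 => some (o i)
  | .omegaProd o, i => fun k => match k with | 0 => none | 1 => some (o i)
  | .defSet o _, _ => fun k => match k with | 0 => none | 1 => some o
  | .quot o _, _ => fun k => match k with | 0 => some o | 1 => none

/-- The vocabulary of the imaginary expansion. -/
def Vocab.extend (V : Vocab.{v}) (st : Step V) : Vocab.{v} where
  Sorts := Option V.Sorts
  Preds := V.Preds ⊕ st.NewPred
  ar p := match p with | .inl p => V.ar p | .inr _ => 2
  dom p := match p with | .inl p => fun i => some (V.dom p i) | .inr i => st.newDom i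

/-- The step makes sense in `A`: the formula given for a definable set is the distance predicate
of a non-empty set, and the formula given for a quotient is a pseudo-metric. -/
def Step.Valid {V : Vocab.{v}} (A : PreStructure.{u, v} V) : Step V → Prop
  | .finProd _ _ => True
  | .omegaProd _ => True
  | .defSet o φ => φ.FreeIn {(o, 0)} ∧ IsDistPred (A.sort o) (φ.val₁ A o)
  | .quot o φ => φ.FreeIn {(o, 0), (o, 1)} ∧ IsPseudoMetric (A.sort o) (φ.val₂ A o)

/-- The interpretation of the new sort. -/
noncomputable def Step.newSort {V : Vocab.{v}} (A : PreStructure.{u, v} V) :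
    (st : Step V) → st.Valid A → MSort.{u}
  | .finProd _ o, _ => MSort.finProd fun i => A.sort (o i)
  | .omegaProd o, _ => MSort.omegaProd fun i => A.sort (o i)
  | .defSet o φ, h => (A.sort o).subset (φ.val₁ A o) h.2
  | .quot o φ, h => (A.sort o).quot (φ.val₂ A o) h.2

/-- The sorts of the imaginary expansion. -/
noncomputable def Step.extSort {V : Vocab.{v}} (A : PreStructure.{u, v} V) (st : Step V)
    (h : st.Valid A) : Option V.Sorts → MSort.{u}
  | none => st.newSort A h
  | some s => A.sort s

/-- The new predicates: `π_i(x, y) = d(x_i, y)`, `ι(x, y) = d(x, y)` and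
`q(x, [y]) = ρ(x, y)`, the last one being the distance of `[x]` and `[y]` in the quotient. -/
noncomputable def Step.newPred {V : Vocab.{v}} (A : PreStructure.{u, v} V) :
    (st : Step V) → (h : st.Valid A) → (i : st.NewPred) →
      (∀ k, st.extSort A h (st.newDom i k)) → ℝ
  | .finProd _ o, _, i, x =>
      dist (α := A.sort (o i)) ((show ∀ i, A.sort (o i) from x 0) i) (x 1)
  | .omegaProd o, _, i, x =>
      dist (α := A.sort (o i)) ((show ∀ i, A.sort (o i) from x 0) i) (x 1)
  | .defSet o φ, _, _, x =>
      dist (α := A.sort o) (show {x : A.sort o // φ.val₁ A o x = 0} from x 0).1 (x 1)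
  | .quot o φ, h, _, x =>
      dist (α := (A.sort o).quot (φ.val₂ A o) h.2) ((A.sort o).cls (φ.val₂ A o) h.2 (x 0)) (x 1)

theorem Step.newPred_mem {V : Vocab.{v}} (A : PreStructure.{u, v} V) (st : Step V)
    (h : st.Valid A) (i : st.NewPred) (x : ∀ k, st.extSort A h (st.newDom i k)) :
    st.newPred A h i x ∈ Set.Icc (0 : ℝ) 1 := by
  cases st <;> exact ⟨dist_nonneg, MSort.dist_le_one _ _ _⟩

/-- The imaginary expansion of `A`. -/
noncomputable def Step.apply {V : Vocab.{v}} (A : PreStructure.{u, v} V) (st : Step V)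
    (h : st.Valid A) : PreStructure.{u, v} (V.extend st) where
  sort := st.extSort A h
  pred p := match p with
    | .inl p => fun x => A.pred p x
    | .inr i => st.newPred A h i
  pred_mem p := match p with
    | .inl p => fun x => A.pred_mem p x
    | .inr i => fun x => st.newPred_mem A h i x

/-- Iterated imaginary expansions, from one vocabulary to another. -/
inductive Chain : Vocab.{v} → Vocab.{v} → Type (v + 1)
  | nil (V : Vocab.{v}) : Chain V V
  | cons {V W : Vocab.{v}} (st : Step V) (c : Chain (V.extend st) W) : Chain V W

/-- Each step makes sense in the structure obtained so far. -/
def Chain.Valid : {V W : Vocab.{v}} → Chain V W → PreStructure.{u, v} V → Prop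
  | _, _, .nil _, _ => True
  | _, _, .cons st c, A => ∃ h : st.Valid A, c.Valid (st.apply A h)

/-- The iterated imaginary expansion of `A`. -/
noncomputable def Chain.expand : {V W : Vocab.{v}} → (c : Chain V W) →
    (A : PreStructure.{u, v} V) → c.Valid A → PreStructure.{u, v} W
  | _, _, .nil _, A, _ => A
  | _, _, .cons st c, A, h => c.expand (st.apply A h.fst) h.snd

/-- Old sort symbols are among the new ones. -/
def Chain.inj : {V W : Vocab.{v}} → Chain V W → V.Sorts → W.Sorts
  | _, _, .nil _, s => s
  | _, _, .cons _ c, s => c.inj (some s)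

/-- Old sorts are unchanged in the expansion: the identity map, as a map into the expansion. -/
noncomputable def Chain.old : {V W : Vocab.{v}} → (c : Chain V W) →
    (A : PreStructure.{u, v} V) → (h : c.Valid A) → (s : V.Sorts) →
      A.sort s ≃ᵢ (c.expand A h).sort (c.inj s)
  | _, _, .nil _, A, _, s => IsometryEquiv.refl (A.sort s)
  | _, _, .cons st c, A, h, s => c.old (st.apply A h.fst) h.snd (some s)

/-! ## The countable metric disjoint union -/

/-- The set `{∗} ∪ ⊔ O n`. -/
inductive Cmdu {V : Vocab.{v}} (A : PreStructure.{u, v} V) (O : ℕ → V.Sorts) : Type u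
  | star : Cmdu A O
  | pt : (n : ℕ) → A.sort (O n) → Cmdu A O

/-- The distance on the countable metric disjoint union. -/
noncomputable def Cmdu.d {V : Vocab.{v}} (A : PreStructure.{u, v} V) (O : ℕ → V.Sorts) :
    Cmdu A O → Cmdu A O → ℝ
  | .star, .star => 0
  | .star, .pt n _ => (1 / 2 : ℝ) ^ n
  | .pt n _, .star => (1 / 2 : ℝ) ^ n
  | .pt n x, .pt m y =>
      if h : n = m then (1 / 2 : ℝ) ^ n * dist (h ▸ x : A.sort (O m)) y
      else |(1 / 2 : ℝ) ^ n - (1 / 2 : ℝ) ^ m|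

/-- The function `d` is a metric on `X`. -/
structure IsMetric {X : Type u} (d : X → X → ℝ) : Prop where
  nonneg : ∀ x y, 0 ≤ d x y
  eq_zero_iff : ∀ x y, d x y = 0 ↔ x = y
  symm : ∀ x y, d x y = d y x
  triangle : ∀ x y z, d x z ≤ d x y + d y z

/-- Every `d`-Cauchy sequence has a `d`-limit. -/
def IsCompleteMetric {X : Type u} (d : X → X → ℝ) : Prop :=
  ∀ a : ℕ → X, (∀ ε > 0, ∃ N, ∀ m ≥ N, ∀ n ≥ N, d (a m) (a n) < ε) →
    ∃ l, ∀ ε > 0, ∃ N, ∀ n ≥ N, d (a n) l < ε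

section Cmdu

variable {V : Vocab.{v}} (A : PreStructure.{u, v} V) (O : ℕ → V.Sorts)

/-- Distance to `∗`. -/
noncomputable def Cmdu.height : Cmdu A O → ℝ
  | .star => 0
  | .pt n _ => (1 / 2 : ℝ) ^ n

theorem Cmdu.d_same (n : ℕ) (x y : A.sort (O n)) :
    Cmdu.d A O (.pt n x) (.pt n y) = (1 / 2 : ℝ) ^ n * dist x y := by
  simp [Cmdu.d]

theorem Cmdu.cases₂ (a b : Cmdu A O) :
    (a = .star ∧ b = .star) ∨ (∃ n x y, a = .pt n x ∧ b = .pt n y) ∨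
      Cmdu.d A O a b = |Cmdu.height A O a - Cmdu.height A O b| := by
  cases a with
  | star => cases b with
    | star => simp
    | pt n x => right; right; simp [Cmdu.d, Cmdu.height]
  | pt n x => cases b with
    | star => right; right; simp [Cmdu.d, Cmdu.height]
    | pt m y =>
      by_cases h : n = m
      · subst h; right; left; exact ⟨n, x, y, rfl, rfl⟩
      · right; right; simp [Cmdu.d, Cmdu.height, h]

theorem Cmdu.height_le (a b : Cmdu A O) :
    |Cmdu.height A O a - Cmdu.height A O b| ≤ Cmdu.d A O a b := by
  rcases Cmdu.cases₂ A O a b with ⟨rfl, rfl⟩ | ⟨n, x, y, rfl, rfl⟩ | h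
  · simp [Cmdu.d]
  · rw [Cmdu.d_same]
    simp only [Cmdu.height, sub_self, abs_zero]
    positivity
  · exact h.ge

theorem pow_half_gap {n m : ℕ} (h : n ≠ m) :
    (1 / 2 : ℝ) ^ n / 2 ≤ |(1 / 2 : ℝ) ^ n - (1 / 2 : ℝ) ^ m| := by
  rcases lt_or_gt_of_ne h with h | h
  · have h1 : (1 / 2 : ℝ) ^ m ≤ (1 / 2 : ℝ) ^ (n + 1) :=
      pow_le_pow_of_le_one (by norm_num) (by norm_num) h
    rw [pow_succ] at h1
    exact le_trans (by linarith) (le_abs_self _)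
  · have h1 : (1 / 2 : ℝ) ^ n ≤ (1 / 2 : ℝ) ^ (m + 1) :=
      pow_le_pow_of_le_one (by norm_num) (by norm_num) h
    rw [pow_succ] at h1
    have h2 : (0 : ℝ) < (1 / 2 : ℝ) ^ n := by positivity
    exact le_trans (by linarith) (neg_le_abs _)

/-- A point outside of `O n` has distance at least `2 ^ -n / 2` from the points of `O n`. -/
theorem Cmdu.gap (n : ℕ) (x : A.sort (O n)) (b : Cmdu A O) :
    (∃ y, b = .pt n y) ∨ (1 / 2 : ℝ) ^ n / 2 ≤ Cmdu.d A O (.pt n x) b := by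
  cases b with
  | star =>
    right
    have h2 : (0 : ℝ) < (1 / 2 : ℝ) ^ n := by positivity
    simp only [Cmdu.d]
    linarith
  | pt m y =>
    by_cases h : n = m
    · subst h; exact Or.inl ⟨y, rfl⟩
    · right
      simp only [Cmdu.d, h, dite_false]
      exact pow_half_gap h

theorem Cmdu.symm (a b : Cmdu A O) : Cmdu.d A O a b = Cmdu.d A O b a := by
  cases a with
  | star => cases b <;> rfl
  | pt n x => cases b with
    | star => rfl
    | pt m y =>
      by_cases h : n = m
      · subst h; rw [Cmdu.d_same, Cmdu.d_same, dist_comm]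
      · simp only [Cmdu.d, h, Ne.symm h, dite_false]
        exact abs_sub_comm _ _

theorem Cmdu.isMetric : IsMetric (Cmdu.d A O) where
  nonneg a b := (abs_nonneg _).trans (Cmdu.height_le A O a b)
  eq_zero_iff a b := by
    constructor
    · intro h
      cases a with
      | star => cases b with
        | star => rfl
        | pt n x => exact absurd h (by simp [Cmdu.d])
      | pt n x =>
        rcases Cmdu.gap A O n x b with ⟨y, rfl⟩ | h'
        · rw [Cmdu.d_same] at h
          have h3 : dist x y = 0 := by simpa using h
          rw [dist_eq_zero.1 h3]
        · have h2 : (0 : ℝ) < (1 / 2 : ℝ) ^ n := by positivity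
          exact absurd h' (by rw [h]; linarith)
    · rintro rfl
      cases a with
      | star => rfl
      | pt n x => simp [Cmdu.d_same]
  symm := Cmdu.symm A O
  triangle a b c := by
    rcases Cmdu.cases₂ A O a c with ⟨rfl, rfl⟩ | ⟨n, x, y, rfl, rfl⟩ | h
    · have h1 := (abs_nonneg _).trans (Cmdu.height_le A O .star b)
      have h2 := (abs_nonneg _).trans (Cmdu.height_le A O b .star)
      have h3 : Cmdu.d A O .star .star = 0 := rfl
      linarith
    · have h2 : (0 : ℝ) < (1 / 2 : ℝ) ^ n := by positivity
      rcases Cmdu.gap A O n x b with ⟨z, rfl⟩ | h1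
      · simp only [Cmdu.d_same]
        nlinarith [dist_triangle x z y]
      · rcases Cmdu.gap A O n y b with ⟨z, rfl⟩ | h3
        · simp only [Cmdu.d_same]
          nlinarith [dist_triangle x z y]
        · rw [Cmdu.symm A O b, Cmdu.d_same]
          have := (A.sort (O n)).dist_le_one x y
          nlinarith
    · rw [h]
      exact (abs_sub_le _ (Cmdu.height A O b) _).trans
        (add_le_add (Cmdu.height_le A O a b) (Cmdu.height_le A O b c))

noncomputable instance : MetricSpace (Cmdu A O) where
  dist := Cmdu.d A O
  dist_self a := ((Cmdu.isMetric A O).eq_zero_iff a a).2 rfl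
  dist_comm := (Cmdu.isMetric A O).symm
  dist_triangle := (Cmdu.isMetric A O).triangle
  eq_of_dist_eq_zero h := ((Cmdu.isMetric A O).eq_zero_iff _ _).1 h

theorem Cmdu.dist_le_one (a b : Cmdu A O) : dist a b ≤ 1 := by
  have hp : ∀ n : ℕ, (1 / 2 : ℝ) ^ n ≤ 1 := fun n => pow_le_one₀ (by norm_num) (by norm_num)
  have h0 : ∀ c : Cmdu A O, 0 ≤ Cmdu.height A O c ∧ Cmdu.height A O c ≤ 1 := by
    rintro (_ | ⟨n, x⟩)
    · simp [Cmdu.height]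
    · exact ⟨by simp only [Cmdu.height]; positivity, hp n⟩
  change Cmdu.d A O a b ≤ 1
  rcases Cmdu.cases₂ A O a b with ⟨rfl, rfl⟩ | ⟨n, x, y, rfl, rfl⟩ | h
  · simp [Cmdu.d]
  · rw [Cmdu.d_same]
    exact mul_le_one₀ (hp n) dist_nonneg ((A.sort (O n)).dist_le_one x y)
  · rw [h, abs_le]
    have h1 := h0 a
    have h2 := h0 b
    constructor <;> linarith

instance : CompleteSpace (Cmdu A O) := by
  refine Metric.complete_of_cauchySeq_tendsto fun a ha => ?_
  by_cases hs : Filter.Tendsto a Filter.atTop (nhds .star)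
  · exact ⟨_, hs⟩
  rw [Metric.tendsto_atTop] at hs
  push Not at hs
  obtain ⟨ε, hε, hs⟩ := hs
  obtain ⟨N, hN⟩ := Metric.cauchySeq_iff.1 ha (ε / 2) (half_pos hε)
  obtain ⟨k, hk, hk'⟩ := hs N
  obtain ⟨n, x, hx⟩ : ∃ n x, a k = .pt n x := by
    cases h : a k with
    | star => rw [h, dist_self] at hk'; linarith
    | pt n x => exact ⟨n, x, rfl⟩
  have hn : ε ≤ (1 / 2 : ℝ) ^ n := by rw [hx] at hk'; exact hk'
  have hj : ∀ j, ∃ y : A.sort (O n), a (j + N) = .pt n y := fun j => by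
    rcases Cmdu.gap A O n x (a (j + N)) with h | h
    · exact h
    · have h1 := hN k hk (j + N) (Nat.le_add_left _ _)
      rw [hx] at h1
      have h2 : dist (Cmdu.pt n x) (a (j + N)) = Cmdu.d A O (.pt n x) (a (j + N)) := rfl
      linarith
  choose y hy using hj
  have hp : (0 : ℝ) < (1 / 2 : ℝ) ^ n := by positivity
  have hd : ∀ y z : A.sort (O n),
      dist (Cmdu.pt (A := A) (O := O) n y) (.pt n z) = (1 / 2 : ℝ) ^ n * dist y z :=
    Cmdu.d_same A O n
  have hc : CauchySeq y := by
    rw [Metric.cauchySeq_iff] at ha ⊢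
    intro η hη
    obtain ⟨M, hM⟩ := ha ((1 / 2 : ℝ) ^ n * η) (mul_pos hp hη)
    refine ⟨M, fun i hi j hj => ?_⟩
    have h1 := hM (i + N) (by omega) (j + N) (by omega)
    rw [hy, hy, hd] at h1
    exact lt_of_mul_lt_mul_left h1 hp.le
  obtain ⟨l, hl⟩ := cauchySeq_tendsto_of_complete hc
  refine ⟨.pt n l, (Filter.tendsto_add_atTop_iff_nat N).1 ?_⟩
  rw [tendsto_iff_dist_tendsto_zero] at hl ⊢
  simpa [hy, hd] using hl.const_mul ((1 / 2 : ℝ) ^ n)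

/-- The countable metric disjoint union as a complete metric space. -/
noncomputable def Cmdu.msort : MSort.{u} where
  carrier := Cmdu A O
  metric := inferInstance
  complete := inferInstance
  nonempty := ⟨.star⟩
  dist_le_one := Cmdu.dist_le_one A O

end Cmdu

/-- The copy in the disjoint union of a point of the sort `s = O n`. -/
def Cmdu.inc {V : Vocab.{v}} {A : PreStructure.{u, v} V} {O : ℕ → V.Sorts} (n : ℕ) {s : V.Sorts}
    (h : O n = s) (y : A.sort s) : Cmdu A O :=
  .pt n (h ▸ y)

/-- The copy of `O n` inside the disjoint union. -/
def Cmdu.part {V : Vocab.{v}} (A : PreStructure.{u, v} V) (O : ℕ → V.Sorts) (n : ℕ) :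
    Set (Cmdu A O) :=
  Set.range (.pt n)

/-- The vocabulary of the disjoint union. It has one sort, a unary symbol `none` for the distance
to `∗`, and for every predicate symbol `p` on `O (i 0) × ⋯ × O (i (k-1))` a symbol `(p, i)`.
(If the sorts `O n` are pairwise distinct, `i` is determined by `p`.) -/
def cmduVocab (V : Vocab.{v}) (O : ℕ → V.Sorts) : Vocab.{v} where
  Sorts := PUnit
  Preds := Option (Σ p : V.Preds, {i : Fin (V.ar p) → ℕ // ∀ k, O (i k) = V.dom p k})
  ar q := match q with | none => 1 | some q => V.ar q.1
  dom _ _ := PUnit.unit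

open Classical in
/-- A predicate on `O (i 0) × ⋯ × O (i (k-1))`, extended by the value `1` outside of its
domain. -/
noncomputable def Cmdu.extPred {V : Vocab.{v}} (A : PreStructure.{u, v} V) (O : ℕ → V.Sorts)
    (p : V.Preds) (i : Fin (V.ar p) → ℕ) (hi : ∀ k, O (i k) = V.dom p k)
    (x : Fin (V.ar p) → Cmdu A O) : ℝ :=
  if h : ∃ y : ∀ k, A.sort (V.dom p k), ∀ k, x k = Cmdu.inc (i k) (hi k) (y k) then
    A.pred p h.choose
  else 1

/-- The countable metric disjoint union as a metric structure. -/
noncomputable def cmdu {V : Vocab.{v}} (A : PreStructure.{u, v} V) (O : ℕ → V.Sorts) :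
    PreStructure.{u, v} (cmduVocab V O) where
  sort _ := Cmdu.msort A O
  pred q := match q with
    | none => fun x => Cmdu.d A O (x (0 : Fin 1)) .star
    | some q => fun x => Cmdu.extPred A O q.1 q.2.1 q.2.2 x
  pred_mem q := match q with
    | none => fun x => ⟨(Cmdu.isMetric A O).nonneg _ _, Cmdu.dist_le_one A O _ _⟩
    | some q => fun x => by
      change Cmdu.extPred A O q.1 q.2.1 q.2.2 x ∈ _
      unfold Cmdu.extPred
      split_ifs
      · exact A.pred_mem _ _
      · simp

/-- The signature of the disjoint union. The syntactic modulus of the distance to `∗` is the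
identity; the one of the extension of `p` to the disjoint union is
`min (max (Δ_p (min (2 ^ N * t) 1)) (2 ^ (N + 1) * t)) 1`, with `N` the greatest index of the sorts
of its arguments. (`Set.projIcc` truncates a real number to `[0,1]`.) -/
noncomputable def cmduSig (L : MetricSignature.{v}) (O : ℕ → L.Sorts) : MetricSignature.{v} where
  toVocab := cmduVocab L.toVocab O
  modulus q := match q with
    | none => fun t => t
    | some q => fun t =>
      Set.projIcc (0 : ℝ) 1 zero_le_one
        (max (L.modulus q.1 (Set.projIcc (0 : ℝ) 1 zero_le_one
            ((2 : ℝ) ^ (Finset.univ.sup q.2.1) * (t : ℝ))) : ℝ)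
          ((2 : ℝ) ^ (Finset.univ.sup q.2.1 + 1) * (t : ℝ)))
  modulus_continuous q := match q with
    | none => continuous_id
    | some q => by
      have h := L.modulus_continuous q.1
      refine continuous_projIcc.comp (Continuous.max ?_ (by fun_prop))
      exact continuous_subtype_val.comp (h.comp (continuous_projIcc.comp (by fun_prop)))
  modulus_zero q := match q with
    | none => rfl
    | some q => by
      simp [L.modulus_zero]

/-! ## Computability -/

/-- Partial recursive functionals: partial functions of a natural number that are computed,
uniformly in the oracle, with an oracle `ℕ → ℕ`. -/
inductive RecFunctional : ((ℕ → ℕ) → ℕ →. ℕ) → Prop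
  | zero : RecFunctional fun _ _ => Part.some 0
  | succ : RecFunctional fun _ n => Part.some (n + 1)
  | left : RecFunctional fun _ n => Part.some n.unpair.1
  | right : RecFunctional fun _ n => Part.some n.unpair.2
  | oracle : RecFunctional fun h n => Part.some (h n)
  | pair {F G : (ℕ → ℕ) → ℕ →. ℕ} : RecFunctional F → RecFunctional G →
      RecFunctional fun h n => Nat.pair <$> F h n <*> G h n
  | comp {F G : (ℕ → ℕ) → ℕ →. ℕ} : RecFunctional F → RecFunctional G →
      RecFunctional fun h n => G h n >>= F h
  | prec {F G : (ℕ → ℕ) → ℕ →. ℕ} : RecFunctional F → RecFunctional G →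
      RecFunctional fun h p =>
        p.unpair.2.rec (F h p.unpair.1) fun y IH =>
          IH >>= fun i => G h (Nat.pair p.unpair.1 (Nat.pair y i))
  | rfind {F : (ℕ → ℕ) → ℕ →. ℕ} : RecFunctional F →
      RecFunctional fun h a => Nat.rfind fun n => (fun m => m = 0) <$> F h (Nat.pair a n)

/-- With oracle `h`, the functional `F` computes the total function `g`. -/
def Outputs (F : (ℕ → ℕ) → ℕ →. ℕ) (h g : ℕ → ℕ) : Prop :=
  ∀ n, F h n = Part.some (g n)

/-- `Out` is uniformly computable from `In`: there is one functional that turns every name `h` of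
every `i` into a name of an output for `i`. In particular, if `h` is computable, so is the
output. -/
def UniformlyComputable {ι : Type u} (In Out : ι → (ℕ → ℕ) → Prop) : Prop :=
  ∃ F, RecFunctional F ∧ ∀ i h, In i h →
    ∃ g, Outputs F h g ∧ Out i g ∧ (Computable h → Computable g)

/-- The `i`-th component of a name. -/
def comp (i : ℕ) (h : ℕ → ℕ) : ℕ → ℕ := fun n => h (Nat.pair i n)

/-- `a / 2 ^ k` approximates `x` up to `2 ^ -k`. -/
def Approx (a k : ℕ) (x : ℝ) : Prop := |(a : ℝ) / 2 ^ k - x| ≤ 1 / 2 ^ k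

/-- An identification of the sorts and predicate symbols with natural numbers. -/
structure Numbering (V : Vocab.{v}) where
  sortCode : V.Sorts → ℕ
  predCode : V.Preds → ℕ
  sortCode_injective : Function.Injective sortCode
  predCode_injective : Function.Injective predCode

/-- Code of a finite list of natural numbers. -/
def tupleCode {n : ℕ} (x : Fin n → ℕ) : ℕ := Encodable.encode (List.ofFn x)

/-- The function `h` describes the signature `L`: the sets of (codes of) sorts and predicate
symbols by their characteristic functions, the arity function, and the moduli as functions
`[0,1] → [0,1]`, by approximations of their values at dyadic rationals together with a
modulus of continuity. -/
structure IsSigName (L : MetricSignature.{v}) (ν : Numbering L.toVocab) (h : ℕ → ℕ) : Prop where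
  sorts : ∀ c, (c ∈ Set.range ν.sortCode → comp 0 h c = 1) ∧
    (c ∉ Set.range ν.sortCode → comp 0 h c = 0)
  preds : ∀ c, (c ∈ Set.range ν.predCode → comp 1 h c = 1) ∧
    (c ∉ Set.range ν.predCode → comp 1 h c = 0)
  arity : ∀ p, comp 2 h (ν.predCode p) = tupleCode fun i => ν.sortCode (L.dom p i)
  modulus : ∀ p j m k, Approx
    (comp 3 h (Nat.pair (ν.predCode p) (Nat.pair j (Nat.pair m k)))) k
    (L.modulus p (Set.projIcc (0 : ℝ) 1 zero_le_one ((j : ℝ) / 2 ^ m)))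
  modulus_cont : ∀ p k, ∀ s t : unitInterval,
    |(s : ℝ) - t| ≤ 1 / 2 ^ (comp 4 h (Nat.pair (ν.predCode p) k)) →
      |(L.modulus p s : ℝ) - L.modulus p t| ≤ 1 / 2 ^ k

/-- The function `h` describes a presentation of the structure `A`: the points `pts s i` form a
dense sequence in each sort `s`, and `h` gives approximations of their distances and of the
values of the predicates on them. (The predicates are then uniformly computable functions, since
their moduli of uniform continuity are given with the signature.) -/
structure IsPresentation {V : Vocab.{v}} (ν : Numbering V) (A : PreStructure.{u, v} V)
    (pts : A.Val) (h : ℕ → ℕ) : Prop where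
  dense : ∀ s, DenseRange (pts s)
  dist : ∀ s i j k, Approx
    (comp 0 h (Nat.pair (ν.sortCode s) (Nat.pair i (Nat.pair j k)))) k
    (Dist.dist (pts s i) (pts s j))
  pred : ∀ p (i : Fin (V.ar p) → ℕ) k, Approx
    (comp 1 h (Nat.pair (ν.predCode p) (Nat.pair (tupleCode i) k))) k
    (A.pred p fun a => pts _ (i a))

/-- Codes of restricted formulas. -/
def RFormula.code {V : Vocab.{v}} (ν : Numbering V) : RFormula V → ℕ
  | .zero => Nat.pair 0 0
  | .one => Nat.pair 1 0
  | .half φ => Nat.pair 2 (φ.code ν)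
  | .sub φ ψ => Nat.pair 3 (Nat.pair (φ.code ν) (ψ.code ν))
  | .dist s i j => Nat.pair 4 (Nat.pair (ν.sortCode s) (Nat.pair i j))
  | .pred p idx => Nat.pair 5 (Nat.pair (ν.predCode p) (tupleCode idx))
  | .sup s i φ => Nat.pair 6 (Nat.pair (ν.sortCode s) (Nat.pair i (φ.code ν)))
  | .inf s i φ => Nat.pair 7 (Nat.pair (ν.sortCode s) (Nat.pair i (φ.code ν)))

/-- The function `g` lists the codes of the components of `φ`. -/
def Formula.HasName {V : Vocab.{v}} (ν : Numbering V) (φ : Formula V) (g : ℕ → ℕ) : Prop :=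
  ∀ n, g n = (φ n).code ν

/-- Codes of the new predicate symbols. -/
def Step.newCode {V : Vocab.{v}} : (st : Step V) → st.NewPred → ℕ
  | .finProd _ _, i => i.val
  | .omegaProd _, i => i
  | .defSet _ _, _ => 0
  | .quot _ _, _ => 0

theorem Step.newCode_injective {V : Vocab.{v}} (st : Step V) :
    Function.Injective st.newCode := by
  cases st with
  | finProd n o => exact Fin.val_injective
  | omegaProd o => exact fun _ _ h => h
  | defSet o φ => exact fun _ _ _ => rfl
  | quot o φ => exact fun _ _ _ => rfl

/-- The numbering of the vocabulary of an imaginary expansion. -/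
def Numbering.extend {V : Vocab.{v}} (ν : Numbering V) (st : Step V) :
    Numbering (V.extend st) where
  sortCode s := match s with | none => 0 | some s => ν.sortCode s + 1
  predCode p := match p with
    | .inl p => 2 * ν.predCode p
    | .inr i => 2 * st.newCode i + 1
  sortCode_injective := by
    rintro (_ | a) (_ | b) h
    · rfl
    · simp at h
    · simp at h
    · simp only [Nat.add_right_cancel_iff] at h
      rw [ν.sortCode_injective h]
  predCode_injective := by
    rintro (a | a) (b | b) h <;> simp only at h
    · rw [ν.predCode_injective (by omega : ν.predCode a = ν.predCode b)]
    · omega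
    · omega
    · rw [st.newCode_injective (by omega : st.newCode a = st.newCode b)]

/-- The function `g` describes an imaginary expansion. -/
def Step.HasName {V : Vocab.{v}} (ν : Numbering V) : Step V → (ℕ → ℕ) → Prop
  | .finProd _ o, g => g 0 = Nat.pair 0 (tupleCode fun i => ν.sortCode (o i))
  | .omegaProd o, g => g 0 = Nat.pair 1 0 ∧ ∀ i, g (i + 1) = ν.sortCode (o i)
  | .defSet o φ, g => g 0 = Nat.pair 2 (ν.sortCode o) ∧ φ.HasName ν fun n => g (n + 1)
  | .quot o φ, g => g 0 = Nat.pair 3 (ν.sortCode o) ∧ φ.HasName ν fun n => g (n + 1)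

/-- The numbering of the vocabulary of an iterated imaginary expansion. -/
def Chain.numbering : {V W : Vocab.{v}} → Chain V W → Numbering V → Numbering W
  | _, _, .nil _, ν => ν
  | _, _, .cons st c, ν => c.numbering (ν.extend st)

/-- The function `g` describes an iterated imaginary expansion. -/
def Chain.HasName : {V W : Vocab.{v}} → Numbering V → Chain V W → (ℕ → ℕ) → Prop
  | _, _, _, .nil _, g => g 0 = 0
  | _, _, ν, .cons st c, g => g 0 = 1 ∧ st.HasName ν (fun n => g (Nat.pair 0 n + 1)) ∧
      c.HasName (ν.extend st) (fun n => g (Nat.pair 1 n + 1))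

/-- The numbering of the vocabulary of the disjoint union. -/
def Numbering.cmdu {V : Vocab.{v}} (ν : Numbering V) (O : ℕ → V.Sorts) :
    Numbering (cmduVocab V O) where
  sortCode _ := 0
  predCode q := match q with
    | none => 0
    | some q => Nat.pair (ν.predCode q.1) (tupleCode q.2.1) + 1
  sortCode_injective := fun _ _ _ => rfl
  predCode_injective := by
    rintro (_ | ⟨p, i, hi⟩) (_ | ⟨q, j, hj⟩) h
    · rfl
    · simp at h
    · simp at h
    · simp only [Nat.add_right_cancel_iff, Nat.pair_eq_pair] at h
      obtain ⟨h1, h2⟩ := h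
      obtain rfl := ν.predCode_injective h1
      obtain rfl : i = j := List.ofFn_injective (Encodable.encode_injective h2)
      rfl

/-! ## The disjoint union as an imaginary -/

/-- Data of an interpretation of the disjoint union as an imaginary: an iterated imaginary
expansion, one of its sorts, and formulas in the expansion. -/
structure Interp (V : Vocab.{v}) (O : ℕ → V.Sorts) where
  {W : Vocab.{v}}
  /-- the imaginary expansion -/
  chain : Chain V W
  /-- the imaginary sort -/
  imag : W.Sorts
  /-- formulas for the predicates of the disjoint union -/
  predForm : (cmduVocab V O).Preds → Formula W
  /-- formulas for the distance to `O n` -/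
  partForm : ℕ → Formula W
  /-- formulas for the bijection between the sort `O n` and the subset `O n` -/
  bijForm : ℕ → Formula W

/-- In `A`, the imaginary sort is isometric to the disjoint union, by an isometry `e` for which
the formulas have their intended meanings. -/
def Interp.CorrectIn {V : Vocab.{v}} {O : ℕ → V.Sorts} (I : Interp V O)
    (A : PreStructure.{u, v} V) : Prop :=
  ∃ h : I.chain.Valid A, ∃ e : (I.chain.expand A h).sort I.imag ≃ᵢ Cmdu A O,
    (∀ q, ∀ w : (I.chain.expand A h).Val, (I.predForm q).eval _ w =
      (cmdu A O).pred q fun k => e (w I.imag k)) ∧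
    (∀ n, ∀ w : (I.chain.expand A h).Val, (I.partForm n).eval _ w =
      Metric.infDist (w I.imag 0) (e ⁻¹' Cmdu.part A O n)) ∧
    (∀ n, ∀ w : (I.chain.expand A h).Val, ∀ x : A.sort (O n),
      w (I.chain.inj (O n)) 0 = I.chain.old A h (O n) x →
        (I.bijForm n).eval _ w = dist (e.symm (.pt n x)) (w I.imag 1))

/-- The formulas are finitary, have the right free variables, and have their intended meanings
in all structures of the class `C_{L,r}`. -/
structure Interp.Correct {L : MetricSignature.{v}} {O : ℕ → L.Sorts} (I : Interp L.toVocab O)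
    (H : L.Sorts) (r : ℝ) : Prop where
  predFree : ∀ q, (I.predForm q).FreeIn
    (Set.range fun k : Fin ((cmduVocab L.toVocab O).ar q) => (I.imag, (k : ℕ)))
  partFree : ∀ n, (I.partForm n).FreeIn {(I.imag, 0)}
  bijFree : ∀ n, (I.bijForm n).FreeIn {(I.chain.inj (O n), 0), (I.imag, 1)}
  correctIn : ∀ A : LStructure.{u, v} L, InClass H r A → I.CorrectIn A.toPreStructure

/-- The function `g` describes the interpretation `I`. -/
structure Interp.HasName {V : Vocab.{v}} {O : ℕ → V.Sorts} (ν : Numbering V) (I : Interp V O)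
    (g : ℕ → ℕ) : Prop where
  chain : I.chain.HasName ν (comp 0 g)
  imag : comp 1 g 0 = (I.chain.numbering ν).sortCode I.imag
  predForm : ∀ q, (I.predForm q).HasName (I.chain.numbering ν)
    (comp ((ν.cmdu O).predCode q) (comp 2 g))
  partForm : ∀ n, (I.partForm n).HasName (I.chain.numbering ν) (comp n (comp 3 g))
  bijForm : ∀ n, (I.bijForm n).HasName (I.chain.numbering ν) (comp n (comp 4 g))

/-- The dense sequence of the disjoint union that belongs to dense sequences of the sorts. -/
def cmduPts {V : Vocab.{v}} (A : PreStructure.{u, v} V) (O : ℕ → V.Sorts) (pts : A.Val) :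
    (cmdu A O).Val :=
  fun _ i => match i with
    | 0 => Cmdu.star
    | i + 1 => Cmdu.pt i.unpair.1 (pts (O i.unpair.1) i.unpair.2)

/-- The formulas `φ n` of the signature of the disjoint union define, in every disjoint union, the
distance to `O n`. -/
def DefinesParts {L : MetricSignature.{v}} (O : ℕ → L.Sorts)
    (φ : ℕ → Formula (cmduVocab L.toVocab O)) : Prop :=
  ∀ n, (φ n).FreeIn {(PUnit.unit, 0)} ∧
    ∀ (A : LStructure.{u, v} L) (w : (cmdu A.toPreStructure O).Val),
      (φ n).eval _ w = Metric.infDist (w PUnit.unit 0) (Cmdu.part A.toPreStructure O n)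

/-- `M` is a model of the theory `T`, i.e. of the conditions `φ = 0` for `φ ∈ T`. -/
def Models {V : Vocab.{v}} (M : PreStructure.{u, v} V) (T : Set (Formula V)) : Prop :=
  ∀ φ ∈ T, ∀ w : M.Val, φ.eval M w = 0

/-- `T` is a theory and `Ξ` is a sentence such that, for all `r ∈ (0,1]`, the models of
`T ∪ {Ξ ≥ r}` are, up to isomorphism, the disjoint unions of structures in `C_{L,r}`. -/
def Axiomatizes {L : MetricSignature.{v}} (H : L.Sorts) (O : ℕ → L.Sorts)
    (T : Set (Formula (cmduVocab L.toVocab O))) (Ξ : Formula (cmduVocab L.toVocab O)) : Prop :=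
  (∀ φ ∈ T, φ.FreeIn ∅) ∧ Ξ.FreeIn ∅ ∧
    ∀ r : ℝ, 0 < r → r ≤ 1 → ∀ M : LStructure.{u, v} (cmduSig L O),
      (Models M.toPreStructure T ∧ ∀ w : M.Val, r ≤ Ξ.eval M.toPreStructure w) ↔
        ∃ A : LStructure.{u, v} L, InClass H r A ∧
          Isomorphic M.toPreStructure (cmdu A.toPreStructure O)

/-! ## Names of the input data -/

/-- A numbered signature together with a home sort and a sequence of sorts. -/
structure Setting : Type (v + 1) where
  L : MetricSignature.{v}
  ν : Numbering L.toVocab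
  home : L.Sorts
  seq : ℕ → L.Sorts

/-- The function `h` describes the signature and the sequence of sorts. -/
def Setting.SeqName (D : Setting.{v}) (h : ℕ → ℕ) : Prop :=
  IsSigName D.L D.ν (comp 0 h) ∧ (∀ n, comp 1 h n = D.ν.sortCode (D.seq n))

/-- The function `h` describes the signature, its home sort, the sequence of sorts, and the real
number `r`. -/
def Setting.FullName (D : Setting.{v}) (r : ℝ) (h : ℕ → ℕ) : Prop :=
  D.SeqName h ∧ comp 2 h 0 = D.ν.sortCode D.home ∧ ∀ k, Approx (comp 3 h k) k r

end MetricLogic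

open MetricLogic

/-! The metric of the union is governed by the height d(x,∗), whose only values are 0 and 2^-n.
Distances between different pieces are differences of heights, and a point of O_n is at least 2^-n/2
away from everything outside O_n. This gap yields completeness, and it makes the extension of a
predicate by the value 1 uniformly continuous: two tuples lie both in the domain, or both outside,
or some coordinate has to cross a gap (`Cmdu.extPred_cases`). The distance to O_n is |height - 2^-n|
(`Cmdu.infDist_part`).

The core is the construction of a disjoint union from products, definable subsets and quotients
only. Two points of H at distance more than 2^-m, where 2^-m < r, serve as a switch. In the product
of H, O_0, H, O_1, … the level of a point p is the supremum over k of min(2^-k, 2^m d(p_{2k+2},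
p_0)). An element of O_n is represented by a point p whose H-coordinates all equal p_0 except the
one with number 2n+2, and whose coordinate in O_n is that element; ∗ is represented by points whose
H-coordinates are all equal. The levels are then 2^-n and 0, the heights of the elements.

Every p has a profile, a function on the union. Its value at ∗ is the level. Its value at y in O_k
is a Lipschitz interpolation (`blend`) between 2^-k d(p_{2k+1}, y), taken at level 2^-k, and |level
- 2^-k|, taken at all other possible heights. The profile of a representative of u is d(u,·), so for
the supremum distance of profiles the union embeds isometrically in the quotient, as in Kuratowski's
embedding (`exists_isEmbedding`).

Definability of the image, of ∗ and of the points of O_n follows from one principle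
(`abs_iInf_sub_infDist_le`): if F(p) bounds the distance of the class [p] to a set K, and every
point of K is the class of some p with F(p) = 0, then the infimum over p of d([p],z) + F(p) is the
distance of z to K. Here F is three times the infimum over n of |level - 2^-n|, or 3·level, or
3|level - 2^-n| + d(p_{2n+1}, x). An extended predicate is an infimum of P(z) plus a steep penalty
for the distance of z to the arguments (`IsQuotEmbedding.abs_eval_extApprox_sub_le`). The k-th
coordinates influence all these quantities only up to a multiple of 2^-k, so each of them is a
uniform limit of restricted formulas at a known rate, and `Formula.lim` turns such a limit into a
formula.

For the axiomatization, conditions force the heights into {0} ∪ {2^-n}, prescribe distances across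
pieces, bound the pieces, and fix the predicates outside of their domains. The point ∗ then exists
by completeness, and the pieces, scaled back by 2^n, form a structure of the original signature
(`isUnion_iff`). The modulus of an extension is too weak to return the modulus of P, so the theory
states the latter separately, through dyadic approximations. The diameter of O_0 is the value of one
sentence, which does not depend on r.

For computability, every formula is accompanied by a function on codes that is recursive in the name
of the data. The only unbounded search is the one for m with 2^-m < r. -/

namespace MetricLogic

/-! ## Total recursive functionals -/

/-- The total functional `f` is recursive, uniformly in the oracle. -/
def TotalRec (f : (ℕ → ℕ) → ℕ → ℕ) : Prop :=
  RecFunctional fun h n => Part.some (f h n)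

namespace TotalRec

theorem comp {f g : (ℕ → ℕ) → ℕ → ℕ} (hf : TotalRec f) (hg : TotalRec g) :
    TotalRec fun h n => f h (g h n) := by
  have := RecFunctional.comp hf hg
  unfold TotalRec
  convert this using 3
  simp

theorem pair {f g : (ℕ → ℕ) → ℕ → ℕ} (hf : TotalRec f) (hg : TotalRec g) :
    TotalRec fun h n => Nat.pair (f h n) (g h n) := by
  have := RecFunctional.pair hf hg
  unfold TotalRec
  convert this using 3
  simp [Seq.seq]

theorem prec {f g : (ℕ → ℕ) → ℕ → ℕ} (hf : TotalRec f) (hg : TotalRec g) :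
    TotalRec fun h p => p.unpair.2.rec (f h p.unpair.1)
      fun y i => g h (Nat.pair p.unpair.1 (Nat.pair y i)) := by
  have := RecFunctional.prec hf hg
  -- All stages of the recursion are defined, so the recursion on partial values collapses to one on
  -- numbers.
  have h1 : ∀ (h : ℕ → ℕ) (p : ℕ), p.unpair.2.rec (Part.some (f h p.unpair.1))
      (fun y IH => IH >>= fun i => Part.some (g h (Nat.pair p.unpair.1 (Nat.pair y i)))) =
      Part.some (p.unpair.2.rec (motive := fun _ => ℕ) (f h p.unpair.1)
        fun y i => g h (Nat.pair p.unpair.1 (Nat.pair y i))) := fun h p => by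
    induction p.unpair.2 with
    | zero => rfl
    | succ n ih => simp only [ih]; simp
  unfold TotalRec
  simpa only [h1] using this

theorem of_primrec {f : ℕ → ℕ} (hf : Nat.Primrec f) : TotalRec fun _ => f := by
  induction hf with
  | zero => exact RecFunctional.zero
  | succ => exact RecFunctional.succ
  | left => exact RecFunctional.left
  | right => exact RecFunctional.right
  | pair _ _ hf hg => exact hf.pair hg
  | comp _ _ hf hg => exact hf.comp hg
  | prec _ _ hf hg => exact hf.prec hg

end TotalRec

/-- A recursive functional with a computable oracle is a partial recursive function. -/
theorem RecFunctional.partrec {F : (ℕ → ℕ) → ℕ →. ℕ} (hF : RecFunctional F) {h : ℕ → ℕ}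
    (hh : Computable h) : Nat.Partrec (F h) := by
  induction hF with
  | zero => exact .zero
  | succ => exact .succ
  | left => exact .left
  | right => exact .right
  | oracle => exact Partrec.nat_iff.1 hh
  | pair _ _ hf hg => exact .pair hf hg
  | comp _ _ hf hg => exact .comp hf hg
  | prec _ _ hf hg => exact .prec hf hg
  | rfind _ hf => exact .rfind hf

theorem Outputs.computable {F : (ℕ → ℕ) → ℕ →. ℕ} (hF : RecFunctional F) {h g : ℕ → ℕ}
    (ho : Outputs F h g) (hh : Computable h) : Computable g :=
  Partrec.nat_iff.2 ((hF.partrec hh).of_eq ho)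

/-- A recursive functional may be applied to an oracle that is itself computed by one. -/
theorem RecFunctional.subst {F : (ℕ → ℕ) → ℕ →. ℕ} (hF : RecFunctional F)
    {s : (ℕ → ℕ) → ℕ → ℕ} (hs : TotalRec s) : RecFunctional fun h => F (s h) := by
  induction hF with
  | zero => exact .zero
  | succ => exact .succ
  | left => exact .left
  | right => exact .right
  | oracle => exact hs
  | pair _ _ hf hg => exact .pair hf hg
  | comp _ _ hf hg => exact .comp hf hg
  | prec _ _ hf hg => exact .prec hf hg
  | rfind _ hf => exact .rfind hf

theorem RecFunctional.of_partrec {f : ℕ →. ℕ} (hf : Nat.Partrec f) :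
    RecFunctional fun _ => f := by
  induction hf with
  | zero => exact .zero
  | succ => exact .succ
  | left => exact .left
  | right => exact .right
  | pair _ _ hf hg => exact .pair hf hg
  | comp _ _ hf hg => exact .comp hf hg
  | prec _ _ hf hg => exact .prec hf hg
  | rfind _ hf => exact .rfind hf

theorem TotalRec.of_computable {f : ℕ → ℕ} (hf : Computable f) : TotalRec fun _ => f :=
  RecFunctional.of_partrec (Partrec.nat_iff.1 hf)

/-! ## Total recursive functionals between coded types -/

section RelRec

variable {α β γ δ ε σ τ : Type} [Primcodable α] [Primcodable β] [Primcodable γ] [Primcodable δ]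
  [Primcodable ε] [Primcodable σ] [Primcodable τ]

/-- The total functional `f` between coded types is recursive, uniformly in the oracle. -/
def RelRec (f : (ℕ → ℕ) → α → σ) : Prop :=
  ∃ F, TotalRec F ∧ ∀ h a, F h (Encodable.encode a) = Encodable.encode (f h a)

theorem relRec_nat_iff {f : (ℕ → ℕ) → ℕ → ℕ} : RelRec f ↔ TotalRec f := by
  constructor
  · rintro ⟨F, hF, h⟩
    have : F = f := by
      funext a b
      simpa using h a b
    exact this ▸ hF
  · intro h
    exact ⟨f, h, fun _ _ => by simp⟩

namespace RelRec

theorem of_eq {f g : (ℕ → ℕ) → α → σ} (hf : RelRec f) (h : ∀ o a, f o a = g o a) : RelRec g :=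
  (funext fun o => funext (h o) : f = g) ▸ hf

theorem of_primrec {f : α → σ} (hf : Primrec f) : RelRec fun _ => f := by
  -- The code of `some x` is one more than that of `x`, which `Nat.pred` undoes; numbers that code
  -- nothing are sent to 0.
  refine ⟨fun _ n => (Encodable.encode ((Encodable.decode (α := α) n).map f)).pred,
    TotalRec.of_primrec (Nat.Primrec.pred.comp hf), fun h a => ?_⟩
  simp

protected theorem id : RelRec fun _ (a : α) => a := of_primrec Primrec.id

protected theorem fst : RelRec fun _ (a : α × β) => a.1 := of_primrec Primrec.fst

protected theorem snd : RelRec fun _ (a : α × β) => a.2 := of_primrec Primrec.snd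

protected theorem const (c : σ) : RelRec fun _ (_ : α) => c := of_primrec (Primrec.const c)

protected theorem comp {f : (ℕ → ℕ) → β → σ} {g : (ℕ → ℕ) → α → β} (hf : RelRec f)
    (hg : RelRec g) : RelRec fun h a => f h (g h a) := by
  obtain ⟨F, hF, h1⟩ := hf
  obtain ⟨G, hG, h2⟩ := hg
  exact ⟨_, hF.comp hG, fun h a => by rw [h2, h1]⟩

protected theorem pair {f : (ℕ → ℕ) → α → β} {g : (ℕ → ℕ) → α → γ} (hf : RelRec f)
    (hg : RelRec g) : RelRec fun h a => (f h a, g h a) := by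
  obtain ⟨F, hF, h1⟩ := hf
  obtain ⟨G, hG, h2⟩ := hg
  exact ⟨_, hF.pair hG, fun h a => by rw [h2, h1]; rfl⟩

theorem comp₁ {f : β → σ} {g : (ℕ → ℕ) → α → β} (hf : Primrec f) (hg : RelRec g) :
    RelRec fun h a => f (g h a) := (of_primrec hf).comp hg

theorem comp₂ {f : β → γ → σ} {g : (ℕ → ℕ) → α → β} {k : (ℕ → ℕ) → α → γ} (hf : Primrec₂ f)
    (hg : RelRec g) (hk : RelRec k) : RelRec fun h a => f (g h a) (k h a) :=
  comp₁ (f := fun p : β × γ => f p.1 p.2) hf (hg.pair hk)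

protected theorem oracle {f : (ℕ → ℕ) → α → ℕ} (hf : RelRec f) : RelRec fun h a => h (f h a) :=
  RelRec.comp (f := fun h n => h n) (relRec_nat_iff.2 RecFunctional.oracle) hf

theorem natPair {f g : (ℕ → ℕ) → α → ℕ} (hf : RelRec f) (hg : RelRec g) :
    RelRec fun h a => Nat.pair (f h a) (g h a) := comp₂ Primrec₂.natPair hf hg

theorem add {f g : (ℕ → ℕ) → α → ℕ} (hf : RelRec f) (hg : RelRec g) :
    RelRec fun h a => f h a + g h a := comp₂ Primrec.nat_add hf hg

theorem sub {f g : (ℕ → ℕ) → α → ℕ} (hf : RelRec f) (hg : RelRec g) :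
    RelRec fun h a => f h a - g h a := comp₂ Primrec.nat_sub hf hg

theorem mul {f g : (ℕ → ℕ) → α → ℕ} (hf : RelRec f) (hg : RelRec g) :
    RelRec fun h a => f h a * g h a := comp₂ Primrec.nat_mul hf hg

theorem div {f g : (ℕ → ℕ) → α → ℕ} (hf : RelRec f) (hg : RelRec g) :
    RelRec fun h a => f h a / g h a := comp₂ Primrec.nat_div hf hg

theorem max {f g : (ℕ → ℕ) → α → ℕ} (hf : RelRec f) (hg : RelRec g) :
    RelRec fun h a => max (f h a) (g h a) := comp₂ Primrec.nat_max hf hg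

theorem min {f g : (ℕ → ℕ) → α → ℕ} (hf : RelRec f) (hg : RelRec g) :
    RelRec fun h a => min (f h a) (g h a) := comp₂ Primrec.nat_min hf hg

theorem unpair_fst {f : (ℕ → ℕ) → α → ℕ} (hf : RelRec f) : RelRec fun h a => (f h a).unpair.1 :=
  (RelRec.fst (α := ℕ) (β := ℕ)).comp (comp₁ Primrec.unpair hf)

theorem unpair_snd {f : (ℕ → ℕ) → α → ℕ} (hf : RelRec f) : RelRec fun h a => (f h a).unpair.2 :=
  (RelRec.snd (α := ℕ) (β := ℕ)).comp (comp₁ Primrec.unpair hf)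

theorem nat_rec {k : (ℕ → ℕ) → α → ℕ} {f : (ℕ → ℕ) → α → σ}
    {g : (ℕ → ℕ) → α → ℕ → σ → σ} (hk : RelRec k) (hf : RelRec f)
    (hg : RelRec fun h (q : α × ℕ × σ) => g h q.1 q.2.1 q.2.2) :
    RelRec fun h a => (k h a).rec (motive := fun _ => σ) (f h a) (g h a) := by
  obtain ⟨K, hK, h1⟩ := hk
  obtain ⟨F, hF, h2⟩ := hf
  obtain ⟨G, hG, h3⟩ := hg
  refine ⟨_, (hF.prec hG).comp ((relRec_nat_iff.1 RelRec.id).pair hK), fun h a => ?_⟩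
  simp only [Nat.unpair_pair, h1]
  simp only [Encodable.encode_nat]
  induction k h a with
  | zero => exact h2 h a
  | succ n ih =>
    simp only [ih]
    exact h3 h (a, n, _)

theorem ite_eq [DecidableEq β] {f g : (ℕ → ℕ) → α → β} {x y : (ℕ → ℕ) → α → σ} (hf : RelRec f)
    (hg : RelRec g) (hx : RelRec x) (hy : RelRec y) :
    RelRec fun h a => if f h a = g h a then x h a else y h a :=
  comp₁ (f := fun p : (β × β) × σ × σ => if p.1.1 = p.1.2 then p.2.1 else p.2.2)
    (Primrec.ite (Primrec.eq.comp (Primrec.fst.comp Primrec.fst) (Primrec.snd.comp Primrec.fst))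
      (Primrec.fst.comp Primrec.snd) (Primrec.snd.comp Primrec.snd))
    ((hf.pair hg).pair (hx.pair hy))

theorem two_pow {f : (ℕ → ℕ) → α → ℕ} (hf : RelRec f) : RelRec fun h a => 2 ^ f h a :=
  (nat_rec (g := fun _ _ _ i => 2 * i) hf (RelRec.const 1)
    ((RelRec.const 2).mul (RelRec.snd.comp RelRec.snd))).of_eq
    fun h a => by
      induction f h a with
      | zero => rfl
      | succ n ih => simp only [ih, pow_succ]; ring

/-- The mapped function may query the oracle, so it need not be primitive recursive. The list is
therefore rebuilt by recursion on an index, with `nat_rec`. -/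
theorem list_map {l : (ℕ → ℕ) → α → List ℕ} {f : (ℕ → ℕ) → α → ℕ → σ} (hl : RelRec l)
    (hf : RelRec fun h (q : α × ℕ) => f h q.1 q.2) :
    RelRec fun h a => (l h a).map (f h a) := by
  have h1 : RelRec fun h a => (l h a).length := comp₁ Primrec.list_length hl
  have h2 : RelRec fun h (q : α × ℕ × List σ) => (l h q.1).getD q.2.1 0 :=
    comp₂ (f := fun (l : List ℕ) n => l.getD n 0) (Primrec.list_getD 0) (hl.comp RelRec.fst)
      (RelRec.fst.comp RelRec.snd)
  have h3 : RelRec fun h (q : α × ℕ × List σ) => f h q.1 ((l h q.1).getD q.2.1 0) :=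
    hf.comp (RelRec.fst.pair h2)
  have h4 : RelRec fun h (q : α × ℕ × List σ) =>
      q.2.2 ++ [f h q.1 ((l h q.1).getD q.2.1 0)] :=
    comp₂ Primrec.list_append (RelRec.snd.comp RelRec.snd)
      (comp₂ Primrec.list_cons h3 (RelRec.const []))
  refine (nat_rec (g := fun h a n acc => acc ++ [f h a ((l h a).getD n 0)]) h1
    (RelRec.const []) h4).of_eq fun h a => ?_
  -- Invariant: after `n` rounds the accumulator holds the image of the first `n` entries, so the
  -- default value of `getD` is never used.
  have : ∀ n ≤ (l h a).length, n.rec (motive := fun _ => List σ) []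
      (fun n acc => acc ++ [f h a ((l h a).getD n 0)]) = ((l h a).take n).map (f h a) := by
    intro n
    induction n with
    | zero => intro _; simp
    | succ n ih =>
      intro hn
      simp only [ih (by omega)]
      rw [List.take_add_one, List.map_append, List.getElem?_eq_getElem (by omega)]
      simp [List.getD_eq_getElem?_getD, List.getElem?_eq_getElem (show n < (l h a).length by omega)]
  rw [this _ le_rfl, List.take_length]

end RelRec

end RelRec

theorem UniformlyComputable.of_relRec {ι : Type u} {In Out : ι → (ℕ → ℕ) → Prop}
    {f : (ℕ → ℕ) → ℕ → ℕ} (hf : RelRec f) (h : ∀ i h, In i h → Out i (f h)) :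
    UniformlyComputable In Out :=
  ⟨_, relRec_nat_iff.1 hf, fun i o ho => ⟨f o, fun _ => rfl, h i o ho,
    Outputs.computable (relRec_nat_iff.1 hf) fun _ => rfl⟩⟩

/-- An algorithm that first searches for a number and then uses it as a parameter. -/
theorem UniformlyComputable.of_search {ι : Type u} {In Out : ι → (ℕ → ℕ) → Prop}
    {f : (ℕ → ℕ) → ℕ × ℕ → ℕ} (hf : RelRec f) {t : (ℕ → ℕ) → ℕ → ℕ} (ht : RelRec t)
    (h : ∀ i h, In i h → (∃ m, t h m = 0) ∧ ∀ m, t h m = 0 → Out i fun n => f h (m, n)) :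
    UniformlyComputable In Out := by
  classical
  -- The test sees only the search variable and not the argument `n`. The same least zero is found
  -- for all `n`, so one parameter serves the whole output function.
  have h1 : TotalRec fun h p => t h p.unpair.2 :=
    relRec_nat_iff.1 (ht.comp (RelRec.unpair_snd RelRec.id))
  have h2 : TotalRec fun h p => f h p.unpair :=
    relRec_nat_iff.1 (hf.comp (RelRec.of_primrec Primrec.unpair))
  obtain ⟨F, hF, hFe⟩ : ∃ F, RecFunctional F ∧ ∀ h n, F h n =
      (Nat.pair <$> (Nat.rfind fun k => (fun m => decide (m = 0)) <$>
        (Part.some (t h (Nat.pair n k).unpair.2) : Part ℕ)) <*> Part.some n) >>=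
        fun n => Part.some (f h n.unpair) :=
    ⟨_, RecFunctional.comp h2 (RecFunctional.pair (RecFunctional.rfind h1)
      (relRec_nat_iff.1 (RelRec.id (α := ℕ)))), fun _ _ => rfl⟩
  refine ⟨F, hF, fun i o hio => ?_⟩
  obtain ⟨hm, hout⟩ := h i o hio
  have ho : Outputs F o fun n => f o (Nat.find hm, n) := by
    intro n
    have : (Nat.rfind fun k => (fun m => decide (m = 0)) <$>
        (Part.some (t o (Nat.pair n k).unpair.2) : Part ℕ)) = Part.some (Nat.find hm) := by
      refine Part.eq_some_iff.2 (Nat.mem_rfind.2 ⟨?_, fun {k} hk => ?_⟩)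
      · simpa using Nat.find_spec hm
      · simpa using Nat.find_min hm hk
    rw [hFe, this]
    simp [Seq.seq]
  exact ⟨_, ho, hout _ (Nat.find_spec hm), ho.computable hF⟩

/-! ## Derived connectives and quantifiers -/

namespace PreStructure.Val

variable {V : Vocab.{v}} {A : PreStructure.{u, v} V}

@[simp] theorem upd_self (w : A.Val) (s : V.Sorts) (i : ℕ) (a : A.sort s) :
    w.upd s i a s i = a := by
  simp [upd]

theorem upd_of_ne (w : A.Val) {s t : V.Sorts} {i j : ℕ} (a : A.sort s) (h : ¬(s = t ∧ i = j)) :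
    w.upd s i a t j = w t j := by
  simp only [upd, h, dite_false]

@[simp] theorem upd_of_sort_ne (w : A.Val) {s t : V.Sorts} (i j : ℕ) (a : A.sort s) (h : s ≠ t) :
    w.upd s i a t j = w t j :=
  w.upd_of_ne a fun h' => h h'.1

@[simp] theorem upd_of_index_ne (w : A.Val) {s t : V.Sorts} {i j : ℕ} (a : A.sort s) (h : i ≠ j) :
    w.upd s i a t j = w t j :=
  w.upd_of_ne a fun h' => h h'.2

end PreStructure.Val

namespace RFormula

variable {V : Vocab.{v}}

/-- Truncated addition. -/
def plus (φ ψ : RFormula V) : RFormula V := .sub .one (.sub (.sub .one φ) ψ)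

/-- Minimum. -/
def min (φ ψ : RFormula V) : RFormula V := .sub φ (.sub φ ψ)

/-- Maximum. -/
def max (φ ψ : RFormula V) : RFormula V := .plus φ (.sub ψ φ)

/-- Absolute difference. -/
def absDiff (φ ψ : RFormula V) : RFormula V := .plus (.sub φ ψ) (.sub ψ φ)

/-- Truncated doubling. -/
def double (φ : RFormula V) : RFormula V := φ.plus φ

/-- The constant `2 ^ -n`. -/
def halfPow (n : ℕ) : RFormula V := half^[n] one

/-- The constant `a / 2 ^ k`, truncated to `[0,1]`. -/
def dyadic (a k : ℕ) : RFormula V := (fun φ => φ.plus (halfPow k))^[a] zero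

section eval

variable (A : PreStructure.{u, v} V) (φ ψ : RFormula V) (w : A.Val)

@[simp] theorem eval_plus : (φ.plus ψ).eval A w = Min.min 1 (φ.eval A w + ψ.eval A w) := by
  have h1 := φ.eval_mem A w
  have h2 := ψ.eval_mem A w
  simp only [plus, eval, Set.mem_Icc] at *
  rcases le_total 1 (φ.eval A w + ψ.eval A w) with h | h
  · rw [min_eq_left h, max_eq_left (by linarith : (0 : ℝ) ≤ 1 - φ.eval A w),
      max_eq_right (by linarith : 1 - φ.eval A w - ψ.eval A w ≤ 0)]
    simp
  · rw [min_eq_right h, max_eq_left (by linarith : (0 : ℝ) ≤ 1 - φ.eval A w),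
      max_eq_left (by linarith : 0 ≤ 1 - φ.eval A w - ψ.eval A w), max_eq_left (by linarith)]
    ring

@[simp] theorem eval_min : (φ.min ψ).eval A w = Min.min (φ.eval A w) (ψ.eval A w) := by
  have h1 := φ.eval_mem A w
  have h2 := ψ.eval_mem A w
  simp only [min, eval, Set.mem_Icc] at *
  rcases le_total (φ.eval A w) (ψ.eval A w) with h | h
  · rw [min_eq_left h, max_eq_right (by linarith : φ.eval A w - ψ.eval A w ≤ 0), sub_zero,
      max_eq_left h1.1]
  · rw [min_eq_right h, max_eq_left (by linarith : 0 ≤ φ.eval A w - ψ.eval A w),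
      max_eq_left (by linarith)]
    ring

@[simp] theorem eval_max : (φ.max ψ).eval A w = Max.max (φ.eval A w) (ψ.eval A w) := by
  have h1 := φ.eval_mem A w
  have h2 := ψ.eval_mem A w
  simp only [max, eval_plus, eval, Set.mem_Icc] at *
  rcases le_total (φ.eval A w) (ψ.eval A w) with h | h
  · rw [max_eq_right h, max_eq_left (by linarith : 0 ≤ ψ.eval A w - φ.eval A w),
      min_eq_right (by linarith)]
    ring
  · rw [max_eq_left h, max_eq_right (by linarith : ψ.eval A w - φ.eval A w ≤ 0),
      min_eq_right (by linarith), add_zero]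

@[simp] theorem eval_absDiff : (φ.absDiff ψ).eval A w = |φ.eval A w - ψ.eval A w| := by
  have h1 := φ.eval_mem A w
  have h2 := ψ.eval_mem A w
  simp only [absDiff, eval_plus, eval, Set.mem_Icc] at *
  rcases le_total (φ.eval A w) (ψ.eval A w) with h | h
  · rw [max_eq_right (by linarith), max_eq_left (by linarith), abs_of_nonpos (by linarith),
      min_eq_right (by linarith)]
    ring
  · rw [max_eq_left (by linarith), max_eq_right (by linarith), abs_of_nonneg (by linarith),
      min_eq_right (by linarith)]
    ring

@[simp] theorem eval_double : φ.double.eval A w = Min.min 1 (2 * φ.eval A w) := by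
  rw [double, eval_plus, two_mul]

@[simp] theorem eval_double_iterate (n : ℕ) :
    (double^[n] φ).eval A w = Min.min 1 (2 ^ n * φ.eval A w) := by
  induction n with
  | zero => simp [(φ.eval_mem A w).2]
  | succ n ih =>
    rw [Function.iterate_succ_apply', eval_double, ih, mul_min_of_nonneg _ _ zero_le_two,
      ← min_assoc, min_eq_left (by norm_num : (1 : ℝ) ≤ 2 * 1), pow_succ]
    ring_nf

@[simp] theorem eval_half_iterate (n : ℕ) :
    (half^[n] φ).eval A w = (1 / 2) ^ n * φ.eval A w := by
  induction n with
  | zero => simp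
  | succ n ih =>
    rw [Function.iterate_succ_apply', eval, ih, pow_succ]
    ring

@[simp] theorem eval_halfPow (n : ℕ) : (halfPow n : RFormula V).eval A w = (1 / 2) ^ n := by
  simp [halfPow, eval]

@[simp] theorem eval_dyadic (a k : ℕ) :
    (dyadic a k : RFormula V).eval A w = Min.min 1 ((a : ℝ) / 2 ^ k) := by
  unfold dyadic
  induction a with
  | zero => simp [eval]
  | succ a ih =>
    rw [Function.iterate_succ_apply', eval_plus, ih, eval_halfPow]
    have hp : (0 : ℝ) < 1 / 2 ^ k := by positivity
    have h1 : ((a + 1 : ℕ) : ℝ) / 2 ^ k = a / 2 ^ k + 1 / 2 ^ k := by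
      push_cast
      ring
    rw [h1, one_div_pow]
    rcases le_total 1 ((a : ℝ) / 2 ^ k) with h | h
    · rw [min_eq_left h, min_eq_left (by linarith), min_eq_left (by linarith)]
    · rw [min_eq_right h]

theorem eval_nonneg : 0 ≤ φ.eval A w := (φ.eval_mem A w).1

theorem eval_le_one : φ.eval A w ≤ 1 := (φ.eval_mem A w).2

theorem bddBelow_eval {ι : Type*} (f : ι → A.Val) :
    BddBelow (Set.range fun i => φ.eval A (f i)) :=
  ⟨0, by rintro _ ⟨i, rfl⟩; exact φ.eval_nonneg A _⟩

theorem bddAbove_eval {ι : Type*} (f : ι → A.Val) :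
    BddAbove (Set.range fun i => φ.eval A (f i)) :=
  ⟨1, by rintro _ ⟨i, rfl⟩; exact φ.eval_le_one A _⟩

end eval

section free

variable (φ ψ : RFormula V)

@[simp] theorem free_plus : (φ.plus ψ).free = φ.free ∪ ψ.free := by simp [plus, free]

@[simp] theorem free_min : (φ.min ψ).free = φ.free ∪ ψ.free := by simp [min, free]

@[simp] theorem free_max : (φ.max ψ).free = φ.free ∪ ψ.free := by
  simp [max, free, Set.union_comm]

@[simp] theorem free_absDiff : (φ.absDiff ψ).free = φ.free ∪ ψ.free := by
  simp only [absDiff, free_plus, free, Set.union_comm ψ.free, Set.union_self]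

@[simp] theorem free_double : φ.double.free = φ.free := by simp [double]

@[simp] theorem free_double_iterate (n : ℕ) : (double^[n] φ).free = φ.free := by
  induction n with
  | zero => rfl
  | succ n ih => rw [Function.iterate_succ_apply', free_double, ih]

@[simp] theorem free_half_iterate (n : ℕ) : (half^[n] φ).free = φ.free := by
  induction n with
  | zero => rfl
  | succ n ih => rw [Function.iterate_succ_apply', free, ih]

@[simp] theorem free_halfPow (n : ℕ) : (halfPow n : RFormula V).free = ∅ := by
  simp [halfPow, free]

@[simp] theorem free_dyadic (a k : ℕ) : (dyadic a k : RFormula V).free = ∅ := by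
  unfold dyadic
  induction a with
  | zero => rfl
  | succ a ih => rw [Function.iterate_succ_apply', free_plus, ih]; simp

end free

/-! ### Blocks of quantifiers and finite lattice operations -/

/-- Infimum over a list of variables. -/
def infs (l : List (V.Sorts × ℕ)) (φ : RFormula V) : RFormula V :=
  l.foldr (fun x ψ => .inf x.1 x.2 ψ) φ

/-- Supremum over a list of variables. -/
def sups (l : List (V.Sorts × ℕ)) (φ : RFormula V) : RFormula V :=
  l.foldr (fun x ψ => .sup x.1 x.2 ψ) φ

/-- The maximum of a list of formulas. -/
def maxs (l : List (RFormula V)) : RFormula V := l.foldr max zero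

/-- The minimum of a list of formulas. -/
def mins (l : List (RFormula V)) : RFormula V := l.foldr min one

theorem free_infs (l : List (V.Sorts × ℕ)) (φ : RFormula V) :
    (φ.infs l).free = φ.free \ {x | x ∈ l} := by
  induction l with
  | nil => simp [infs]
  | cons x l ih =>
    change (φ.infs l).free \ {(x.1, x.2)} = _
    rw [ih]
    ext y
    simp only [Set.mem_sdiff, Set.mem_ofPred_eq, Set.mem_singleton_iff, List.mem_cons]
    tauto

theorem free_sups (l : List (V.Sorts × ℕ)) (φ : RFormula V) :
    (φ.sups l).free = φ.free \ {x | x ∈ l} := by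
  induction l with
  | nil => simp [sups]
  | cons x l ih =>
    change (φ.sups l).free \ {(x.1, x.2)} = _
    rw [ih]
    ext y
    simp only [Set.mem_sdiff, Set.mem_ofPred_eq, Set.mem_singleton_iff, List.mem_cons]
    tauto

theorem free_maxs_subset {l : List (RFormula V)} {F : Set (V.Sorts × ℕ)}
    (h : ∀ φ ∈ l, φ.free ⊆ F) : (maxs l).free ⊆ F := by
  induction l with
  | nil => simp [maxs, free]
  | cons φ l ih =>
    simp only [maxs, List.foldr_cons, free_max, Set.union_subset_iff]
    exact ⟨h φ (by simp), ih fun ψ hψ => h ψ (by simp [hψ])⟩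

theorem free_mins_subset {l : List (RFormula V)} {F : Set (V.Sorts × ℕ)}
    (h : ∀ φ ∈ l, φ.free ⊆ F) : (mins l).free ⊆ F := by
  induction l with
  | nil => simp [mins, free]
  | cons φ l ih =>
    simp only [mins, List.foldr_cons, free_min, Set.union_subset_iff]
    exact ⟨h φ (by simp), ih fun ψ hψ => h ψ (by simp [hψ])⟩

variable {A : PreStructure.{u, v} V}

/-- Together with `le_infs`, this treats a block of infima as one infimum over all assignments that
agree with `w` off the list. The listed variables need not be distinct. -/
theorem infs_le {l : List (V.Sorts × ℕ)} (φ : RFormula V) {w w' : A.Val}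
    (h : ∀ s i, (s, i) ∉ l → w' s i = w s i) : (φ.infs l).eval A w ≤ φ.eval A w' := by
  induction l generalizing w with
  | nil =>
    have : w' = w := funext fun s => funext fun i => h s i (by simp)
    rw [this]; rfl
  | cons x l ih =>
    refine (ciInf_le (bddBelow_eval A (φ.infs l) fun a => w.upd x.1 x.2 a) (w' x.1 x.2)).trans
      (ih fun s i hi => ?_)
    by_cases hx : x.1 = s ∧ x.2 = i
    · obtain ⟨rfl, rfl⟩ := hx
      simp
    · rw [w.upd_of_ne _ hx]
      refine h s i fun hm => ?_
      rcases List.mem_cons.1 hm with rfl | hm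
      · exact hx ⟨rfl, rfl⟩
      · exact hi hm

theorem le_infs {l : List (V.Sorts × ℕ)} (φ : RFormula V) {w : A.Val} {c : ℝ}
    (h : ∀ w' : A.Val, (∀ s i, (s, i) ∉ l → w' s i = w s i) → c ≤ φ.eval A w') :
    c ≤ (φ.infs l).eval A w := by
  induction l generalizing w with
  | nil => exact h w fun _ _ _ => rfl
  | cons x l ih =>
    refine le_ciInf fun a => ih fun w' hw' => h w' fun s i hi => ?_
    rw [List.mem_cons, not_or] at hi
    rw [hw' s i hi.2, w.upd_of_ne]
    rintro ⟨rfl, rfl⟩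
    exact hi.1 rfl

theorem le_sups {l : List (V.Sorts × ℕ)} (φ : RFormula V) {w w' : A.Val}
    (h : ∀ s i, (s, i) ∉ l → w' s i = w s i) : φ.eval A w' ≤ (φ.sups l).eval A w := by
  induction l generalizing w with
  | nil =>
    have : w' = w := funext fun s => funext fun i => h s i (by simp)
    rw [this]; rfl
  | cons x l ih =>
    refine (ih fun s i hi => ?_).trans
      (le_ciSup (bddAbove_eval A (φ.sups l) fun a => w.upd x.1 x.2 a) (w' x.1 x.2))
    by_cases hx : x.1 = s ∧ x.2 = i
    · obtain ⟨rfl, rfl⟩ := hx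
      simp
    · rw [w.upd_of_ne _ hx]
      refine h s i fun hm => ?_
      rcases List.mem_cons.1 hm with rfl | hm
      · exact hx ⟨rfl, rfl⟩
      · exact hi hm

theorem sups_le {l : List (V.Sorts × ℕ)} (φ : RFormula V) {w : A.Val} {c : ℝ}
    (h : ∀ w' : A.Val, (∀ s i, (s, i) ∉ l → w' s i = w s i) → φ.eval A w' ≤ c) :
    (φ.sups l).eval A w ≤ c := by
  induction l generalizing w with
  | nil => exact h w fun _ _ _ => rfl
  | cons x l ih =>
    refine ciSup_le fun a => ih fun w' hw' => h w' fun s i hi => ?_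
    rw [List.mem_cons, not_or] at hi
    rw [hw' s i hi.2, w.upd_of_ne]
    rintro ⟨rfl, rfl⟩
    exact hi.1 rfl

theorem le_maxs {l : List (RFormula V)} {φ : RFormula V} (h : φ ∈ l) (w : A.Val) :
    φ.eval A w ≤ (maxs l).eval A w := by
  induction l with
  | nil => simp at h
  | cons ψ l ih =>
    simp only [maxs, List.foldr_cons, eval_max]
    rcases List.mem_cons.1 h with rfl | h
    · exact le_max_left _ _
    · exact (ih h).trans (le_max_right _ _)

theorem maxs_le {l : List (RFormula V)} {w : A.Val} {c : ℝ} (hc : 0 ≤ c)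
    (h : ∀ φ ∈ l, φ.eval A w ≤ c) : (maxs l).eval A w ≤ c := by
  induction l with
  | nil => simpa [maxs, eval] using hc
  | cons ψ l ih =>
    simp only [maxs, List.foldr_cons, eval_max]
    exact max_le (h ψ (by simp)) (ih fun φ hφ => h φ (by simp [hφ]))

theorem mins_le {l : List (RFormula V)} {φ : RFormula V} (h : φ ∈ l) (w : A.Val) :
    (mins l).eval A w ≤ φ.eval A w := by
  induction l with
  | nil => simp at h
  | cons ψ l ih =>
    simp only [mins, List.foldr_cons, eval_min]
    rcases List.mem_cons.1 h with rfl | h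
    · exact min_le_left _ _
    · exact (min_le_right _ _).trans (ih h)

/-- The bound `c < 1` is what the empty list requires, whose minimum is 1. -/
theorem lt_mins {l : List (RFormula V)} {w : A.Val} {c : ℝ} (hc : c < 1)
    (h : ∀ φ ∈ l, c < φ.eval A w) : c < (mins l).eval A w := by
  induction l with
  | nil => simpa [mins, eval] using hc
  | cons ψ l ih =>
    simp only [mins, List.foldr_cons, eval_min]
    exact lt_min (h ψ (by simp)) (ih fun φ hφ => h φ (by simp [hφ]))

end RFormula

/-! ## Uniform limits of restricted formulas -/

/-- A restricted formula as a formula. -/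
def RFormula.toFormula {V : Vocab.{v}} (φ : RFormula V) : Formula V := fun _ => φ

theorem hasSum_half_pow_succ : HasSum (fun n : ℕ => (1 / 2 : ℝ) ^ (n + 1)) 1 := by
  have := hasSum_geometric_two.mul_right (1 / 2 : ℝ)
  simpa [pow_succ] using this

@[simp] theorem RFormula.eval_toFormula {V : Vocab.{v}} (A : PreStructure.{u, v} V)
    (φ : RFormula V) (w : A.Val) : φ.toFormula.eval A w = φ.eval A w := by
  simp only [Formula.eval, toFormula, tsum_mul_right, hasSum_half_pow_succ.tsum_eq, one_mul]

namespace Formula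

variable {V : Vocab.{v}}

/-- Auxiliary digit of the limit of a sequence of restricted formulas, given the partial sum. -/
def limDigit (ψ : ℕ → RFormula V) (n : ℕ) (S : RFormula V) : RFormula V :=
  (RFormula.sub (RFormula.double^[n] (.sub (ψ (n + 2)) S)) (RFormula.halfPow 2)).double

/-- Partial sums of the limit of a sequence of restricted formulas. -/
def limSum (ψ : ℕ → RFormula V) : ℕ → RFormula V
  | 0 => .zero
  | n + 1 => (limSum ψ n).plus (RFormula.half^[n + 1] (limDigit ψ n (limSum ψ n)))

/-- The limit of a sequence of restricted formulas that converges at the rate `2 ^ -n`. -/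
def lim (ψ : ℕ → RFormula V) : Formula V := fun n => limDigit ψ n (limSum ψ n)

/-- Let `S` be the n-th partial sum and y = 2^n (x - S), a number in [0,1]. The formula `ψ (n + 2)`
determines y up to 1/4. Subtracting 1/4 makes the error one-sided, between -1/2 and 0, and doubling
gives a digit D with 2y - 1 ≤ D ≤ 2y. The new remainder 2^-n (y - D/2) lies between 0 and 2^-(n+1)
again, so non-negative digits suffice. -/
theorem lim_eval_aux (ψ : ℕ → RFormula V) (A : PreStructure.{u, v} V) (w : A.Val) {x : ℝ}
    (hx : x ∈ Set.Icc (0 : ℝ) 1) (h : ∀ n, |(ψ n).eval A w - x| ≤ (1 / 2) ^ n) (n : ℕ) :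
    (limSum ψ n).eval A w =
      ∑ k ∈ Finset.range n, (1 / 2 : ℝ) ^ (k + 1) * (lim ψ k).eval A w ∧
    0 ≤ x - (limSum ψ n).eval A w ∧ x - (limSum ψ n).eval A w ≤ (1 / 2) ^ n := by
  induction n with
  | zero => simpa [limSum, RFormula.eval] using hx
  | succ n ih =>
    obtain ⟨h1, h2, h3⟩ := ih
    set S := (limSum ψ n).eval A w with hS
    have hd : (lim ψ n).eval A w =
        Min.min 1 (2 * Max.max (Min.min 1 (2 ^ n * Max.max ((ψ (n + 2)).eval A w - S) 0)
          - (1 / 2) ^ 2) 0) := by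
      simp [lim, limDigit, RFormula.eval, ← hS]
    set D := (lim ψ n).eval A w with hD
    have hp : (0 : ℝ) < 2 ^ n := by positivity
    have hq : (1 / 2 : ℝ) ^ n = 1 / 2 ^ n := one_div_pow _ _
    obtain ⟨y, hy⟩ : ∃ y, y = 2 ^ n * (x - S) := ⟨_, rfl⟩
    have hxy : x - S = (1 / 2) ^ n * y := by rw [hy, hq]; field_simp
    have hy0 : 0 ≤ y := by rw [hy]; positivity
    have hy1 : y ≤ 1 := by
      rw [hq, le_div_iff₀ hp] at h3
      linarith
    obtain ⟨z, hz⟩ : ∃ z, z = 2 ^ n * Max.max ((ψ (n + 2)).eval A w - S) 0 := ⟨_, rfl⟩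
    have hzy : |z - y| ≤ 1 / 4 := by
      have h4 : |Max.max ((ψ (n + 2)).eval A w - S) 0 - Max.max (x - S) 0| ≤
          |(ψ (n + 2)).eval A w - x| := by
        refine (abs_max_sub_max_le_abs _ _ _).trans (le_of_eq ?_)
        congr 1; ring
      rw [max_eq_left h2] at h4
      have h5 := h4.trans (h (n + 2))
      rw [hz, hy, ← mul_sub, abs_mul, abs_of_pos hp]
      calc 2 ^ n * |Max.max ((ψ (n + 2)).eval A w - S) 0 - (x - S)|
          ≤ 2 ^ n * (1 / 2) ^ (n + 2) := mul_le_mul_of_nonneg_left h5 hp.le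
        _ = 1 / 4 := by rw [pow_add, hq]; field_simp; norm_num
    rw [← hz] at hd
    have hD01 : 2 * y - 1 ≤ D ∧ D ≤ 2 * y := by
      have := abs_le.1 hzy
      rw [hd]
      constructor
      · refine le_min (by linarith) ?_
        have : y - 1 / 2 ≤ Min.min 1 z - (1 / 2) ^ 2 := by
          have : y - 1 / 4 ≤ Min.min 1 z := le_min (by linarith) (by linarith)
          linarith
        have := this.trans (le_max_left _ 0)
        linarith
      · refine (min_le_right _ _).trans ?_
        have : Max.max (Min.min 1 z - (1 / 2) ^ 2) 0 ≤ y :=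
          max_le (by have := min_le_right 1 z; linarith) hy0
        linarith
    -- The truncated sum is a genuine one: it stays below x, which is at most 1.
    have hS1 : (limSum ψ (n + 1)).eval A w = S + (1 / 2) ^ (n + 1) * D := by
      have : (limSum ψ (n + 1)).eval A w = Min.min 1 (S + (1 / 2) ^ (n + 1) * D) := by
        rw [limSum, RFormula.eval_plus, RFormula.eval_half_iterate, ← hS]
        rfl
      rw [this, min_eq_right]
      have : (1 / 2 : ℝ) ^ (n + 1) * D ≤ x - S := by
        rw [hxy, pow_succ]
        nlinarith [hD01.2, pow_pos (by norm_num : (0 : ℝ) < 1 / 2) n]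
      linarith [hx.2]
    have hp' := pow_pos (by norm_num : (0 : ℝ) < 1 / 2) n
    refine ⟨?_, ?_, ?_⟩
    · rw [hS1, Finset.sum_range_succ, ← h1]
    · rw [hS1, ← sub_sub, hxy, pow_succ]
      nlinarith [hD01.2]
    · rw [hS1, ← sub_sub, hxy, pow_succ]
      nlinarith [hD01.1]

/-- This is the source of all formulas below that are not restricted: it suffices to give restricted
approximations up to 2^-n, from a sequence that does not depend on the structure. -/
theorem lim_eval (ψ : ℕ → RFormula V) (A : PreStructure.{u, v} V) (w : A.Val) {x : ℝ}
    (hx : x ∈ Set.Icc (0 : ℝ) 1) (h : ∀ n, |(ψ n).eval A w - x| ≤ (1 / 2) ^ n) :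
    (lim ψ).eval A w = x := by
  have hs := lim_eval_aux ψ A w hx h
  have h0 : ∀ n, 0 ≤ (1 / 2 : ℝ) ^ (n + 1) * (lim ψ n).eval A w := fun n =>
    mul_nonneg (by positivity) ((lim ψ n).eval_nonneg A w)
  refine HasSum.tsum_eq ((hasSum_iff_tendsto_nat_of_nonneg h0 x).2 ?_)
  have ht : Filter.Tendsto (fun n : ℕ => x - (1 / 2 : ℝ) ^ n) Filter.atTop (nhds x) := by
    simpa using (tendsto_pow_atTop_nhds_zero_of_lt_one (by norm_num : (0 : ℝ) ≤ 1 / 2)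
      (by norm_num)).const_sub x
  refine tendsto_of_tendsto_of_tendsto_of_le_of_le ht tendsto_const_nhds ?_ ?_
  · intro n
    have := hs n
    simp only
    linarith
  · intro n
    have := hs n
    simp only
    linarith

theorem lim_free {ψ : ℕ → RFormula V} {F : Set (V.Sorts × ℕ)} (h : ∀ n, (ψ n).free ⊆ F) :
    (lim ψ).FreeIn F := by
  have h1 : ∀ n S, S.free ⊆ F → (limDigit ψ n S).free ⊆ F := fun n S hS => by
    simp only [limDigit, RFormula.free_double, RFormula.free, RFormula.free_double_iterate,
      RFormula.free_halfPow, Set.union_empty]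
    exact Set.union_subset (h _) hS
  have h2 : ∀ n, (limSum ψ n).free ⊆ F := fun n => by
    induction n with
    | zero => simp [limSum, RFormula.free]
    | succ n ih =>
      rw [limSum, RFormula.free_plus, RFormula.free_half_iterate]
      exact Set.union_subset ih (h1 _ _ ih)
  exact fun n => h1 _ _ (h2 n)

end Formula

/-! ## Metric and predicates of the disjoint union -/

section

variable {V : Vocab.{v}} (A : PreStructure.{u, v} V) (O : ℕ → V.Sorts)

theorem Cmdu.isCompleteMetric : IsCompleteMetric (Cmdu.d A O) := by
  intro a ha
  have hc : CauchySeq a := Metric.cauchySeq_iff.2 ha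
  obtain ⟨l, hl⟩ := cauchySeq_tendsto_of_complete hc
  exact ⟨l, Metric.tendsto_atTop.1 hl⟩

variable {A O}

theorem Cmdu.dist_eq (a b : Cmdu A O) : dist a b = Cmdu.d A O a b := rfl

theorem Cmdu.dist_star (a : Cmdu A O) : dist a .star = Cmdu.height A O a := by
  cases a <;> rfl

theorem Cmdu.dist_pt (n : ℕ) (x y : A.sort (O n)) :
    dist (Cmdu.pt n x : Cmdu A O) (.pt n y) = (1 / 2 : ℝ) ^ n * dist x y :=
  Cmdu.d_same A O n x y

theorem Cmdu.dist_of_ne {n m : ℕ} (h : n ≠ m) (x : A.sort (O n)) (y : A.sort (O m)) :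
    dist (Cmdu.pt n x : Cmdu A O) (.pt m y) = |(1 / 2 : ℝ) ^ n - (1 / 2 : ℝ) ^ m| := by
  rw [Cmdu.dist_eq]
  simp [Cmdu.d, h]

theorem Cmdu.height_mem (a : Cmdu A O) : Cmdu.height A O a ∈ Set.Icc (0 : ℝ) 1 :=
  ⟨Cmdu.dist_star a ▸ dist_nonneg, Cmdu.dist_star a ▸ Cmdu.dist_le_one A O _ _⟩

theorem Cmdu.dist_inc {n : ℕ} {s : V.Sorts} (h : O n = s) (x y : A.sort s) :
    dist (Cmdu.inc n h x : Cmdu A O) (Cmdu.inc n h y) = (1 / 2 : ℝ) ^ n * dist x y := by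
  subst h
  exact Cmdu.dist_pt n x y

theorem Cmdu.inc_injective {n : ℕ} {s : V.Sorts} (h : O n = s) :
    Function.Injective (Cmdu.inc (A := A) (O := O) n h) := by
  subst h
  intro x y hxy
  simpa [Cmdu.inc] using hxy

/-- A point outside of `O n` has distance at least `2 ^ -n / 2` from the points of `O n`. -/
theorem Cmdu.gap_inc {n : ℕ} {s : V.Sorts} (h : O n = s) (x : A.sort s) (b : Cmdu A O) :
    (∃ y, b = Cmdu.inc n h y) ∨ (1 / 2 : ℝ) ^ n / 2 ≤ dist (Cmdu.inc n h x) b := by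
  subst h
  exact Cmdu.gap A O n x b

theorem Cmdu.height_inc {n : ℕ} {s : V.Sorts} (h : O n = s) (x : A.sort s) :
    Cmdu.height A O (Cmdu.inc n h x) = (1 / 2) ^ n := by
  subst h; rfl

theorem Cmdu.eq_inc_of_height {n : ℕ} {s : V.Sorts} (h : O n = s) {a : Cmdu A O}
    (ha : Cmdu.height A O a = (1 / 2) ^ n) : ∃ x, a = Cmdu.inc n h x := by
  subst h
  cases a with
  | star => exact absurd ha.symm (pow_pos (by norm_num) n).ne'
  | pt m x =>
    have : m = n := pow_right_injective₀ (by norm_num) (by norm_num) ha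
    subst this
    exact ⟨x, rfl⟩

/-- The distance to `O n` is a function of the height. -/
theorem Cmdu.infDist_part (n : ℕ) (a : Cmdu A O) :
    Metric.infDist a (Cmdu.part A O n) = |Cmdu.height A O a - (1 / 2) ^ n| := by
  have hne : (Cmdu.part A O n).Nonempty := ⟨.pt n (Classical.choice (A.sort (O n)).nonempty), _, rfl⟩
  by_cases ha : a ∈ Cmdu.part A O n
  · rw [Metric.infDist_zero_of_mem ha]
    obtain ⟨x, rfl⟩ := ha
    simp [Cmdu.height]
  · have hd : ∀ x : A.sort (O n), dist a (.pt n x) = |Cmdu.height A O a - (1 / 2) ^ n| := fun x => by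
      rcases Cmdu.cases₂ A O a (.pt n x) with ⟨-, h⟩ | ⟨m, y, z, rfl, h⟩ | h
      · exact absurd h (by simp)
      · obtain ⟨rfl, -⟩ := Cmdu.pt.inj h
        exact absurd ⟨y, rfl⟩ ha
      · exact h
    refine le_antisymm ?_ ((Metric.le_infDist hne).2 ?_)
    · obtain ⟨_, x, rfl⟩ := hne
      have hx : Cmdu.pt n x ∈ Cmdu.part A O n := ⟨x, rfl⟩
      exact (Metric.infDist_le_dist_of_mem hx).trans (hd x).le
    · rintro _ ⟨x, rfl⟩
      exact (hd x).ge

variable {p : V.Preds} {i : Fin (V.ar p) → ℕ} (hi : ∀ k, O (i k) = V.dom p k)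

/-- The definition chooses some tuple of preimages; injectivity of `Cmdu.inc` makes the choice
irrelevant. -/
theorem Cmdu.extPred_inc (y : ∀ k, A.sort (V.dom p k)) :
    Cmdu.extPred A O p i hi (fun k => Cmdu.inc (i k) (hi k) (y k)) = A.pred p y := by
  have h : ∃ z : ∀ k, A.sort (V.dom p k), ∀ k,
      (Cmdu.inc (i k) (hi k) (y k) : Cmdu A O) = Cmdu.inc (i k) (hi k) (z k) := ⟨y, fun _ => rfl⟩
  rw [Cmdu.extPred, dif_pos h]
  congr 1
  exact funext fun k => (Cmdu.inc_injective (hi k) (h.choose_spec k)).symm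

theorem Cmdu.extPred_of_not {x : Fin (V.ar p) → Cmdu A O}
    (h : ¬∃ y : ∀ k, A.sort (V.dom p k), ∀ k, x k = Cmdu.inc (i k) (hi k) (y k)) :
    Cmdu.extPred A O p i hi x = 1 := by
  rw [Cmdu.extPred, dif_neg h]

theorem Cmdu.extPred_of_height_ne {x : Fin (V.ar p) → Cmdu A O} {k : Fin (V.ar p)}
    (h : Cmdu.height A O (x k) ≠ (1 / 2) ^ i k) : Cmdu.extPred A O p i hi x = 1 := by
  refine Cmdu.extPred_of_not hi fun ⟨y, hy⟩ => h ?_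
  rw [hy k, Cmdu.height_inc]

theorem half_pow_sup_le (i : Fin (V.ar p) → ℕ) (k : Fin (V.ar p)) :
    (1 / 2 : ℝ) ^ Finset.univ.sup i ≤ (1 / 2) ^ i k :=
  pow_le_pow_of_le_one (by norm_num) (by norm_num) (Finset.le_sup (Finset.mem_univ k))

/-- If both tuples are in the domain, passing back to the sorts stretches distances by at most 2^N,
with N the largest index. If neither is, both values are 1. If exactly one is, some coordinate
leaves its piece, and the gap around that piece makes it move by at least 2^-(N+1). Moduli and
Lipschitz constants are read off from this trichotomy. -/
theorem Cmdu.extPred_cases (x y : Fin (V.ar p) → Cmdu A O) :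
    (∃ a b : ∀ k, A.sort (V.dom p k), (x = fun k => Cmdu.inc (i k) (hi k) (a k)) ∧
      (y = fun k => Cmdu.inc (i k) (hi k) (b k)) ∧
        ∀ k, dist (a k) (b k) ≤ 2 ^ Finset.univ.sup i * dist (x k) (y k)) ∨
    (Cmdu.extPred A O p i hi x = Cmdu.extPred A O p i hi y) ∨
      ∃ k, 1 ≤ 2 ^ (Finset.univ.sup i + 1) * dist (x k) (y k) := by
  have key : ∀ x y : Fin (V.ar p) → Cmdu A O,
      (∃ a : ∀ k, A.sort (V.dom p k), ∀ k, x k = Cmdu.inc (i k) (hi k) (a k)) →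
      (¬∃ b : ∀ k, A.sort (V.dom p k), ∀ k, y k = Cmdu.inc (i k) (hi k) (b k)) →
      ∃ k, 1 ≤ 2 ^ (Finset.univ.sup i + 1) * dist (x k) (y k) := by
    rintro x y ⟨a, ha⟩ hy
    by_contra! hcon
    refine hy ?_
    have : ∀ k, ∃ b, y k = Cmdu.inc (i k) (hi k) b := fun k => by
      rcases Cmdu.gap_inc (hi k) (a k) (y k) with h | h
      · exact h
      · rw [← ha k] at h
        have h1 := hcon k
        have h2 := half_pow_sup_le i k
        have h3 : (2 : ℝ) ^ (Finset.univ.sup i + 1) * ((1 / 2) ^ Finset.univ.sup i / 2) = 1 := by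
          rw [one_div_pow, pow_succ]
          field_simp
        have h4 : (2 : ℝ) ^ (Finset.univ.sup i + 1) * ((1 / 2) ^ Finset.univ.sup i / 2) ≤
            2 ^ (Finset.univ.sup i + 1) * dist (x k) (y k) :=
          mul_le_mul_of_nonneg_left (by linarith) (by positivity)
        linarith
    choose b hb using this
    exact ⟨b, hb⟩
  by_cases hx : ∃ a : ∀ k, A.sort (V.dom p k), ∀ k, x k = Cmdu.inc (i k) (hi k) (a k)
  · by_cases hy : ∃ a : ∀ k, A.sort (V.dom p k), ∀ k, y k = Cmdu.inc (i k) (hi k) (a k)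
    · obtain ⟨a, ha⟩ := hx
      obtain ⟨b, hb⟩ := hy
      refine Or.inl ⟨a, b, funext ha, funext hb, fun k => ?_⟩
      rw [ha k, hb k, Cmdu.dist_inc, ← mul_assoc]
      refine le_mul_of_one_le_left dist_nonneg ?_
      have h3 : (2 : ℝ) ^ Finset.univ.sup i * (1 / 2) ^ Finset.univ.sup i = 1 := by
        rw [← mul_pow]; norm_num
      exact h3.ge.trans (mul_le_mul_of_nonneg_left (half_pow_sup_le i k) (by positivity))
    · exact Or.inr (Or.inr (key x y hx hy))
  · by_cases hy : ∃ a : ∀ k, A.sort (V.dom p k), ∀ k, y k = Cmdu.inc (i k) (hi k) (a k)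
    · obtain ⟨k, hk⟩ := key y x hy hx
      exact Or.inr (Or.inr ⟨k, dist_comm (x k) (y k) ▸ hk⟩)
    · exact Or.inr (Or.inl (by rw [Cmdu.extPred_of_not hi hx, Cmdu.extPred_of_not hi hy]))

theorem Cmdu.extPred_mem (x : Fin (V.ar p) → Cmdu A O) :
    Cmdu.extPred A O p i hi x ∈ Set.Icc (0 : ℝ) 1 :=
  (cmdu A O).pred_mem (some ⟨p, i, hi⟩) x

end

theorem abs_sub_le_one {a b : ℝ} (ha : a ∈ Set.Icc (0 : ℝ) 1) (hb : b ∈ Set.Icc (0 : ℝ) 1) :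
    |a - b| ≤ 1 :=
  abs_sub_le_iff.2 ⟨by linarith [ha.2, hb.1], by linarith [hb.2, ha.1]⟩

/-- Truncation of a real number to the unit interval. -/
theorem coe_projIcc_unit {x : ℝ} (hx : 0 ≤ x) :
    (Set.projIcc (0 : ℝ) 1 zero_le_one x : ℝ) = min 1 x := by
  rw [Set.coe_projIcc, max_eq_right (le_min zero_le_one hx)]

/-! ### Moduli and Lipschitz constants of the extended predicates -/

section

variable {L : MetricSignature.{v}} {O : ℕ → L.Sorts}

theorem cmduSig_modulus (p : L.Preds) (i : Fin (L.ar p) → ℕ) (hi : ∀ k, O (i k) = L.dom p k)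
    (t : unitInterval) :
    ((cmduSig L O).modulus (some ⟨p, i, hi⟩) t : ℝ) =
      min 1 (max (L.modulus p (Set.projIcc (0 : ℝ) 1 zero_le_one
            ((2 : ℝ) ^ (Finset.univ.sup i) * (t : ℝ))) : ℝ)
          ((2 : ℝ) ^ (Finset.univ.sup i + 1) * (t : ℝ))) :=
  coe_projIcc_unit (le_max_of_le_left (L.modulus p _).2.1)

/-- The first term of the modulus pays for tuples inside the domain. For tuples that cross its
boundary the second term is at least 1. -/
theorem cmdu_respects (A : LStructure.{u, v} L) :
    (cmdu A.toPreStructure O).Respects (cmduSig L O) := by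
  rintro (_ | ⟨p, i, hi⟩) δ x y hxy
  · change |dist (α := Cmdu A.toPreStructure O) (x (0 : Fin 1)) .star -
      dist (α := Cmdu A.toPreStructure O) (y (0 : Fin 1)) .star| ≤ δ
    exact (abs_dist_sub_le _ _ _).trans (hxy (0 : Fin 1))
  · rw [cmduSig_modulus]
    change |Cmdu.extPred _ O p i hi x - Cmdu.extPred _ O p i hi y| ≤ _
    have h1 := abs_sub_le_one (Cmdu.extPred_mem hi x) (Cmdu.extPred_mem hi y)
    refine le_min h1 ?_
    rcases Cmdu.extPred_cases hi x y with ⟨a, b, rfl, rfl, hab⟩ | h | ⟨k, hk⟩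
    · refine le_max_of_le_left ?_
      rw [Cmdu.extPred_inc, Cmdu.extPred_inc]
      refine A.respects p _ a b fun k => ?_
      rw [coe_projIcc_unit (mul_nonneg (by positivity) δ.2.1)]
      refine le_min ((A.sort _).dist_le_one _ _) ((hab k).trans ?_)
      exact mul_le_mul_of_nonneg_left (hxy k) (by positivity)
    · rw [h, sub_self, abs_zero]
      exact le_max_of_le_left (L.modulus p _).2.1
    · exact le_max_of_le_right (h1.trans (hk.trans
        (mul_le_mul_of_nonneg_left (hxy k) (by positivity))))

/-- The disjoint union as a structure of its own signature. -/
noncomputable def cmduStructure (A : LStructure.{u, v} L) (O : ℕ → L.Sorts) :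
    LStructure.{u, v} (cmduSig L O) where
  toPreStructure := cmdu A.toPreStructure O
  respects := cmdu_respects A

theorem LStructure.uniformContinuous_pred (A : LStructure.{u, v} L) (p : L.Preds) :
    UniformContinuous (A.pred p) := by
  rw [Metric.uniformContinuous_iff]
  intro ε hε
  obtain ⟨δ, hδ, h⟩ := Metric.continuous_iff.1 (L.modulus_continuous p) 0 ε hε
  -- Cut down to [0,1], where the modulus is defined, and halved, so that its distance to 0 is
  -- strictly less than δ.
  refine ⟨min δ 1 / 2, by positivity, fun x y hxy => ?_⟩
  have hm : min δ 1 / 2 ∈ unitInterval :=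
    ⟨by positivity, by linarith [min_le_right δ 1]⟩
  have h1 := A.respects p ⟨min δ 1 / 2, hm⟩ x y fun i => (dist_le_pi_dist x y i).trans hxy.le
  have h2 : dist (⟨min δ 1 / 2, hm⟩ : unitInterval) 0 < δ := by
    rw [Subtype.dist_eq, Set.Icc.coe_zero, Real.dist_eq, sub_zero, abs_of_nonneg hm.1]
    have := min_le_left δ 1
    have : 0 < min δ 1 := by positivity
    linarith
  have h3 := h _ h2
  rw [L.modulus_zero, Subtype.dist_eq, Set.Icc.coe_zero, Real.dist_eq, sub_zero] at h3
  rw [Real.dist_eq]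
  exact h1.trans_lt ((le_abs_self _).trans_lt h3)

theorem cmdu_lipschitz_height (A : PreStructure.{u, v} L.toVocab) :
    LipschitzWith 1 ((cmdu A O).pred none) := by
  refine LipschitzWith.of_dist_le_mul fun x y => ?_
  rw [NNReal.coe_one, one_mul]
  refine le_trans ?_ (dist_le_pi_dist x y (0 : Fin 1))
  exact abs_dist_sub_le (α := Cmdu A O) (x (0 : Fin 1)) (y (0 : Fin 1)) .star

theorem cmdu_lipschitz_extPred (p : L.Preds) (i : Fin (L.ar p) → ℕ)
    (hi : ∀ k, O (i k) = L.dom p k) (K : NNReal) :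
    ∃ K' : NNReal, (∀ A : LStructure.{u, v} L, LipschitzWith K (A.pred p) →
        LipschitzWith K' ((cmdu A.toPreStructure O).pred (some ⟨p, i, hi⟩))) ∧
      ((∀ t : unitInterval, (L.modulus p t : ℝ) ≤ K * t) →
        ∀ t : unitInterval, ((cmduSig L O).modulus (some ⟨p, i, hi⟩) t : ℝ) ≤ K' * t) := by
  -- The first constant serves tuples inside the domain, the second one tuples that cross a gap. The
  -- two terms of the syntactic modulus have the same slopes.
  refine ⟨max (K * 2 ^ Finset.univ.sup i) (2 ^ (Finset.univ.sup i + 1)), fun A hA => ?_,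
    fun h t => ?_⟩
  · refine LipschitzWith.of_dist_le_mul fun x y => ?_
    change dist (Cmdu.extPred _ O p i hi x) (Cmdu.extPred _ O p i hi y) ≤ _
    have h1 := abs_sub_le_one (Cmdu.extPred_mem hi x) (Cmdu.extPred_mem hi y)
    have hd : ∀ k, dist (α := Cmdu A.toPreStructure O) (x k) (y k) ≤ dist x y :=
      dist_le_pi_dist x y
    rw [Real.dist_eq]
    push_cast
    rcases Cmdu.extPred_cases hi x y with ⟨a, b, rfl, rfl, hab⟩ | h | ⟨k, hk⟩
    · rw [Cmdu.extPred_inc, Cmdu.extPred_inc, ← Real.dist_eq]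
      refine (hA.dist_le_mul a b).trans (le_trans ?_
        (mul_le_mul_of_nonneg_right (le_max_left _ _) dist_nonneg))
      rw [mul_assoc]
      refine mul_le_mul_of_nonneg_left ?_ K.2
      refine (dist_pi_le_iff (mul_nonneg (by positivity) dist_nonneg)).2 fun k => ?_
      exact (hab k).trans (mul_le_mul_of_nonneg_left (hd k) (by positivity))
    · rw [h, sub_self, abs_zero]
      exact mul_nonneg (by positivity) dist_nonneg
    · refine h1.trans (hk.trans ?_)
      exact mul_le_mul (le_max_right _ _) (hd k) dist_nonneg (by positivity)
  · rw [cmduSig_modulus]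
    refine (min_le_right _ _).trans ?_
    push_cast
    rw [max_mul_of_nonneg _ _ t.2.1]
    refine max_le_max ?_ le_rfl
    refine (h _).trans ?_
    rw [coe_projIcc_unit (mul_nonneg (by positivity) t.2.1), mul_assoc]
    exact mul_le_mul_of_nonneg_left (min_le_right _ _) K.2

end

/-! ## Dyadic approximations -/

theorem Approx.max {a b k : ℕ} {x y : ℝ} (ha : Approx a k x) (hb : Approx b k y) :
    Approx (max a b) k (max x y) := by
  unfold Approx at *
  have h : ((Max.max a b : ℕ) : ℝ) / 2 ^ k = Max.max ((a : ℝ) / 2 ^ k) (b / 2 ^ k) := by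
    rw [Nat.cast_max, max_div_div_right (by positivity)]
  rw [h]
  exact (abs_max_sub_max_le_max _ _ _ _).trans (max_le ha hb)

theorem Approx.min_one {a k : ℕ} {x : ℝ} (ha : Approx a k x) :
    Approx (min (2 ^ k) a) k (min 1 x) := by
  unfold Approx at *
  have h : ((Min.min (2 ^ k) a : ℕ) : ℝ) / 2 ^ k = Min.min 1 ((a : ℝ) / 2 ^ k) := by
    rw [Nat.cast_min, ← min_div_div_right (by positivity)]
    simp
  rw [h]
  refine (abs_min_sub_min_le_max _ _ _ _).trans (max_le ?_ ha)
  simp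

/-- The remainder is at most d - 1, so rounding down loses at most 1 - 1/d. The slack 1/d is needed
in `Approx.div_two_pow`. -/
theorem nat_div_bounds (a : ℕ) {d : ℕ} (hd : 0 < d) :
    ((a / d : ℕ) : ℝ) ≤ (a : ℝ) / d ∧ (a : ℝ) / d ≤ (a / d : ℕ) + (1 - 1 / d) := by
  have hd' : (0 : ℝ) < d := by exact_mod_cast hd
  refine ⟨Nat.cast_div_le, ?_⟩
  have h1 : d * (a / d) + a % d = a := Nat.div_add_mod a d
  have h2 : a % d + 1 ≤ d := Nat.mod_lt a hd
  have h3 : (d : ℝ) * (a / d : ℕ) + (a % d : ℕ) = a := by exact_mod_cast h1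
  have h4 : ((a % d : ℕ) : ℝ) + 1 ≤ d := by exact_mod_cast h2
  rw [div_le_iff₀ hd']
  have h5 : ((a / d : ℕ) + (1 - 1 / (d : ℝ))) * d = d * (a / d : ℕ) + (d - 1) := by
    field_simp
  rw [h5]
  linarith

/-- In units of 2^-k, the old error shrinks to 2^-n and integer division adds at most 1 - 2^-n. The
total is at most one unit, so no additional precision has to be requested from the name. -/
theorem Approx.div_two_pow {a k : ℕ} {x : ℝ} (ha : Approx a k x) (n : ℕ) :
    Approx (a / 2 ^ n) k ((1 / 2) ^ n * x) := by
  unfold Approx at *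
  obtain ⟨h1, h2⟩ := nat_div_bounds a (show 0 < 2 ^ n by positivity)
  push_cast at h1 h2
  have hn : (0 : ℝ) < 2 ^ n := by positivity
  have hk : (0 : ℝ) < 2 ^ k := by positivity
  have h3 := abs_le.1 ha
  have h4 : (a : ℝ) ≤ 2 ^ k * x + 1 ∧ 2 ^ k * x - 1 ≤ a := by
    constructor
    · have := h3.2
      rw [sub_le_iff_le_add, div_le_iff₀ hk] at this
      have h5 : (1 / 2 ^ k + x) * 2 ^ k = 2 ^ k * x + 1 := by field_simp; ring
      linarith
    · have := h3.1
      rw [le_sub_iff_add_le, le_div_iff₀ hk] at this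
      have h5 : (-(1 / 2 ^ k) + x) * 2 ^ k = 2 ^ k * x - 1 := by field_simp; ring
      linarith
  have h6 : (a : ℝ) / 2 ^ n ≤ 2 ^ k * ((1 / 2) ^ n * x) + 1 / 2 ^ n := by
    have := div_le_div_of_nonneg_right h4.1 hn.le
    rw [one_div_pow]
    calc (a : ℝ) / 2 ^ n ≤ (2 ^ k * x + 1) / 2 ^ n := this
      _ = _ := by ring
  have h7 : 2 ^ k * ((1 / 2) ^ n * x) - 1 / 2 ^ n ≤ (a : ℝ) / 2 ^ n := by
    have := div_le_div_of_nonneg_right h4.2 hn.le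
    rw [one_div_pow]
    calc 2 ^ k * (1 / 2 ^ n * x) - 1 / 2 ^ n = (2 ^ k * x - 1) / 2 ^ n := by ring
      _ ≤ _ := this
  have h9 : (1 : ℝ) / 2 ^ n ≤ 1 := by
    rw [div_le_one hn]
    exact one_le_pow₀ (by norm_num)
  rw [abs_le, le_sub_iff_add_le, le_div_iff₀ hk, sub_le_iff_le_add, div_le_iff₀ hk]
  constructor
  · have h5 : (-(1 / 2 ^ k) + (1 / 2) ^ n * x) * 2 ^ k = 2 ^ k * ((1 / 2) ^ n * x) - 1 := by
      field_simp
      ring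
    linarith
  · have h5 : (1 / 2 ^ k + (1 / 2) ^ n * x) * 2 ^ k = 2 ^ k * ((1 / 2) ^ n * x) + 1 := by
      field_simp
      ring
    linarith

theorem approx_one (k : ℕ) : Approx (2 ^ k) k 1 := by
  unfold Approx
  simp

theorem approx_half_pow (n k : ℕ) : Approx (2 ^ k / 2 ^ n) k ((1 / 2) ^ n) := by
  simpa using (approx_one k).div_two_pow n

theorem approx_div_two_pow (j m k : ℕ) : Approx (j * 2 ^ k / 2 ^ m) k (j / 2 ^ m) := by
  have h : Approx (j * 2 ^ k) k j := by
    unfold Approx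
    simp
  have := h.div_two_pow m
  rwa [one_div_pow, one_div_mul_eq_div] at this

/-- Both quotients are rounded in the same direction by less than one unit, so their difference is
off by less than one unit too. -/
theorem approx_abs_sub_half_pow (n m k : ℕ) :
    Approx (max (2 ^ k / 2 ^ n) (2 ^ k / 2 ^ m) - min (2 ^ k / 2 ^ n) (2 ^ k / 2 ^ m)) k
      |(1 / 2) ^ n - (1 / 2) ^ m| := by
  unfold Approx
  obtain ⟨h1, h2⟩ := nat_div_bounds (2 ^ k) (show 0 < 2 ^ n by positivity)
  obtain ⟨h3, h4⟩ := nat_div_bounds (2 ^ k) (show 0 < 2 ^ m by positivity)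
  generalize 2 ^ k / 2 ^ n = a at *
  generalize 2 ^ k / 2 ^ m = b at *
  push_cast at h1 h2 h3 h4
  have hk : (0 : ℝ) < 2 ^ k := by positivity
  have hn : (0 : ℝ) < 1 / 2 ^ n := by positivity
  have hm : (0 : ℝ) < 1 / 2 ^ m := by positivity
  have hab : ((Max.max a b - Min.min a b : ℕ) : ℝ) = |(a : ℝ) - b| := by
    rw [Nat.cast_sub (min_le_max), Nat.cast_max, Nat.cast_min, max_sub_min_eq_abs']
  have h5 : |(1 / 2 : ℝ) ^ n - (1 / 2) ^ m| = |(2 : ℝ) ^ k / 2 ^ n - 2 ^ k / 2 ^ m| / 2 ^ k := by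
    rw [one_div_pow, one_div_pow, div_eq_mul_one_div ((2 : ℝ) ^ k) ((2 : ℝ) ^ n),
      div_eq_mul_one_div ((2 : ℝ) ^ k) ((2 : ℝ) ^ m), ← mul_sub, abs_mul, abs_of_pos hk,
      mul_div_cancel_left₀ _ hk.ne']
  rw [hab, h5, ← sub_div, abs_div, abs_of_pos hk, div_le_div_iff_of_pos_right hk]
  refine (abs_abs_sub_abs_le _ _).trans ?_
  rw [abs_le]
  constructor <;> linarith

/-! ## Codes of finite sequences -/

/-- The list with a given code. -/
def listOf (c : ℕ) : List ℕ := Denumerable.ofNat (List ℕ) c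

@[simp] theorem listOf_encode (l : List ℕ) : listOf (Encodable.encode l) = l := by
  simp [listOf]

@[simp] theorem encode_listOf (c : ℕ) : Encodable.encode (listOf c) = c := by
  simp [listOf]

@[simp] theorem listOf_tupleCode {n : ℕ} (x : Fin n → ℕ) : listOf (tupleCode x) = List.ofFn x :=
  listOf_encode _

theorem foldr_max_ofFn {n : ℕ} (i : Fin n → ℕ) :
    (List.ofFn i).foldr max 0 = Finset.univ.sup i := by
  refine le_antisymm ?_ (Finset.sup_le fun k _ => ?_)
  · have : ∀ l : List ℕ, (∀ a ∈ l, a ≤ Finset.univ.sup i) → l.foldr max 0 ≤ Finset.univ.sup i := by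
      intro l
      induction l with
      | nil => simp
      | cons a l ih =>
        intro h
        exact max_le (h a (by simp)) (ih fun b hb => h b (by simp [hb]))
    refine this _ fun a ha => ?_
    obtain ⟨k, rfl⟩ := List.mem_ofFn.1 ha
    exact Finset.le_sup (Finset.mem_univ k)
  · have : ∀ l : List ℕ, ∀ a ∈ l, a ≤ l.foldr max 0 := by
      intro l
      induction l with
      | nil => simp
      | cons b l ih =>
        intro a ha
        rcases List.mem_cons.1 ha with rfl | ha
        · exact le_max_left _ _
        · exact (ih a ha).trans (le_max_right _ _)
    exact this _ _ (List.mem_ofFn.2 ⟨k, rfl⟩)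

namespace RelRec

variable {α : Type} [Primcodable α]

theorem listOf {f : (ℕ → ℕ) → α → ℕ} (hf : RelRec f) :
    RelRec fun h a => MetricLogic.listOf (f h a) :=
  comp₁ (Primrec.ofNat (List ℕ)) hf

theorem encode {σ : Type} [Primcodable σ] {f : (ℕ → ℕ) → α → σ} (hf : RelRec f) :
    RelRec fun h a => Encodable.encode (f h a) := comp₁ Primrec.encode hf

theorem foldr_max {f : (ℕ → ℕ) → α → List ℕ} (hf : RelRec f) :
    RelRec fun h a => (f h a).foldr Max.max 0 :=
  comp₁ (f := fun l : List ℕ => l.foldr Max.max 0)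
    (Primrec.list_foldr Primrec.id (Primrec.const 0)
      (Primrec.nat_max.comp (Primrec.fst.comp Primrec.snd) (Primrec.snd.comp Primrec.snd)).to₂) hf

end RelRec

/-- A name put together from components. -/
def assemble (f : Fin 5 → ℕ → ℕ) (n : ℕ) : ℕ :=
  if n.unpair.1 = 0 then f 0 n.unpair.2 else if n.unpair.1 = 1 then f 1 n.unpair.2 else
    if n.unpair.1 = 2 then f 2 n.unpair.2 else if n.unpair.1 = 3 then f 3 n.unpair.2 else
      f 4 n.unpair.2

@[simp] theorem comp_assemble (f : Fin 5 → ℕ → ℕ) (i : Fin 5) : comp i (assemble f) = f i := by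
  funext n
  fin_cases i <;> simp [comp, assemble]

theorem RelRec.assemble {α : Type} [Primcodable α] {f : (ℕ → ℕ) → Fin 5 → α → ℕ → ℕ}
    (h : ∀ i, RelRec fun o (q : α × ℕ) => f o i q.1 q.2) {g : (ℕ → ℕ) → α → ℕ} (hg : RelRec g) :
    RelRec fun o a => MetricLogic.assemble (fun i => f o i a) (g o a) := by
  have hc : ∀ i, RelRec fun o a => f o i a (g o a).unpair.2 := fun i =>
    (h i).comp (RelRec.id.pair hg.unpair_snd)
  exact ite_eq hg.unpair_fst (.const 0) (hc 0) <| ite_eq hg.unpair_fst (.const 1) (hc 1) <|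
    ite_eq hg.unpair_fst (.const 2) (hc 2) <| ite_eq hg.unpair_fst (.const 3) (hc 3) (hc 4)

/-! ## The predicate symbols of the disjoint union -/

/-- The number `c` is the code of a predicate symbol of the signature named by `h`. -/
def sigPred (h : ℕ → ℕ) (c : ℕ) : ℕ := h (Nat.pair 0 (Nat.pair 1 c))

/-- The arity of the predicate symbol with code `c` of the signature named by `h`. -/
def sigArity (h : ℕ → ℕ) (c : ℕ) : ℕ := h (Nat.pair 0 (Nat.pair 2 c))

/-- Approximations of the moduli of the signature named by `h`. -/
def sigModulus (h : ℕ → ℕ) (c : ℕ) : ℕ := h (Nat.pair 0 (Nat.pair 3 c))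

/-- Moduli of continuity of the moduli of the signature named by `h`. -/
def sigModulusCont (h : ℕ → ℕ) (c : ℕ) : ℕ := h (Nat.pair 0 (Nat.pair 4 c))

/-- Codes of the sorts of the sequence named by `h`. -/
def seqCode (h : ℕ → ℕ) (n : ℕ) : ℕ := h (Nat.pair 1 n)

/-- Whether `c` is the code of a predicate symbol together with a list of indices of sorts that
fits its arity. -/
def isExt (h : ℕ → ℕ) (c : ℕ) : ℕ :=
  if sigPred h c.unpair.1 = 1 then
    if Encodable.encode ((listOf c.unpair.2).map (seqCode h)) = sigArity h c.unpair.1 then 1 else 0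
  else 0

namespace RelRec

variable {α : Type} [Primcodable α] {f : (ℕ → ℕ) → α → ℕ}

theorem sigPred (hf : RelRec f) : RelRec fun h a => MetricLogic.sigPred h (f h a) :=
  ((RelRec.const 0).natPair ((RelRec.const 1).natPair hf)).oracle

theorem sigArity (hf : RelRec f) : RelRec fun h a => MetricLogic.sigArity h (f h a) :=
  ((RelRec.const 0).natPair ((RelRec.const 2).natPair hf)).oracle

theorem sigModulus (hf : RelRec f) : RelRec fun h a => MetricLogic.sigModulus h (f h a) :=
  ((RelRec.const 0).natPair ((RelRec.const 3).natPair hf)).oracle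

theorem sigModulusCont (hf : RelRec f) : RelRec fun h a => MetricLogic.sigModulusCont h (f h a) :=
  ((RelRec.const 0).natPair ((RelRec.const 4).natPair hf)).oracle

theorem seqCode (hf : RelRec f) : RelRec fun h a => MetricLogic.seqCode h (f h a) :=
  ((RelRec.const 1).natPair hf).oracle

theorem isExt (hf : RelRec f) : RelRec fun h a => MetricLogic.isExt h (f h a) :=
  ite_eq hf.unpair_fst.sigPred (.const 1)
    (ite_eq (list_map hf.unpair_snd.listOf RelRec.snd.seqCode).encode hf.unpair_fst.sigArity
      (.const 1) (.const 0)) (.const 0)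

end RelRec

section names

variable {D : Setting.{v}} {h : ℕ → ℕ}

theorem Setting.SeqName.isExt_of (hD : D.SeqName h)
    (q : Σ p : D.L.Preds, {i : Fin (D.L.ar p) → ℕ // ∀ k, D.seq (i k) = D.L.dom p k}) :
    isExt h (Nat.pair (D.ν.predCode q.1) (tupleCode q.2.1)) = 1 := by
  obtain ⟨p, i, hi⟩ := q
  have h1 : sigPred h (D.ν.predCode p) = 1 := (hD.1.preds _).1 ⟨p, rfl⟩
  have h2 : sigArity h (D.ν.predCode p) = _ := hD.1.arity p
  simp only [isExt, Nat.unpair_pair, h1, h2, listOf_tupleCode, List.map_ofFn]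
  rw [if_pos trivial, if_pos]
  unfold tupleCode
  congr 2
  funext k
  simp only [Function.comp_apply]
  rw [← hi k]
  exact hD.2 (i k)

/-- The test compares codes of lists of sorts. Codes of lists and of sorts are injective, so
equality of the codes gives back the number of indices and the typing condition on each of them. -/
theorem Setting.SeqName.isExt_cases (hD : D.SeqName h) (c : ℕ) : isExt h c = 0 ∨
    ∃ q : Σ p : D.L.Preds, {i : Fin (D.L.ar p) → ℕ // ∀ k, D.seq (i k) = D.L.dom p k},
      c = Nat.pair (D.ν.predCode q.1) (tupleCode q.2.1) := by
  by_cases h1 : sigPred h c.unpair.1 = 1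
  · by_cases h2 : Encodable.encode ((listOf c.unpair.2).map (seqCode h)) = sigArity h c.unpair.1
    · right
      have h3 : c.unpair.1 ∈ Set.range D.ν.predCode := by
        by_contra hn
        have := (hD.1.preds _).2 hn
        change sigPred h c.unpair.1 = 0 at this
        omega
      obtain ⟨p, hp⟩ := h3
      have h4 : sigArity h (D.ν.predCode p) = _ := hD.1.arity p
      rw [← hp, h4] at h2
      have h5 := Encodable.encode_injective h2
      have hl : (listOf c.unpair.2).length = D.L.ar p := by
        simpa using congrArg List.length h5
      have hofn : List.ofFn (fun k : Fin (D.L.ar p) => (listOf c.unpair.2)[(k : ℕ)]) =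
          listOf c.unpair.2 := by
        refine List.ext_getElem (by simp [hl]) fun n _ _ => by simp
      refine ⟨⟨p, fun k => (listOf c.unpair.2)[(k : ℕ)], fun k => ?_⟩, ?_⟩
      · refine D.ν.sortCode_injective ?_
        rw [← hD.2]
        change seqCode h _ = _
        have h6 := congrArg (fun l => l[(k : ℕ)]?) h5
        simpa [hl] using h6
      · rw [hp, tupleCode, hofn, encode_listOf, Nat.pair_unpair]
    · left
      simp [isExt, h2]
  · left
    simp [isExt, h1]

end names

/-! ## The name of the signature of the disjoint union -/

/-- Largest index in the list coded by the second component. -/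
def maxIndex (c : ℕ) : ℕ := (listOf c.unpair.2).foldr max 0

theorem RelRec.maxIndex {α : Type} [Primcodable α] {f : (ℕ → ℕ) → α → ℕ} (hf : RelRec f) :
    RelRec fun h a => MetricLogic.maxIndex (f h a) := hf.unpair_snd.listOf.foldr_max

@[simp] theorem maxIndex_pair (a : ℕ) {n : ℕ} (i : Fin n → ℕ) :
    maxIndex (Nat.pair a (tupleCode i)) = Finset.univ.sup i := by
  simp [maxIndex, foldr_max_ofFn]

/-- Approximations of the moduli of the disjoint union. -/
def cmduModulus (h : ℕ → ℕ) (c j m k : ℕ) : ℕ :=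
  if c = 0 then min (2 ^ k) (j * 2 ^ k / 2 ^ m) else
    min (2 ^ k) (max (sigModulus h (Nat.pair (c - 1).unpair.1
        (Nat.pair (2 ^ maxIndex (c - 1) * min j (2 ^ m)) (Nat.pair m k))))
      ((2 ^ (maxIndex (c - 1) + 1) * min j (2 ^ m)) * 2 ^ k / 2 ^ m))

/-- Components of the name of the signature of the disjoint union. -/
def cmduSigName (h : ℕ → ℕ) (i : Fin 5) (c : ℕ) : ℕ :=
  match i with
  | 0 => if c = 0 then 1 else 0
  | 1 => if c = 0 then 1 else isExt h (c - 1)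
  | 2 => if c = 0 then Encodable.encode [0] else
      Encodable.encode ((listOf (c - 1).unpair.2).map fun _ => 0)
  | 3 => cmduModulus h c.unpair.1 c.unpair.2.unpair.1 c.unpair.2.unpair.2.unpair.1
      c.unpair.2.unpair.2.unpair.2
  | 4 => if c.unpair.1 = 0 then c.unpair.2 else
      max (sigModulusCont h (Nat.pair (c.unpair.1 - 1).unpair.1 c.unpair.2) +
        maxIndex (c.unpair.1 - 1)) (c.unpair.2 + (maxIndex (c.unpair.1 - 1) + 1))

theorem RelRec.cmduSigName (i : Fin 5) : RelRec fun h c => MetricLogic.cmduSigName h i c := by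
  have hid : RelRec fun _ (c : ℕ) => c := RelRec.id
  match i with
  | 0 => exact ite_eq hid (.const 0) (.const 1) (.const 0)
  | 1 => exact ite_eq hid (.const 0) (.const 1) (hid.sub (.const 1)).isExt
  | 2 =>
    exact ite_eq hid (.const 0) (.const _)
      (list_map (hid.sub (.const 1)).unpair_snd.listOf (.const 0)).encode
  | 3 =>
    have hc := hid.unpair_fst
    have hj := hid.unpair_snd.unpair_fst
    have hm := hid.unpair_snd.unpair_snd.unpair_fst
    have hk := hid.unpair_snd.unpair_snd.unpair_snd
    have hc1 := hc.sub (.const 1)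
    exact ite_eq hc (.const 0) (hk.two_pow.min ((hj.mul hk.two_pow).div hm.two_pow))
      (hk.two_pow.min ((hc1.unpair_fst.natPair
        ((hc1.maxIndex.two_pow.mul (hj.min hm.two_pow)).natPair (hm.natPair hk))).sigModulus.max
        ((((hc1.maxIndex.add (.const 1)).two_pow.mul (hj.min hm.two_pow)).mul hk.two_pow).div
          hm.two_pow)))
  | 4 =>
    have hc1 := hid.unpair_fst.sub (.const 1)
    exact ite_eq hid.unpair_fst (.const 0) hid.unpair_snd
      (((hc1.unpair_fst.natPair hid.unpair_snd).sigModulusCont.add hc1.maxIndex).max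
        (hid.unpair_snd.add (hc1.maxIndex.add (.const 1))))

theorem coe_projIcc_dyadic (j m : ℕ) :
    (Set.projIcc (0 : ℝ) 1 zero_le_one ((j : ℝ) / 2 ^ m) : ℝ) = (min j (2 ^ m) : ℕ) / 2 ^ m := by
  rw [coe_projIcc_unit (by positivity), Nat.cast_min, ← min_div_div_right (by positivity)]
  push_cast
  rw [div_self (by positivity), min_comm]

theorem isSigName_cmdu {D : Setting.{v}} {h : ℕ → ℕ} (hD : D.SeqName h) :
    IsSigName (cmduSig D.L D.seq) (D.ν.cmdu D.seq) (assemble (cmduSigName h)) := by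
  have h0 : comp 0 (assemble (cmduSigName h)) = cmduSigName h 0 := comp_assemble _ 0
  have h1 : comp 1 (assemble (cmduSigName h)) = cmduSigName h 1 := comp_assemble _ 1
  have h2 : comp 2 (assemble (cmduSigName h)) = cmduSigName h 2 := comp_assemble _ 2
  have h3 : comp 3 (assemble (cmduSigName h)) = cmduSigName h 3 := comp_assemble _ 3
  have h4 : comp 4 (assemble (cmduSigName h)) = cmduSigName h 4 := comp_assemble _ 4
  have hsome : ∀ q, (D.ν.cmdu D.seq).predCode (some q) =
    Nat.pair (D.ν.predCode q.1) (tupleCode q.2.1) + 1 := fun _ => rfl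
  have hnone : (D.ν.cmdu D.seq).predCode none = 0 := rfl
  refine ⟨fun c => ?_, fun c => ?_, fun p => ?_, fun p j m k => ?_, fun p k s t hst => ?_⟩
  · rw [h0]
    constructor
    · rintro ⟨_, rfl⟩
      rfl
    · intro hc
      refine if_neg fun hc0 => hc ⟨PUnit.unit, hc0.symm⟩
  · rw [h1]
    constructor
    · rintro ⟨_ | q, rfl⟩
      · rfl
      · rw [hsome]
        simpa [cmduSigName] using hD.isExt_of q
    · intro hc
      have hc0 : c ≠ 0 := fun hc0 => hc ⟨none, hc0.symm⟩
      simp only [cmduSigName, if_neg hc0]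
      rcases hD.isExt_cases (c - 1) with h | ⟨q, hq⟩
      · exact h
      · exact absurd ⟨some q, by rw [hsome]; omega⟩ hc
  · rw [h2]
    rcases p with _ | q
    · rfl
    · rw [hsome]
      simp only [cmduSigName, Nat.add_sub_cancel, Nat.unpair_pair, listOf_tupleCode]
      rw [if_neg (by omega), tupleCode, List.map_ofFn]
      rfl
  · rw [h3]
    simp only [cmduSigName, Nat.unpair_pair]
    rcases p with _ | ⟨p, i, hi⟩
    · rw [hnone, cmduModulus, if_pos rfl]
      change Approx _ k (Set.projIcc (0 : ℝ) 1 zero_le_one ((j : ℝ) / 2 ^ m) : ℝ)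
      rw [coe_projIcc_unit (by positivity)]
      exact (approx_div_two_pow j m k).min_one
    · rw [hsome, cmduModulus, if_neg (by omega), cmduSig_modulus, coe_projIcc_dyadic]
      simp only [Nat.add_sub_cancel, Nat.unpair_pair, maxIndex_pair]
      refine Approx.min_one (Approx.max ?_ ?_)
      · have := hD.1.modulus p (2 ^ Finset.univ.sup i * min j (2 ^ m)) m k
        push_cast at this ⊢
        rw [← mul_div_assoc]
        exact this
      · have := approx_div_two_pow (2 ^ (Finset.univ.sup i + 1) * min j (2 ^ m)) m k
        push_cast at this ⊢
        rw [← mul_div_assoc]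
        exact this
  · rw [h4] at hst
    simp only [cmduSigName, Nat.unpair_pair] at hst
    rcases p with _ | ⟨p, i, hi⟩
    · rw [hnone, if_pos rfl] at hst
      exact hst
    · rw [hsome, if_neg (by omega)] at hst
      simp only [Nat.add_sub_cancel, Nat.unpair_pair, maxIndex_pair] at hst
      rw [cmduSig_modulus, cmduSig_modulus]
      set N := Finset.univ.sup i
      set c := sigModulusCont h (Nat.pair (D.ν.predCode p) k)
      have hmono : ∀ {a b : ℕ}, a ≤ b → (1 : ℝ) / 2 ^ b ≤ 1 / 2 ^ a := fun hab =>
        one_div_le_one_div_of_le (by positivity) (pow_le_pow_right₀ (by norm_num) hab)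
      -- The summands N and N + 1 in the exponents of the name absorb the factors 2^N and 2^(N+1) by
      -- which the argument is stretched.
      have hA : |(2 : ℝ) ^ N * s - 2 ^ N * t| ≤ 1 / 2 ^ c := by
        rw [← mul_sub, abs_mul, abs_of_pos (by positivity)]
        calc (2 : ℝ) ^ N * |(s : ℝ) - t| ≤ 2 ^ N * (1 / 2 ^ (c + N)) :=
              mul_le_mul_of_nonneg_left (hst.trans (hmono (le_max_left _ _))) (by positivity)
          _ = 1 / 2 ^ c := by rw [pow_add]; field_simp
      have hB : |(2 : ℝ) ^ (N + 1) * s - 2 ^ (N + 1) * t| ≤ 1 / 2 ^ k := by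
        rw [← mul_sub, abs_mul, abs_of_pos (by positivity)]
        calc (2 : ℝ) ^ (N + 1) * |(s : ℝ) - t| ≤ 2 ^ (N + 1) * (1 / 2 ^ (k + (N + 1))) :=
              mul_le_mul_of_nonneg_left (hst.trans (hmono (le_max_right _ _))) (by positivity)
          _ = 1 / 2 ^ k := by rw [pow_add _ k]; field_simp
      refine (abs_min_sub_min_le_max _ _ _ _).trans (max_le (by simp) ?_)
      refine (abs_max_sub_max_le_max _ _ _ _).trans (max_le ?_ hB)
      refine hD.1.modulus_cont p k _ _ ?_
      refine le_trans ?_ hA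
      rw [coe_projIcc_unit (mul_nonneg (by positivity) s.2.1),
        coe_projIcc_unit (mul_nonneg (by positivity) t.2.1)]
      exact (abs_min_sub_min_le_max _ _ _ _).trans (max_le (by simp) le_rfl)

theorem uniformlyComputable_cmduSig :
    UniformlyComputable (ι := Setting.{v}) (fun D h => D.SeqName h)
      (fun D g => IsSigName (cmduSig D.L D.seq) (D.ν.cmdu D.seq) g) :=
  .of_relRec (RelRec.assemble (α := ℕ) (f := fun h i _ c => cmduSigName h i c)
    (fun i => (RelRec.cmduSigName i).comp .snd) .id) fun _ _ => isSigName_cmdu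

/-! ## Codes of derived connectives -/

namespace Code

/-- Code of `0`. -/
def zero : ℕ := Nat.pair 0 0

/-- Code of `1`. -/
def one : ℕ := Nat.pair 1 0

/-- Effect of `half` on codes. -/
def half (a : ℕ) : ℕ := Nat.pair 2 a

/-- Effect of truncated subtraction on codes. -/
def sub (a b : ℕ) : ℕ := Nat.pair 3 (Nat.pair a b)

/-- Code of a distance. -/
def dist (s i j : ℕ) : ℕ := Nat.pair 4 (Nat.pair s (Nat.pair i j))

/-- Code of a predicate. -/
def pred (p : ℕ) (l : List ℕ) : ℕ := Nat.pair 5 (Nat.pair p (Encodable.encode l))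

/-- Effect of suprema on codes. -/
def sup (s i a : ℕ) : ℕ := Nat.pair 6 (Nat.pair s (Nat.pair i a))

/-- Effect of infima on codes. -/
def inf (s i a : ℕ) : ℕ := Nat.pair 7 (Nat.pair s (Nat.pair i a))

/-- Effect of truncated addition on codes. -/
def plus (a b : ℕ) : ℕ := sub one (sub (sub one a) b)

/-- Effect of minima on codes. -/
def min (a b : ℕ) : ℕ := sub a (sub a b)

/-- Effect of maxima on codes. -/
def max (a b : ℕ) : ℕ := plus a (sub b a)

/-- Effect of absolute differences on codes. -/
def absDiff (a b : ℕ) : ℕ := plus (sub a b) (sub b a)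

/-- Effect of truncated doubling on codes. -/
def double (a : ℕ) : ℕ := plus a a

/-- Code of the constant `2 ^ -n`. -/
def halfPow (n : ℕ) : ℕ := half^[n] one

/-- Code of the constant `a / 2 ^ k`. -/
def dyadic (a k : ℕ) : ℕ := a.rec zero fun _ b => plus b (halfPow k)

/-- Effect of maxima of lists on codes. -/
def maxs (l : List ℕ) : ℕ := l.foldr max zero

/-- Effect of minima of lists on codes. -/
def mins (l : List ℕ) : ℕ := l.foldr min one

/-- Effect of infima over lists of variables on codes. -/
def infs (l : List (ℕ × ℕ)) (a : ℕ) : ℕ := l.foldr (fun x b => inf x.1 x.2 b) a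

/-- Effect of suprema over lists of variables on codes. -/
def sups (l : List (ℕ × ℕ)) (a : ℕ) : ℕ := l.foldr (fun x b => sup x.1 x.2 b) a

/-- Code of the digits of a limit. -/
def limDigit (n a S : ℕ) : ℕ := double (sub (double^[n] (sub a S)) (halfPow 2))

/-- Code of the partial sums of a limit. -/
def limSum (f : ℕ → ℕ) (n : ℕ) : ℕ :=
  n.rec zero fun n S => plus S (half^[n + 1] (limDigit n (f (n + 2)) S))

/-- Codes of the components of a limit. -/
def lim (f : ℕ → ℕ) (n : ℕ) : ℕ := limDigit n (f (n + 2)) (limSum f n)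

end Code

/-! ### Coding commutes with the derived connectives -/

section code

variable {V : Vocab.{v}} (ν : Numbering V)

namespace RFormula

@[simp] theorem code_zero : (zero : RFormula V).code ν = Code.zero := rfl

@[simp] theorem code_one : (one : RFormula V).code ν = Code.one := rfl

@[simp] theorem code_half (φ : RFormula V) : φ.half.code ν = Code.half (φ.code ν) := rfl

@[simp] theorem code_sub (φ ψ : RFormula V) :
    (φ.sub ψ).code ν = Code.sub (φ.code ν) (ψ.code ν) := rfl

@[simp] theorem code_sup (s : V.Sorts) (i : ℕ) (φ : RFormula V) :
    (sup s i φ).code ν = Code.sup (ν.sortCode s) i (φ.code ν) := rfl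

@[simp] theorem code_inf (s : V.Sorts) (i : ℕ) (φ : RFormula V) :
    (inf s i φ).code ν = Code.inf (ν.sortCode s) i (φ.code ν) := rfl

@[simp] theorem code_plus (φ ψ : RFormula V) :
    (φ.plus ψ).code ν = Code.plus (φ.code ν) (ψ.code ν) := rfl

@[simp] theorem code_min (φ ψ : RFormula V) :
    (φ.min ψ).code ν = Code.min (φ.code ν) (ψ.code ν) := rfl

@[simp] theorem code_max (φ ψ : RFormula V) :
    (φ.max ψ).code ν = Code.max (φ.code ν) (ψ.code ν) := rfl

@[simp] theorem code_absDiff (φ ψ : RFormula V) :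
    (φ.absDiff ψ).code ν = Code.absDiff (φ.code ν) (ψ.code ν) := rfl

@[simp] theorem code_double (φ : RFormula V) : φ.double.code ν = Code.double (φ.code ν) := rfl

@[simp] theorem code_double_iterate (φ : RFormula V) (n : ℕ) :
    (double^[n] φ).code ν = Code.double^[n] (φ.code ν) :=
  Function.Semiconj.iterate_right (f := fun φ : RFormula V => φ.code ν) (code_double ν) n φ

@[simp] theorem code_half_iterate (φ : RFormula V) (n : ℕ) :
    (half^[n] φ).code ν = Code.half^[n] (φ.code ν) :=
  Function.Semiconj.iterate_right (f := fun φ : RFormula V => φ.code ν) (code_half ν) n φ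

@[simp] theorem code_halfPow (n : ℕ) : (halfPow n : RFormula V).code ν = Code.halfPow n :=
  code_half_iterate ν one n

@[simp] theorem code_dyadic (a k : ℕ) : (dyadic a k : RFormula V).code ν = Code.dyadic a k := by
  unfold dyadic
  induction a with
  | zero => rfl
  | succ a ih =>
    rw [Function.iterate_succ_apply', code_plus, ih, code_halfPow]
    rfl

@[simp] theorem code_maxs (l : List (RFormula V)) :
    (maxs l).code ν = Code.maxs (l.map (code ν)) := by
  induction l with
  | nil => rfl
  | cons φ l ih =>
    change (φ.max (maxs l)).code ν = _
    rw [code_max, ih]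
    rfl

@[simp] theorem code_mins (l : List (RFormula V)) :
    (mins l).code ν = Code.mins (l.map (code ν)) := by
  induction l with
  | nil => rfl
  | cons φ l ih =>
    change (φ.min (mins l)).code ν = _
    rw [code_min, ih]
    rfl

@[simp] theorem code_infs (l : List (V.Sorts × ℕ)) (φ : RFormula V) :
    (φ.infs l).code ν = Code.infs (l.map fun x => (ν.sortCode x.1, x.2)) (φ.code ν) := by
  induction l with
  | nil => rfl
  | cons x l ih =>
    change Code.inf _ _ ((φ.infs l).code ν) = _
    rw [ih]
    rfl

@[simp] theorem code_sups (l : List (V.Sorts × ℕ)) (φ : RFormula V) :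
    (φ.sups l).code ν = Code.sups (l.map fun x => (ν.sortCode x.1, x.2)) (φ.code ν) := by
  induction l with
  | nil => rfl
  | cons x l ih =>
    change Code.sup _ _ ((φ.sups l).code ν) = _
    rw [ih]
    rfl

end RFormula

/-- Digits and partial sums are built from the approximations by fixed connectives, so the codes of
a limit depend on the codes of the approximations only. -/
theorem Formula.lim_code (ψ : ℕ → RFormula V) (n : ℕ) :
    (lim ψ n).code ν = Code.lim (fun n => (ψ n).code ν) n := by
  have h1 : ∀ n S, (limDigit ψ n S).code ν = Code.limDigit n ((ψ (n + 2)).code ν) (S.code ν) :=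
    fun n S => by simp [limDigit, Code.limDigit]
  have h2 : ∀ n, (limSum ψ n).code ν = Code.limSum (fun n => (ψ n).code ν) n := fun n => by
    induction n with
    | zero => rfl
    | succ n ih =>
      rw [limSum, RFormula.code_plus, RFormula.code_half_iterate, h1, ih]
      rfl
  rw [lim, h1, h2]
  rfl

end code

/-! ### Recursiveness of the operations on codes -/

namespace RelRec

variable {α : Type} [Primcodable α] {f g k : (ℕ → ℕ) → α → ℕ}

theorem codeHalf (hf : RelRec f) : RelRec fun h a => Code.half (f h a) :=
  (RelRec.const 2).natPair hf

theorem codeSub (hf : RelRec f) (hg : RelRec g) : RelRec fun h a => Code.sub (f h a) (g h a) :=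
  (RelRec.const 3).natPair (hf.natPair hg)

theorem codeDist (hf : RelRec f) (hg : RelRec g) (hk : RelRec k) :
    RelRec fun h a => Code.dist (f h a) (g h a) (k h a) :=
  (RelRec.const 4).natPair (hf.natPair (hg.natPair hk))

theorem codePred {l : (ℕ → ℕ) → α → List ℕ} (hf : RelRec f) (hl : RelRec l) :
    RelRec fun h a => Code.pred (f h a) (l h a) :=
  (RelRec.const 5).natPair (hf.natPair hl.encode)

theorem codeSup (hf : RelRec f) (hg : RelRec g) (hk : RelRec k) :
    RelRec fun h a => Code.sup (f h a) (g h a) (k h a) :=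
  (RelRec.const 6).natPair (hf.natPair (hg.natPair hk))

theorem codeInf (hf : RelRec f) (hg : RelRec g) (hk : RelRec k) :
    RelRec fun h a => Code.inf (f h a) (g h a) (k h a) :=
  (RelRec.const 7).natPair (hf.natPair (hg.natPair hk))

theorem codePlus (hf : RelRec f) (hg : RelRec g) : RelRec fun h a => Code.plus (f h a) (g h a) :=
  (RelRec.const _).codeSub (((RelRec.const _).codeSub hf).codeSub hg)

theorem codeMin (hf : RelRec f) (hg : RelRec g) : RelRec fun h a => Code.min (f h a) (g h a) :=
  hf.codeSub (hf.codeSub hg)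

theorem codeMax (hf : RelRec f) (hg : RelRec g) : RelRec fun h a => Code.max (f h a) (g h a) :=
  hf.codePlus (hg.codeSub hf)

theorem codeAbsDiff (hf : RelRec f) (hg : RelRec g) :
    RelRec fun h a => Code.absDiff (f h a) (g h a) :=
  (hf.codeSub hg).codePlus (hg.codeSub hf)

theorem codeDouble (hf : RelRec f) : RelRec fun h a => Code.double (f h a) := hf.codePlus hf

theorem iterate {x : (ℕ → ℕ) → α → ℕ} {G : ℕ → ℕ} (hf : RelRec f) (hx : RelRec x)
    (hG : RelRec fun _ => G) : RelRec fun h a => G^[f h a] (x h a) :=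
  (nat_rec (g := fun _ _ _ i => G i) hf hx (hG.comp (RelRec.snd.comp .snd))).of_eq fun h a => by
    induction f h a with
    | zero => rfl
    | succ n ih => rw [Function.iterate_succ_apply', ← ih]

theorem codeHalf_iterate (hf : RelRec f) (hg : RelRec g) :
    RelRec fun h a => Code.half^[f h a] (g h a) := iterate hf hg (codeHalf .id)

theorem codeDouble_iterate (hf : RelRec f) (hg : RelRec g) :
    RelRec fun h a => Code.double^[f h a] (g h a) := iterate hf hg (codeDouble .id)

theorem codeHalfPow (hf : RelRec f) : RelRec fun h a => Code.halfPow (f h a) :=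
  codeHalf_iterate hf (.const _)

theorem codeDyadic (hf : RelRec f) (hg : RelRec g) :
    RelRec fun h a => Code.dyadic (f h a) (g h a) :=
  nat_rec (g := fun h a _ i => Code.plus i (Code.halfPow (g h a))) hf (.const _)
    ((RelRec.snd.comp .snd).codePlus (hg.comp .fst).codeHalfPow)

theorem foldr {σ : Type} [Primcodable σ] {l : (ℕ → ℕ) → α → List σ} {G : σ → ℕ → ℕ}
    (hl : RelRec l) (hf : RelRec f) (hG : Primrec₂ G) :
    RelRec fun h a => (l h a).foldr G (f h a) :=
  comp₂ (f := fun (l : List σ) (a : ℕ) => l.foldr G a)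
    (Primrec.list_foldr Primrec.fst Primrec.snd
      (hG.comp (Primrec.fst.comp Primrec.snd) (Primrec.snd.comp Primrec.snd)).to₂) hl hf

theorem primrec_pair {a b : α → ℕ} (ha : Primrec a) (hb : Primrec b) :
    Primrec fun x => Nat.pair (a x) (b x) := Primrec₂.natPair.comp ha hb

theorem primrec_sub {a b : α → ℕ} (ha : Primrec a) (hb : Primrec b) :
    Primrec fun x => Code.sub (a x) (b x) :=
  primrec_pair (.const 3) (primrec_pair ha hb)

/-- The operation that is folded has to be primitive recursive without oracle; the maximum is
unfolded into truncated subtractions for this purpose. -/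
theorem codeMaxs {l : (ℕ → ℕ) → α → List ℕ} (hl : RelRec l) :
    RelRec fun h a => Code.maxs (l h a) :=
  hl.foldr (.const _) (primrec_sub (.const _) (primrec_sub (primrec_sub (.const _) .fst)
    (primrec_sub .snd .fst)))

theorem codeMins {l : (ℕ → ℕ) → α → List ℕ} (hl : RelRec l) :
    RelRec fun h a => Code.mins (l h a) :=
  hl.foldr (.const _) (primrec_sub .fst (primrec_sub .fst .snd))

theorem codeInfs {l : (ℕ → ℕ) → α → List (ℕ × ℕ)} (hl : RelRec l) (hf : RelRec f) :
    RelRec fun h a => Code.infs (l h a) (f h a) :=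
  hl.foldr hf (primrec_pair (.const 7) (primrec_pair (Primrec.fst.comp .fst)
    (primrec_pair (Primrec.snd.comp .fst) .snd)))

theorem codeSups {l : (ℕ → ℕ) → α → List (ℕ × ℕ)} (hl : RelRec l) (hf : RelRec f) :
    RelRec fun h a => Code.sups (l h a) (f h a) :=
  hl.foldr hf (primrec_pair (.const 6) (primrec_pair (Primrec.fst.comp .fst)
    (primrec_pair (Primrec.snd.comp .fst) .snd)))

theorem codeLimDigit (hf : RelRec f) (hg : RelRec g) (hk : RelRec k) :
    RelRec fun h a => Code.limDigit (f h a) (g h a) (k h a) :=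
  ((hf.codeDouble_iterate (hg.codeSub hk)).codeSub (.const _)).codeDouble

theorem codeLim {ψ : (ℕ → ℕ) → α → ℕ → ℕ} (hψ : RelRec fun h (q : α × ℕ) => ψ h q.1 q.2)
    (hf : RelRec f) : RelRec fun h a => Code.lim (ψ h a) (f h a) := by
  have h1 : RelRec fun h a => Code.limSum (ψ h a) (f h a) :=
    nat_rec (g := fun h a n S =>
        Code.plus S (Code.half^[n + 1] (Code.limDigit n (ψ h a (n + 2)) S))) hf (.const _)
      ((RelRec.snd.comp .snd).codePlus (codeHalf_iterate ((RelRec.fst.comp .snd).add (.const 1))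
        (codeLimDigit (RelRec.fst.comp .snd)
          (hψ.comp (RelRec.fst.pair ((RelRec.fst.comp .snd).add (.const 2))))
          (RelRec.snd.comp .snd))))
  exact codeLimDigit hf (hψ.comp (RelRec.id.pair (hf.add (.const 2)))) h1

end RelRec

/-! ## The distance to `O n` in the disjoint union -/

/-- The distance to `∗` of the variable with number `i`. -/
def heightFormula {V : Vocab.{v}} (O : ℕ → V.Sorts) (i : ℕ) : RFormula (cmduVocab V O) :=
  .pred none fun _ => i

/-- The code of `heightFormula`. -/
def Code.height (i : ℕ) : ℕ := Code.pred 0 [i]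

/-- The difference of the height and `2 ^ -n`. -/
def heightDiff {V : Vocab.{v}} (O : ℕ → V.Sorts) (n i : ℕ) : RFormula (cmduVocab V O) :=
  (heightFormula O i).absDiff (.halfPow n)

/-- The code of `heightDiff`. -/
def Code.heightDiff (n i : ℕ) : ℕ := Code.absDiff (Code.height i) (Code.halfPow n)

@[simp] theorem code_heightFormula {V : Vocab.{v}} (ν : Numbering V) (O : ℕ → V.Sorts) (i : ℕ) :
    (heightFormula O i).code (ν.cmdu O) = Code.height i := rfl

@[simp] theorem code_heightDiff {V : Vocab.{v}} (ν : Numbering V) (O : ℕ → V.Sorts) (n i : ℕ) :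
    (heightDiff O n i).code (ν.cmdu O) = Code.heightDiff n i := by
  simp [heightDiff, Code.heightDiff]

@[simp] theorem free_heightFormula {V : Vocab.{v}} (O : ℕ → V.Sorts) (i : ℕ) :
    (heightFormula O i).free = {(PUnit.unit, i)} := by
  change Set.range (fun _ : Fin 1 => ((PUnit.unit, i) : PUnit × ℕ)) = _
  exact Set.range_const

@[simp] theorem free_heightDiff {V : Vocab.{v}} (O : ℕ → V.Sorts) (n i : ℕ) :
    (heightDiff O n i).free = {(PUnit.unit, i)} := by
  simp [heightDiff]

theorem RelRec.codeHeight {α : Type} [Primcodable α] {f : (ℕ → ℕ) → α → ℕ} (hf : RelRec f) :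
    RelRec fun h a => Code.height (f h a) :=
  codePred (.const 0) (comp₂ Primrec.list_cons hf (.const []))

theorem RelRec.codeHeightDiff {α : Type} [Primcodable α] {f g : (ℕ → ℕ) → α → ℕ} (hf : RelRec f)
    (hg : RelRec g) : RelRec fun h a => Code.heightDiff (f h a) (g h a) :=
  hg.codeHeight.codeAbsDiff hf.codeHalfPow

theorem eval_heightFormula_cmdu {V : Vocab.{v}} (A : PreStructure.{u, v} V) (O : ℕ → V.Sorts)
    (i : ℕ) (w : (cmdu A O).Val) :
    (heightFormula O i).eval (cmdu A O) w = Cmdu.height A O (w PUnit.unit i) :=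
  Cmdu.dist_star (A := A) (O := O) (w PUnit.unit i)

/-- By `Cmdu.infDist_part`, the distance to O_n is the difference of the height and 2^-n, so that a
restricted formula suffices and no limit is needed. -/
theorem definesParts {L : MetricSignature.{v}} (O : ℕ → L.Sorts) :
    DefinesParts.{u, v} O fun n => (heightDiff O n 0).toFormula := by
  refine fun n => ⟨fun _ => (free_heightDiff O n 0).subset, fun A w => ?_⟩
  rw [RFormula.eval_toFormula, heightDiff, RFormula.eval_absDiff,
    eval_heightFormula_cmdu, RFormula.eval_halfPow]
  exact (Cmdu.infDist_part (A := A.toPreStructure) (O := O) n (w PUnit.unit 0)).symm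

theorem uniformlyComputable_definesParts :
    UniformlyComputable (ι := Setting.{v}) (fun D h => D.SeqName h)
      (fun D g => ∃ φ : ℕ → Formula (cmduVocab D.L.toVocab D.seq), DefinesParts.{u, v} D.seq φ ∧
        ∀ n, (φ n).HasName (D.ν.cmdu D.seq) (comp n g)) :=
  .of_relRec (f := fun _ n => Code.heightDiff n.unpair.1 0)
    (RelRec.codeHeightDiff RelRec.id.unpair_fst (.const 0)) fun D _ _ =>
      ⟨_, definesParts D.seq, fun n k => by
        simp [comp, RFormula.toFormula]⟩

/-! ## Presentations of the disjoint union -/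

/-- Approximations of the distances of the points of the dense sequence. -/
def cmduDist (h : ℕ → ℕ) (i j k : ℕ) : ℕ :=
  if i = 0 then if j = 0 then 0 else 2 ^ k / 2 ^ (j - 1).unpair.1
  else if j = 0 then 2 ^ k / 2 ^ (i - 1).unpair.1
  else if (i - 1).unpair.1 = (j - 1).unpair.1 then
    h (Nat.pair 2 (Nat.pair 0 (Nat.pair (seqCode h (i - 1).unpair.1)
      (Nat.pair (i - 1).unpair.2 (Nat.pair (j - 1).unpair.2 k))))) / 2 ^ (i - 1).unpair.1
  else max (2 ^ k / 2 ^ (i - 1).unpair.1) (2 ^ k / 2 ^ (j - 1).unpair.1) -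
    min (2 ^ k / 2 ^ (i - 1).unpair.1) (2 ^ k / 2 ^ (j - 1).unpair.1)

/-- Approximations of the values of the predicates on the dense sequence: `c` is the code of the
symbol, `b` is the code of the list of the indices of the arguments. -/
def cmduPredVal (h : ℕ → ℕ) (c b k : ℕ) : ℕ :=
  if c = 0 then cmduDist h ((listOf b).headD 0) 0 k
  else if (listOf b).map (fun i => if i = 0 then 0 else (i - 1).unpair.1 + 1) =
      (listOf (c - 1).unpair.2).map (fun n => n + 1) then
    h (Nat.pair 2 (Nat.pair 1 (Nat.pair (c - 1).unpair.1 (Nat.pair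
      (Encodable.encode ((listOf b).map fun i => (i - 1).unpair.2)) k))))
  else 2 ^ k

/-- Components of the name of the presentation of the disjoint union. -/
def cmduPresName (h : ℕ → ℕ) (i : Fin 5) (c : ℕ) : ℕ :=
  match i with
  | 0 => cmduDist h c.unpair.2.unpair.1 c.unpair.2.unpair.2.unpair.1 c.unpair.2.unpair.2.unpair.2
  | 1 => cmduPredVal h c.unpair.1 c.unpair.2.unpair.1 c.unpair.2.unpair.2
  | _ => 0

namespace RelRec

variable {α : Type} [Primcodable α] {f g k : (ℕ → ℕ) → α → ℕ}

theorem cmduDist (hf : RelRec f) (hg : RelRec g) (hk : RelRec k) :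
    RelRec fun h a => MetricLogic.cmduDist h (f h a) (g h a) (k h a) := by
  have hf1 := hf.sub (.const 1)
  have hg1 := hg.sub (.const 1)
  have hp := hk.two_pow.div hf1.unpair_fst.two_pow
  have hq := hk.two_pow.div hg1.unpair_fst.two_pow
  refine ite_eq hf (.const 0) (ite_eq hg (.const 0) (.const 0) hq) (ite_eq hg (.const 0) hp
    (ite_eq hf1.unpair_fst hg1.unpair_fst ?_ ((hp.max hq).sub (hp.min hq))))
  exact ((RelRec.const 2).natPair ((RelRec.const 0).natPair (hf1.unpair_fst.seqCode.natPair
    (hf1.unpair_snd.natPair (hg1.unpair_snd.natPair hk))))).oracle.div hf1.unpair_fst.two_pow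

theorem cmduPredVal (hf : RelRec f) (hg : RelRec g) (hk : RelRec k) :
    RelRec fun h a => MetricLogic.cmduPredVal h (f h a) (g h a) (k h a) := by
  have hf1 := hf.sub (.const 1)
  have hs : RelRec fun _ (q : α × ℕ) => q.2 := .snd
  have hs1 := hs.sub (.const 1)
  refine ite_eq hf (.const 0) (cmduDist
    (comp₁ (f := fun l : List ℕ => l.headD 0) ?_ hg.listOf) (.const 0) hk)
    (ite_eq (list_map hg.listOf (ite_eq hs (.const 0) (.const 0) (hs1.unpair_fst.add (.const 1))))
      (list_map hf1.unpair_snd.listOf (hs.add (.const 1))) ?_ hk.two_pow)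
  · exact (Primrec.option_getD.comp Primrec.list_head? (Primrec.const 0)).of_eq fun l => by
      cases l <;> rfl
  · exact ((RelRec.const 2).natPair ((RelRec.const 1).natPair (hf1.unpair_fst.natPair
      ((list_map hg.listOf hs1.unpair_snd).encode.natPair hk)))).oracle

theorem cmduPresName (i : Fin 5) : RelRec fun h c => MetricLogic.cmduPresName h i c := by
  have hid : RelRec fun _ (c : ℕ) => c := RelRec.id
  match i with
  | 0 =>
    exact cmduDist hid.unpair_snd.unpair_fst hid.unpair_snd.unpair_snd.unpair_fst
      hid.unpair_snd.unpair_snd.unpair_snd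
  | 1 => exact cmduPredVal hid.unpair_fst hid.unpair_snd.unpair_fst hid.unpair_snd.unpair_snd
  | 2 => exact .const 0
  | 3 => exact .const 0
  | 4 => exact .const 0

end RelRec

/-! ### Correctness of the name of the presentation -/

section presentation

variable {D : Setting.{v}} {A : LStructure.{u, v} D.L} {pts : A.Val} {h : ℕ → ℕ}

/-- The points of the dense sequence of the disjoint union. -/
def cmduPoint (A : LStructure.{u, v} D.L) (pts : A.Val) (i : ℕ) : Cmdu A.toPreStructure D.seq :=
  cmduPts A.toPreStructure D.seq pts PUnit.unit i

theorem cmduPoint_zero : cmduPoint A pts 0 = .star := rfl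

theorem cmduPoint_succ (i : ℕ) : cmduPoint A pts (i + 1) =
    .pt i.unpair.1 (pts (D.seq i.unpair.1) i.unpair.2) := rfl

theorem approx_cmduDist (hD : D.SeqName h)
    (hA : IsPresentation D.ν A.toPreStructure pts (comp 2 h)) (i j k : ℕ) :
    Approx (cmduDist h i j k) k (dist (cmduPoint A pts i) (cmduPoint A pts j)) := by
  rcases i with _ | i
  · rcases j with _ | j
    · simp [cmduDist, cmduPoint_zero, Approx]
    · rw [cmduPoint_zero, dist_comm, Cmdu.dist_star, cmduPoint_succ]
      exact approx_half_pow _ _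
  · rcases j with _ | j
    · rw [cmduPoint_zero, Cmdu.dist_star, cmduPoint_succ]
      simp only [cmduDist, if_neg (Nat.succ_ne_zero i)]
      exact approx_half_pow _ _
    · rw [cmduPoint_succ, cmduPoint_succ]
      simp only [cmduDist, if_neg (Nat.succ_ne_zero _), Nat.add_sub_cancel]
      split_ifs with hij
      · have h1 := hA.dist (D.seq i.unpair.1) i.unpair.2 j.unpair.2 k
        rw [← hD.2] at h1
        have h2 := h1.div_two_pow i.unpair.1
        rw [← hij, Cmdu.dist_pt]
        exact h2
      · rw [Cmdu.dist_of_ne hij]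
        exact approx_abs_sub_half_pow _ _ _

theorem approx_cmduPredVal_zero (hD : D.SeqName h)
    (hA : IsPresentation D.ν A.toPreStructure pts (comp 2 h)) (x : Fin 1 → ℕ) (k : ℕ) :
    Approx (cmduPredVal h 0 (tupleCode x) k) k (dist (cmduPoint A pts (x 0)) .star) := by
  have : cmduPredVal h 0 (tupleCode x) k = cmduDist h (x 0) 0 k := by
    rw [cmduPredVal, if_pos rfl, listOf_tupleCode]
    simp
  rw [this]
  exact approx_cmduDist hD hA _ 0 k

theorem approx_cmduPredVal_succ
    (hA : IsPresentation D.ν A.toPreStructure pts (comp 2 h)) {p : D.L.Preds}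
    {i : Fin (D.L.ar p) → ℕ} (hi : ∀ k, D.seq (i k) = D.L.dom p k) (x : Fin (D.L.ar p) → ℕ)
    (k : ℕ) :
    Approx (cmduPredVal h (Nat.pair (D.ν.predCode p) (tupleCode i) + 1) (tupleCode x) k) k
      (Cmdu.extPred A.toPreStructure D.seq p i hi fun a => cmduPoint A pts (x a)) := by
  rw [cmduPredVal, if_neg (Nat.succ_ne_zero _)]
  simp only [Nat.add_sub_cancel, Nat.unpair_pair, listOf_tupleCode, List.map_ofFn]
  -- The lists record the piece of each argument, with 0 for ∗ and n + 1 for O_n. Their equality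
  -- decides whether the tuple belongs to the domain, where the given presentation has to be
  -- consulted.
  have key : List.ofFn ((fun i => if i = 0 then 0 else (i - 1).unpair.1 + 1) ∘ x) =
      List.ofFn ((fun n => n + 1) ∘ i) ↔ ∀ a, x a ≠ 0 ∧ (x a - 1).unpair.1 = i a := by
    rw [List.ofFn_injective.eq_iff, funext_iff]
    refine forall_congr' fun a => ?_
    simp only [Function.comp_apply]
    split_ifs with h0
    · simp [h0]
    · simp [h0]
  split_ifs with hx
  · rw [key] at hx
    have hy : ∀ a, cmduPoint A pts (x a) =
        Cmdu.inc (i a) (hi a) (pts (D.L.dom p a) (x a - 1).unpair.2) := fun a => by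
      obtain ⟨h0, h1⟩ := hx a
      obtain ⟨y, hy⟩ := Nat.exists_eq_succ_of_ne_zero h0
      rw [hy, Nat.succ_eq_add_one] at h1 ⊢
      rw [Nat.add_sub_cancel] at h1
      rw [cmduPoint_succ, Nat.add_sub_cancel]
      have : ∀ (n : ℕ) (s : D.L.Sorts) (e : D.seq n = s) (m j : ℕ) (_ : m = n),
          (Cmdu.pt m (pts (D.seq m) j) : Cmdu A.toPreStructure D.seq) =
            Cmdu.inc n e (pts s j) := by
        rintro n s rfl m j rfl
        rfl
      exact this _ _ _ _ _ h1
    rw [funext hy, Cmdu.extPred_inc]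
    exact hA.pred p (fun a => (x a - 1).unpair.2) k
  · rw [key] at hx
    rw [Cmdu.extPred_of_not]
    · exact approx_one k
    · rintro ⟨y, hy⟩
      refine hx fun a => ?_
      have h1 := congrArg (Cmdu.height A.toPreStructure D.seq) (hy a)
      rw [Cmdu.height_inc] at h1
      have hp : (0 : ℝ) < (1 / 2) ^ i a := by positivity
      rcases hxa : x a with _ | y
      · rw [hxa, cmduPoint_zero] at h1
        exact absurd h1 hp.ne
      · rw [hxa, cmduPoint_succ] at h1
        exact ⟨Nat.succ_ne_zero _, pow_right_injective₀ (by norm_num) (by norm_num) h1⟩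

theorem isPresentation_cmdu (hD : D.SeqName h)
    (hA : IsPresentation D.ν A.toPreStructure pts (comp 2 h)) :
    IsPresentation (D.ν.cmdu D.seq) (cmdu A.toPreStructure D.seq)
      (cmduPts A.toPreStructure D.seq pts) (assemble (cmduPresName h)) where
  dense := by
    rintro ⟨⟩
    intro z
    refine Metric.mem_closure_range_iff.2 fun ε hε => ?_
    change ∃ i, dist (α := Cmdu A.toPreStructure D.seq) z (cmduPoint A pts i) < ε
    rcases z with _ | ⟨n, x⟩
    · exact ⟨0, by rw [cmduPoint_zero]; simpa using hε⟩
    · obtain ⟨j, hj⟩ := Metric.denseRange_iff.1 (hA.dense (D.seq n)) x ε hε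
      refine ⟨Nat.pair n j + 1, ?_⟩
      rw [cmduPoint_succ, Nat.unpair_pair, Cmdu.dist_pt]
      exact (mul_le_of_le_one_left dist_nonneg
        (pow_le_one₀ (by norm_num) (by norm_num))).trans_lt hj
  dist := by
    rintro ⟨⟩ i j k
    rw [show comp 0 (assemble (cmduPresName h)) = _ from comp_assemble _ 0]
    simp only [cmduPresName, Nat.unpair_pair]
    exact approx_cmduDist hD hA i j k
  pred := by
    intro q x k
    rw [show comp 1 (assemble (cmduPresName h)) = _ from comp_assemble _ 1]
    simp only [cmduPresName, Nat.unpair_pair]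
    rcases q with _ | ⟨p, i, hi⟩
    · exact approx_cmduPredVal_zero hD hA x k
    · exact approx_cmduPredVal_succ hA hi x k

end presentation

theorem relRec_cmduPresName : RelRec fun h n => assemble (cmduPresName h) n :=
  RelRec.assemble (α := ℕ) (f := fun h i _ c => cmduPresName h i c)
    (fun i => (RelRec.cmduPresName i).comp .snd) .id

theorem uniformlyComputable_presentation :
    UniformlyComputable (ι := Σ D : Setting.{v}, Σ A : LStructure.{u, v} D.L, A.Val)
      (fun i h => i.1.SeqName h ∧ IsPresentation i.1.ν i.2.1.toPreStructure i.2.2 (comp 2 h))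
      (fun i g => IsPresentation (i.1.ν.cmdu i.1.seq) (cmdu i.2.1.toPreStructure i.1.seq)
        (cmduPts i.2.1.toPreStructure i.1.seq i.2.2) g) :=
  .of_relRec relRec_cmduPresName fun _ _ h => isPresentation_cmdu h.1 h.2

theorem computable_presentation (D : Setting.{v}) {h : ℕ → ℕ} (hD : D.SeqName h)
    (hh : Computable h) :
    ∃ F, RecFunctional F ∧ ∀ (A : LStructure.{u, v} D.L) (pts : A.Val) (f : ℕ → ℕ),
      IsPresentation D.ν A.toPreStructure pts f → ∃ g, Outputs F f g ∧
        IsPresentation (D.ν.cmdu D.seq) (cmdu A.toPreStructure D.seq)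
          (cmduPts A.toPreStructure D.seq pts) g := by
  -- The computable name of the signature is built into the oracle: component 2 is answered by `f`,
  -- all other components by `h`.
  let s : (ℕ → ℕ) → ℕ → ℕ := fun f n => if n.unpair.1 = 2 then f n.unpair.2 else h n
  have hs : TotalRec s := relRec_nat_iff.1 (RelRec.ite_eq RelRec.id.unpair_fst (.const 2)
    RelRec.id.unpair_snd.oracle (relRec_nat_iff.2 (.of_computable hh)))
  refine ⟨_, (relRec_nat_iff.1 relRec_cmduPresName).subst hs, fun A pts f hf =>
    ⟨_, fun n => rfl, isPresentation_cmdu ?_ ?_⟩⟩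
  · have h0 : comp 0 (s f) = comp 0 h := by
      funext n
      simp [comp, s]
    have h1 : comp 1 (s f) = comp 1 h := by
      funext n
      simp [comp, s]
    unfold Setting.SeqName
    rw [h0, h1]
    exact hD
  · have h2 : comp 2 (s f) = f := by
      funext n
      simp [comp, s]
    rw [h2]
    exact hf

/-! ## Structures that are disjoint unions -/

section

variable {V : Vocab.{v}} {O : ℕ → V.Sorts}

/-- The only sort of a structure of the vocabulary of the disjoint union. -/
abbrev Pts (M : PreStructure.{u, v} (cmduVocab V O)) : MSort.{u} := M.sort PUnit.unit

/-- The unary predicate. -/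
def hgt (M : PreStructure.{u, v} (cmduVocab V O)) (x : Pts M) : ℝ := M.pred none fun _ => x

/-- The other predicates. -/
def ext (M : PreStructure.{u, v} (cmduVocab V O)) {p : V.Preds} {i : Fin (V.ar p) → ℕ}
    (hi : ∀ k, O (i k) = V.dom p k) (x : Fin (V.ar p) → Pts M) : ℝ :=
  M.pred (some ⟨p, i, hi⟩) x

theorem hgt_mem (M : PreStructure.{u, v} (cmduVocab V O)) (x : Pts M) :
    hgt M x ∈ Set.Icc (0 : ℝ) 1 := M.pred_mem none _

theorem ext_mem (M : PreStructure.{u, v} (cmduVocab V O)) {p : V.Preds} {i : Fin (V.ar p) → ℕ}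
    (hi : ∀ k, O (i k) = V.dom p k) (x : Fin (V.ar p) → Pts M) :
    ext M hi x ∈ Set.Icc (0 : ℝ) 1 := M.pred_mem (some ⟨p, i, hi⟩) x

end

section

variable {L : MetricSignature.{v}} {O : ℕ → L.Sorts}

/-- The modulus of d(·,∗) in the signature is the identity, so this property holds in all structures
and needs no axiom. -/
theorem abs_hgt_sub_le (M : LStructure.{u, v} (cmduSig L O))
    (x y : Pts (V := L.toVocab) (O := O) M.toPreStructure) :
    |hgt (V := L.toVocab) (O := O) M.toPreStructure x - hgt (O := O) M.toPreStructure y| ≤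
      dist x y :=
  M.respects none ⟨dist x y, dist_nonneg, MSort.dist_le_one _ _ _⟩ (fun _ => x) (fun _ => y)
    fun _ => le_rfl

/-- The structure `M` looks like a disjoint union. -/
structure IsUnion (M : PreStructure.{u, v} (cmduVocab L.toVocab O)) : Prop where
  lipschitz : ∀ x y : Pts M, |hgt M x - hgt M y| ≤ dist x y
  gap : ∀ (x : Pts M) (n : ℕ), hgt M x ≤ (1 / 2) ^ (n + 1) ∨ (1 / 2) ^ n ≤ hgt M x
  nonempty : ∀ n : ℕ, ∃ x : Pts M, hgt M x = (1 / 2) ^ n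
  separated : ∀ x y : Pts M, hgt M x ≠ hgt M y → dist x y ≤ |hgt M x - hgt M y|
  diam : ∀ x y : Pts M, dist x y ≤ max (hgt M x) (hgt M y)
  outside : ∀ {p : L.Preds} {i : Fin (L.ar p) → ℕ} (hi : ∀ k, O (i k) = L.dom p k)
    (x : Fin (L.ar p) → Pts M) (k : Fin (L.ar p)), hgt M (x k) ≠ (1 / 2) ^ i k → ext M hi x = 1
  modulus : ∀ {p : L.Preds} {i : Fin (L.ar p) → ℕ} (hi : ∀ k, O (i k) = L.dom p k)
    (δ : unitInterval) (x y : Fin (L.ar p) → Pts M), (∀ k, hgt M (x k) = (1 / 2) ^ i k) →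
    (∀ k, hgt M (y k) = (1 / 2) ^ i k) → (∀ k, 2 ^ i k * dist (x k) (y k) ≤ (δ : ℝ)) →
    |ext M hi x - ext M hi y| ≤ L.modulus p δ

theorem two_pow_mul_half_pow (n : ℕ) (x : ℝ) : 2 ^ n * ((1 / 2) ^ n * x) = x := by
  rw [← mul_assoc, ← mul_pow]
  norm_num

theorem half_pow_mul_two_pow (n : ℕ) (x : ℝ) : (1 / 2) ^ n * (2 ^ n * x) = x := by
  rw [← mul_assoc, ← mul_pow]
  norm_num

theorem half_pow_le_half_pow {m n : ℕ} (h : m ≤ n) : (1 / 2 : ℝ) ^ n ≤ (1 / 2) ^ m :=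
  pow_le_pow_of_le_one (by norm_num) (by norm_num) h

theorem half_pow_pos (n : ℕ) : (0 : ℝ) < (1 / 2) ^ n := by positivity

theorem half_pow_le_one (n : ℕ) : (1 / 2 : ℝ) ^ n ≤ 1 := pow_le_one₀ (by norm_num) (by norm_num)

theorem Cmdu.height_gap {A : PreStructure.{u, v} L.toVocab} (x : Cmdu A O) (n : ℕ) :
    Cmdu.height A O x ≤ (1 / 2) ^ (n + 1) ∨ (1 / 2) ^ n ≤ Cmdu.height A O x := by
  cases x with
  | star => exact Or.inl (half_pow_pos _).le
  | pt m x =>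
    rcases le_or_gt m n with h | h
    · exact Or.inr (half_pow_le_half_pow h)
    · exact Or.inl (half_pow_le_half_pow h)

/-- A structure that is isomorphic to a disjoint union looks like one. -/
theorem isUnion_of_isometryEquiv {M : PreStructure.{u, v} (cmduVocab L.toVocab O)}
    (A : LStructure.{u, v} L) (e : Pts M ≃ᵢ Cmdu A.toPreStructure O)
    (he : ∀ x, hgt M x = Cmdu.height _ O (e x))
    (he' : ∀ {p : L.Preds} {i : Fin (L.ar p) → ℕ} (hi : ∀ k, O (i k) = L.dom p k)
      (x : Fin (L.ar p) → Pts M), ext M hi x = Cmdu.extPred _ O p i hi fun k => e (x k)) :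
    IsUnion M where
  lipschitz x y := by
    rw [he, he, ← e.dist_eq]
    exact Cmdu.height_le _ _ _ _
  gap x n := by
    rw [he]
    exact Cmdu.height_gap _ n
  nonempty n :=
    ⟨e.symm (.pt n (Classical.choice (A.sort (O n)).nonempty)), by
      rw [he, e.apply_symm_apply]; rfl⟩
  separated x y hxy := by
    rw [he, he] at hxy ⊢
    rw [← e.dist_eq]
    rcases Cmdu.cases₂ _ O (e x) (e y) with ⟨h1, h2⟩ | ⟨n, a, b, h1, h2⟩ | h
    · rw [h1, h2] at hxy
      exact absurd rfl hxy
    · rw [h1, h2] at hxy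
      exact absurd rfl hxy
    · exact h.le
  diam x y := by
    rw [he, he, ← e.dist_eq x y]
    rcases Cmdu.cases₂ _ O (e x) (e y) with ⟨h1, h2⟩ | ⟨n, a, b, h1, h2⟩ | h
    · rw [h1, h2, dist_self]
      exact le_max_of_le_left le_rfl
    · rw [h1, h2, Cmdu.dist_pt]
      exact le_max_of_le_left (mul_le_of_le_one_right (half_pow_pos n).le
        (MSort.dist_le_one _ _ _))
    · rw [Cmdu.dist_eq, h]
      have h1 := (Cmdu.height_mem (e x)).1
      have h2 := (Cmdu.height_mem (e y)).1
      rcases le_total (Cmdu.height _ O (e x)) (Cmdu.height _ O (e y)) with h3 | h3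
      · rw [abs_of_nonpos (by linarith), max_eq_right h3]
        linarith
      · rw [abs_of_nonneg (by linarith), max_eq_left h3]
        linarith
  outside hi x k hk := by
    rw [he']
    exact Cmdu.extPred_of_height_ne hi (k := k) (by rwa [← he])
  modulus {p i} hi δ x y hx hy hxy := by
    rw [he', he']
    choose a ha using fun k => Cmdu.eq_inc_of_height (hi k) ((he (x k)).symm.trans (hx k))
    choose b hb using fun k => Cmdu.eq_inc_of_height (hi k) ((he (y k)).symm.trans (hy k))
    rw [funext ha, funext hb, Cmdu.extPred_inc, Cmdu.extPred_inc]
    refine A.respects p δ a b fun k => ?_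
    have h1 := hxy k
    rwa [← e.dist_eq, ha, hb, Cmdu.dist_inc, two_pow_mul_half_pow] at h1

end

/-- A non-empty closed subset of a sort, with a rescaled metric. -/
@[reducible] noncomputable def MSort.scaledMetric (X : MSort.{u}) (S : Set X) {c : ℝ} (hc : 0 < c) :
    MetricSpace S where
  dist x y := c * dist x.1 y.1
  dist_self x := by simp
  dist_comm x y := by simp only [dist_comm]
  dist_triangle x y z := by
    rw [← mul_add]
    exact mul_le_mul_of_nonneg_left (dist_triangle _ _ _) hc.le
  eq_of_dist_eq_zero {x y} h := by
    have : dist x.1 y.1 = 0 := (mul_eq_zero.1 h).resolve_left hc.ne'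
    exact Subtype.ext (dist_eq_zero.1 this)

/-- A non-empty closed subset of a sort, with a rescaled metric, as a sort. -/
noncomputable def MSort.scaled (X : MSort.{u}) (S : Set X) (hS : IsClosed S) (hne : S.Nonempty)
    {c : ℝ} (hc : 0 < c) (hd : ∀ x ∈ S, ∀ y ∈ S, c * dist x y ≤ 1) : MSort.{u} where
  carrier := S
  metric := X.scaledMetric S hc
  complete := by
    refine @Metric.complete_of_cauchySeq_tendsto S (X.scaledMetric S hc).toPseudoMetricSpace
      fun a ha => ?_
    have h1 : CauchySeq fun n => (a n : X) := by
      have ha' := (@Metric.cauchySeq_iff S ℕ (X.scaledMetric S hc).toPseudoMetricSpace _ _ a).1 ha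
      rw [Metric.cauchySeq_iff]
      intro ε hε
      obtain ⟨N, hN⟩ := ha' (c * ε) (by positivity)
      exact ⟨N, fun m hm n hn => lt_of_mul_lt_mul_left (hN m hm n hn) hc.le⟩
    obtain ⟨l, hl⟩ := cauchySeq_tendsto_of_complete h1
    have hlS : l ∈ S := hS.mem_of_tendsto hl (Filter.Eventually.of_forall fun n => (a n).2)
    refine ⟨⟨l, hlS⟩, ?_⟩
    rw [Metric.tendsto_atTop] at hl
    refine (@Metric.tendsto_atTop S ℕ (X.scaledMetric S hc).toPseudoMetricSpace _ _ a _).2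
      fun ε hε => ?_
    obtain ⟨N, hN⟩ := hl (ε / c) (by positivity)
    exact ⟨N, fun n hn => (lt_div_iff₀' hc).1 (hN n hn)⟩
  nonempty := hne.to_subtype
  dist_le_one x y := hd x.1 x.2 y.1 y.2

/-! ### Recovery of the original structure -/

namespace IsUnion

variable {L : MetricSignature.{v}} {O : ℕ → L.Sorts}
  {M : PreStructure.{u, v} (cmduVocab L.toVocab O)}
  (hM : IsUnion M)

/-- Points of height 2^-n form a Cauchy sequence because distances are bounded by the larger height.
Heights are continuous, so the limit has height 0: completeness of the sort takes the place of an
axiom for ∗. -/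
theorem exists_star (hM : IsUnion M) : ∃ x : Pts M, hgt M x = 0 := by
  choose a ha using hM.nonempty
  have hc : CauchySeq a := by
    refine Metric.cauchySeq_iff'.2 fun ε hε => ?_
    obtain ⟨N, hN⟩ := exists_pow_lt_of_lt_one hε (by norm_num : (1 / 2 : ℝ) < 1)
    refine ⟨N, fun n hn => (hM.diam _ _).trans_lt ?_⟩
    rw [ha, ha, max_eq_right (half_pow_le_half_pow hn)]
    exact hN
  obtain ⟨l, hl⟩ := cauchySeq_tendsto_of_complete hc
  refine ⟨l, le_antisymm (le_of_forall_pos_lt_add fun ε hε => ?_) (hgt_mem _ _).1⟩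
  obtain ⟨N, hN⟩ := exists_pow_lt_of_lt_one (half_pos hε) (by norm_num : (1 / 2 : ℝ) < 1)
  obtain ⟨N', hN'⟩ := Metric.tendsto_atTop.1 hl (ε / 2) (half_pos hε)
  have h1 := hN' (max N N') (le_max_right _ _)
  have h2 := (abs_le.1 (hM.lipschitz (a (max N N')) l)).1
  have h3 := half_pow_le_half_pow (le_max_left N N')
  rw [ha] at h2
  linarith

/-- A positive height lies in some interval (2^-(n+1), 2^-n], and `gap` excludes everything there
except the right end point. -/
theorem hgt_cases (hM : IsUnion M) (x : Pts M) :
    hgt M x = 0 ∨ ∃ n : ℕ, hgt M x = (1 / 2) ^ n := by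
  rcases (hgt_mem M x).1.eq_or_lt with h | h
  · exact Or.inl h.symm
  · obtain ⟨n, h1, h2⟩ := exists_nat_pow_near_of_lt_one h (hgt_mem M x).2
      (by norm_num : (0 : ℝ) < 1 / 2) (by norm_num)
    refine Or.inr ⟨n, le_antisymm h2 ?_⟩
    rcases hM.gap x n with h3 | h3
    · exact absurd h1 (not_lt.2 h3)
    · exact h3

open Classical in
/-- The height of the points that represent the sort `s`. -/
noncomputable def weight (O : ℕ → L.Sorts) (s : L.Sorts) : ℝ :=
  if h : ∃ n, O n = s then (1 / 2) ^ h.choose else 0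

open Classical in
/-- The factor between the metric of the sort `s` and the metric of the union. -/
noncomputable def scale (O : ℕ → L.Sorts) (s : L.Sorts) : ℝ :=
  if h : ∃ n, O n = s then 2 ^ h.choose else 1

/-- The sorts of the sequence are distinct, so the chosen index can only be `n`. Distinctness is
needed because each sort must be recovered from a single piece. -/
theorem weight_eq (hO : Function.Injective O) {n : ℕ} {s : L.Sorts} (h : O n = s) :
    weight O s = (1 / 2) ^ n := by
  have h' : ∃ n, O n = s := ⟨n, h⟩
  rw [weight, dif_pos h', hO (h'.choose_spec.trans h.symm)]

theorem scale_eq (hO : Function.Injective O) {n : ℕ} {s : L.Sorts} (h : O n = s) :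
    scale O s = 2 ^ n := by
  have h' : ∃ n, O n = s := ⟨n, h⟩
  rw [scale, dif_pos h', hO (h'.choose_spec.trans h.symm)]

theorem scale_pos (O : ℕ → L.Sorts) (s : L.Sorts) : 0 < scale O s := by
  unfold scale
  split_ifs <;> positivity

/-- A sort outside of the sequence gets weight 0 and scale 1. It is interpreted by the points of
height 0, of which there is just one, by `diam`. For O_n, the bound says that the piece has diameter
at most 1 after rescaling. -/
theorem scale_mul_weight_le (O : ℕ → L.Sorts) (s : L.Sorts) : scale O s * weight O s ≤ 1 := by
  unfold scale weight
  split_ifs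
  · rw [← mul_pow]
    norm_num
  · norm_num

/-- The sorts of the structure of which `M` is the disjoint union. -/
noncomputable def sortOf (hM : IsUnion M) (s : L.Sorts) : MSort.{u} :=
  (Pts M).scaled {x | hgt M x = weight O s}
    (by
      have : LipschitzWith 1 (hgt M) :=
        LipschitzWith.of_dist_le_mul fun x y => by
          simpa [Real.dist_eq] using hM.lipschitz x y
      exact isClosed_eq this.continuous continuous_const)
    (by
      unfold weight
      split_ifs with h
      · exact hM.nonempty _
      · exact hM.exists_star)
    (scale_pos O s)
    (by
      intro x hx y hy
      refine le_trans (mul_le_mul_of_nonneg_left ?_ (scale_pos O s).le) (scale_mul_weight_le O s)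
      have := hM.diam x y
      rwa [show hgt M x = weight O s from hx,
        show hgt M y = weight O s from hy, max_self] at this)

open Classical in
/-- The structure of which `M` is the disjoint union. -/
noncomputable def preOf : PreStructure.{u, v} L.toVocab where
  sort := hM.sortOf
  pred p x := if h : ∃ i : Fin (L.ar p) → ℕ, ∀ k, O (i k) = L.dom p k then
    ext M h.choose_spec fun k => Subtype.val (x k : hM.sortOf (L.dom p k)) else 0
  pred_mem p x := by
    split_ifs
    · exact ext_mem _ _ _
    · simp

/-- The point of the union that belongs to a point of a sort. -/
def val {s : L.Sorts} (x : hM.preOf.sort s) : Pts M := Subtype.val (x : hM.sortOf s)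

theorem hgt_val {s : L.Sorts} (x : hM.preOf.sort s) : hgt M (hM.val x) = weight O s :=
  Subtype.property (x : hM.sortOf s)

theorem dist_eq {s : L.Sorts} (x y : hM.preOf.sort s) :
    dist x y = scale O s * dist (hM.val x) (hM.val y) := rfl

theorem preOf_pred (hO : Function.Injective O) {p : L.Preds} {i : Fin (L.ar p) → ℕ}
    (hi : ∀ k, O (i k) = L.dom p k) (x : ∀ k, hM.preOf.sort (L.dom p k)) :
    hM.preOf.pred p x = ext M hi fun k => hM.val (x k) := by
  have h : ∃ i : Fin (L.ar p) → ℕ, ∀ k, O (i k) = L.dom p k := ⟨i, hi⟩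
  have h' : h.choose = i := funext fun k => hO ((h.choose_spec k).trans (hi k).symm)
  have key : ∀ (j : Fin (L.ar p) → ℕ) (hj : ∀ k, O (j k) = L.dom p k), j = i →
      ext M hj (fun k => hM.val (x k)) =
        ext M hi fun k => hM.val (x k) := by
    rintro j hj rfl
    rfl
  exact (dif_pos h).trans (key _ _ h')

theorem preOf_respects (hO : Function.Injective O) : hM.preOf.Respects L := by
  intro p δ x y hxy
  by_cases h : ∃ i : Fin (L.ar p) → ℕ, ∀ k, O (i k) = L.dom p k
  · obtain ⟨i, hi⟩ := h
    rw [hM.preOf_pred hO hi, hM.preOf_pred hO hi]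
    refine hM.modulus hi δ _ _ (fun k => ?_) (fun k => ?_) fun k => ?_
    · rw [hgt_val, weight_eq hO (hi k)]
    · rw [hgt_val, weight_eq hO (hi k)]
    · rw [← scale_eq hO (hi k)]
      exact hxy k
  · have h0 : ∀ z, hM.preOf.pred p z = 0 := fun z => dif_neg h
    rw [h0, h0, sub_zero, abs_zero]
    exact (L.modulus p δ).2.1

/-- The structure of which `M` is the disjoint union. -/
noncomputable def structureOf (hO : Function.Injective O) : LStructure.{u, v} L where
  toPreStructure := hM.preOf
  respects := hM.preOf_respects hO

/-- The point of `M` that belongs to a point of the disjoint union. -/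
noncomputable def toPts : Cmdu hM.preOf O → Pts M
  | .star => hM.exists_star.choose
  | .pt _ x => hM.val x

theorem hgt_toPts (hO : Function.Injective O) (x : Cmdu hM.preOf O) :
    hgt M (hM.toPts x) = Cmdu.height _ O x := by
  cases x with
  | star => exact hM.exists_star.choose_spec
  | pt n x => exact (hM.hgt_val x).trans (weight_eq hO rfl)

theorem toPts_inc {n : ℕ} {s : L.Sorts} (h : O n = s) (x : hM.preOf.sort s) :
    hM.toPts (Cmdu.inc n h x) = hM.val x := by
  subst h
  rfl

theorem isometry_toPts (hO : Function.Injective O) : Isometry hM.toPts := by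
  refine Isometry.of_dist_eq fun x y => ?_
  rcases Cmdu.cases₂ _ O x y with ⟨rfl, rfl⟩ | ⟨n, a, b, rfl, rfl⟩ | h
  · rw [dist_self, dist_self]
  · rw [Cmdu.dist_pt, hM.dist_eq, scale_eq hO rfl, half_pow_mul_two_pow]
    rfl
  · rw [Cmdu.dist_eq, h, ← hM.hgt_toPts hO, ← hM.hgt_toPts hO]
    refine le_antisymm ?_ (hM.lipschitz _ _)
    -- The axiom on separated points says nothing about equal heights; in the present case equal
    -- heights mean d(x,y) = 0.
    by_cases hxy : hgt M (hM.toPts x) = hgt M (hM.toPts y)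
    · have : Cmdu.d hM.preOf O x y = 0 := by
        rw [h, ← hM.hgt_toPts hO, ← hM.hgt_toPts hO, hxy, sub_self, abs_zero]
      rw [((Cmdu.isMetric hM.preOf O).eq_zero_iff x y).1 this]
      simp
    · exact hM.separated _ _ hxy

theorem surjective_toPts (hO : Function.Injective O) : Function.Surjective hM.toPts := by
  intro x
  rcases hM.hgt_cases x with h | ⟨n, h⟩
  -- Two points of height 0 have distance at most max 0 0, so the chosen one is the only one.
  · refine ⟨.star, dist_le_zero.1 ((hM.diam _ _).trans ?_)⟩
    rw [h, hM.hgt_toPts hO]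
    simp [Cmdu.height]
  · exact ⟨.pt n ⟨x, h.trans (weight_eq hO rfl).symm⟩, rfl⟩

theorem extPred_toPts (hO : Function.Injective O) {p : L.Preds} {i : Fin (L.ar p) → ℕ}
    (hi : ∀ k, O (i k) = L.dom p k) (x : Fin (L.ar p) → Cmdu hM.preOf O) :
    Cmdu.extPred hM.preOf O p i hi x = ext M hi fun k => hM.toPts (x k) := by
  by_cases h : ∀ k, Cmdu.height _ O (x k) = (1 / 2) ^ i k
  · choose a ha using fun k => Cmdu.eq_inc_of_height (hi k) (h k)
    rw [funext ha, Cmdu.extPred_inc, hM.preOf_pred hO hi]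
    simp only [toPts_inc]
  · push Not at h
    obtain ⟨k, hk⟩ := h
    rw [Cmdu.extPred_of_height_ne hi hk, hM.outside hi _ k]
    rwa [hM.hgt_toPts hO]

end IsUnion

/-- The structures that look like disjoint unions are isomorphic to disjoint unions. -/
theorem isUnion_iff {L : MetricSignature.{v}} {O : ℕ → L.Sorts} (hO : Function.Injective O)
    (M : PreStructure.{u, v} (cmduVocab L.toVocab O)) :
    IsUnion M ↔
      ∃ A : LStructure.{u, v} L, Isomorphic M (cmdu A.toPreStructure O) := by
  constructor
  · intro hM
    let f : Cmdu hM.preOf O ≃ᵢ Pts M :=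
      ⟨Equiv.ofBijective hM.toPts
        ⟨(hM.isometry_toPts hO).injective, hM.surjective_toPts hO⟩, hM.isometry_toPts hO⟩
    have hf : ∀ x, hM.toPts (f.symm x) = x := f.apply_symm_apply
    refine ⟨hM.structureOf hO, fun _ => f.symm, ?_⟩
    rintro (_ | ⟨p, i, hi⟩) x
    · change Fin 1 → Pts M at x
      change dist (f.symm (x 0)) .star = _
      rw [Cmdu.dist_star, ← hM.hgt_toPts hO, hf]
      unfold hgt
      congr 1
      funext k
      exact congrArg x (Subsingleton.elim _ _)
    · exact (hM.extPred_toPts hO hi fun k => f.symm (x k)).trans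
        (congrArg (ext M hi) (funext fun k => hf (x k)))
  · rintro ⟨A, e, he⟩
    refine isUnion_of_isometryEquiv A (e PUnit.unit) (fun x => ?_) fun hi x => ?_
    · exact (he none fun _ => x).symm.trans (Cmdu.dist_star (A := A.toPreStructure) _)
    · exact (he (some ⟨_, _, hi⟩) x).symm

/-! ## The theory of disjoint unions -/

/-- Predicate symbols of the disjoint union that extend predicate symbols. -/
abbrev ExtSymbol (V : Vocab.{v}) (O : ℕ → V.Sorts) : Type v :=
  Σ p : V.Preds, {i : Fin (V.ar p) → ℕ // ∀ k, O (i k) = V.dom p k}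

section formulas

variable {V : Vocab.{v}} (O : ℕ → V.Sorts)

/-- The first `n` variables. -/
def unionVars (n : ℕ) : List ((cmduVocab V O).Sorts × ℕ) :=
  (List.range n).map fun k => (PUnit.unit, k)

/-- An extended predicate. -/
def extFormula (q : ExtSymbol V O) (f : Fin (V.ar q.1) → ℕ) : RFormula (cmduVocab V O) :=
  .pred (some q) f

/-- The distance of two variables. -/
def unionDist (i j : ℕ) : RFormula (cmduVocab V O) := .dist (PUnit.unit : PUnit) i j

/-- The height avoids the interval between `2 ^ -(n+1)` and `2 ^ -n`. -/
def gapAxiom (n : ℕ) : RFormula (cmduVocab V O) :=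
  .sups (unionVars O 1) (.min (.sub (heightFormula O 0) (.halfPow (n + 1)))
    (.sub (.halfPow n) (heightFormula O 0)))

/-- The height takes values close to `2 ^ -n`. -/
def nonemptyAxiom (n : ℕ) : RFormula (cmduVocab V O) := .infs (unionVars O 1) (heightDiff O n 0)

/-- The distance of points of different height. -/
def separatedAxiom : RFormula (cmduVocab V O) :=
  .sups (unionVars O 2) (.min (.absDiff (heightFormula O 0) (heightFormula O 1))
    (.sub (unionDist O 0 1) (.absDiff (heightFormula O 0) (heightFormula O 1))))

/-- The distance is bounded by the heights. -/
def diamAxiom : RFormula (cmduVocab V O) :=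
  .sups (unionVars O 2) (.sub (unionDist O 0 1) (.max (heightFormula O 0) (heightFormula O 1)))

/-- The extended predicates have the value `1` outside of their domains. -/
def outsideAxiom (q : ExtSymbol V O) : RFormula (cmduVocab V O) :=
  .sups (unionVars O (V.ar q.1)) (.min (.sub .one (extFormula O q fun k => k))
    (.maxs (List.ofFn fun k => heightDiff O (q.2.1 k) k)))

/-- A formula that is positive if the variables with numbers `a` and `a + 1` belong to `O n`, and
have distance less than `j / 2 ^ m` there. -/
def closeFormula (j m n a : ℕ) : RFormula (cmduVocab V O) :=
  .min (.min (.sub (.halfPow (n + 2)) (heightDiff O n a))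
      (.sub (.halfPow (n + 2)) (heightDiff O n (a + 1))))
    (if min j (2 ^ m) = 2 ^ m then .one else .sub (.dyadic j (m + n)) (unionDist O a (a + 1)))

/-- The values of an extended predicate at points with distances less than `j / 2 ^ m` differ by at
most `b / 2 ^ k`. -/
def modulusAxiom (q : ExtSymbol V O) (j m b k : ℕ) : RFormula (cmduVocab V O) :=
  .sups (unionVars O (2 * V.ar q.1)) (.min
    (.sub (.absDiff (extFormula O q fun k => 2 * k) (extFormula O q fun k => 2 * k + 1))
      (.dyadic b k))
    (.mins (List.ofFn fun l => closeFormula O j m (q.2.1 l) (2 * l))))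

/-- The axioms of the theory of disjoint unions; `ap p j m k` is an approximation of the value of
the modulus of `p` at `j / 2 ^ m`. -/
inductive IsAxiom (ap : V.Preds → ℕ → ℕ → ℕ → ℕ) : RFormula (cmduVocab V O) → Prop
  | gap (n : ℕ) : IsAxiom ap (gapAxiom O n)
  | nonempty (n : ℕ) : IsAxiom ap (nonemptyAxiom O n)
  | separated : IsAxiom ap (separatedAxiom O)
  | diam : IsAxiom ap (diamAxiom O)
  | outside (q : ExtSymbol V O) : IsAxiom ap (outsideAxiom O q)
  | modulus (q : ExtSymbol V O) (j m k : ℕ) :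
      IsAxiom ap (modulusAxiom O q j m (ap q.1 j m k + 1) k)

/-- The diameter of `O 0`. -/
def diamSentence : RFormula (cmduVocab V O) :=
  .sups (unionVars O 2) (.sub (unionDist O 0 1)
    (RFormula.double^[2] (.plus (heightDiff O 0 0) (heightDiff O 0 1))))

theorem mem_unionVars {n k : ℕ} (h : k < n) :
    ((PUnit.unit, k) : (cmduVocab V O).Sorts × ℕ) ∈ unionVars O n :=
  List.mem_map.2 ⟨k, List.mem_range.2 h, rfl⟩

theorem free_sups_unionVars {n : ℕ} {φ : RFormula (cmduVocab V O)}
    (h : φ.free ⊆ {x | x.2 < n}) : (φ.sups (unionVars O n)).free = ∅ := by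
  rw [RFormula.free_sups]
  refine Set.sdiff_eq_empty.2 fun x hx => ?_
  obtain ⟨⟨⟩, k⟩ := x
  exact mem_unionVars O (h hx)

theorem free_extFormula (q : ExtSymbol V O) (f : Fin (V.ar q.1) → ℕ) :
    (extFormula O q f).free = Set.range fun k => ((PUnit.unit, f k) : PUnit × ℕ) := rfl

theorem free_unionDist (i j : ℕ) :
    (unionDist O i j).free = {((PUnit.unit, i) : PUnit × ℕ), ((PUnit.unit, j) : PUnit × ℕ)} := rfl

theorem free_closeFormula (j m n a : ℕ) :
    (closeFormula O j m n a).free ⊆ {x | x.2 < a + 2} := by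
  have h : ∀ i < a + 2, ({((PUnit.unit, i) : PUnit × ℕ)} : Set (PUnit × ℕ)) ⊆ {x | x.2 < a + 2} :=
    fun i hi => by rintro _ rfl; exact hi
  unfold closeFormula
  rw [RFormula.free_min, RFormula.free_min]
  simp only [RFormula.free, RFormula.free_halfPow, free_heightDiff, Set.empty_union]
  refine Set.union_subset (Set.union_subset (h _ (by omega)) (h _ (by omega))) ?_
  split_ifs
  · exact Set.empty_subset _
  · simp only [RFormula.free, RFormula.free_dyadic, Set.empty_union, free_unionDist]
    rintro _ (rfl | rfl)
    · exact h a (by omega) rfl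
    · exact h (a + 1) (by omega) rfl

theorem IsAxiom.free_eq {ap : V.Preds → ℕ → ℕ → ℕ → ℕ} {φ : RFormula (cmduVocab V O)}
    (h : IsAxiom O ap φ) : φ.free = ∅ := by
  have hs : ∀ {i n : ℕ}, i < n → ({((PUnit.unit, i) : PUnit × ℕ)} : Set (PUnit × ℕ)) ⊆
      {x | x.2 < n} := fun {i n} hi => by rintro _ rfl; exact hi
  have hd : (unionDist O 0 1).free ⊆ {x | x.2 < 2} := by
    rw [free_unionDist]
    rintro _ (rfl | rfl)
    · exact Nat.zero_lt_two
    · exact Nat.one_lt_two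
  cases h with
  | gap n =>
    refine free_sups_unionVars O ?_
    simp only [RFormula.free_min, RFormula.free, free_heightFormula, RFormula.free_halfPow,
      Set.union_empty, Set.empty_union, Set.union_self]
    exact hs Nat.zero_lt_one
  | nonempty n =>
    unfold nonemptyAxiom
    rw [RFormula.free_infs, free_heightDiff]
    refine Set.sdiff_eq_empty.2 ?_
    rintro _ rfl
    exact mem_unionVars O Nat.zero_lt_one
  | separated =>
    refine free_sups_unionVars O ?_
    simp only [RFormula.free_min, RFormula.free_absDiff, RFormula.free, free_heightFormula]
    exact Set.union_subset (Set.union_subset (hs (by omega)) (hs (by omega)))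
      (Set.union_subset hd (Set.union_subset (hs (by omega)) (hs (by omega))))
  | diam =>
    refine free_sups_unionVars O ?_
    simp only [RFormula.free_max, RFormula.free, free_heightFormula]
    exact Set.union_subset hd (Set.union_subset (hs (by omega)) (hs (by omega)))
  | outside q =>
    refine free_sups_unionVars O ?_
    simp only [RFormula.free_min, RFormula.free, Set.empty_union]
    refine Set.union_subset ?_ (RFormula.free_maxs_subset fun φ hφ => ?_)
    · rw [free_extFormula]
      rintro _ ⟨k, rfl⟩
      exact k.2
    · obtain ⟨k, rfl⟩ := List.mem_ofFn.1 hφ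
      rw [free_heightDiff]
      exact hs k.2
  | modulus q j m k =>
    refine free_sups_unionVars O ?_
    simp only [RFormula.free_min, RFormula.free_absDiff, RFormula.free, RFormula.free_dyadic,
      Set.union_empty]
    refine Set.union_subset (Set.union_subset ?_ ?_) (RFormula.free_mins_subset fun φ hφ => ?_)
    · rw [free_extFormula]
      rintro _ ⟨l, rfl⟩
      exact show 2 * (l : ℕ) < 2 * V.ar q.1 by omega
    · rw [free_extFormula]
      rintro _ ⟨l, rfl⟩
      exact show 2 * (l : ℕ) + 1 < 2 * V.ar q.1 by omega
    · obtain ⟨l, rfl⟩ := List.mem_ofFn.1 hφ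
      refine (free_closeFormula O _ _ _ _).trans fun x hx => ?_
      exact lt_of_lt_of_le hx (show 2 * (l : ℕ) + 2 ≤ 2 * V.ar q.1 by omega)

theorem free_diamSentence : (diamSentence O).free = ∅ := by
  have hs : ∀ {i n : ℕ}, i < n → ({((PUnit.unit, i) : PUnit × ℕ)} : Set (PUnit × ℕ)) ⊆
      {x | x.2 < n} := fun {i n} hi => by rintro _ rfl; exact hi
  refine free_sups_unionVars O ?_
  simp only [RFormula.free, RFormula.free_double_iterate, RFormula.free_plus, free_heightDiff]
  refine Set.union_subset ?_ (Set.union_subset (hs (by omega)) (hs (by omega)))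
  rw [free_unionDist]
  rintro _ (rfl | rfl)
  · exact Nat.zero_lt_two
  · exact Nat.one_lt_two

variable {O} (M : PreStructure.{u, v} (cmduVocab V O))

/-- The assignment of a sequence of points to the variables. -/
def seqVal (x : ℕ → Pts M) : M.Val := fun _ k => x k

/-- All values are non-negative, so the condition sup φ = 0 says that φ vanishes identically. In the
axioms, φ = min φ₁ φ₂ then says that φ₁ or φ₂ vanishes at each tuple, which expresses an
implication. -/
theorem forall_sups_eq_zero {V : Vocab.{v}} (M : PreStructure.{u, v} V) (l : List (V.Sorts × ℕ))
    (φ : RFormula V) :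
    (∀ w : M.Val, (φ.sups l).eval M w = 0) ↔ ∀ w : M.Val, φ.eval M w = 0 :=
  ⟨fun h w => le_antisymm ((φ.le_sups fun _ _ _ => rfl).trans (h w).le) (φ.eval_nonneg M w),
    fun h w => le_antisymm (φ.sups_le fun w' _ => (h w').le) (RFormula.eval_nonneg M _ w)⟩

variable {M}

theorem eval_heightFormula (i : ℕ) (w : M.Val) :
    (heightFormula O i).eval M w = hgt M (w PUnit.unit i) := rfl

theorem eval_heightDiff (n i : ℕ) (w : M.Val) :
    (heightDiff O n i).eval M w = |hgt M (w PUnit.unit i) - (1 / 2) ^ n| := by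
  rw [heightDiff, RFormula.eval_absDiff, eval_heightFormula, RFormula.eval_halfPow]

theorem eval_extFormula (q : ExtSymbol V O) (f : Fin (V.ar q.1) → ℕ) (w : M.Val) :
    (extFormula O q f).eval M w = ext M q.2.2 fun k => w PUnit.unit (f k) := rfl

theorem eval_unionDist (i j : ℕ) (w : M.Val) :
    (unionDist O i j).eval M w = dist (α := Pts M) (w PUnit.unit i) (w PUnit.unit j) := rfl

end formulas

theorem half_pow_le_abs_sub {n m : ℕ} (h : n ≠ m) :
    (1 / 2 : ℝ) ^ (m + 2) < |(1 / 2) ^ n - (1 / 2) ^ m| := by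
  have h1 := pow_half_gap h.symm
  rw [abs_sub_comm]
  refine lt_of_lt_of_le ?_ h1
  have := half_pow_pos m
  rw [pow_add]
  linarith

/-! ### Meaning of the axioms -/

section semantics

variable {L : MetricSignature.{v}} {O : ℕ → L.Sorts} {ap : L.Preds → ℕ → ℕ → ℕ → ℕ}

/-- All other possible heights differ from 2^-n by at least 2^-n/2, so the radius 2^-(n+2) singles
out the piece O_n. The first two conditions in `closeFormula` use this radius. -/
theorem IsUnion.hgt_eq_of_close {M : PreStructure.{u, v} (cmduVocab L.toVocab O)} (hM : IsUnion M)
    {x : Pts M} {n : ℕ} (h : |hgt M x - (1 / 2) ^ n| < (1 / 2) ^ (n + 2)) :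
    hgt M x = (1 / 2) ^ n := by
  rcases hM.hgt_cases x with h0 | ⟨m, hm⟩
  · rw [h0, zero_sub, abs_neg, abs_of_pos (half_pow_pos n)] at h
    exact absurd h (not_lt.2 (half_pow_le_half_pow (by omega)))
  · by_contra hne
    rw [hm] at h hne
    exact absurd h (half_pow_le_abs_sub fun e => hne (by rw [e])).le.not_gt

/-- Disjoint unions satisfy the axioms. -/
theorem IsUnion.eval_eq_zero {M : PreStructure.{u, v} (cmduVocab L.toVocab O)} (hM : IsUnion M)
    (hap : ∀ p j m k, Approx (ap p j m k) k
      (L.modulus p (Set.projIcc (0 : ℝ) 1 zero_le_one ((j : ℝ) / 2 ^ m))))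
    {φ : RFormula (cmduVocab L.toVocab O)} (h : IsAxiom O ap φ) (w : M.Val) : φ.eval M w = 0 := by
  cases h with
  | gap n =>
    refine (forall_sups_eq_zero M _ _).2 (fun w => ?_) w
    simp only [RFormula.eval_min, RFormula.eval, RFormula.eval_halfPow, eval_heightFormula]
    rcases hM.gap (w PUnit.unit 0) n with h | h
    · rw [max_eq_right (sub_nonpos.2 h), min_eq_left (le_max_right _ _)]
    · rw [max_eq_right (sub_nonpos.2 h), min_eq_right (le_max_right _ _)]
  | nonempty n =>
    obtain ⟨x, hx⟩ := hM.nonempty n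
    refine le_antisymm ?_ (RFormula.eval_nonneg M _ w)
    refine ((heightDiff O n 0).infs_le (w' := w.upd PUnit.unit 0 x) fun s i hi => ?_).trans ?_
    · refine w.upd_of_index_ne _ fun h0 => ?_
      subst h0
      exact hi (mem_unionVars O Nat.zero_lt_one)
    · refine (eval_heightDiff n 0 _).trans_le (le_of_eq ?_)
      refine (congrArg (fun y => |hgt M y - (1 / 2) ^ n|) (w.upd_self PUnit.unit 0 x)).trans ?_
      simp [hx]
  | separated =>
    refine (forall_sups_eq_zero M _ _).2 (fun w => ?_) w
    simp only [RFormula.eval_min, RFormula.eval, RFormula.eval_absDiff, eval_heightFormula,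
      eval_unionDist]
    by_cases h : hgt M (w PUnit.unit 0) = hgt M (w PUnit.unit 1)
    · rw [h, sub_self, abs_zero, min_eq_left (le_max_right _ _)]
    · rw [max_eq_right (sub_nonpos.2 (hM.separated _ _ h)), min_eq_right (abs_nonneg _)]
  | diam =>
    refine (forall_sups_eq_zero M _ _).2 (fun w => ?_) w
    simp only [RFormula.eval, RFormula.eval_max, eval_heightFormula, eval_unionDist]
    exact max_eq_right (sub_nonpos.2 (hM.diam _ _))
  | outside q =>
    refine (forall_sups_eq_zero M _ _).2 (fun w => ?_) w
    rw [RFormula.eval_min]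
    refine le_antisymm ?_ (le_min (RFormula.eval_nonneg _ _ _) (RFormula.eval_nonneg _ _ _))
    by_cases h : ∃ k, hgt M (w PUnit.unit (k : Fin (L.ar q.1))) ≠ (1 / 2) ^ q.2.1 k
    · obtain ⟨k, hk⟩ := h
      refine (min_le_left _ _).trans ?_
      simp only [RFormula.eval, eval_extFormula]
      rw [hM.outside q.2.2 _ k hk, sub_self, max_self]
    · push Not at h
      refine (min_le_right _ _).trans (RFormula.maxs_le le_rfl fun φ hφ => ?_)
      obtain ⟨k, rfl⟩ := List.mem_ofFn.1 hφ
      rw [eval_heightDiff, h, sub_self, abs_zero]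
  | modulus q j m k =>
    refine (forall_sups_eq_zero M _ _).2 (fun w => ?_) w
    rw [RFormula.eval_min]
    refine le_antisymm ?_ (le_min (RFormula.eval_nonneg _ _ _) (RFormula.eval_nonneg _ _ _))
    -- Either a closeness condition fails and the minimum is 0, or all arguments lie in their pieces
    -- and are close there, so that the modulus of P applies.
    by_cases h : ∃ l, (closeFormula O j m (q.2.1 l) (2 * (l : Fin (L.ar q.1)))).eval M w = 0
    · obtain ⟨l, hl⟩ := h
      exact (min_le_right _ _).trans
        ((RFormula.mins_le (List.mem_ofFn.2 ⟨l, rfl⟩) w).trans hl.le)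
    · have h : ∀ l, 0 < (closeFormula O j m (q.2.1 l) (2 * (l : Fin (L.ar q.1)))).eval M w :=
        fun l => (RFormula.eval_nonneg _ _ _).lt_of_ne fun h0 => h ⟨l, h0.symm⟩
      have hc : ∀ l : Fin (L.ar q.1), hgt M (w PUnit.unit (2 * l)) = (1 / 2) ^ q.2.1 l ∧
          hgt M (w PUnit.unit (2 * l + 1)) = (1 / 2) ^ q.2.1 l ∧
          2 ^ q.2.1 l * dist (α := Pts M) (w PUnit.unit (2 * l)) (w PUnit.unit (2 * l + 1)) ≤
            (Set.projIcc (0 : ℝ) 1 zero_le_one ((j : ℝ) / 2 ^ m) : ℝ) := fun l => by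
        have hl := h l
        rw [closeFormula, RFormula.eval_min, RFormula.eval_min, lt_min_iff, lt_min_iff] at hl
        obtain ⟨⟨h1, h2⟩, h3⟩ := hl
        simp only [RFormula.eval, eval_heightDiff, RFormula.eval_halfPow, lt_max_iff,
          lt_irrefl, or_false, sub_pos] at h1 h2
        have h1' := hM.hgt_eq_of_close h1
        have h2' := hM.hgt_eq_of_close h2
        refine ⟨h1', h2', ?_⟩
        rw [coe_projIcc_dyadic]
        -- If j ≥ 2^m, the clamped bound is 1. It holds for all pairs of points of O_n, and
        -- `closeFormula` does not test their distance.
        split_ifs at h3 with hj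
        · rw [hj]
          push_cast
          rw [div_self (by positivity)]
          have hd := hM.diam (w PUnit.unit (2 * l)) (w PUnit.unit (2 * l + 1))
          rw [h1', h2', max_self] at hd
          calc _ ≤ (2 : ℝ) ^ q.2.1 l * ((1 / 2) ^ q.2.1 l * 1) :=
                mul_le_mul_of_nonneg_left (by rwa [mul_one]) (by positivity)
            _ = 1 := two_pow_mul_half_pow _ _
        · have hj' : min j (2 ^ m) = j := min_eq_left (by
            by_contra hcon
            exact hj (min_eq_right (by omega)))
          rw [hj']
          simp only [RFormula.eval, RFormula.eval_dyadic, eval_unionDist, lt_max_iff,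
            lt_irrefl, or_false, sub_pos] at h3
          have h4 := h3.le.trans (min_le_right _ _)
          calc _ ≤ (2 : ℝ) ^ q.2.1 l * ((j : ℝ) / 2 ^ (m + q.2.1 l)) :=
                mul_le_mul_of_nonneg_left h4 (by positivity)
            _ = _ := by rw [pow_add]; field_simp
      refine (min_le_left _ _).trans ?_
      simp only [RFormula.eval, RFormula.eval_absDiff, RFormula.eval_dyadic, eval_extFormula]
      refine max_le (sub_nonpos.2 (le_min
        (abs_sub_le_one (ext_mem _ _ _) (ext_mem _ _ _)) ?_)) le_rfl
      refine (hM.modulus q.2.2 _ _ _ (fun l => (hc l).1) (fun l => (hc l).2.1)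
        fun l => (hc l).2.2).trans ?_
      -- The approximation may lie below the modulus by 2^-k. The summand 1 in the numerator of the
      -- axiom makes up for it.
      have h5 := (abs_le.1 (hap q.1 j m k)).1
      push_cast
      rw [add_div]
      linarith

/-- The closeness test is a strict inequality, so δ has to be approached by dyadics that exceed it
strictly; hence the floor plus one. -/
theorem tendsto_projIcc_dyadic (δ : unitInterval) : Filter.Tendsto
    (fun m : ℕ => Set.projIcc (0 : ℝ) 1 zero_le_one
      (((⌊(2 : ℝ) ^ m * δ⌋₊ + 1 : ℕ) : ℝ) / 2 ^ m)) Filter.atTop (nhds δ) := by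
  have h1 : Filter.Tendsto (fun m : ℕ => ((⌊(2 : ℝ) ^ m * δ⌋₊ + 1 : ℕ) : ℝ) / 2 ^ m)
      Filter.atTop (nhds (δ : ℝ)) := by
    have h2 : Filter.Tendsto (fun m : ℕ => (δ : ℝ) + (1 / 2) ^ m) Filter.atTop (nhds (δ : ℝ)) := by
      simpa using (tendsto_pow_atTop_nhds_zero_of_lt_one (by norm_num : (0 : ℝ) ≤ 1 / 2)
        (by norm_num)).const_add (δ : ℝ)
    refine tendsto_of_tendsto_of_tendsto_of_le_of_le tendsto_const_nhds h2 (fun m => ?_)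
      fun m => ?_
    · have := (Nat.lt_floor_add_one ((2 : ℝ) ^ m * δ)).le
      simp only
      rw [le_div_iff₀ (by positivity)]
      push_cast
      linarith
    · have := Nat.floor_le (mul_nonneg (by positivity : (0 : ℝ) ≤ 2 ^ m) δ.2.1)
      simp only
      rw [div_le_iff₀ (by positivity), add_mul, ← mul_pow]
      push_cast
      norm_num
      linarith
  have h2 := (continuous_projIcc (a := (0 : ℝ)) (b := 1) (h := zero_le_one)).tendsto (δ : ℝ)
  rw [Set.projIcc_val] at h2
  exact h2.comp h1

/-- Models of the axioms are disjoint unions. -/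
theorem isUnion_of_axioms (M : PreStructure.{u, v} (cmduVocab L.toVocab O))
    (hlip : ∀ x y : Pts M, |hgt M x - hgt M y| ≤ dist x y)
    (hap : ∀ p j m k, Approx (ap p j m k) k
      (L.modulus p (Set.projIcc (0 : ℝ) 1 zero_le_one ((j : ℝ) / 2 ^ m))))
    (h : ∀ φ, IsAxiom O ap φ → ∀ w : M.Val, φ.eval M w = 0) : IsUnion M := by
  have hgap : ∀ (x : Pts M) (n : ℕ), hgt M x ≤ (1 / 2) ^ (n + 1) ∨ (1 / 2) ^ n ≤ hgt M x := by
    intro x n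
    have := (forall_sups_eq_zero M _ _).1 (h _ (.gap n)) (seqVal M fun _ => x)
    simp only [RFormula.eval_min, RFormula.eval, RFormula.eval_halfPow, eval_heightFormula] at this
    by_contra! hcon
    exact (lt_min (lt_max_of_lt_left (sub_pos.2 hcon.1))
      (lt_max_of_lt_left (sub_pos.2 hcon.2))).ne' this
  refine ⟨hlip, hgap, fun n => ?_, fun x y hxy => ?_, fun x y => ?_, fun {p i} hi x k hk => ?_,
    fun {p i} hi δ x y hx hy hxy => ?_⟩
  · have h1 := h _ (.nonempty n) M.base
    by_contra! hcon
    -- The axiom only provides heights arbitrarily close to 2^-n. By the gap condition a height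
    -- within 2^-(n+2) of 2^-n equals it, so the infimum could not be 0 unless it were attained.
    have h2 : (1 / 2 : ℝ) ^ (n + 2) ≤ (nonemptyAxiom O n).eval M M.base := by
      refine RFormula.le_infs _ fun w _ => ?_
      rw [eval_heightDiff]
      by_contra! hlt
      refine hcon (w PUnit.unit 0) ?_
      obtain ⟨h3, h4⟩ := abs_lt.1 hlt
      have hp := half_pow_pos n
      have e1 : (1 / 2 : ℝ) ^ (n + 2) = (1 / 2) ^ n / 4 := by rw [pow_add]; ring
      have e2 : (1 / 2 : ℝ) ^ (n + 1) = (1 / 2) ^ n / 2 := by rw [pow_succ]; ring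
      have h5 : (1 / 2) ^ n ≤ hgt M (w PUnit.unit 0) :=
        (hgap _ n).resolve_left fun h => by linarith
      -- The upper bound comes from the gap between 2^-n and 2^-(n-1); for n = 0 it is the bound 1
      -- for all predicates.
      rcases n with _ | n
      · exact le_antisymm (by simpa using (hgt_mem M _).2) h5
      · have e3 : (1 / 2 : ℝ) ^ (n + 1) = (1 / 2) ^ n / 2 := by rw [pow_succ]; ring
        refine le_antisymm ((hgap _ n).resolve_right fun h => by linarith) h5
    have := half_pow_pos (n + 2)
    linarith
  · have := (forall_sups_eq_zero M _ _).1 (h _ .separated)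
      (seqVal M fun k => if k = 0 then x else y)
    simp only [RFormula.eval_min, RFormula.eval, RFormula.eval_absDiff, eval_heightFormula,
      eval_unionDist] at this
    by_contra! hcon
    exact (lt_min (abs_pos.2 (sub_ne_zero.2 hxy))
      (lt_max_of_lt_left (sub_pos.2 hcon))).ne' this
  · have := (forall_sups_eq_zero M _ _).1 (h _ .diam)
      (seqVal M fun k => if k = 0 then x else y)
    simp only [RFormula.eval, RFormula.eval_max, eval_heightFormula, eval_unionDist] at this
    exact sub_nonpos.1 ((le_max_left _ _).trans this.le)
  · have := (forall_sups_eq_zero M _ _).1 (h _ (.outside ⟨p, i, hi⟩))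
      (seqVal M fun l => if hl : l < L.ar p then x ⟨l, hl⟩ else x k)
    rw [RFormula.eval_min] at this
    refine le_antisymm (ext_mem M hi x).2 (not_lt.1 fun hlt => ?_)
    have hval : ∀ l : Fin (L.ar p), (if hl : (l : ℕ) < L.ar p then x ⟨l, hl⟩ else x k) = x l :=
      fun l => dif_pos l.2
    have h1 : 0 < RFormula.eval M (.sub .one (extFormula O ⟨p, i, hi⟩ fun l => l))
        (seqVal M fun l => if hl : l < L.ar p then x ⟨l, hl⟩ else x k) := by
      simp only [RFormula.eval, eval_extFormula]
      refine lt_max_of_lt_left (sub_pos.2 ?_)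
      convert hlt using 2
      exact funext hval
    have h2 : 0 < RFormula.eval M
        (.maxs (List.ofFn fun l : Fin (L.ar p) => heightDiff O (i l) l))
        (seqVal M fun l => if hl : l < L.ar p then x ⟨l, hl⟩ else x k) := by
      refine lt_of_lt_of_le ?_ (RFormula.le_maxs (List.mem_ofFn.2 ⟨k, rfl⟩ :
        heightDiff O (i k) k ∈ List.ofFn fun l : Fin (L.ar p) => heightDiff O (i l) l) _)
      rw [eval_heightDiff]
      refine abs_pos.2 (sub_ne_zero.2 ?_)
      convert hk using 2
      exact hval k
    exact (lt_min h1 h2).ne' this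
  · let z : ℕ → Pts M := fun l => if hl : l / 2 < L.ar p then
      if l % 2 = 0 then x ⟨l / 2, hl⟩ else y ⟨l / 2, hl⟩ else M.base PUnit.unit 0
    have hz0 : ∀ l : Fin (L.ar p), z (2 * l) = x l := fun l => by
      have hl : 2 * (l : ℕ) / 2 < L.ar p := by omega
      simp only [z]
      rw [dif_pos hl, if_pos (by omega)]
      congr 1
      exact Fin.ext (by simp)
    have hz1 : ∀ l : Fin (L.ar p), z (2 * l + 1) = y l := fun l => by
      have hl : (2 * (l : ℕ) + 1) / 2 < L.ar p := by omega
      simp only [z]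
      rw [dif_pos hl, if_neg (by omega)]
      congr 1
      exact Fin.ext (by simp only; omega)
    -- The error 2·2^-k consists of the error of the approximation and of the summand 1 in its
    -- numerator.
    have hle : ∀ m k : ℕ, |ext M hi x - ext M hi y| ≤
        L.modulus p (Set.projIcc (0 : ℝ) 1 zero_le_one
          (((⌊(2 : ℝ) ^ m * δ⌋₊ + 1 : ℕ) : ℝ) / 2 ^ m)) + (1 / 2) ^ k * 2 := by
      intro m k
      set j := ⌊(2 : ℝ) ^ m * δ⌋₊ + 1 with hj
      have hδj : (δ : ℝ) < j / 2 ^ m := by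
        rw [lt_div_iff₀ (by positivity), hj]
        push_cast
        linarith [Nat.lt_floor_add_one ((2 : ℝ) ^ m * δ)]
      have h1 := (forall_sups_eq_zero M _ _).1 (h _ (.modulus ⟨p, i, hi⟩ j m k)) (seqVal M z)
      rw [RFormula.eval_min] at h1
      have h2 : 0 < (RFormula.mins (List.ofFn fun l : Fin (L.ar p) =>
          closeFormula O j m (i l) (2 * l))).eval M (seqVal M z) := by
        refine RFormula.lt_mins zero_lt_one fun φ hφ => ?_
        obtain ⟨l, rfl⟩ := List.mem_ofFn.1 hφ
        rw [closeFormula, RFormula.eval_min, RFormula.eval_min, lt_min_iff, lt_min_iff]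
        have hzx : ∀ a, seqVal M z PUnit.unit a = z a := fun _ => rfl
        refine ⟨⟨?_, ?_⟩, ?_⟩
        · simp only [RFormula.eval, eval_heightDiff, RFormula.eval_halfPow]
          refine lt_max_of_lt_left (sub_pos.2 ?_)
          refine lt_of_eq_of_lt ?_ (half_pow_pos (i l + 2))
          refine (congrArg (fun u => |hgt M u - (1 / 2) ^ i l|) (hz0 l)).trans ?_
          simp [hx l]
        · simp only [RFormula.eval, eval_heightDiff, RFormula.eval_halfPow]
          refine lt_max_of_lt_left (sub_pos.2 ?_)
          refine lt_of_eq_of_lt ?_ (half_pow_pos (i l + 2))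
          refine (congrArg (fun u => |hgt M u - (1 / 2) ^ i l|) (hz1 l)).trans ?_
          simp [hy l]
        · split_ifs with hjm
          · exact zero_lt_one
          · simp only [RFormula.eval, RFormula.eval_dyadic, eval_unionDist]
            refine lt_max_of_lt_left (sub_pos.2 ?_)
            have hd : dist (α := Pts M) (seqVal M z PUnit.unit (2 * l))
                (seqVal M z PUnit.unit (2 * l + 1)) = dist (x l) (y l) :=
              congrArg₂ dist (hz0 l) (hz1 l)
            rw [hd]
            have hlt : dist (x l) (y l) < (j : ℝ) / 2 ^ (m + i l) := by
              rw [pow_add, ← div_div, lt_div_iff₀' (by positivity)]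
              exact (hxy l).trans_lt hδj
            refine lt_min (hlt.trans_le ?_) hlt
            have hj' : (j : ℝ) ≤ 2 ^ m := by
              have : j ≤ 2 ^ m := by
                by_contra hcon
                exact hjm (min_eq_right (by omega))
              exact_mod_cast this
            rw [div_le_one (by positivity)]
            exact hj'.trans (pow_le_pow_right₀ (by norm_num) (Nat.le_add_right _ _))
      have h3 : RFormula.eval M (.sub (.absDiff (extFormula O ⟨p, i, hi⟩ fun k => 2 * k)
          (extFormula O ⟨p, i, hi⟩ fun k => 2 * k + 1)) (.dyadic (ap p j m k + 1) k))
          (seqVal M z) ≤ 0 := by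
        by_contra! hcon
        exact (lt_min hcon h2).ne' h1
      simp only [RFormula.eval, RFormula.eval_absDiff, RFormula.eval_dyadic,
        eval_extFormula] at h3
      have hex : ext M hi (fun l => seqVal M z PUnit.unit (2 * l)) = ext M hi x :=
        congrArg (ext M hi) (funext hz0)
      have hey : ext M hi (fun l => seqVal M z PUnit.unit (2 * l + 1)) = ext M hi y :=
        congrArg (ext M hi) (funext hz1)
      rw [hex, hey] at h3
      have h4 := (sub_nonpos.1 ((le_max_left _ _).trans h3)).trans (min_le_right _ _)
      have h5 := (abs_le.1 (hap p j m k)).2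
      push_cast at h4 h5
      rw [one_div_pow]
      rw [add_div] at h4
      linarith
    -- The precision k tends to infinity for fixed m; afterwards m tends to infinity and continuity
    -- of the modulus at δ gives the claim.
    have h1 : ∀ m : ℕ, |ext M hi x - ext M hi y| ≤ L.modulus p (Set.projIcc (0 : ℝ) 1 zero_le_one
          (((⌊(2 : ℝ) ^ m * δ⌋₊ + 1 : ℕ) : ℝ) / 2 ^ m)) := fun m => by
      refine ge_of_tendsto' (f := fun k : ℕ => _) (x := Filter.atTop) ?_ (hle m)
      simpa using ((tendsto_pow_atTop_nhds_zero_of_lt_one (by norm_num : (0 : ℝ) ≤ 1 / 2)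
        (by norm_num)).mul_const 2).const_add _
    refine ge_of_tendsto' (x := Filter.atTop) ?_ h1
    exact (continuous_subtype_val.comp (L.modulus_continuous p)).continuousAt.tendsto.comp
      (tendsto_projIcc_dyadic δ)

/-- The sentence `diamSentence` measures the diameter of `O 0`. -/
theorem le_diamSentence_iff {M : PreStructure.{u, v} (cmduVocab L.toVocab O)}
    (A : LStructure.{u, v} L) (e : Pts M ≃ᵢ Cmdu A.toPreStructure O)
    (he : ∀ x, hgt M x = Cmdu.height _ O (e x)) (w : M.Val) (r : ℝ) :
    r ≤ (diamSentence O).eval M w ↔ InClass (O 0) r A := by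
  have hev : ∀ w : M.Val, RFormula.eval M (.sub (unionDist O 0 1)
      (RFormula.double^[2] (.plus (heightDiff O 0 0) (heightDiff O 0 1)))) w =
      max (dist (e (w PUnit.unit 0)) (e (w PUnit.unit 1)) - min 1 (2 ^ 2 * min 1
        (|Cmdu.height _ O (e (w PUnit.unit 0)) - 1| +
          |Cmdu.height _ O (e (w PUnit.unit 1)) - 1|))) 0 := fun w => by
    simp only [RFormula.eval, RFormula.eval_double_iterate, RFormula.eval_plus, eval_heightDiff,
      eval_unionDist, he, pow_zero]
    rw [e.dist_eq]
  have hb : Bornology.IsBounded (Set.univ : Set (A.sort (O 0))) :=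
    Metric.isBounded_iff.2 ⟨1, fun x _ y _ => MSort.dist_le_one _ _ _⟩
  -- Outside of O_0 the height is at most 1/2. Four times its deviation from 1 then reaches the
  -- truncation at 1 and cancels any distance, so that only pairs in O_0, whose metric is not
  -- rescaled, contribute to the supremum.
  have hfar : ∀ x : Cmdu A.toPreStructure O, (∃ a, x = .pt 0 a) ∨
      1 / 2 ≤ |Cmdu.height _ O x - 1| := fun x => by
    rcases x with _ | ⟨n, a⟩
    · right; simp [Cmdu.height]; norm_num
    · rcases n with _ | n
      · exact Or.inl ⟨a, rfl⟩
      · right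
        have := half_pow_le_half_pow (show 1 ≤ n + 1 by omega)
        simp only [Cmdu.height]
        rw [abs_sub_comm]
        refine le_trans ?_ (le_abs_self _)
        rw [pow_one] at this
        linarith
  have heq : (diamSentence O).eval M w = Metric.diam (Set.univ : Set (A.sort (O 0))) := by
    refine le_antisymm (RFormula.sups_le _ fun w _ => ?_) ?_
    · rw [hev]
      refine max_le ?_ Metric.diam_nonneg
      have h1 := Cmdu.dist_le_one _ O (e (w PUnit.unit 0)) (e (w PUnit.unit 1))
      have far : 1 / 2 ≤ |Cmdu.height _ O (e (w PUnit.unit 0)) - 1| +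
          |Cmdu.height _ O (e (w PUnit.unit 1)) - 1| →
          dist (e (w PUnit.unit 0)) (e (w PUnit.unit 1)) - min 1 (2 ^ 2 * min 1
        (|Cmdu.height _ O (e (w PUnit.unit 0)) - 1| +
          |Cmdu.height _ O (e (w PUnit.unit 1)) - 1|)) ≤
            Metric.diam (Set.univ : Set (A.sort (O 0))) := fun hle => by
        rw [min_eq_left (b := 2 ^ 2 * min 1 _)]
        · linarith [Metric.diam_nonneg (s := (Set.univ : Set (A.sort (O 0))))]
        · have : (1 : ℝ) / 2 ≤ min 1 (|Cmdu.height _ O (e (w PUnit.unit 0)) - 1| +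
            |Cmdu.height _ O (e (w PUnit.unit 1)) - 1|) := le_min (by norm_num) hle
          linarith
      rcases hfar (e (w PUnit.unit 0)) with ⟨a, ha⟩ | h
      · rcases hfar (e (w PUnit.unit 1)) with ⟨b, hb'⟩ | h
        · rw [ha, hb', Cmdu.dist_pt, pow_zero, one_mul]
          refine le_trans (sub_le_self _ (le_min zero_le_one (by positivity))) ?_
          exact Metric.dist_le_diam_of_mem hb trivial trivial
        · exact far (h.trans (le_add_of_nonneg_left (abs_nonneg _)))
      · exact far (h.trans (le_add_of_nonneg_right (abs_nonneg _)))
    · refine Metric.diam_le_of_forall_dist_le (RFormula.eval_nonneg _ _ _) fun a _ b _ => ?_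
      have h1 := RFormula.le_sups (A := M) (l := unionVars O 2) (.sub (unionDist O 0 1)
        (RFormula.double^[2] (.plus (heightDiff O 0 0) (heightDiff O 0 1)))) (w := w)
        (w' := fun _ k => if k = 0 then e.symm (.pt 0 a) else if k = 1 then e.symm (.pt 0 b)
          else w PUnit.unit k) fun s k hk => by
            have h0 : k ≠ 0 := by rintro rfl; exact hk (mem_unionVars O Nat.zero_lt_two)
            have h1 : k ≠ 1 := by rintro rfl; exact hk (mem_unionVars O Nat.one_lt_two)
            exact (if_neg h0).trans (if_neg h1)
      refine le_trans ?_ ((hev _).symm.le.trans h1)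
      simp only [if_true, one_ne_zero, if_false, e.apply_symm_apply, Cmdu.dist_pt, Cmdu.height]
      simp
  rw [heq]
  rfl

/-- The trivial condition 0 is admitted among the members of `T` because a computable enumeration of
the axioms emits it at indices that code none of them. -/
theorem axiomatizes (hO : Function.Injective O) {H : L.Sorts} (hH : O 0 = H)
    (hap : ∀ p j m k, Approx (ap p j m k) k
      (L.modulus p (Set.projIcc (0 : ℝ) 1 zero_le_one ((j : ℝ) / 2 ^ m))))
    {T : Set (Formula (cmduVocab L.toVocab O))}
    (hT : ∀ φ ∈ T, ∃ ψ : RFormula _, φ = ψ.toFormula ∧ (ψ = .zero ∨ IsAxiom O ap ψ))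
    (hT' : ∀ ψ, IsAxiom O ap ψ → ψ.toFormula ∈ T) :
    Axiomatizes.{u, v} H O T (diamSentence O).toFormula := by
  subst hH
  refine ⟨fun φ hφ n => ?_, fun n => (free_diamSentence O).subset, fun r hr _ M => ?_⟩
  · obtain ⟨ψ, rfl, rfl | h⟩ := hT φ hφ
    · exact subset_rfl
    · exact (IsAxiom.free_eq O h).subset
  · have hmod : Models M.toPreStructure T ↔ IsUnion (L := L) (O := O) M.toPreStructure := by
      constructor
      · intro h
        refine isUnion_of_axioms _ (abs_hgt_sub_le M) hap fun φ hφ w => ?_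
        exact (RFormula.eval_toFormula (V := cmduVocab L.toVocab O) M.toPreStructure φ w).symm.trans
          (h _ (hT' φ hφ) w)
      · intro h φ hφ w
        obtain ⟨ψ, rfl, rfl | h'⟩ := hT φ hφ
        · exact RFormula.eval_toFormula _ _ _
        · exact (RFormula.eval_toFormula _ _ _).trans (h.eval_eq_zero hap h' w)
    have hiso : ∀ A : LStructure.{u, v} L, Isomorphic M.toPreStructure (cmdu A.toPreStructure O) →
        ∀ w : M.Val, r ≤ Formula.eval M.toPreStructure (diamSentence O).toFormula w ↔
          InClass (O 0) r A := by
      rintro A ⟨e, he⟩ w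
      have h1 := le_diamSentence_iff (M := M.toPreStructure) A (e PUnit.unit)
        (fun x => (he none fun _ => x).symm.trans (Cmdu.dist_star (A := A.toPreStructure) _)) w r
      rw [← h1]
      exact (RFormula.eval_toFormula M.toPreStructure (diamSentence O) w) ▸ Iff.rfl
    have hmod' := hmod.trans (isUnion_iff hO _)
    constructor
    · rintro ⟨h0, h⟩
      obtain ⟨A, hA⟩ := hmod'.1 h0
      exact ⟨A, (hiso A hA M.base).1 (h M.base), hA⟩
    · rintro ⟨A, hA, hi⟩
      exact ⟨hmod'.2 ⟨A, hi⟩, fun w => (hiso A hi w).2 hA⟩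

end semantics

/-- The diameter sentence and the axioms, for arbitrary moduli. -/
theorem exists_axiomatizes {L : MetricSignature.{v}} {O : ℕ → L.Sorts} (hO : Function.Injective O)
    {H : L.Sorts} (hH : O 0 = H) : ∃ T Ξ, Axiomatizes.{u, v} H O T Ξ := by
  -- In the absence of a name, rounding down supplies the approximations of the moduli.
  have hap : ∀ x : ℝ, 0 ≤ x → ∀ k, Approx ⌊x * 2 ^ k⌋₊ k x := fun x hx k => by
    unfold Approx
    have h1 := Nat.floor_le (mul_nonneg hx (by positivity : (0 : ℝ) ≤ 2 ^ k))
    have h2 := (Nat.lt_floor_add_one (x * 2 ^ k)).le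
    have hk : (0 : ℝ) < 2 ^ k := by positivity
    have h3 : (⌊x * 2 ^ k⌋₊ : ℝ) / 2 ^ k - x = ((⌊x * 2 ^ k⌋₊ : ℝ) - x * 2 ^ k) / 2 ^ k := by
      field_simp
    rw [h3, abs_div, abs_of_pos hk]
    refine div_le_div_of_nonneg_right (abs_le.2 ⟨by linarith, by linarith⟩) hk.le
  exact ⟨{φ | ∃ ψ, φ = RFormula.toFormula ψ ∧ IsAxiom O (fun p j m k =>
      ⌊(L.modulus p (Set.projIcc (0 : ℝ) 1 zero_le_one ((j : ℝ) / 2 ^ m)) : ℝ) * 2 ^ k⌋₊) ψ}, _,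
    axiomatizes hO hH (fun p j m k => hap _ (L.modulus p _).2.1 k)
      (fun φ ⟨ψ, h1, h2⟩ => ⟨ψ, h1, Or.inr h2⟩) fun ψ hψ => ⟨ψ, rfl, hψ⟩⟩

/-! ## Names of the theory of disjoint unions -/

/-- A list of the values of a function on `Fin n`. -/
theorem ofFn_eq_map_range {α : Type*} {n : ℕ} (f : Fin n → α) (g : ℕ → α) (h : ∀ k, f k = g k) :
    List.ofFn f = (List.range n).map g :=
  List.ext_getElem (by simp) fun k h1 h2 => by simp [h]

theorem getD_ofFn {n : ℕ} (i : Fin n → ℕ) (k : Fin n) : (List.ofFn i).getD k 0 = i k := by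
  simp [List.getD_eq_getElem?_getD]

namespace Code

/-- Codes of the first `n` variables of the disjoint union. -/
def unionVars (n : ℕ) : List (ℕ × ℕ) := (List.range n).map fun k => (0, k)

/-- Code of `gapAxiom`. -/
def gapAxiom (n : ℕ) : ℕ :=
  sups (unionVars 1) (min (sub (height 0) (halfPow (n + 1))) (sub (halfPow n) (height 0)))

/-- Code of `nonemptyAxiom`. -/
def nonemptyAxiom (n : ℕ) : ℕ := infs (unionVars 1) (heightDiff n 0)

/-- Code of `separatedAxiom`. -/
def separatedAxiom : ℕ :=
  sups (unionVars 2) (min (absDiff (height 0) (height 1))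
    (sub (dist 0 0 1) (absDiff (height 0) (height 1))))

/-- Code of `diamAxiom`. -/
def diamAxiom : ℕ := sups (unionVars 2) (sub (dist 0 0 1) (max (height 0) (height 1)))

/-- Code of `outsideAxiom`; `c + 1` is the code of the predicate symbol. -/
def outsideAxiom (c : ℕ) : ℕ :=
  sups (unionVars (listOf c.unpair.2).length)
    (min (sub one (pred (c + 1) ((List.range (listOf c.unpair.2).length).map fun k => k)))
      (maxs ((List.range (listOf c.unpair.2).length).map fun k =>
        heightDiff ((listOf c.unpair.2).getD k 0) k)))

/-- Code of `closeFormula`. -/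
def closeFormula (j m n a : ℕ) : ℕ :=
  min (min (sub (halfPow (n + 2)) (heightDiff n a)) (sub (halfPow (n + 2)) (heightDiff n (a + 1))))
    (if Min.min j (2 ^ m) = 2 ^ m then one else sub (dyadic j (m + n)) (dist 0 a (a + 1)))

/-- Code of `modulusAxiom`; `c + 1` is the code of the predicate symbol. -/
def modulusAxiom (c j m b k : ℕ) : ℕ :=
  sups (unionVars (2 * (listOf c.unpair.2).length))
    (min (sub (absDiff
        (pred (c + 1) ((List.range (listOf c.unpair.2).length).map fun k => 2 * k))
        (pred (c + 1) ((List.range (listOf c.unpair.2).length).map fun k => 2 * k + 1)))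
      (dyadic b k))
    (mins ((List.range (listOf c.unpair.2).length).map fun l =>
      closeFormula j m ((listOf c.unpair.2).getD l 0) (2 * l))))

end Code

/-! ### The axioms and their codes -/

section code

variable {V : Vocab.{v}} (ν : Numbering V) (O : ℕ → V.Sorts)

/-- The code of an extended predicate symbol. -/
def ExtSymbol.code {O : ℕ → V.Sorts} (q : ExtSymbol V O) : ℕ :=
  Nat.pair (ν.predCode q.1) (tupleCode q.2.1)

theorem ExtSymbol.code_injective : Function.Injective (ExtSymbol.code ν (O := O)) := fun q q' h =>
  Option.some_injective _ ((ν.cmdu O).predCode_injective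
    (show ExtSymbol.code ν q + 1 = ExtSymbol.code ν q' + 1 by rw [h]))

theorem code_unionVars (n : ℕ) :
    (unionVars O n).map (fun x => ((ν.cmdu O).sortCode x.1, x.2)) = Code.unionVars n := by
  simp only [unionVars, Code.unionVars, List.map_map]
  rfl

theorem code_extFormula (q : ExtSymbol V O) (f : Fin (V.ar q.1) → ℕ) :
    (extFormula O q f).code (ν.cmdu O) = Code.pred (q.code ν + 1) (List.ofFn f) := rfl

theorem code_unionDist (i j : ℕ) : (unionDist O i j).code (ν.cmdu O) = Code.dist 0 i j := rfl

theorem code_gapAxiom (n : ℕ) : (gapAxiom O n).code (ν.cmdu O) = Code.gapAxiom n := by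
  simp [gapAxiom, Code.gapAxiom, code_unionVars]

theorem code_nonemptyAxiom (n : ℕ) :
    (nonemptyAxiom O n).code (ν.cmdu O) = Code.nonemptyAxiom n := by
  simp [nonemptyAxiom, Code.nonemptyAxiom, code_unionVars]

theorem code_separatedAxiom : (separatedAxiom O).code (ν.cmdu O) = Code.separatedAxiom := by
  simp [separatedAxiom, Code.separatedAxiom, code_unionVars, code_unionDist]

theorem code_diamAxiom : (diamAxiom O).code (ν.cmdu O) = Code.diamAxiom := by
  simp [diamAxiom, Code.diamAxiom, code_unionVars, code_unionDist]

theorem listOf_code (q : ExtSymbol V O) : listOf (q.code ν).unpair.2 = List.ofFn q.2.1 := by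
  simp [ExtSymbol.code]

theorem code_outsideAxiom (q : ExtSymbol V O) :
    (outsideAxiom O q).code (ν.cmdu O) = Code.outsideAxiom (q.code ν) := by
  simp only [outsideAxiom, Code.outsideAxiom, RFormula.code_sups, code_unionVars,
    RFormula.code_min, RFormula.code_sub, RFormula.code_one, code_extFormula, RFormula.code_maxs,
    listOf_code, List.length_ofFn, List.map_ofFn]
  have h1 := ofFn_eq_map_range (fun k : Fin (V.ar q.1) => (k : ℕ)) (fun k => k) fun _ => rfl
  have h2 := ofFn_eq_map_range
    (RFormula.code (ν.cmdu O) ∘ fun k : Fin (V.ar q.1) => heightDiff O (q.2.1 k) k)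
    (fun k => Code.heightDiff ((List.ofFn q.2.1).getD k 0) k) fun k => by
      rw [getD_ofFn, Function.comp_apply, code_heightDiff]
  rw [h1, h2]

theorem code_closeFormula (j m n a : ℕ) :
    (closeFormula O j m n a).code (ν.cmdu O) = Code.closeFormula j m n a := by
  unfold closeFormula Code.closeFormula
  split_ifs <;> simp [code_unionDist]

theorem code_modulusAxiom (q : ExtSymbol V O) (j m b k : ℕ) :
    (modulusAxiom O q j m b k).code (ν.cmdu O) = Code.modulusAxiom (q.code ν) j m b k := by
  simp only [modulusAxiom, Code.modulusAxiom, RFormula.code_sups, code_unionVars,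
    RFormula.code_min, RFormula.code_sub, RFormula.code_absDiff, code_extFormula,
    RFormula.code_mins, RFormula.code_dyadic, listOf_code, List.length_ofFn, List.map_ofFn]
  have h1 := ofFn_eq_map_range (fun k : Fin (V.ar q.1) => 2 * (k : ℕ)) (fun k => 2 * k) fun _ => rfl
  have h2 := ofFn_eq_map_range (fun k : Fin (V.ar q.1) => 2 * (k : ℕ) + 1) (fun k => 2 * k + 1)
    fun _ => rfl
  have h3 := ofFn_eq_map_range
    (RFormula.code (ν.cmdu O) ∘ fun l : Fin (V.ar q.1) => closeFormula O j m (q.2.1 l) (2 * l))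
    (fun l => Code.closeFormula j m ((List.ofFn q.2.1).getD l 0) (2 * l)) fun l =>
      (code_closeFormula ν O j m (q.2.1 l) (2 * l)).trans
        (congrArg (fun n => Code.closeFormula j m n (2 * l)) (getD_ofFn q.2.1 l).symm)
  rw [h1, h2, h3]

open Classical in
/-- The extended predicate symbol with a given code. -/
noncomputable def symbolAt (c : ℕ) : Option (ExtSymbol V O) :=
  if h : ∃ q : ExtSymbol V O, q.code ν = c then some h.choose else none

theorem symbolAt_code (q : ExtSymbol V O) : symbolAt ν O (q.code ν) = some q := by
  have h : ∃ q' : ExtSymbol V O, q'.code ν = q.code ν := ⟨q, rfl⟩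
  rw [symbolAt, dif_pos h]
  exact congrArg some (ExtSymbol.code_injective ν O h.choose_spec)

theorem symbolAt_of_not {c : ℕ} (h : ¬∃ q : ExtSymbol V O, q.code ν = c) :
    symbolAt ν O c = none := dif_neg h

/-- A sequence that consists of the axioms of the theory of disjoint unions. -/
noncomputable def axiomSeq (ap : ℕ → ℕ) (i : ℕ) : RFormula (cmduVocab V O) :=
  match i.unpair.1 with
  | 0 => gapAxiom O i.unpair.2
  | 1 => nonemptyAxiom O i.unpair.2
  | 2 => separatedAxiom O
  | 3 => diamAxiom O
  | 4 => (symbolAt ν O i.unpair.2).elim .zero fun q => outsideAxiom O q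
  | _ => (symbolAt ν O i.unpair.2.unpair.1).elim .zero fun q =>
    modulusAxiom O q i.unpair.2.unpair.2.unpair.1 i.unpair.2.unpair.2.unpair.2.unpair.1
      (ap (Nat.pair (ν.predCode q.1) i.unpair.2.unpair.2) + 1)
      i.unpair.2.unpair.2.unpair.2.unpair.2

end code

/-- The code of `axiomSeq`, in terms of a name of the signature and the sequence of sorts. -/
def axiomCode (h : ℕ → ℕ) (i : ℕ) : ℕ :=
  if i.unpair.1 = 0 then Code.gapAxiom i.unpair.2
  else if i.unpair.1 = 1 then Code.nonemptyAxiom i.unpair.2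
  else if i.unpair.1 = 2 then Code.separatedAxiom
  else if i.unpair.1 = 3 then Code.diamAxiom
  else if i.unpair.1 = 4 then
    if isExt h i.unpair.2 = 1 then Code.outsideAxiom i.unpair.2 else Code.zero
  else
    if isExt h i.unpair.2.unpair.1 = 1 then
      Code.modulusAxiom i.unpair.2.unpair.1 i.unpair.2.unpair.2.unpair.1
        i.unpair.2.unpair.2.unpair.2.unpair.1
        (sigModulus h (Nat.pair i.unpair.2.unpair.1.unpair.1 i.unpair.2.unpair.2) + 1)
        i.unpair.2.unpair.2.unpair.2.unpair.2
    else Code.zero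

/-- The formulas select symbols by choice while the codes rely on `isExt`. Both make the same case
distinction, as `isExt` decides which numbers are codes of extended symbols. -/
theorem code_axiomSeq {D : Setting.{v}} {h : ℕ → ℕ} (hD : D.SeqName h) (i : ℕ) :
    (axiomSeq D.ν D.seq (sigModulus h) i).code (D.ν.cmdu D.seq) = axiomCode h i := by
  have hs : ∀ c, isExt h c ≠ 1 → symbolAt D.ν D.seq c = none := fun c hc =>
    symbolAt_of_not _ _ fun ⟨q, hq⟩ => hc (hq ▸ hD.isExt_of q)
  have hs' : ∀ c, isExt h c = 1 → ∃ q : ExtSymbol D.L.toVocab D.seq, c = q.code D.ν := fun c hc =>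
    (hD.isExt_cases c).resolve_left (by omega)
  unfold axiomSeq axiomCode
  generalize i.unpair.1 = a
  rcases a with _ | _ | _ | _ | _ | a
  · exact code_gapAxiom _ _ _
  · exact code_nonemptyAxiom _ _ _
  · exact code_separatedAxiom _ _
  · exact code_diamAxiom _ _
  · change RFormula.code _ ((symbolAt D.ν D.seq i.unpair.2).elim .zero _) =
      if isExt h i.unpair.2 = 1 then Code.outsideAxiom i.unpair.2 else Code.zero
    split_ifs with h1
    · obtain ⟨q, hq⟩ := hs' _ h1
      rw [hq, symbolAt_code]
      exact code_outsideAxiom _ _ q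
    · rw [hs _ h1]
      rfl
  · change RFormula.code _ ((symbolAt D.ν D.seq i.unpair.2.unpair.1).elim .zero _) =
      if isExt h i.unpair.2.unpair.1 = 1 then _ else Code.zero
    split_ifs with h1
    · obtain ⟨q, hq⟩ := hs' _ h1
      rw [hq, symbolAt_code]
      refine (code_modulusAxiom _ _ q _ _ _ _).trans ?_
      simp [ExtSymbol.code]
    · rw [hs _ h1]
      rfl

theorem axiomSeq_isAxiom {D : Setting.{v}} {h : ℕ → ℕ} (i : ℕ) :
    axiomSeq D.ν D.seq (sigModulus h) i = .zero ∨ IsAxiom D.seq (fun p j m k =>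
      sigModulus h (Nat.pair (D.ν.predCode p) (Nat.pair j (Nat.pair m k))))
        (axiomSeq D.ν D.seq (sigModulus h) i) := by
  unfold axiomSeq
  generalize i.unpair.1 = a
  rcases a with _ | _ | _ | _ | _ | a
  · exact .inr (.gap _)
  · exact .inr (.nonempty _)
  · exact .inr .separated
  · exact .inr .diam
  · rcases symbolAt D.ν D.seq i.unpair.2 with _ | q
    · exact .inl rfl
    · exact .inr (.outside q)
  · rcases symbolAt D.ν D.seq i.unpair.2.unpair.1 with _ | q
    · exact .inl rfl
    · refine .inr ?_
      have := IsAxiom.modulus (O := D.seq) (ap := fun p j m k =>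
        sigModulus h (Nat.pair (D.ν.predCode p) (Nat.pair j (Nat.pair m k)))) q
        i.unpair.2.unpair.2.unpair.1 i.unpair.2.unpair.2.unpair.2.unpair.1
        i.unpair.2.unpair.2.unpair.2.unpair.2
      simp only [Nat.pair_unpair] at this
      exact this

theorem exists_axiomSeq_eq {D : Setting.{v}} {h : ℕ → ℕ}
    {φ : RFormula (cmduVocab D.L.toVocab D.seq)} (hφ : IsAxiom D.seq (fun p j m k =>
      sigModulus h (Nat.pair (D.ν.predCode p) (Nat.pair j (Nat.pair m k)))) φ) :
    ∃ i, axiomSeq D.ν D.seq (sigModulus h) i = φ := by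
  cases hφ with
  | gap n => exact ⟨Nat.pair 0 n, by simp [axiomSeq]⟩
  | nonempty n => exact ⟨Nat.pair 1 n, by simp [axiomSeq]⟩
  | separated => exact ⟨Nat.pair 2 0, by simp [axiomSeq]⟩
  | diam => exact ⟨Nat.pair 3 0, by simp [axiomSeq]⟩
  | outside q => exact ⟨Nat.pair 4 (q.code D.ν), by simp [axiomSeq, symbolAt_code]⟩
  | modulus q j m k =>
    exact ⟨Nat.pair 5 (Nat.pair (q.code D.ν) (Nat.pair j (Nat.pair m k))), by
      simp [axiomSeq, symbolAt_code]⟩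

/-! ### Recursiveness of the enumeration of axioms -/

namespace RelRec

variable {α : Type} [Primcodable α] {f g k l b : (ℕ → ℕ) → α → ℕ}

theorem list_range (hf : RelRec f) : RelRec fun h a => List.range (f h a) :=
  comp₁ Primrec.list_range hf

theorem list_length {x : (ℕ → ℕ) → α → List ℕ} (hx : RelRec x) :
    RelRec fun h a => (x h a).length := comp₁ Primrec.list_length hx

theorem list_getD {x : (ℕ → ℕ) → α → List ℕ} (hx : RelRec x) (hf : RelRec f) :
    RelRec fun h a => (x h a).getD (f h a) 0 :=
  comp₂ (f := fun (l : List ℕ) n => l.getD n 0) (Primrec.list_getD 0) hx hf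

theorem codeUnionVars (hf : RelRec f) : RelRec fun h a => Code.unionVars (f h a) :=
  hf.list_range.list_map ((RelRec.const 0).pair .snd)

theorem codeCloseFormula (hf : RelRec f) (hg : RelRec g) (hk : RelRec k) (hl : RelRec l) :
    RelRec fun h a => Code.closeFormula (f h a) (g h a) (k h a) (l h a) :=
  (((hk.add (.const 2)).codeHalfPow.codeSub (hk.codeHeightDiff hl)).codeMin
    ((hk.add (.const 2)).codeHalfPow.codeSub (hk.codeHeightDiff (hl.add (.const 1))))).codeMin
    (ite_eq (hf.min hg.two_pow) hg.two_pow (.const _)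
      ((hf.codeDyadic (hg.add hk)).codeSub ((RelRec.const 0).codeDist hl (hl.add (.const 1)))))

theorem codeOutsideAxiom (hf : RelRec f) : RelRec fun h a => Code.outsideAxiom (f h a) := by
  have hl : RelRec fun h a => MetricLogic.listOf (f h a).unpair.2 := hf.unpair_snd.listOf
  have hr : RelRec fun h a => List.range (MetricLogic.listOf (f h a).unpair.2).length :=
    hl.list_length.list_range
  have h1 : RelRec fun h a =>
      (List.range (MetricLogic.listOf (f h a).unpair.2).length).map fun k => k :=
    list_map (f := fun _ _ k => k) hr .snd
  have h2 : RelRec fun h a => (List.range (MetricLogic.listOf (f h a).unpair.2).length).map fun k =>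
      Code.heightDiff ((MetricLogic.listOf (f h a).unpair.2).getD k 0) k :=
    list_map
      (f := fun h a k => Code.heightDiff ((MetricLogic.listOf (f h a).unpair.2).getD k 0) k) hr
      (((hl.comp .fst).list_getD .snd).codeHeightDiff .snd)
  exact hl.list_length.codeUnionVars.codeSups (((RelRec.const _).codeSub
    ((hf.add (.const 1)).codePred h1)).codeMin h2.codeMaxs)

theorem codeModulusAxiom (hf : RelRec f) (hg : RelRec g) (hk : RelRec k) (hl : RelRec l)
    (hb : RelRec b) :
    RelRec fun h a => Code.modulusAxiom (f h a) (g h a) (k h a) (l h a) (b h a) := by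
  have hx : RelRec fun h a => MetricLogic.listOf (f h a).unpair.2 := hf.unpair_snd.listOf
  have hr : RelRec fun h a => List.range (MetricLogic.listOf (f h a).unpair.2).length :=
    hx.list_length.list_range
  have hs : RelRec fun _ (q : α × ℕ) => 2 * q.2 := (RelRec.const 2).mul .snd
  have h1 : RelRec fun h a =>
      (List.range (MetricLogic.listOf (f h a).unpair.2).length).map fun k => 2 * k :=
    list_map (f := fun _ _ k => 2 * k) hr hs
  have h2 : RelRec fun h a =>
      (List.range (MetricLogic.listOf (f h a).unpair.2).length).map fun k => 2 * k + 1 :=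
    list_map (f := fun _ _ k => 2 * k + 1) hr (hs.add (.const 1))
  have h3 : RelRec fun h a => (List.range (MetricLogic.listOf (f h a).unpair.2).length).map fun n =>
      Code.closeFormula (g h a) (k h a) ((MetricLogic.listOf (f h a).unpair.2).getD n 0) (2 * n) :=
    list_map (f := fun h a n =>
      Code.closeFormula (g h a) (k h a) ((MetricLogic.listOf (f h a).unpair.2).getD n 0) (2 * n)) hr
      ((hg.comp .fst).codeCloseFormula (hk.comp .fst) ((hx.comp .fst).list_getD .snd) hs)
  exact ((RelRec.const 2).mul hx.list_length).codeUnionVars.codeSups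
    (((((hf.add (.const 1)).codePred h1).codeAbsDiff
      ((hf.add (.const 1)).codePred h2)).codeSub (hl.codeDyadic hb)).codeMin h3.codeMins)

theorem axiomCode : RelRec MetricLogic.axiomCode := by
  have hi : RelRec fun _ (i : ℕ) => i := .id
  have h2 := hi.unpair_snd
  have h22 := h2.unpair_snd
  refine ite_eq hi.unpair_fst (.const 0)
    ((RelRec.const _).codeSups ((RelRec.codeSub (.const _) (h2.add (.const 1)).codeHalfPow).codeMin
      (h2.codeHalfPow.codeSub (.const _))))
    (ite_eq hi.unpair_fst (.const 1) ((RelRec.const _).codeInfs (h2.codeHeightDiff (.const 0)))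
    (ite_eq hi.unpair_fst (.const 2) (.const _) (ite_eq hi.unpair_fst (.const 3) (.const _)
    (ite_eq hi.unpair_fst (.const 4) (ite_eq h2.isExt (.const 1) h2.codeOutsideAxiom (.const _))
    (ite_eq h2.unpair_fst.isExt (.const 1)
      (h2.unpair_fst.codeModulusAxiom h22.unpair_fst h22.unpair_snd.unpair_fst
        ((h2.unpair_fst.unpair_fst.natPair h22).sigModulus.add (.const 1))
        h22.unpair_snd.unpair_snd) (.const _))))))

end RelRec

theorem uniformlyComputable_theory : UniformlyComputable (ι := Setting.{v})
      (fun D h => Function.Injective D.seq ∧ D.seq 0 = D.home ∧ D.SeqName h)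
      (fun D g => ∃ (T : ℕ → Formula (cmduVocab D.L.toVocab D.seq))
        (Ξ : Formula (cmduVocab D.L.toVocab D.seq)),
        Axiomatizes.{u, v} D.home D.seq (Set.range T) Ξ ∧
        ∀ i, (T i).HasName (D.ν.cmdu D.seq) (comp i g)) := by
  -- A restricted formula is regarded as a constant sequence, so the value depends on the number of
  -- the axiom only.
  refine .of_relRec (f := fun h n => axiomCode h n.unpair.1)
    (RelRec.axiomCode.comp RelRec.id.unpair_fst) fun D h ⟨hO, hH, hD⟩ =>
      ⟨fun i => (axiomSeq D.ν D.seq (sigModulus h) i).toFormula, _,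
        axiomatizes hO hH (fun p j m k => hD.1.modulus p j m k) ?_ ?_, fun i n => ?_⟩
  · rintro _ ⟨i, rfl⟩
    exact ⟨_, rfl, axiomSeq_isAxiom i⟩
  · rintro φ hφ
    obtain ⟨i, rfl⟩ := exists_axiomSeq_eq hφ
    exact ⟨i, rfl⟩
  · simp only [comp, Nat.unpair_pair]
    exact (code_axiomSeq hD i).symm

/-! ## The profile of a point of a product -/

/-- A function of `η` and `t` that has the value `2 ^ -k * t` for `η = 2 ^ -k`, and the value
`|η - 2 ^ -k|` for all other `η` that belong to `{0} ∪ {2 ^ -n | n < ω}`. -/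
noncomputable def blend (k : ℕ) (η t : ℝ) : ℝ :=
  max (min ((1 / 2) ^ k * t) (|η - (1 / 2) ^ k| + max ((1 / 2) ^ k - 2 * |η - (1 / 2) ^ k|) 0))
    (max (|η - (1 / 2) ^ k| - max ((1 / 2) ^ k - 2 * |η - (1 / 2) ^ k|) 0) 0)

theorem abs_min_sub_min_le {a b c d e : ℝ} (h : |a - c| ≤ e) (h' : |b - d| ≤ e) :
    |min a b - min c d| ≤ e := (abs_min_sub_min_le_max a b c d).trans (max_le h h')

theorem abs_max_sub_max_le {a b c d e : ℝ} (h : |a - c| ≤ e) (h' : |b - d| ≤ e) :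
    |max a b - max c d| ≤ e := (abs_max_sub_max_le_max a b c d).trans (max_le h h')

/-- `blend k η t` is 2^-k t clamped to the interval with centre c = |η - 2^-k| and radius max(2^-k -
2c, 0), and to non-negative values. At η = 2^-k the interval is [-2^-k, 2^-k] and clamping changes
nothing. As soon as c ≥ 2^-k/2, the radius is 0 and the value is c, as used in `blend_of_le`. -/
theorem blend_self (k : ℕ) {t : ℝ} (h0 : 0 ≤ t) (h1 : t ≤ 1) :
    blend k ((1 / 2) ^ k) t = (1 / 2) ^ k * t := by
  have hp := half_pow_pos k
  have h2 : (1 / 2 : ℝ) ^ k * t ≤ (1 / 2) ^ k := mul_le_of_le_one_right hp.le h1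
  simp only [blend, sub_self, abs_zero, mul_zero, sub_zero, zero_add, zero_sub]
  rw [max_eq_left hp.le, min_eq_left h2, max_eq_right (neg_nonpos.2 hp.le), max_eq_left]
  positivity

theorem blend_of_le {k : ℕ} {η t : ℝ} (h : (1 / 2) ^ k / 2 ≤ |η - (1 / 2) ^ k|) :
    blend k η t = |η - (1 / 2) ^ k| := by
  rw [blend, max_eq_right (b := (0 : ℝ)) (a := (1 / 2) ^ k - _) (by linarith), add_zero, sub_zero,
    max_eq_left (abs_nonneg (η - (1 / 2) ^ k)), max_eq_right (min_le_right _ _)]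

theorem blend_half_pow {k n : ℕ} (h : n ≠ k) (t : ℝ) :
    blend k ((1 / 2) ^ n) t = |(1 / 2) ^ n - (1 / 2) ^ k| :=
  blend_of_le (by rw [abs_sub_comm]; exact pow_half_gap h.symm)

theorem blend_zero (k : ℕ) (t : ℝ) : blend k 0 t = (1 / 2) ^ k := by
  have hp := half_pow_pos k
  have h : |(0 : ℝ) - (1 / 2) ^ k| = (1 / 2) ^ k := by rw [zero_sub, abs_neg, abs_of_pos hp]
  rw [blend_of_le (by rw [h]; linarith), h]

/-- As functions of η, the centre of the clamping interval is 1-Lipschitz and its radius is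
2-Lipschitz. -/
theorem abs_blend_sub_blend_le (k : ℕ) (η η' t : ℝ) :
    |blend k η t - blend k η' t| ≤ 3 * |η - η'| := by
  have hc : abs (|η - (1 / 2) ^ k| - |η' - (1 / 2) ^ k|) ≤ |η - η'| := by
    simpa using abs_abs_sub_abs_le_abs_sub (η - (1 / 2) ^ k) (η' - (1 / 2) ^ k)
  have hw : |max ((1 / 2) ^ k - 2 * |η - (1 / 2) ^ k|) 0 -
      max ((1 / 2) ^ k - 2 * |η' - (1 / 2) ^ k|) 0| ≤ 2 * |η - η'| := by
    refine abs_max_sub_max_le ?_ (by simp)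
    rw [abs_le] at *
    constructor <;> linarith
  have h0 := abs_nonneg (η - η')
  unfold blend
  refine abs_max_sub_max_le (abs_min_sub_min_le (by simp) ?_) (abs_max_sub_max_le ?_ (by simp))
  all_goals
    rw [abs_le] at *
    constructor <;> linarith

theorem abs_blend_sub_blend_le' (k : ℕ) (η t t' : ℝ) : |blend k η t - blend k η t'| ≤ |t - t'| := by
  have h0 := abs_nonneg (t - t')
  unfold blend
  refine abs_max_sub_max_le (abs_min_sub_min_le ?_ (by simp)) (by simp)
  rw [← mul_sub, abs_mul, abs_of_pos (half_pow_pos k)]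
  exact mul_le_of_le_one_left h0 (half_pow_le_one k)

/-- For large k the value is nearly the level, whatever the coordinates are. This permits cutting
the supremum in `profileDist` to finitely many k. -/
theorem abs_blend_sub_le (k : ℕ) {η t : ℝ} (h0 : 0 ≤ η) :
    |blend k η t - η| ≤ 2 * (1 / 2) ^ k := by
  have hp := half_pow_pos k
  have hw0 := le_max_right ((1 / 2) ^ k - 2 * |η - (1 / 2) ^ k|) 0
  have hw1 : max ((1 / 2) ^ k - 2 * |η - (1 / 2) ^ k|) 0 ≤ (1 / 2) ^ k :=
    max_le (by linarith [abs_nonneg (η - (1 / 2) ^ k)]) hp.le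
  have hc1 : |η - (1 / 2) ^ k| ≤ η + (1 / 2) ^ k := abs_le.2 ⟨by linarith, by linarith⟩
  have hc0 := le_abs_self (η - (1 / 2) ^ k)
  rw [abs_le, blend]
  constructor
  · have := le_max_right (min ((1 / 2) ^ k * t)
      (|η - (1 / 2) ^ k| + max ((1 / 2) ^ k - 2 * |η - (1 / 2) ^ k|) 0))
      (max (|η - (1 / 2) ^ k| - max ((1 / 2) ^ k - 2 * |η - (1 / 2) ^ k|) 0) 0)
    have h2 := le_max_left (|η - (1 / 2) ^ k| - max ((1 / 2) ^ k - 2 * |η - (1 / 2) ^ k|) 0) 0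
    linarith
  · refine sub_le_iff_le_add.2 (max_le ((min_le_right _ _).trans (by linarith))
      (max_le (by linarith) (by linarith)))

theorem blend_nonneg (k : ℕ) (η t : ℝ) : 0 ≤ blend k η t :=
  (le_max_right _ _).trans (le_max_right _ _)

theorem blend_le_one (k : ℕ) {η t : ℝ} (h0 : 0 ≤ η) (h1 : η ≤ 1) (ht : t ≤ 1) :
    blend k η t ≤ 1 := by
  have hp := half_pow_pos k
  have hp1 := half_pow_le_one k
  have hw0 := le_max_right ((1 / 2) ^ k - 2 * |η - (1 / 2) ^ k|) 0
  have hc : |η - (1 / 2) ^ k| ≤ 1 := abs_le.2 ⟨by linarith, by linarith⟩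
  refine max_le ((min_le_left _ _).trans ?_) (max_le (by linarith) zero_le_one)
  exact (mul_le_of_le_one_right hp.le ht).trans hp1

section profile

variable {V : Vocab.{v}} {A : PreStructure.{u, v} V} {o : ℕ → V.Sorts}
  (ho : ∀ k, o (2 * k + 2) = o 0) (m : ℕ)

/-- The distance of the coordinates with the numbers `2 * k + 2` and `0`. -/
noncomputable def coordGap (p : ∀ i, A.sort (o i)) (k : ℕ) : ℝ :=
  dist (ho k ▸ p (2 * k + 2) : A.sort (o 0)) (p 0)

/-- The level of a point of the product; if the point represents an element of the disjoint union,
this is the distance of that element to `∗`. -/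
noncomputable def level (p : ∀ i, A.sort (o i)) : ℝ :=
  ⨆ k, min ((1 / 2 : ℝ) ^ k) (2 ^ m * coordGap ho p k)

/-- The distances of the element of the disjoint union that is represented by `p`. -/
noncomputable def profile (p : ∀ i, A.sort (o i)) : Cmdu A (fun k => o (2 * k + 1)) → ℝ
  | .star => level ho m p
  | .pt k y => blend k (level ho m p) (dist (p (2 * k + 1)) y)

/-- The pseudo-metric on the product. -/
noncomputable def profileDist (p p' : ∀ i, A.sort (o i)) : ℝ :=
  ⨆ v, |profile ho m p v - profile ho m p' v|

theorem coordGap_nonneg (p : ∀ i, A.sort (o i)) (k : ℕ) : 0 ≤ coordGap ho p k := dist_nonneg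

theorem bddAbove_level (p : ∀ i, A.sort (o i)) :
    BddAbove (Set.range fun k => min ((1 / 2 : ℝ) ^ k) (2 ^ m * coordGap ho p k)) :=
  ⟨1, by rintro _ ⟨k, rfl⟩; exact (min_le_left _ _).trans (half_pow_le_one k)⟩

theorem level_mem (p : ∀ i, A.sort (o i)) : level ho m p ∈ Set.Icc (0 : ℝ) 1 :=
  ⟨Real.iSup_nonneg fun k => le_min (half_pow_pos k).le
    (mul_nonneg (by positivity) (coordGap_nonneg ho p k)),
    ciSup_le fun k => (min_le_left _ _).trans (half_pow_le_one k)⟩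

theorem profile_mem (p : ∀ i, A.sort (o i)) (v : Cmdu A fun k => o (2 * k + 1)) :
    profile ho m p v ∈ Set.Icc (0 : ℝ) 1 := by
  have h := level_mem ho m p
  cases v with
  | star => exact h
  | pt k y => exact ⟨blend_nonneg _ _ _, blend_le_one _ h.1 h.2 ((A.sort _).dist_le_one _ _)⟩

theorem bddAbove_profileDist (p p' : ∀ i, A.sort (o i)) :
    BddAbove (Set.range fun v => |profile ho m p v - profile ho m p' v|) :=
  ⟨1, by rintro _ ⟨v, rfl⟩; exact abs_sub_le_one (profile_mem ho m p v) (profile_mem ho m p' v)⟩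

theorem le_profileDist (p p' : ∀ i, A.sort (o i)) (v : Cmdu A fun k => o (2 * k + 1)) :
    |profile ho m p v - profile ho m p' v| ≤ profileDist ho m p p' :=
  le_ciSup (bddAbove_profileDist ho m p p') v

theorem profileDist_le {p p' : ∀ i, A.sort (o i)} {c : ℝ}
    (h : ∀ v, |profile ho m p v - profile ho m p' v| ≤ c) : profileDist ho m p p' ≤ c :=
  haveI : Nonempty (Cmdu A fun k => o (2 * k + 1)) := ⟨.star⟩
  ciSup_le h

theorem isPseudoMetric_profileDist {X : MSort.{u}} (f : X → ∀ i, A.sort (o i)) :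
    IsPseudoMetric X fun x y => profileDist ho m (f x) (f y) where
  self x := by simp [profileDist]
  symm x y := by simp only [profileDist, abs_sub_comm]
  triangle x y z := profileDist_le ho m fun v => (abs_sub_le _ (profile ho m (f y) v) _).trans
    (add_le_add (le_profileDist ho m _ _ v) (le_profileDist ho m _ _ v))
  mem x y := ⟨Real.iSup_nonneg fun _ => abs_nonneg _,
    profileDist_le ho m fun v => abs_sub_le_one (profile_mem ho m _ v) (profile_mem ho m _ v)⟩

/-- The coordinates in H and those in the sorts O_k are prescribed independently, by parity of the
index. The term `c 0` belongs to coordinate 0 and `c (k + 1)` to coordinate 2k + 2. -/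
theorem exists_coords (c : ℕ → A.sort (o 0)) (x : ∀ k, A.sort (o (2 * k + 1))) :
    ∃ p : ∀ i, A.sort (o i), p 0 = c 0 ∧ (∀ k, ho k ▸ p (2 * k + 2) = c (k + 1)) ∧
      ∀ k, p (2 * k + 1) = x k := by
  have h : ∀ i, ∃ y : A.sort (o i), (∀ h : i = 0, (h ▸ y : A.sort (o 0)) = c 0) ∧
      (∀ k, ∀ h : i = 2 * k + 2, ho k ▸ (h ▸ y : A.sort (o (2 * k + 2))) = c (k + 1)) ∧
      ∀ k, ∀ h : i = 2 * k + 1, (h ▸ y : A.sort (o (2 * k + 1))) = x k := by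
    intro i
    have : i = 0 ∨ (∃ k, i = 2 * k + 2) ∨ ∃ k, i = 2 * k + 1 := by
      rcases i with _ | i
      · exact .inl rfl
      · rcases Nat.even_or_odd' i with ⟨k, rfl | rfl⟩
        · exact .inr (.inr ⟨k, rfl⟩)
        · exact .inr (.inl ⟨k, rfl⟩)
    rcases this with rfl | ⟨k, rfl⟩ | ⟨k, rfl⟩
    · exact ⟨c 0, fun _ => rfl, fun _ h => by omega, fun _ h => by omega⟩
    · refine ⟨(ho k).symm ▸ c (k + 1), fun h => by omega, fun l h => ?_, fun _ h => by omega⟩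
      obtain rfl : k = l := by omega
      have : ∀ {s : V.Sorts} (e : s = o 0) (z : A.sort (o 0)),
          (e ▸ (e.symm ▸ z : A.sort s) : A.sort (o 0)) = z := by rintro s rfl z; rfl
      exact this (ho k) _
    · refine ⟨x k, fun h => by omega, fun _ h => by omega, fun l h => ?_⟩
      obtain rfl : k = l := by omega
      rfl
  choose p hp using h
  exact ⟨p, (hp 0).1 rfl, fun k => (hp _).2.1 k rfl, fun k => (hp _).2.2 k rfl⟩

variable {m}

/-- Every element of the disjoint union is represented by a point of the product. -/
theorem exists_profile_eq {a b : A.sort (o 0)} (hab : (1 / 2 : ℝ) ^ m < dist a b)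
    (u : Cmdu A fun k => o (2 * k + 1)) : ∃ p : ∀ i, A.sort (o i),
      level ho m p = Cmdu.height A _ u ∧ (∀ v, profile ho m p v = dist u v) ∧
        ∀ n x, u = .pt n x → p (2 * n + 1) = x := by
  have x0 : ∀ k, A.sort (o (2 * k + 1)) := fun k => Classical.choice (A.sort _).nonempty
  cases u with
  | star =>
    -- All switches are off. The coordinates in the sorts O_k are arbitrary, since `blend` ignores
    -- them at level 0.
    obtain ⟨p, h0, h1, -⟩ := exists_coords ho (fun _ => a) x0
    have hl : level ho m p = 0 := by
      have : ∀ k, min ((1 / 2 : ℝ) ^ k) (2 ^ m * coordGap ho p k) = 0 := fun k => by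
        rw [coordGap, h0, h1, dist_self, mul_zero, min_eq_right (half_pow_pos k).le]
      simp only [level, this]
      exact ciSup_const
    refine ⟨p, hl, fun v => ?_, fun n x h => by cases h⟩
    cases v with
    | star => rw [dist_self]; exact hl
    | pt k y =>
      change blend k (level ho m p) _ = (1 / 2) ^ k
      rw [hl, blend_zero]
  | pt n x =>
    -- Only the switch number n is on: coordinate 2n + 2 is b, coordinate 0 and all other switches
    -- are a. The coordinate in O_n is x.
    obtain ⟨p, h0, h1, h2⟩ := exists_coords ho (fun k => if k = n + 1 then b else a)
      (Function.update x0 n x)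
    have hx : p (2 * n + 1) = x := by rw [h2, Function.update_self]
    have h0' : p 0 = a := by rw [h0, if_neg (by omega)]
    -- Since d(a,b) > 2^-m, the switch contributes its full value 2^-n to the level.
    have hn : min ((1 / 2 : ℝ) ^ n) (2 ^ m * coordGap ho p n) = (1 / 2) ^ n := by
      rw [coordGap, h1, h0', if_pos rfl, dist_comm]
      refine min_eq_left ((half_pow_le_one n).trans ?_)
      rw [← two_pow_mul_half_pow m 1, mul_one]
      exact mul_le_mul_of_nonneg_left hab.le (by positivity)
    have hl : level ho m p = (1 / 2) ^ n := by
      refine le_antisymm (ciSup_le fun k => ?_) (hn.ge.trans (le_ciSup (bddAbove_level ho m p) n))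
      by_cases hk : k = n
      · subst hk
        exact min_le_left _ _
      · rw [coordGap, h1, h0', if_neg (by omega), dist_self, mul_zero]
        exact (min_le_right _ _).trans (half_pow_pos n).le
    refine ⟨p, hl, fun v => ?_, fun n' x' h => by cases h; exact hx⟩
    cases v with
    | star => exact hl
    | pt k y =>
      change blend k (level ho m p) _ = _
      rw [hl]
      by_cases hk : n = k
      · subst hk
        rw [hx, blend_self _ dist_nonneg ((A.sort _).dist_le_one _ _), Cmdu.dist_pt]
      · rw [blend_half_pow hk, Cmdu.dist_of_ne hk]

/-- At level 0 all values of `blend k` equal 2^-k, which is the profile of ∗. Lowering the level of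
p to 0 costs at most three times the level. -/
theorem profileDist_le_level {p p' : ∀ i, A.sort (o i)}
    (h : ∀ v, profile ho m p' v = dist .star v) (h' : level ho m p' = 0) :
    profileDist ho m p p' ≤ 3 * level ho m p := by
  have h0 := (level_mem ho m p).1
  refine profileDist_le ho m fun v => ?_
  cases v with
  | star =>
    change |level ho m p - level ho m p'| ≤ _
    rw [h', sub_zero, abs_of_nonneg h0]
    linarith
  | pt k y =>
    have h1 := h (.pt k y)
    rw [h1]
    have h2 := abs_blend_sub_blend_le k (level ho m p) 0 (dist (p (2 * k + 1)) y)
    rw [sub_zero, abs_of_nonneg h0, blend_zero] at h2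
    exact h2

/-- Moving the level of p to 2^-n costs at most three times the change. At level 2^-n only the
coordinate in O_n is visible, and replacing it by x costs at most its distance to x. -/
theorem profileDist_le_add {p p' : ∀ i, A.sort (o i)} {n : ℕ} {x : A.sort (o (2 * n + 1))}
    (h : ∀ v, profile ho m p' v = dist (.pt n x) v) (h' : level ho m p' = (1 / 2) ^ n) :
    profileDist ho m p p' ≤ 3 * |level ho m p - (1 / 2) ^ n| + dist (p (2 * n + 1)) x := by
  have h0 := abs_nonneg (level ho m p - (1 / 2) ^ n)
  have hd : 0 ≤ dist (p (2 * n + 1)) x := dist_nonneg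
  refine profileDist_le ho m fun v => ?_
  cases v with
  | star =>
    change |level ho m p - level ho m p'| ≤ _
    rw [h']
    linarith
  | pt k y =>
    rw [h]
    have h2 := abs_blend_sub_blend_le k (level ho m p) ((1 / 2) ^ n) (dist (p (2 * k + 1)) y)
    refine (abs_sub_le _ (blend k ((1 / 2) ^ n) (dist (p (2 * k + 1)) y)) _).trans
      (add_le_add h2 ?_)
    by_cases hk : n = k
    · subst hk
      rw [Cmdu.dist_pt, ← blend_self n dist_nonneg ((A.sort _).dist_le_one x y)]
      refine (abs_blend_sub_blend_le' _ _ _ _).trans ?_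
      exact abs_dist_sub_le _ _ _
    · rw [blend_half_pow hk, Cmdu.dist_of_ne hk, sub_self, abs_zero]
      exact hd

end profile

/-! ## The disjoint union inside the quotient -/

/-- An infimal convolution: since F bounds the distance of `c p` to K, the triangle inequality
bounds the infimum from below by the distance to K, and the representatives with F = 0 bound it from
above. Truncation at 1 is harmless because distances are at most 1, and an error ε in F passes to
the result unchanged. The lemma is applied with K the image of the union, the image of ∗, and the
image of a point of O_n. -/
theorem abs_iInf_sub_infDist_le {X : Type*} {Q : Type*} [MetricSpace Q] [Nonempty X]
    (hQ : ∀ x y : Q, dist x y ≤ 1) (c : X → Q) {K : Set Q} (F φ : X → ℝ) {ε : ℝ} (hK : K.Nonempty)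
    (h1 : ∀ p, Metric.infDist (c p) K ≤ F p) (h2 : ∀ u ∈ K, ∃ p, c p = u ∧ F p = 0)
    (hφ : ∀ p, |φ p - min 1 (F p)| ≤ ε) (hφ0 : ∀ p, 0 ≤ φ p) (z : Q) :
    |(⨅ p, min 1 (dist (c p) z + φ p)) - Metric.infDist z K| ≤ ε := by
  have hb : BddBelow (Set.range fun p => min 1 (dist (c p) z + φ p)) :=
    ⟨0, by rintro _ ⟨p, rfl⟩; exact le_min zero_le_one (add_nonneg dist_nonneg (hφ0 p))⟩
  have hε : 0 ≤ ε := (abs_nonneg _).trans (hφ (Classical.arbitrary X))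
  rw [abs_le]
  constructor
  · rw [neg_le_sub_iff_le_add, ← sub_le_iff_le_add]
    refine le_ciInf fun p => ?_
    have h3 : Metric.infDist z K ≤ 1 := by
      obtain ⟨u, hu⟩ := hK
      exact (Metric.infDist_le_dist_of_mem hu).trans (hQ _ _)
    have h4 : Metric.infDist z K ≤ Metric.infDist (c p) K + dist z (c p) :=
      Metric.infDist_le_infDist_add_dist
    have h5 := (abs_le.1 (hφ p)).1
    have h6 := h1 p
    rw [dist_comm] at h4
    have hd : 0 ≤ dist (c p) z := dist_nonneg
    refine le_min (by linarith) ?_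
    rcases min_cases 1 (F p) with ⟨h, -⟩ | ⟨h, -⟩ <;> rw [h] at h5 <;> linarith
  · rw [sub_le_iff_le_add]
    refine le_of_forall_pos_le_add fun δ hδ => ?_
    obtain ⟨u, hu, hz⟩ := (Metric.infDist_lt_iff hK).1 (lt_add_of_pos_right (Metric.infDist z K) hδ)
    obtain ⟨p, rfl, hp⟩ := h2 u hu
    have h5 := (abs_le.1 (hφ p)).2
    rw [hp, min_eq_right zero_le_one] at h5
    rw [dist_comm] at hz
    linarith [ciInf_le hb p, min_le_right 1 (dist (c p) z + φ p)]

section embedding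

variable {V : Vocab.{v}} {A : PreStructure.{u, v} V} {o : ℕ → V.Sorts}
  (ho : ∀ k, o (2 * k + 2) = o 0) {m : ℕ}

theorem MSort.dist_cls (X : MSort.{u}) (ρ : X → X → ℝ) (h : IsPseudoMetric X ρ) (x y : X) :
    dist (X.cls ρ h x) (X.cls ρ h y) = ρ x y := UniformSpace.Completion.dist_eq _ _

/-- The map `κ` is an embedding of the disjoint union into the quotient of the product by the
pseudo-metric `profileDist`. -/
structure IsEmbedding {X : MSort.{u}} (f : X → ∀ i, A.sort (o i)) {ρ : X → X → ℝ}
    (h : IsPseudoMetric X ρ) (m : ℕ) (κ : Cmdu A (fun k => o (2 * k + 1)) → X.quot ρ h) : Prop where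
  isometry : Isometry κ
  exists_rep : ∀ u, ∃ x, X.cls ρ h x = κ u ∧ level ho m (f x) = Cmdu.height A _ u ∧
    ∀ n y, u = .pt n y → f x (2 * n + 1) = y
  dist_star_le : ∀ x, dist (X.cls ρ h x) (κ .star) ≤ 3 * level ho m (f x)
  dist_pt_le : ∀ x n y, dist (X.cls ρ h x) (κ (.pt n y)) ≤
    3 * |level ho m (f x) - (1 / 2) ^ n| + dist (f x (2 * n + 1)) y

/-- The profile of a representative of u is the distance function d(u,·). As in Kuratowski's
embedding, the supremum of |d(u,v) - d(u',v)| over v is d(u,u'), and v = u' attains it. -/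
theorem exists_isEmbedding (hd : ∃ a b : A.sort (o 0), (1 / 2 : ℝ) ^ m < dist a b)
    {X : MSort.{u}} (f : X → ∀ i, A.sort (o i)) (hf : Function.Surjective f)
    {ρ : X → X → ℝ} (h : IsPseudoMetric X ρ)
    (hρ : ∀ x y, ρ x y = profileDist ho m (f x) (f y)) :
    ∃ κ, IsEmbedding ho f h m κ := by
  obtain ⟨a, b, hab⟩ := hd
  have hx : ∀ u, ∃ x : X, level ho m (f x) = Cmdu.height A _ u ∧
      (∀ v, profile ho m (f x) v = dist u v) ∧ ∀ n y, u = .pt n y → f x (2 * n + 1) = y := by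
    intro u
    obtain ⟨p, hp⟩ := exists_profile_eq ho hab u
    obtain ⟨x, rfl⟩ := hf p
    exact ⟨x, hp⟩
  choose g hg1 hg2 hg3 using hx
  refine ⟨fun u => X.cls ρ h (g u), Isometry.of_dist_eq fun u u' => ?_,
    fun u => ⟨g u, rfl, hg1 u, hg3 u⟩, fun x => ?_, fun x n y => ?_⟩
  · rw [MSort.dist_cls, hρ]
    refine le_antisymm (profileDist_le ho m fun v => ?_) ?_
    · rw [hg2, hg2]
      exact abs_dist_sub_le _ _ _
    · refine le_trans ?_ (le_profileDist ho m _ _ u')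
      rw [hg2, hg2, dist_self, sub_zero]
      exact le_abs_self _
  · rw [MSort.dist_cls, hρ]
    exact profileDist_le_level ho (hg2 _) (hg1 _)
  · rw [MSort.dist_cls, hρ]
    exact profileDist_le_add ho (hg2 _) (hg1 _)

end embedding

/-! ## Formulas about the points of the product -/

/-- The sort of a product and its projections, in an expansion of the vocabulary. -/
structure Frame (V : Vocab.{v}) (o : ℕ → V.Sorts) (V' : Vocab.{v}) where
  /-- the product -/
  prod : V'.Sorts
  /-- the original sorts -/
  inj : V.Sorts → V'.Sorts
  /-- the predicates of the projections -/
  proj : ℕ → V'.Preds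
  inj_ne : ∀ s, inj s ≠ prod
  free_proj : ∀ i v j, (RFormula.pred (proj i) fun k => if k.val = 0 then v else j).free =
    {(prod, v), (inj (o i), j)}

namespace Frame

variable {V V' : Vocab.{v}} {o : ℕ → V.Sorts} (F : Frame V o V')

/-- The distance of the coordinate with number `i` of the variable with number `v` of the product
and the variable with number `j` of a sort. -/
def atom (v i j : ℕ) : RFormula V' := .pred (F.proj i) fun k => if k.val = 0 then v else j

/-- Formula for `coordGap`. -/
def gap (v k : ℕ) : RFormula V' :=
  .sup (F.inj (o 0)) 0 (.absDiff (F.atom v (2 * k + 2) 0) (F.atom v 0 0))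

/-- Approximation of `level` up to `2 ^ -N`. -/
def level (m v N : ℕ) : RFormula V' :=
  .maxs ((List.range N).map fun k => .min (.halfPow k) (RFormula.double^[m] (F.gap v k)))

end Frame

/-- Formula for `blend`. -/
def RFormula.blend {V : Vocab.{v}} (k : ℕ) (η t : RFormula V) : RFormula V :=
  .max (.min (half^[k] t) (.plus (.absDiff η (.halfPow k))
      (.sub (.halfPow k) (.double (.absDiff η (.halfPow k))))))
    (.sub (.absDiff η (.halfPow k)) (.sub (.halfPow k) (.double (.absDiff η (.halfPow k)))))

/-- Three times a formula. -/
def RFormula.triple {V : Vocab.{v}} (φ : RFormula V) : RFormula V := .plus φ (.plus φ φ)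

namespace Frame

variable {V V' : Vocab.{v}} {o : ℕ → V.Sorts} (F : Frame V o V')

/-- Approximation of `profileDist` for the variables with the numbers `0` and `1`. -/
def profileDist (m N : ℕ) : RFormula V' :=
  .max (.absDiff (F.level m 0 N) (F.level m 1 N))
    (.maxs ((List.range N).map fun k => .sup (F.inj (o (2 * k + 1))) 0
      (.absDiff (.blend k (F.level m 0 N) (F.atom 0 (2 * k + 1) 0))
        (.blend k (F.level m 1 N) (F.atom 1 (2 * k + 1) 0)))))

/-- Bound for the distance to `∗`. -/
def starBound (m v N : ℕ) : RFormula V' := (F.level m v (N + 2)).triple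

/-- Bound for the distance to a point of `O n`. -/
def pointBound (m v n j N : ℕ) : RFormula V' :=
  .plus (.triple (.absDiff (F.level m v (N + 2)) (.halfPow n))) (F.atom v (2 * n + 1) j)

/-- Bound for the distance to the disjoint union. -/
def unionBound (m v N : ℕ) : RFormula V' :=
  .triple (.mins ((List.range (N + 4)).map fun n =>
    .absDiff (F.level m v (N + 3)) (.halfPow n)))

/-- Interpretation of the product and the projections. -/
structure Reads (A : PreStructure.{u, v} V) (B : PreStructure.{u, v} V') where
  pt : B.sort F.prod → ∀ i, A.sort (o i)
  el : ∀ s, B.sort (F.inj s) → A.sort s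
  el_surjective : ∀ s, Function.Surjective (el s)
  eval_atom : ∀ (w : B.Val) v i j,
    (F.atom v i j).eval B w = dist (pt (w F.prod v) i) (el _ (w (F.inj (o i)) j))

theorem free_atom (v i j : ℕ) : (F.atom v i j).free = {(F.prod, v), (F.inj (o i), j)} :=
  F.free_proj i v j

theorem free_gap (ho : ∀ k, o (2 * k + 2) = o 0) (v k : ℕ) :
    (F.gap v k).free ⊆ {(F.prod, v)} := by
  simp only [gap, RFormula.free, RFormula.free_absDiff, free_atom, ho]
  rintro x ⟨(rfl | rfl) | (rfl | rfl), h2⟩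
  · rfl
  · exact absurd rfl h2
  · rfl
  · exact absurd rfl h2

theorem free_level (ho : ∀ k, o (2 * k + 2) = o 0) (m v N : ℕ) :
    (F.level m v N).free ⊆ {(F.prod, v)} := by
  refine RFormula.free_maxs_subset fun φ hφ => ?_
  obtain ⟨k, -, rfl⟩ := List.mem_map.1 hφ
  simp only [RFormula.free_min, RFormula.free_halfPow, RFormula.free_double_iterate,
    Set.empty_union]
  exact F.free_gap ho v k

theorem _root_.MetricLogic.RFormula.free_blend (k : ℕ) (η t : RFormula V) :
    (RFormula.blend k η t).free = η.free ∪ t.free := by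
  simp only [RFormula.blend, RFormula.free_max, RFormula.free_min, RFormula.free_half_iterate,
    RFormula.free_plus, RFormula.free_absDiff, RFormula.free_halfPow, RFormula.free,
    RFormula.free_double, Set.union_empty, Set.empty_union, Set.union_self]
  ext x
  simp only [Set.mem_union]
  tauto

theorem _root_.MetricLogic.RFormula.free_triple (φ : RFormula V) : φ.triple.free = φ.free := by
  simp [RFormula.triple]

theorem free_profileDist (ho : ∀ k, o (2 * k + 2) = o 0) (m N : ℕ) :
    (F.profileDist m N).free ⊆ {(F.prod, 0), (F.prod, 1)} := by
  have h0 : (F.level m 0 N).free ⊆ {(F.prod, 0), (F.prod, 1)} :=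
    (F.free_level ho m 0 N).trans (by simp)
  have h1 : (F.level m 1 N).free ⊆ {(F.prod, 0), (F.prod, 1)} :=
    (F.free_level ho m 1 N).trans (by simp)
  rw [profileDist, RFormula.free_max, RFormula.free_absDiff]
  refine Set.union_subset (Set.union_subset h0 h1) (RFormula.free_maxs_subset fun φ hφ => ?_)
  obtain ⟨k, -, rfl⟩ := List.mem_map.1 hφ
  simp only [RFormula.free, RFormula.free_absDiff, RFormula.free_blend, free_atom]
  rintro x ⟨(h | rfl | rfl) | (h | rfl | rfl), h2⟩
  · exact h0 h
  · simp
  · exact absurd rfl h2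
  · exact h1 h
  · simp
  · exact absurd rfl h2

theorem free_starBound (ho : ∀ k, o (2 * k + 2) = o 0) (m v N : ℕ) :
    (F.starBound m v N).free ⊆ {(F.prod, v)} := by
  rw [starBound, RFormula.free_triple]
  exact F.free_level ho m v _

theorem free_pointBound (ho : ∀ k, o (2 * k + 2) = o 0) (m v n j N : ℕ) :
    (F.pointBound m v n j N).free ⊆ {(F.prod, v), (F.inj (o (2 * n + 1)), j)} := by
  simp only [pointBound, RFormula.free_plus, RFormula.free_triple, RFormula.free_absDiff,
    RFormula.free_halfPow, Set.union_empty, free_atom]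
  exact Set.union_subset ((F.free_level ho m v _).trans (by simp)) subset_rfl

theorem free_unionBound (ho : ∀ k, o (2 * k + 2) = o 0) (m v N : ℕ) :
    (F.unionBound m v N).free ⊆ {(F.prod, v)} := by
  rw [unionBound, RFormula.free_triple]
  refine RFormula.free_mins_subset fun φ hφ => ?_
  obtain ⟨k, -, rfl⟩ := List.mem_map.1 hφ
  simp only [RFormula.free_absDiff, RFormula.free_halfPow, Set.union_empty]
  exact F.free_level ho m v _

end Frame

theorem RFormula.eval_blend {V : Vocab.{v}} (A : PreStructure.{u, v} V) (k : ℕ) (η t : RFormula V)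
    (w : A.Val) : (blend k η t).eval A w = MetricLogic.blend k (η.eval A w) (t.eval A w) := by
  have ht := t.eval_le_one A w
  have hp := half_pow_pos k
  have hp1 := half_pow_le_one k
  simp only [blend, eval_max, eval_min, eval_half_iterate, eval_plus, eval_absDiff, eval_halfPow,
    eval, eval_double, MetricLogic.blend]
  set c := |η.eval A w - (1 / 2) ^ k|
  have hw : Max.max ((1 / 2 : ℝ) ^ k - Min.min 1 (2 * c)) 0 =
      Max.max ((1 / 2) ^ k - 2 * c) 0 := by
    rcases le_total 1 (2 * c) with h | h
    · rw [min_eq_left h, max_eq_right (by linarith), max_eq_right (by linarith)]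
    · rw [min_eq_right h]
  rw [hw]
  congr 1
  have hx : (1 / 2 : ℝ) ^ k * t.eval A w ≤ 1 :=
    (mul_le_of_le_one_right hp.le ht).trans hp1
  rw [← min_assoc, min_eq_left hx]

theorem RFormula.eval_triple {V : Vocab.{v}} (A : PreStructure.{u, v} V) (φ : RFormula V)
    (w : A.Val) : φ.triple.eval A w = Min.min 1 (3 * φ.eval A w) := by
  simp only [triple, eval_plus]
  have h := φ.eval_nonneg A w
  rcases le_total 1 (φ.eval A w + φ.eval A w) with h1 | h1
  · rw [min_eq_left h1, min_eq_left (by linarith), min_eq_left (by linarith)]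
  · rw [min_eq_right h1]
    ring_nf

theorem abs_min_one_sub_le {a b e : ℝ} (h : |a - b| ≤ e) : |min 1 a - min 1 b| ≤ e :=
  abs_min_sub_min_le (by simpa using (abs_nonneg _).trans h) h

namespace Frame

variable {V V' : Vocab.{v}} {o : ℕ → V.Sorts} {F : Frame V o V'} {A : PreStructure.{u, v} V}
  {B : PreStructure.{u, v} V'} (R : F.Reads A B) (ho : ∀ k, o (2 * k + 2) = o 0)
namespace Reads

theorem el_upd (w : B.Val) {s t : V.Sorts} (e : s = t) (j : ℕ) (a : B.sort (F.inj s)) :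
    R.el t (w.upd (F.inj s) j a (F.inj t) j) = e ▸ R.el s a := by
  subst e
  rw [w.upd_self]

theorem upd_prod (w : B.Val) (s : V.Sorts) (v j : ℕ) (a : B.sort (F.inj s)) :
    w.upd (F.inj s) j a F.prod v = w F.prod v := w.upd_of_sort_ne _ _ _ (F.inj_ne s)

/-- The supremum is attained where `f a = y`. This expresses the distance of two elements by means
of predicates that measure only their distances to a third one, such as projections and inclusions.
-/
theorem _root_.MetricLogic.iSup_abs_dist_sub_dist {X Y : Type*} [MetricSpace X] (f : Y → X)
    (hf : Function.Surjective f) (h : ∀ x y : X, dist x y ≤ 1) (x y : X) :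
    ⨆ a, |dist x (f a) - dist y (f a)| = dist x y := by
  have hb : BddAbove (Set.range fun a => |dist x (f a) - dist y (f a)|) :=
    ⟨1, by rintro _ ⟨a, rfl⟩; exact (abs_dist_sub_le _ _ _).trans (h _ _)⟩
  obtain ⟨a, ha⟩ := hf y
  have : Nonempty Y := ⟨a⟩
  refine le_antisymm (ciSup_le fun a => abs_dist_sub_le _ _ _) ?_
  refine le_trans ?_ (le_ciSup hb a)
  rw [ha, dist_self, sub_zero]
  exact le_abs_self _

theorem eval_gap (w : B.Val) (v k : ℕ) :
    (F.gap v k).eval B w = coordGap ho (R.pt (w F.prod v)) k := by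
  -- The sorts of coordinates 2k + 2 and 0 are both H, but not by definition, so the quantified
  -- element has to be transported between them.
  have hcast : ∀ {s : V.Sorts} (e : s = o 0) (x : A.sort s) (z : A.sort (o 0)),
      dist x (e.symm ▸ z) = dist (e ▸ x : A.sort (o 0)) z := by rintro s rfl x z; rfl
  have h : ∀ a : B.sort (F.inj (o 0)), (RFormula.absDiff (F.atom v (2 * k + 2) 0)
      (F.atom v 0 0)).eval B (w.upd (F.inj (o 0)) 0 a) =
      |dist (ho k ▸ R.pt (w F.prod v) (2 * k + 2) : A.sort (o 0)) (R.el _ a) -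
        dist (R.pt (w F.prod v) 0) (R.el _ a)| := fun a => by
    rw [RFormula.eval_absDiff, R.eval_atom, R.eval_atom, upd_prod, R.el_upd w (ho k).symm,
      w.upd_self, hcast]
  simp only [gap, RFormula.eval, h]
  exact iSup_abs_dist_sub_dist _ (R.el_surjective _) (A.sort _).dist_le_one _ _

/-- The terms with k ≥ N of the supremum are at most 2^-N. -/
theorem abs_eval_level_sub_le (w : B.Val) (m v N : ℕ) :
    |(F.level m v N).eval B w - MetricLogic.level ho m (R.pt (w F.prod v))| ≤ (1 / 2) ^ N := by
  have hp := half_pow_pos N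
  have hk : ∀ k, (RFormula.min (.halfPow k) (RFormula.double^[m] (F.gap v k))).eval B w =
      min ((1 / 2) ^ k) (2 ^ m * coordGap ho (R.pt (w F.prod v)) k) := fun k => by
    rw [RFormula.eval_min, RFormula.eval_halfPow, RFormula.eval_double_iterate, R.eval_gap ho,
      ← min_assoc, min_eq_left (half_pow_le_one k)]
  have hb := bddAbove_level ho m (R.pt (w F.prod v))
  have h0 := (level_mem ho m (R.pt (w F.prod v))).1
  rw [abs_le]
  constructor
  · rw [neg_le_sub_iff_le_add]
    refine ciSup_le fun k => ?_
    by_cases hkN : k < N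
    · rw [← hk]
      have := RFormula.le_maxs (A := B) (l := (List.range N).map fun k =>
        RFormula.min (.halfPow k) (RFormula.double^[m] (F.gap v k)))
        (List.mem_map.2 ⟨k, List.mem_range.2 hkN, rfl⟩) w
      exact this.trans (le_add_of_nonneg_right hp.le)
    · exact (min_le_left _ _).trans ((half_pow_le_half_pow (not_lt.1 hkN)).trans
        (le_add_of_nonneg_left (RFormula.eval_nonneg _ _ _)))
  · rw [sub_le_iff_le_add]
    refine RFormula.maxs_le (by linarith) fun φ hφ => ?_
    obtain ⟨k, -, rfl⟩ := List.mem_map.1 hφ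
    rw [hk]
    exact (le_ciSup hb k).trans (le_add_of_nonneg_left hp.le)

/-- For k < N, each of the two levels is off by 2^-N, and `blend` multiplies this by at most 3. For
k ≥ N, each profile value differs from its level by at most 2·2^-N, while the levels contribute
2·2^-N. Both estimates add up to 6·2^-N. -/
theorem abs_eval_profileDist_sub_le (w : B.Val) (m N : ℕ) :
    |(F.profileDist m N).eval B w - MetricLogic.profileDist ho m (R.pt (w F.prod 0))
      (R.pt (w F.prod 1))| ≤ 6 * (1 / 2) ^ N := by
  have hp := half_pow_pos N
  have e0 := R.abs_eval_level_sub_le ho w m 0 N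
  have e1 := R.abs_eval_level_sub_le ho w m 1 N
  set x := R.pt (w F.prod 0) with hx
  set y := R.pt (w F.prod 1) with hy
  set η := (F.level m 0 N).eval B w with hη
  set η' := (F.level m 1 N).eval B w with hη'
  have hlev : ∀ (k : ℕ) (a : B.sort (F.inj (o (2 * k + 1)))) (v : ℕ),
      |(F.level m v N).eval B (w.upd (F.inj (o (2 * k + 1))) 0 a) -
        MetricLogic.level ho m (R.pt (w F.prod v))| ≤ (1 / 2) ^ N := fun k a v => by
    have := R.abs_eval_level_sub_le ho (w.upd (F.inj (o (2 * k + 1))) 0 a) m v N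
    rwa [upd_prod] at this
  have hk : ∀ (k : ℕ) (a : B.sort (F.inj (o (2 * k + 1)))),
      abs ((RFormula.absDiff (.blend k (F.level m 0 N) (F.atom 0 (2 * k + 1) 0))
        (.blend k (F.level m 1 N) (F.atom 1 (2 * k + 1) 0))).eval B
          (w.upd (F.inj (o (2 * k + 1))) 0 a) -
        |profile ho m x (.pt k (R.el _ a)) - profile ho m y (.pt k (R.el _ a))|) ≤
          6 * (1 / 2) ^ N := fun k a => by
    rw [RFormula.eval_absDiff, RFormula.eval_blend, RFormula.eval_blend, R.eval_atom, R.eval_atom,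
      upd_prod, upd_prod, w.upd_self]
    have h0 := (abs_blend_sub_blend_le k _ _ (dist (x (2 * k + 1)) (R.el _ a))).trans
      (mul_le_mul_of_nonneg_left (hlev k a 0) zero_le_three)
    have h1 := (abs_blend_sub_blend_le k _ _ (dist (y (2 * k + 1)) (R.el _ a))).trans
      (mul_le_mul_of_nonneg_left (hlev k a 1) zero_le_three)
    refine (abs_abs_sub_abs_le_abs_sub _ _).trans ?_
    simp only [profile]
    rw [abs_le] at *
    constructor <;> linarith
  rw [abs_le]
  constructor
  · rw [neg_le_sub_iff_le_add]
    refine profileDist_le ho m fun v => ?_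
    have hmax := RFormula.eval_max B (.absDiff (F.level m 0 N) (F.level m 1 N))
      (.maxs ((List.range N).map fun k => .sup (F.inj (o (2 * k + 1))) 0
        (.absDiff (.blend k (F.level m 0 N) (F.atom 0 (2 * k + 1) 0))
        (.blend k (F.level m 1 N) (F.atom 1 (2 * k + 1) 0))))) w
    have hl : |η - η'| ≤ (F.profileDist m N).eval B w := by
      rw [profileDist, hmax, RFormula.eval_absDiff]
      exact le_max_left _ _
    have hl' : |MetricLogic.level ho m x - MetricLogic.level ho m y| ≤
        (F.profileDist m N).eval B w + 2 * (1 / 2) ^ N := by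
      rw [abs_le] at *
      constructor <;> linarith
    cases v with
    | star => exact hl'.trans (by linarith)
    | pt k z =>
      by_cases hkN : k < N
      · obtain ⟨a, rfl⟩ := R.el_surjective _ z
        have h1 := (abs_le.1 (hk k a)).1
        have h2 := RFormula.bddAbove_eval B (RFormula.absDiff
          (.blend k (F.level m 0 N) (F.atom 0 (2 * k + 1) 0))
          (.blend k (F.level m 1 N) (F.atom 1 (2 * k + 1) 0)))
          fun a => w.upd (F.inj (o (2 * k + 1))) 0 a
        have h3 := le_ciSup h2 a
        have h4 := RFormula.le_maxs (A := B) (l := (List.range N).map fun k =>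
          RFormula.sup (F.inj (o (2 * k + 1))) 0
          (.absDiff (.blend k (F.level m 0 N) (F.atom 0 (2 * k + 1) 0))
          (.blend k (F.level m 1 N) (F.atom 1 (2 * k + 1) 0))))
          (List.mem_map.2 ⟨k, List.mem_range.2 hkN, rfl⟩) w
        have h5 : (RFormula.maxs ((List.range N).map fun k =>
          RFormula.sup (F.inj (o (2 * k + 1))) 0
          (.absDiff (.blend k (F.level m 0 N) (F.atom 0 (2 * k + 1) 0))
          (.blend k (F.level m 1 N) (F.atom 1 (2 * k + 1) 0))))).eval B w ≤
            (F.profileDist m N).eval B w := by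
          rw [profileDist, hmax]
          exact le_max_right _ _
        have h6 := h3.trans (h4.trans h5)
        linarith
      · have hkp := half_pow_le_half_pow (not_lt.1 hkN)
        have h1 := abs_blend_sub_le k (t := dist (x (2 * k + 1)) z) (level_mem ho m x).1
        have h2 := abs_blend_sub_le k (t := dist (y (2 * k + 1)) z) (level_mem ho m y).1
        simp only [profile]
        rw [abs_le] at *
        constructor <;> linarith
  · rw [sub_le_iff_le_add, profileDist, RFormula.eval_max, RFormula.eval_absDiff]
    refine max_le ?_ (RFormula.maxs_le ?_ fun φ hφ => ?_)
    · have := le_profileDist ho m x y .star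
      simp only [profile] at this
      rw [abs_le] at *
      constructor <;> linarith
    · have := (abs_nonneg _).trans (le_profileDist ho m x y .star)
      linarith
    · obtain ⟨k, -, rfl⟩ := List.mem_map.1 hφ
      refine ciSup_le fun a => ?_
      have h1 := (abs_le.1 (hk k a)).2
      have h2 := le_profileDist ho m x y (.pt k (R.el _ a))
      linarith

theorem abs_eval_starBound_sub_le (w : B.Val) (m v N : ℕ) :
    |(F.starBound m v N).eval B w - min 1 (3 * MetricLogic.level ho m (R.pt (w F.prod v)))| ≤
      (1 / 2) ^ N := by
  have h := R.abs_eval_level_sub_le ho w m v (N + 2)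
  have hp := half_pow_pos N
  rw [starBound, RFormula.eval_triple]
  refine abs_min_one_sub_le ?_
  rw [pow_add] at h
  rw [abs_le] at *
  constructor <;> linarith

theorem abs_eval_pointBound_sub_le (w : B.Val) (m v n j N : ℕ) :
    |(F.pointBound m v n j N).eval B w - min 1
      (3 * |MetricLogic.level ho m (R.pt (w F.prod v)) - (1 / 2) ^ n| +
        dist (R.pt (w F.prod v) (2 * n + 1)) (R.el _ (w (F.inj (o (2 * n + 1))) j)))| ≤
      (1 / 2) ^ N := by
  have h := (abs_abs_sub_abs_le_abs_sub ((F.level m v (N + 2)).eval B w - (1 / 2) ^ n)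
    (MetricLogic.level ho m (R.pt (w F.prod v)) - (1 / 2) ^ n)).trans
      (by simpa using R.abs_eval_level_sub_le ho w m v (N + 2))
  have hp := half_pow_pos N
  have hd : 0 ≤ dist (R.pt (w F.prod v) (2 * n + 1)) (R.el _ (w (F.inj (o (2 * n + 1))) j)) :=
    dist_nonneg
  rw [pointBound, RFormula.eval_plus, RFormula.eval_triple, R.eval_atom, RFormula.eval_absDiff,
    RFormula.eval_halfPow]
  set a := |(F.level m v (N + 2)).eval B w - (1 / 2) ^ n|
  set d := dist (R.pt (w F.prod v) (2 * n + 1)) (R.el _ (w (F.inj (o (2 * n + 1))) j))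
  have h1 : min 1 (min 1 (3 * a) + d) = min 1 (3 * a + d) := by
    rcases le_total 1 (3 * a) with h | h
    · rw [min_eq_left h, min_eq_left (by linarith), min_eq_left (by linarith)]
    · rw [min_eq_right h]
  rw [h1]
  refine abs_min_one_sub_le ?_
  simp only [pow_add] at h
  rw [abs_le] at *
  norm_num at h
  simp only [one_div, inv_pow] at *
  constructor <;> linarith

/-- All powers 2^-n with n ≥ N + 4 are replaced by 2^-(N+3), at a cost of at most 2^-(N+3). Another
2^-(N+3) comes from the level; three times the sum is less than 2^-N. -/
theorem abs_eval_unionBound_sub_le (w : B.Val) (m v N : ℕ) :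
    |(F.unionBound m v N).eval B w - min 1
      (3 * ⨅ n : ℕ, |MetricLogic.level ho m (R.pt (w F.prod v)) - (1 / 2) ^ n|)| ≤
      (1 / 2) ^ N := by
  have h := R.abs_eval_level_sub_le ho w m v (N + 3)
  have hp := half_pow_pos N
  rw [unionBound, RFormula.eval_triple]
  refine abs_min_one_sub_le ?_
  have hl := level_mem ho m (R.pt (w F.prod v))
  set η := MetricLogic.level ho m (R.pt (w F.prod v))
  set φ := (RFormula.mins ((List.range (N + 4)).map fun n =>
    .absDiff (F.level m v (N + 3)) (.halfPow n)))
  have hb : BddBelow (Set.range fun n : ℕ => |η - (1 / 2) ^ n|) :=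
    ⟨0, by rintro _ ⟨n, rfl⟩; exact abs_nonneg _⟩
  have h3 : (1 / 2 : ℝ) ^ (N + 3) = (1 / 2) ^ N / 8 := by rw [pow_add]; ring
  have hn : ∀ n, abs ((RFormula.absDiff (F.level m v (N + 3)) (.halfPow n)).eval B w -
      |η - (1 / 2) ^ n|) ≤ (1 / 2) ^ N / 8 := fun n => by
    rw [RFormula.eval_absDiff, RFormula.eval_halfPow, ← h3]
    refine (abs_abs_sub_abs_le_abs_sub _ _).trans ?_
    simpa using h
  have h1 : φ.eval B w ≤ (⨅ n : ℕ, |η - (1 / 2) ^ n|) + 2 * ((1 / 2) ^ N / 8) := by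
    rw [← sub_le_iff_le_add]
    refine le_ciInf fun n => ?_
    have hle : ∀ n < N + 4, φ.eval B w ≤ |η - (1 / 2) ^ n| + (1 / 2) ^ N / 8 := fun n hlt => by
      have h1 := RFormula.mins_le (A := B) (l := (List.range (N + 4)).map fun n =>
        RFormula.absDiff (F.level m v (N + 3)) (.halfPow n))
        (List.mem_map.2 ⟨n, List.mem_range.2 hlt, rfl⟩) w
      have h2 := (abs_le.1 (hn n)).2
      linarith
    by_cases hlt : n < N + 4
    · linarith [hle n hlt]
    · have h4 := hle (N + 3) (by omega)
      have h5 := half_pow_le_half_pow (not_lt.1 hlt)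
      have h5' : (1 / 2 : ℝ) ^ (N + 4) ≤ (1 / 2) ^ (N + 3) := half_pow_le_half_pow (by omega)
      have h6 := half_pow_pos n
      have h7 : |η - (1 / 2) ^ (N + 3)| ≤ |η - (1 / 2) ^ n| + (1 / 2) ^ (N + 3) := by
        have h8 := neg_abs_le (η - (1 / 2) ^ n)
        have h9 := le_abs_self (η - (1 / 2) ^ n)
        rw [abs_le]
        constructor <;> linarith
      linarith
  have h2 : (⨅ n : ℕ, |η - (1 / 2) ^ n|) - 2 * ((1 / 2) ^ N / 8) ≤ φ.eval B w := by
    by_contra! hcon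
    have hi1 : (⨅ n : ℕ, |η - (1 / 2) ^ n|) ≤ 1 := by
      refine (ciInf_le hb 0).trans ?_
      rw [pow_zero, abs_le]
      constructor <;> linarith [hl.1, hl.2]
    have h4 : (⨅ n : ℕ, |η - (1 / 2) ^ n|) - 2 * ((1 / 2) ^ N / 8) < φ.eval B w := by
      refine RFormula.lt_mins (by linarith) fun ψ hψ => ?_
      obtain ⟨n, -, rfl⟩ := List.mem_map.1 hψ
      have h5 := (abs_le.1 (hn n)).1
      have h6 := ciInf_le hb n
      linarith
    exact lt_asymm h4 hcon
  rw [abs_le]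
  constructor <;> linarith

end Reads

end Frame

/-! ## The chain of imaginary expansions -/

theorem range_fin_two {α : Type*} (f : Fin 2 → α) : Set.range f = {f 0, f 1} := by
  ext x
  simp [Fin.exists_fin_two, eq_comm]

section chain

variable {V : Vocab.{v}} (o : ℕ → V.Sorts) (m : ℕ)

/-- The vocabulary with the product. -/
abbrev prodVocab : Vocab.{v} := V.extend (.omegaProd o)

/-- The product in the first expansion. -/
def prodFrame : Frame V o (prodVocab o) where
  prod := none
  inj := some
  proj i := .inr i
  inj_ne _ := nofun
  free_proj _ _ _ := range_fin_two (α := Option V.Sorts × ℕ) _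

/-- The pseudo-metric on the product. -/
def quotFormula : Formula (prodVocab o) := .lim fun N => (prodFrame o).profileDist m (N + 3)

/-- The vocabulary with the quotient. -/
abbrev quotVocab : Vocab.{v} := (prodVocab o).extend (.quot none (quotFormula o m))

/-- The product in the second expansion. -/
def quotFrame : Frame V o (quotVocab o m) where
  prod := some none
  inj s := some (some s)
  proj i := .inl (.inr i)
  inj_ne _ := nofun
  free_proj _ _ _ := range_fin_two (α := Option (Option V.Sorts) × ℕ) _

/-- The distance of the class of the variable with number `v` of the product and the variable with
number `j` of the quotient. -/
def clsDist (v j : ℕ) : RFormula (quotVocab o m) :=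
  .pred (.inr ()) fun k => if k.val = 0 then v else j

/-- The distance to the disjoint union in the quotient. -/
def unionFormula : Formula (quotVocab o m) := .lim fun N =>
  .inf (quotFrame o m).prod 0 (.plus (clsDist o m 0 0) ((quotFrame o m).unionBound m 0 N))

/-- The vocabulary with the disjoint union. -/
abbrev unionVocab : Vocab.{v} := (quotVocab o m).extend (.defSet none (unionFormula o m))

/-- The product in the third expansion. -/
def unionFrame : Frame V o (unionVocab o m) where
  prod := some (some none)
  inj s := some (some (some s))
  proj i := .inl (.inl (.inr i))
  inj_ne _ := nofun
  free_proj _ _ _ := range_fin_two (α := Option (Option (Option V.Sorts)) × ℕ) _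

/-- The chain of expansions. -/
def unionChain : Chain V (unionVocab o m) :=
  .cons (.omegaProd o) (.cons (.quot none (quotFormula o m))
    (.cons (.defSet none (unionFormula o m)) (.nil _)))

/-- The distance of the class of the variable with number `v` of the product and the variable with
number `j` of the disjoint union. -/
def imagDist (v j : ℕ) : RFormula (unionVocab o m) :=
  .sup (some none) 0 (.absDiff (.pred (.inr ()) fun k => if k.val = 0 then j else 0)
    (.pred (.inl (.inr ())) fun k => if k.val = 0 then v else 0))

/-- Approximation of the distance to `∗`. -/
def heightApprox (j N : ℕ) : RFormula (unionVocab o m) :=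
  .inf (unionFrame o m).prod 0 (.plus (imagDist o m 0 j) ((unionFrame o m).starBound m 0 N))

/-- Approximation of the distance to a point of `O n`. -/
def pointApprox (n jx jy N : ℕ) : RFormula (unionVocab o m) :=
  .inf (unionFrame o m).prod 0 (.plus (imagDist o m 0 jy)
    ((unionFrame o m).pointBound m 0 n jx N))

theorem free_clsDist (v j : ℕ) :
    (clsDist o m v j).free = {((quotFrame o m).prod, v), (none, j)} :=
  range_fin_two (α := Option (Option V.Sorts) × ℕ) _

theorem free_imagDist (v j : ℕ) :
    (imagDist o m v j).free = {((unionFrame o m).prod, v), (none, j)} := by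
  have h1 : (RFormula.pred (V := unionVocab o m) (.inr ())
      fun k => if k.val = 0 then j else 0).free = {(none, j), (some none, 0)} :=
    range_fin_two (α := Option (Option (Option V.Sorts)) × ℕ) _
  have h2 : (RFormula.pred (V := unionVocab o m) (.inl (.inr ()))
      fun k => if k.val = 0 then v else 0).free = {(some (some none), v), (some none, 0)} :=
    range_fin_two (α := Option (Option (Option V.Sorts)) × ℕ) _
  unfold imagDist
  simp only [RFormula.free, RFormula.free_absDiff]
  simp only [RFormula.free] at h1 h2
  rw [h1, h2]
  ext x
  change ((x = (none, j) ∨ x = (some none, 0)) ∨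
    (x = (some (some none), v) ∨ x = (some none, 0))) ∧ ¬(x = (some none, 0)) ↔
      x = (some (some none), v) ∨ x = (none, j)
  constructor
  · rintro ⟨(h | h) | (h | h), h'⟩
    · exact .inr h
    · exact absurd h h'
    · exact .inl h
    · exact absurd h h'
  · rintro (rfl | rfl)
    · exact ⟨.inr (.inl rfl), nofun⟩
    · exact ⟨.inl (.inl rfl), nofun⟩

variable {o}

theorem free_heightApprox (ho : ∀ k, o (2 * k + 2) = o 0) (j N : ℕ) :
    (heightApprox o m j N).free ⊆ {(none, j)} := by
  simp only [heightApprox, RFormula.free, RFormula.free_plus, free_imagDist]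
  rintro x ⟨(h | h) | h, h'⟩
  · exact absurd h h'
  · exact h
  · exact absurd ((unionFrame o m).free_starBound ho _ _ _ h) h'

theorem free_pointApprox (ho : ∀ k, o (2 * k + 2) = o 0) (n jx jy N : ℕ) :
    (pointApprox o m n jx jy N).free ⊆
    {(some (some (some (o (2 * n + 1)))), jx), (none, jy)} := by
  simp only [pointApprox, RFormula.free, RFormula.free_plus, free_imagDist]
  rintro x ⟨(h | h) | h, h'⟩
  · exact absurd h h'
  · exact .inr h
  · rcases (unionFrame o m).free_pointBound ho _ _ _ _ _ h with h | h
    · exact absurd h h'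
    · exact .inl h

theorem quotFormula_freeIn (ho : ∀ k, o (2 * k + 2) = o 0) :
    (quotFormula o m).FreeIn {(none, 0), (none, 1)} :=
  Formula.lim_free fun _ => (prodFrame o).free_profileDist ho m _

theorem unionFormula_freeIn (ho : ∀ k, o (2 * k + 2) = o 0) :
    (unionFormula o m).FreeIn {(none, 0)} := by
  refine Formula.lim_free fun N => ?_
  simp only [RFormula.free, RFormula.free_plus, free_clsDist]
  rintro x ⟨(h | h) | h, h'⟩
  · exact absurd h h'
  · exact h
  · exact absurd ((quotFrame o m).free_unionBound ho _ _ _ h) h'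

end chain

/-! ### Values in the expansions by the product and the quotient -/

section validity

variable {V : Vocab.{v}} {o : ℕ → V.Sorts} {m : ℕ} (ho : ∀ k, o (2 * k + 2) = o 0)
  (A : PreStructure.{u, v} V)

variable (o) in
/-- The expansion by the product. -/
noncomputable abbrev prodExp : PreStructure.{u, v} (prodVocab o) :=
  Step.apply A (.omegaProd o) trivial

variable (o) in
/-- The points of the product in the first expansion. -/
def prodReads : (prodFrame o).Reads A (prodExp o A) where
  pt x := x
  el _ x := x
  el_surjective _ := Function.surjective_id
  eval_atom _ _ _ _ := rfl

theorem val₂_quotFormula (x y : (prodExp o A).sort none) :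
    (quotFormula o m).val₂ (prodExp o A) none x y = profileDist ho m (A := A) x y := by
  refine Formula.lim_eval _ _ _
    ((isPseudoMetric_profileDist ho m (A := A) (X := (prodExp o A).sort none) fun x => x).mem x y)
    fun N => ?_
  -- The shift by 3 in `quotFormula` turns the error 6·2^-(N+3) into one below 2^-N, the rate
  -- required by `Formula.lim_eval`.
  have h := (prodReads o A).abs_eval_profileDist_sub_le ho
    (((prodExp o A).base.upd none 0 x).upd none 1 y) m (N + 3)
  have h0 : ((prodExp o A).base.upd none 0 x).upd none 1 y none 0 = x :=
    (PreStructure.Val.upd_of_index_ne _ _ one_ne_zero).trans (PreStructure.Val.upd_self _ _ _ _)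
  have h1 : ((prodExp o A).base.upd none 0 x).upd none 1 y none 1 = y :=
    PreStructure.Val.upd_self _ _ _ _
  have h2 : |((prodFrame o).profileDist m (N + 3)).eval (prodExp o A)
      (((prodExp o A).base.upd none 0 x).upd none 1 y) - profileDist ho m (A := A) x y| ≤
        6 * (1 / 2) ^ (N + 3) := by
    refine le_trans (le_of_eq ?_) h
    exact congrArg₂ (fun x' y' => |((prodFrame o).profileDist m (N + 3)).eval (prodExp o A)
      (((prodExp o A).base.upd none 0 x).upd none 1 y) - profileDist ho m (A := A) x' y'|)
      h0.symm h1.symm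
  refine h2.trans ?_
  rw [pow_add]
  have := half_pow_pos N
  linarith

theorem quotFormula_isPseudoMetric (ho : ∀ k, o (2 * k + 2) = o 0)
    (A : PreStructure.{u, v} V) : IsPseudoMetric ((prodExp o A).sort none)
    ((quotFormula o m).val₂ (prodExp o A) none) := by
  have h : (quotFormula o m).val₂ (prodExp o A) none =
      fun x y => profileDist ho m (A := A) x y :=
    funext fun x => funext fun y => val₂_quotFormula ho A x y
  rw [h]
  exact isPseudoMetric_profileDist ho m (A := A) (X := (prodExp o A).sort none) fun x => x

/-- The supremum distance of profiles is a pseudo-metric in every structure. A lower bound for the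
diameter of H is needed only for the representation of the elements of the union. -/
theorem quot_valid (ho : ∀ k, o (2 * k + 2) = o 0) (A : PreStructure.{u, v} V) :
    Step.Valid (prodExp o A) (.quot none (quotFormula o m)) :=
  ⟨quotFormula_freeIn m ho, quotFormula_isPseudoMetric ho A⟩

variable {A} (hq : Step.Valid (prodExp o A) (.quot none (quotFormula o m)))

/-- The expansion by the quotient. -/
noncomputable abbrev quotExp : PreStructure.{u, v} (quotVocab o m) :=
  Step.apply (prodExp o A) (.quot none (quotFormula o m)) hq

/-- The points of the product in the second expansion. -/
def quotReads : (quotFrame o m).Reads A (quotExp hq) where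
  pt x := x
  el _ x := x
  el_surjective _ := Function.surjective_id
  eval_atom _ _ _ _ := rfl

/-- The class of a point of the product. -/
noncomputable def clsOf (x : (prodExp o A).sort none) : (quotExp hq).sort none :=
  MSort.cls ((prodExp o A).sort none) ((quotFormula o m).val₂ (prodExp o A) none) hq.2 x

theorem eval_clsDist (w : (quotExp hq).Val) (v j : ℕ) : (clsDist o m v j).eval (quotExp hq) w =
    dist (clsOf hq (w (some none) v)) (w none j) := rfl

/-- The map `κ` is an embedding of the disjoint union into the quotient. -/
abbrev IsQuotEmbedding (κ : Cmdu A (fun k => o (2 * k + 1)) → (quotExp hq).sort none) : Prop :=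
  IsEmbedding ho (X := (prodExp o A).sort none) (fun x => x) hq.2 m κ

theorem exists_isQuotEmbedding (hd : ∃ a b : A.sort (o 0), (1 / 2 : ℝ) ^ m < dist a b) :
    ∃ κ, IsQuotEmbedding ho hq κ :=
  exists_isEmbedding ho hd (X := (prodExp o A).sort none) (fun x => x) Function.surjective_id hq.2
    fun x y => val₂_quotFormula ho A x y

variable {hq} {ho} {κ : Cmdu A (fun k => o (2 * k + 1)) → (quotExp hq).sort none}

theorem infDist_mem_unit {X : MSort.{u}} (z : X) {K : Set X} (hK : K.Nonempty) :
    Metric.infDist z K ∈ Set.Icc (0 : ℝ) 1 := by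
  obtain ⟨u, hu⟩ := hK
  exact ⟨Metric.infDist_nonneg, (Metric.infDist_le_dist_of_mem hu).trans (X.dist_le_one _ _)⟩

/-- Here F(p) is three times the distance of the level to the set of powers 2^-n. It bounds the
distance of the class of p to the union, and it vanishes for representatives. -/
theorem IsQuotEmbedding.eval_unionFormula (hκ : IsQuotEmbedding ho hq κ) (w : (quotExp hq).Val) :
    (unionFormula o m).eval (quotExp hq) w = Metric.infDist (w none 0) (Set.range κ) := by
  have hne : (Set.range κ).Nonempty := ⟨κ .star, .star, rfl⟩
  refine Formula.lim_eval _ _ _ (infDist_mem_unit _ hne) fun N => ?_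
  have hb : ∀ η : ℝ, BddBelow (Set.range fun n : ℕ => |η - (1 / 2) ^ n|) := fun η =>
    ⟨0, by rintro _ ⟨n, rfl⟩; exact abs_nonneg _⟩
  have h := abs_iInf_sub_infDist_le (X := (prodExp o A).sort none)
    (((quotExp hq).sort none).dist_le_one) (clsOf hq) (K := Set.range κ)
    (fun p => 3 * ⨅ n : ℕ, |level ho m (A := A) p - (1 / 2) ^ n|)
    (fun p => ((quotFrame o m).unionBound m 0 N).eval (quotExp hq) (w.upd (some none) 0 p))
    (ε := (1 / 2) ^ N) hne ?_ ?_ ?_ ?_ (w none 0)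
  · refine le_trans (le_of_eq ?_) h
    congr 2
    refine iInf_congr fun p => ?_
    rw [RFormula.eval_plus, eval_clsDist]
    congr 3
    · exact congrArg (clsOf hq) (w.upd_self _ _ _)
    · exact w.upd_of_sort_ne _ _ _ nofun
  · intro p
    rw [Real.mul_iInf_of_nonneg zero_le_three]
    refine le_ciInf fun n => ?_
    -- For each n, the class of p is compared with the element of O_n given by its own coordinate,
    -- so that only the difference of levels remains.
    refine (Metric.infDist_le_dist_of_mem (Set.mem_range_self
      (.pt n ((show ∀ i, A.sort (o i) from p) (2 * n + 1))))).trans ?_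
    refine (hκ.dist_pt_le p n _).trans (le_of_eq ?_)
    rw [dist_self, add_zero]
  · rintro _ ⟨u, rfl⟩
    obtain ⟨p, hp, hl, -⟩ := hκ.exists_rep u
    refine ⟨p, hp, ?_⟩
    have h0 : (⨅ n : ℕ, |level ho m (A := A) p - (1 / 2) ^ n|) ≤ 0 := by
      rw [hl]
      cases u with
      | star =>
        -- For ∗ the infimum of |0 - 2^-n| is 0 but not attained.
        refine ge_of_tendsto' (x := Filter.atTop) (f := fun n : ℕ => (1 / 2 : ℝ) ^ n)
          (tendsto_pow_atTop_nhds_zero_of_lt_one (by norm_num) (by norm_num)) fun n => ?_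
        refine (ciInf_le (hb _) n).trans ?_
        simp [Cmdu.height]
      | pt n x =>
        refine (ciInf_le (hb _) n).trans ?_
        simp [Cmdu.height]
    rw [le_antisymm h0 (Real.iInf_nonneg fun n => abs_nonneg _), mul_zero]
  · intro p
    have := (quotReads hq).abs_eval_unionBound_sub_le ho (w.upd (some none) 0 p) m 0 N
    refine le_trans (le_of_eq ?_) this
    exact congrArg (fun q => |((quotFrame o m).unionBound m 0 N).eval (quotExp hq)
      (w.upd (some none) 0 p) - min 1 (3 * ⨅ n : ℕ, |level ho m (A := A) q - (1 / 2) ^ n|)|)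
      (w.upd_self (quotFrame o m).prod 0 p).symm
  · intro p
    exact RFormula.eval_nonneg _ _ _

theorem IsQuotEmbedding.val₁_unionFormula (hκ : IsQuotEmbedding ho hq κ)
    (z : (quotExp hq).sort none) :
    (unionFormula o m).val₁ (quotExp hq) none z = Metric.infDist z (Set.range κ) :=
  (hκ.eval_unionFormula _).trans
    (congrArg (fun z => Metric.infDist z (Set.range κ)) (PreStructure.Val.upd_self _ _ _ _))

/-- The isometric image of a complete space is closed, so the zero set of the distance to it adds no
points. -/
theorem IsQuotEmbedding.val₁_eq_zero_iff (hκ : IsQuotEmbedding ho hq κ)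
    (z : (quotExp hq).sort none) :
    (unionFormula o m).val₁ (quotExp hq) none z = 0 ↔ ∃ u, κ u = z := by
  rw [hκ.val₁_unionFormula]
  have hc : IsClosed (Set.range κ) := hκ.isometry.isClosedEmbedding.isClosed_range
  exact (hc.mem_iff_infDist_zero ⟨κ .star, .star, rfl⟩).symm

theorem IsQuotEmbedding.valid (hκ : IsQuotEmbedding ho hq κ) :
    Step.Valid (quotExp hq) (.defSet none (unionFormula o m)) := by
  have hs : {z | (unionFormula o m).val₁ (quotExp hq) none z = 0} = Set.range κ :=
    Set.ext fun z => hκ.val₁_eq_zero_iff z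
  refine ⟨unionFormula_freeIn m ho, ?_, fun z => ?_⟩
  · rw [hs]
    exact ⟨κ .star, .star, rfl⟩
  · rw [hs]
    exact hκ.val₁_unionFormula z

end validity

/-! ### Values in the expansion by the disjoint union -/

section expansion

variable {V : Vocab.{v}} {o : ℕ → V.Sorts} {m : ℕ} {ho : ∀ k, o (2 * k + 2) = o 0}
  {A : PreStructure.{u, v} V} {hq : Step.Valid (prodExp o A) (.quot none (quotFormula o m))}
  (hu : Step.Valid (quotExp hq) (.defSet none (unionFormula o m)))

/-- The expansion by the disjoint union. -/
noncomputable abbrev unionExp : PreStructure.{u, v} (unionVocab o m) :=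
  Step.apply (quotExp hq) (.defSet none (unionFormula o m)) hu

/-- The points of the product in the third expansion. -/
def unionReads : (unionFrame o m).Reads A (unionExp hu) where
  pt x := x
  el _ x := x
  el_surjective _ := Function.surjective_id
  eval_atom _ _ _ _ := rfl

/-- The inclusion of the disjoint union in the quotient. -/
def inclusion (y : (unionExp hu).sort none) : (quotExp hq).sort none :=
  (show {z : (quotExp hq).sort none // (unionFormula o m).val₁ (quotExp hq) none z = 0} from y).1

theorem inclusion_injective : Function.Injective (inclusion hu) := fun _ _ h => Subtype.ext h

/-- No predicate symbol relates the product and the new subset directly. The inclusion and the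
quotient predicate both measure distances to elements of the quotient, and the supremum over these
recovers the distance, by `iSup_abs_dist_sub_dist`. -/
theorem eval_imagDist (w : (unionExp hu).Val) (v j : ℕ) :
    (imagDist o m v j).eval (unionExp hu) w =
      dist (clsOf hq (w (some (some none)) v)) (inclusion hu (w none j)) := by
  have h := iSup_abs_dist_sub_dist (X := (quotExp hq).sort none) (fun a => a)
    Function.surjective_id ((quotExp hq).sort none).dist_le_one
    (inclusion hu (w none j)) (clsOf hq (w (some (some none)) v))
  rw [dist_comm, ← h]
  refine iSup_congr fun a => ?_
  rw [RFormula.eval_absDiff]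
  have h1 : w.upd (some none) 0 a (some none) 0 = a := w.upd_self _ _ _
  have h2 : w.upd (some none) 0 a none j = w none j := w.upd_of_sort_ne _ _ _ nofun
  have h3 : w.upd (some none) 0 a (some (some none)) v = w (some (some none)) v :=
    w.upd_of_sort_ne _ _ _ nofun
  have e1 : RFormula.eval (unionExp hu) (.pred (.inr ()) fun k => if k.val = 0 then j else 0)
      (w.upd (some none) 0 a) = dist (inclusion hu (w none j)) a :=
    congrArg₂ (fun x y => dist (inclusion hu x) y) h2 h1
  have e2 : RFormula.eval (unionExp hu) (.pred (.inl (.inr ())) fun k => if k.val = 0 then v else 0)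
      (w.upd (some none) 0 a) = dist (clsOf hq (w (some (some none)) v)) a :=
    congrArg₂ (fun x y => dist (clsOf hq x) y) h3 h1
  exact congrArg₂ (fun x y => |x - y|) e1 e2

variable {hu} {κ : Cmdu A (fun k => o (2 * k + 1)) → (quotExp hq).sort none}

theorem IsQuotEmbedding.exists_isometryEquiv (hκ : IsQuotEmbedding ho hq κ) :
    ∃ e : (unionExp hu).sort none ≃ᵢ Cmdu A (fun k => o (2 * k + 1)),
      ∀ y, κ (e y) = inclusion hu y := by
  have h0 : ∀ u, (unionFormula o m).val₁ (quotExp hq) none (κ u) = 0 := fun u =>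
    (hκ.val₁_eq_zero_iff _).2 ⟨u, rfl⟩
  have h1 : ∀ y : (unionExp hu).sort none, ∃ u, κ u = inclusion hu y := fun y =>
    (hκ.val₁_eq_zero_iff _).1 (Subtype.prop
      (show {z : (quotExp hq).sort none // (unionFormula o m).val₁ (quotExp hq) none z = 0} from y))
  choose g hg using h1
  let f : Cmdu A (fun k => o (2 * k + 1)) → (unionExp hu).sort none := fun u =>
    (⟨κ u, h0 u⟩ : {z : (quotExp hq).sort none // (unionFormula o m).val₁ (quotExp hq) none z = 0})
  refine ⟨(IsometryEquiv.mk' f g (fun y => inclusion_injective hu (hg y)) ?_).symm, hg⟩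
  exact Isometry.of_dist_eq fun x y => hκ.isometry.dist_eq x y

variable {e : (unionExp hu).sort none ≃ᵢ Cmdu A (fun k => o (2 * k + 1))}

/-- The infimal convolution with K the image of ∗ and F three times the level. -/
theorem IsQuotEmbedding.abs_eval_heightApprox_sub_le (hκ : IsQuotEmbedding ho hq κ)
    (he : ∀ y, κ (e y) = inclusion hu y) (w : (unionExp hu).Val) (j N : ℕ) :
    |(heightApprox o m j N).eval (unionExp hu) w - Cmdu.height A _ (e (w none j))| ≤
      (1 / 2) ^ N := by
  have h := abs_iInf_sub_infDist_le (X := (prodExp o A).sort none)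
    (((quotExp hq).sort none).dist_le_one) (clsOf hq) (K := {κ .star})
    (fun p => 3 * level ho m (A := A) p)
    (fun p => ((unionFrame o m).starBound m 0 N).eval (unionExp hu) (w.upd (some (some none)) 0 p))
    (ε := (1 / 2) ^ N) ⟨_, rfl⟩ ?_ ?_ ?_ ?_ (inclusion hu (w none j))
  · have hz : Metric.infDist (inclusion hu (w none j)) {κ .star} =
        Cmdu.height A _ (e (w none j)) := by
      rw [Metric.infDist_singleton, ← he]
      exact (hκ.isometry.dist_eq _ _).trans (Cmdu.dist_star _)
    rw [hz] at h
    refine le_trans (le_of_eq ?_) h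
    congr 2
    refine iInf_congr fun p => ?_
    rw [RFormula.eval_plus, eval_imagDist]
    congr 3
    · exact congrArg (clsOf hq) (w.upd_self _ _ _)
    · exact congrArg (inclusion hu) (w.upd_of_sort_ne _ _ _ nofun)
  · intro p
    rw [Metric.infDist_singleton]
    exact hκ.dist_star_le p
  · rintro _ rfl
    obtain ⟨p, hp, hl, -⟩ := hκ.exists_rep .star
    exact ⟨p, hp, by rw [hl]; exact mul_zero _⟩
  · intro p
    have := (unionReads hu).abs_eval_starBound_sub_le ho (w.upd (some (some none)) 0 p) m 0 N
    refine le_trans (le_of_eq ?_) this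
    exact congrArg (fun q => |((unionFrame o m).starBound m 0 N).eval (unionExp hu)
      (w.upd (some (some none)) 0 p) - min 1 (3 * level ho m (A := A) q)|)
      (w.upd_self (unionFrame o m).prod 0 p).symm
  · intro p
    exact RFormula.eval_nonneg _ _ _

/-- The infimal convolution with K the image of the point x of O_n. The formula refers to x through
the coordinate in O_n, by a projection predicate, so it defines the bijection between the sort and
its copy. -/
theorem IsQuotEmbedding.abs_eval_pointApprox_sub_le (hκ : IsQuotEmbedding ho hq κ)
    (he : ∀ y, κ (e y) = inclusion hu y) (w : (unionExp hu).Val) (n jx jy N : ℕ) :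
    |(pointApprox o m n jx jy N).eval (unionExp hu) w -
      dist (.pt n (w (some (some (some (o (2 * n + 1))))) jx)) (e (w none jy))| ≤ (1 / 2) ^ N := by
  let x : A.sort (o (2 * n + 1)) := w (some (some (some (o (2 * n + 1))))) jx
  have h := abs_iInf_sub_infDist_le (X := (prodExp o A).sort none)
    (((quotExp hq).sort none).dist_le_one) (clsOf hq) (K := {κ (.pt n x)})
    (fun p => 3 * |level ho m (A := A) p - (1 / 2) ^ n| +
      dist ((show ∀ i, A.sort (o i) from p) (2 * n + 1)) x)
    (fun p => ((unionFrame o m).pointBound m 0 n jx N).eval (unionExp hu)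
      (w.upd (some (some none)) 0 p))
    (ε := (1 / 2) ^ N) ⟨_, rfl⟩ ?_ ?_ ?_ ?_ (inclusion hu (w none jy))
  · have hz : Metric.infDist (inclusion hu (w none jy)) {κ (.pt n x)} =
        dist (.pt n x) (e (w none jy)) := by
      rw [Metric.infDist_singleton, ← he]
      exact (hκ.isometry.dist_eq _ _).trans (dist_comm _ _)
    rw [hz] at h
    refine le_trans (le_of_eq ?_) h
    congr 2
    refine iInf_congr fun p => ?_
    rw [RFormula.eval_plus, eval_imagDist]
    congr 3
    · exact congrArg (clsOf hq) (w.upd_self _ _ _)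
    · exact congrArg (inclusion hu) (w.upd_of_sort_ne _ _ _ nofun)
  · intro p
    rw [Metric.infDist_singleton]
    exact hκ.dist_pt_le p n x
  · rintro _ rfl
    obtain ⟨p, hp, hl, hx⟩ := hκ.exists_rep (.pt n x)
    refine ⟨p, hp, ?_⟩
    have hx' : (show ∀ i, A.sort (o i) from p) (2 * n + 1) = x := hx n x rfl
    rw [hl, hx', dist_self, add_zero]
    simp [Cmdu.height]
  · intro p
    have := (unionReads hu).abs_eval_pointBound_sub_le ho (w.upd (some (some none)) 0 p) m 0 n jx N
    refine le_trans (le_of_eq ?_) this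
    exact congrArg₂ (fun q x => |((unionFrame o m).pointBound m 0 n jx N).eval (unionExp hu)
      (w.upd (some (some none)) 0 p) - min 1 (3 * |level ho m (A := A) q - (1 / 2) ^ n| +
        dist ((show ∀ i, A.sort (o i) from q) (2 * n + 1)) x)|)
      (w.upd_self (unionFrame o m).prod 0 p).symm
      (w.upd_of_sort_ne (s := (unionFrame o m).prod) (t := some (some (some (o (2 * n + 1)))))
        0 jx p nofun).symm
  · intro p
    exact RFormula.eval_nonneg _ _ _

end expansion

/-! ## The interpretation -/

section interp

variable {V : Vocab.{v}} (o : ℕ → V.Sorts) (m : ℕ) (c : V.Preds → ℕ → ℕ)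

/-- The variables for the points of the sorts. -/
def sortVars {n : ℕ} (s : Fin n → V.Sorts) : List ((unionVocab o m).Sorts × ℕ) :=
  List.ofFn fun l => (some (some (some (s l))), l)

/-- A number `J` such that points of the disjoint union whose distance is less than `2 ^ -(J-1)`
belong to the same sort, and the values of the predicate `p` there differ by at most `2 ^ -k`. -/
def scale (p : V.Preds) (i : Fin (V.ar p) → ℕ) (k : ℕ) : ℕ := Finset.univ.sup i + c p k + 3

/-- Approximation of an extended predicate. -/
def extApprox (p : V.Preds) (i : Fin (V.ar p) → ℕ) (k : ℕ) : RFormula (unionVocab o m) :=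
  .infs (sortVars o m (V.dom p)) (.plus (.pred (.inl (.inl (.inl p))) fun l => l)
    (RFormula.double^[scale c p i k] (.maxs (List.ofFn fun l : Fin (V.ar p) =>
      pointApprox o m (i l) l l (scale c p i k + k)))))

/-- The interpretation of the disjoint union as an imaginary. -/
def unionInterp : Interp V (fun k => o (2 * k + 1)) where
  W := unionVocab o m
  chain := unionChain o m
  imag := none
  predForm q := match q with
    | none => .lim (heightApprox o m 0)
    | some q => .lim (extApprox o m c q.1 q.2.1)
  partForm n := .lim fun N => .absDiff (heightApprox o m 0 N) (.halfPow n)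
  bijForm n := .lim (pointApprox o m n 0 1)

variable {o}

theorem free_extApprox (ho : ∀ k, o (2 * k + 2) = o 0) (p : V.Preds) (i : Fin (V.ar p) → ℕ)
    (hi : ∀ l, o (2 * i l + 1) = V.dom p l) (k : ℕ) :
    (extApprox o m c p i k).free ⊆ Set.range fun l : Fin (V.ar p) => (none, (l : ℕ)) := by
  rw [extApprox, RFormula.free_infs, RFormula.free_plus, RFormula.free_double_iterate]
  rintro x ⟨h | h, h'⟩
  · obtain ⟨l, rfl⟩ := h
    exact absurd (show _ ∈ sortVars o m (V.dom p) from List.mem_ofFn.2 ⟨l, rfl⟩) h'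
  · have hF : (RFormula.maxs (List.ofFn fun l : Fin (V.ar p) =>
        pointApprox o m (i l) l l (scale c p i k + k))).free ⊆
        {x | x ∈ sortVars o m (V.dom p)} ∪ Set.range fun l : Fin (V.ar p) => (none, (l : ℕ)) := by
      refine RFormula.free_maxs_subset fun φ hφ => ?_
      obtain ⟨l, rfl⟩ := List.mem_ofFn.1 hφ
      refine (free_pointApprox m ho _ _ _ _).trans ?_
      rintro _ (rfl | rfl)
      · refine .inl (List.mem_ofFn.2 ⟨l, ?_⟩)
        exact congrArg (fun s => (some (some (some s)), (l : ℕ))) (hi l).symm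
      · exact .inr ⟨l, rfl⟩
    exact (hF h).resolve_left h'

/-- The listed variables carry different indices, hence are distinct even if some of the sorts
coincide. -/
theorem exists_assignment {W : Vocab.{v}} {B : PreStructure.{u, v} W} (w : B.Val) {n : ℕ}
    (s : Fin n → W.Sorts) (z : ∀ l, B.sort (s l)) :
    ∃ w' : B.Val, (∀ t j, (t, j) ∉ List.ofFn (fun l => (s l, (l : ℕ))) → w' t j = w t j) ∧
      ∀ l, w' (s l) l = z l := by
  classical
  refine ⟨fun t j => if h : ∃ hj : j < n, s ⟨j, hj⟩ = t then h.2 ▸ z ⟨j, h.1⟩ else w t j,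
    fun t j h => dif_neg fun ⟨hj, hs⟩ => h (List.mem_ofFn.2 ⟨⟨j, hj⟩, by simp [hs]⟩), fun l => ?_⟩
  exact dif_pos ⟨l.2, rfl⟩

/-! ### Correctness of the interpretation -/

section eval

variable {m} {c} {ho : ∀ k, o (2 * k + 2) = o 0} {A : PreStructure.{u, v} V}
  {hq : Step.Valid (prodExp o A) (.quot none (quotFormula o m))}
  {hu : Step.Valid (quotExp hq) (.defSet none (unionFormula o m))}
  {κ : Cmdu A (fun k => o (2 * k + 1)) → (quotExp hq).sort none}
  {e : (unionExp hu).sort none ≃ᵢ Cmdu A (fun k => o (2 * k + 1))}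

/-- The formula minimizes P(z) plus 2^J times the largest distance of the copies of the z_l to the
arguments. A penalty below 1 forces each argument into its piece, by the gap, and forces z so close
to the corresponding tuple that P changes by at most 2^-k. Outside of the domain every penalty
therefore reaches 1, which gives the value 1. -/
theorem IsQuotEmbedding.abs_eval_extApprox_sub_le (hκ : IsQuotEmbedding ho hq κ)
    (he : ∀ y, κ (e y) = inclusion hu y)
    (hc : ∀ p k (x y : ∀ l, A.sort (V.dom p l)), (∀ l, dist (x l) (y l) ≤ (1 / 2) ^ c p k) →
      |A.pred p x - A.pred p y| ≤ (1 / 2) ^ k)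
    (p : V.Preds) (i : Fin (V.ar p) → ℕ) (hi : ∀ l, o (2 * i l + 1) = V.dom p l)
    (w : (unionExp hu).Val) (k : ℕ) :
    |(extApprox o m c p i k).eval (unionExp hu) w -
      Cmdu.extPred A (fun k => o (2 * k + 1)) p i hi fun l => e (w none l)| ≤ (1 / 2) ^ k := by
  set J := scale c p i k with hJ
  have hpk := half_pow_pos k
  have hJ1 : (2 : ℝ) ^ J * (1 / 2) ^ (J + k) = (1 / 2) ^ k := by
    rw [pow_add]
    exact two_pow_mul_half_pow J _
  have hev : ∀ w' : (unionExp hu).Val, RFormula.eval (unionExp hu)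
      (.plus (.pred (.inl (.inl (.inl p))) fun l => l)
      (RFormula.double^[J] (.maxs (List.ofFn fun l : Fin (V.ar p) =>
        pointApprox o m (i l) l l (J + k))))) w' =
      min 1 (A.pred p (fun l => w' (some (some (some (V.dom p l)))) l) + min 1 (2 ^ J *
        (RFormula.maxs (List.ofFn fun l : Fin (V.ar p) =>
          pointApprox o m (i l) l l (J + k))).eval (unionExp hu) w')) := fun w' => by
    rw [RFormula.eval_plus, RFormula.eval_double_iterate]
    rfl
  have hB : ∀ (w' : (unionExp hu).Val) (l : Fin (V.ar p)),
      |(pointApprox o m (i l) l l (J + k)).eval (unionExp hu) w' -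
        dist (Cmdu.inc (A := A) (O := fun k => o (2 * k + 1)) (i l) (hi l)
          (w' (some (some (some (V.dom p l)))) l)) (e (w' none l))| ≤
            (1 / 2) ^ (J + k) := fun w' l => by
    have hcast : ∀ (s : V.Sorts) (h : o (2 * i l + 1) = s),
        (Cmdu.inc (i l) h (w' (some (some (some s))) l) : Cmdu A (fun k => o (2 * k + 1))) =
          .pt (i l) (w' (some (some (some (o (2 * i l + 1))))) l) := by
      rintro _ rfl
      rfl
    rw [hcast _ (hi l)]
    exact hκ.abs_eval_pointApprox_sub_le he w' (i l) l l (J + k)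
  have hout : ∀ w' : (unionExp hu).Val,
      (∀ t j, (t, j) ∉ sortVars o m (V.dom p) → w' t j = w t j) →
      ∀ l : Fin (V.ar p), w' none l = w none l := fun w' h l => h _ _ fun hmem => by
    obtain ⟨l', hl'⟩ := List.mem_ofFn.1 hmem
    exact absurd (congrArg Prod.fst hl') nofun
  have hsup : ∀ l, (1 / 2 : ℝ) ^ Finset.univ.sup i ≤ (1 / 2) ^ i l := half_pow_sup_le i
  -- A penalty below 1 bounds distances by 2·2^-J, that is 2^-N 2^-c / 4. This is less than the gap
  -- 2^-N/2, and after rescaling by at most 2^N it is less than 2^-c.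
  have hJpow : (1 / 2 : ℝ) ^ J = (1 / 2) ^ Finset.univ.sup i * (1 / 2) ^ c p k / 8 := by
    rw [hJ, scale, pow_add, pow_add]
    ring
  have hJk : (1 / 2 : ℝ) ^ (J + k) ≤ (1 / 2) ^ J := half_pow_le_half_pow (by omega)
  have hN := half_pow_pos (Finset.univ.sup i)
  have hcp := half_pow_pos (c p k)
  have hcp1 := half_pow_le_one (c p k)
  -- points that are close to the given ones
  have hclose : ∀ w' : (unionExp hu).Val,
      (∀ t j, (t, j) ∉ sortVars o m (V.dom p) → w' t j = w t j) →
      (2 : ℝ) ^ J * (RFormula.maxs (List.ofFn fun l : Fin (V.ar p) =>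
        pointApprox o m (i l) l l (J + k))).eval (unionExp hu) w' < 1 →
      ∀ l : Fin (V.ar p), dist (Cmdu.inc (A := A) (O := fun k => o (2 * k + 1)) (i l) (hi l)
        (w' (some (some (some (V.dom p l)))) l)) (e (w none l)) ≤
          (1 / 2) ^ Finset.univ.sup i * (1 / 2) ^ c p k / 4 := by
    intro w' hw' hlt l
    have h1 := RFormula.le_maxs (List.mem_ofFn.2 ⟨l, rfl⟩ :
      pointApprox o m (i l) l l (J + k) ∈ List.ofFn fun l : Fin (V.ar p) =>
        pointApprox o m (i l) l l (J + k)) w'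
    have h2 := (abs_le.1 (hB w' l)).1
    rw [hout w' hw' l] at h2
    have h3 : (RFormula.maxs (List.ofFn fun l : Fin (V.ar p) =>
        pointApprox o m (i l) l l (J + k))).eval (unionExp hu) w' < (1 / 2) ^ J := by
      rw [← two_pow_mul_half_pow J 1] at hlt
      have := lt_of_mul_lt_mul_left hlt (by positivity)
      rwa [mul_one] at this
    linarith
  by_cases hz : ∃ z : ∀ l, A.sort (V.dom p l), ∀ l : Fin (V.ar p),
      e (w none l) = Cmdu.inc (A := A) (O := fun k => o (2 * k + 1)) (i l) (hi l) (z l)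
  · obtain ⟨z, hz⟩ := hz
    rw [show (fun l : Fin (V.ar p) => e (w none l)) = _ from funext hz, Cmdu.extPred_inc]
    rw [abs_le]
    constructor
    · rw [neg_le_sub_iff_le_add, ← sub_le_iff_le_add]
      refine RFormula.le_infs _ fun w' hw' => ?_
      rw [hev]
      have hz1 := (A.pred_mem p z).2
      have h0 := (A.pred_mem p fun l => w' (some (some (some (V.dom p l)))) l).1
      have hm0 := RFormula.eval_nonneg (unionExp hu) (.maxs (List.ofFn fun l : Fin (V.ar p) =>
        pointApprox o m (i l) l l (J + k))) w'
      -- A penalty of at least 1 makes the value 1, which is no less than P(z).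
      rcases le_or_gt 1 ((2 : ℝ) ^ J * (RFormula.maxs (List.ofFn fun l : Fin (V.ar p) =>
          pointApprox o m (i l) l l (J + k))).eval (unionExp hu) w') with h1 | h1
      · rw [min_eq_left h1]
        exact le_min (by linarith) (by linarith)
      · have hd := hclose w' hw' h1
        have h2 := hc p k z (fun l => w' (some (some (some (V.dom p l)))) l) fun l => by
          have h3 := hd l
          rw [hz l] at h3
          replace h3 := (Cmdu.dist_inc (A := A) (O := fun k => o (2 * k + 1)) (hi l)
            (w' (some (some (some (V.dom p l)))) l) (z l)).symm.le.trans h3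
          have h4 := mul_le_mul_of_nonneg_right (hsup l)
            (dist_nonneg (x := w' (some (some (some (V.dom p l)))) l) (y := z l))
          have h5 : (1 / 2 : ℝ) ^ Finset.univ.sup i *
              dist (w' (some (some (some (V.dom p l)))) l) (z l) ≤
              (1 / 2) ^ Finset.univ.sup i * (1 / 2) ^ c p k :=
            (h4.trans h3).trans (by nlinarith)
          exact (dist_comm _ _).trans_le (le_of_mul_le_mul_left h5 hN)
        have h3 := (abs_le.1 h2).2
        have h4 : 0 ≤ min 1 ((2 : ℝ) ^ J * (RFormula.maxs (List.ofFn fun l : Fin (V.ar p) =>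
          pointApprox o m (i l) l l (J + k))).eval (unionExp hu) w') :=
            le_min zero_le_one (by positivity)
        exact le_min (by linarith) (by linarith)
    · rw [sub_le_iff_le_add]
      -- The witness is z itself. Its true penalty is 0, and the precision J + k of `pointApprox`
      -- bounds the computed one by 2^J 2^-(J+k) = 2^-k.
      obtain ⟨w', hw', hwz⟩ := exists_assignment w
        (fun l => (some (some (some (V.dom p l))) : (unionVocab o m).Sorts)) z
      refine (RFormula.infs_le _ hw').trans ?_
      rw [hev]
      have hm : (RFormula.maxs (List.ofFn fun l : Fin (V.ar p) =>
          pointApprox o m (i l) l l (J + k))).eval (unionExp hu) w' ≤ (1 / 2) ^ (J + k) := by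
        refine RFormula.maxs_le (half_pow_pos _).le fun φ hφ => ?_
        obtain ⟨l, rfl⟩ := List.mem_ofFn.1 hφ
        have h1 := hB w' l
        have h2 : (w' (some (some (some (V.dom p l)))) l : A.sort (V.dom p l)) = z l := hwz l
        rw [hout w' hw' l, hz l, h2, dist_self, sub_zero] at h1
        exact (le_abs_self _).trans h1
      have hzw : (fun l : Fin (V.ar p) => (w' (some (some (some (V.dom p l)))) l :
          A.sort (V.dom p l))) = z := funext hwz
      refine (min_le_right _ _).trans ?_
      rw [add_comm]
      refine add_le_add ((min_le_right _ _).trans ?_) (congrArg (A.pred p) hzw).le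
      rw [← hJ1]
      exact mul_le_mul_of_nonneg_left hm (by positivity)
  · rw [Cmdu.extPred_of_not (A := A) (O := fun k => o (2 * k + 1)) hi hz]
    have h1 : 1 ≤ (extApprox o m c p i k).eval (unionExp hu) w := by
      refine RFormula.le_infs _ fun w' hw' => ?_
      rw [hev]
      have h0 := (A.pred_mem p fun l => w' (some (some (some (V.dom p l)))) l).1
      rcases le_or_gt 1 ((2 : ℝ) ^ J * (RFormula.maxs (List.ofFn fun l : Fin (V.ar p) =>
          pointApprox o m (i l) l l (J + k))).eval (unionExp hu) w') with h1 | h1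
      · rw [min_eq_left h1]
        exact le_min le_rfl (by linarith)
      · refine absurd ?_ hz
        have hd := hclose w' hw' h1
        have : ∀ l : Fin (V.ar p), ∃ y,
            e (w none l) = Cmdu.inc (A := A) (O := fun k => o (2 * k + 1)) (i l) (hi l) y :=
          fun l => (Cmdu.gap_inc (A := A) (O := fun k => o (2 * k + 1)) (hi l) _
            (e (w none l))).resolve_right fun h => by
            have h2 := h.trans (hd l)
            have h3 := hsup l
            nlinarith
        choose z hz using this
        exact ⟨z, hz⟩
    rw [le_antisymm (RFormula.eval_le_one _ _ _) h1, sub_self, abs_zero]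
    exact hpk.le

theorem unionInterp_correctIn (ho : ∀ k, o (2 * k + 2) = o 0) (A : PreStructure.{u, v} V)
    (hd : ∃ a b : A.sort (o 0), (1 / 2 : ℝ) ^ m < dist a b)
    (hc : ∀ p k (x y : ∀ l, A.sort (V.dom p l)), (∀ l, dist (x l) (y l) ≤ (1 / 2) ^ c p k) →
      |A.pred p x - A.pred p y| ≤ (1 / 2) ^ k) : (unionInterp o m c).CorrectIn A := by
  have hq := quot_valid (m := m) ho A
  obtain ⟨κ, hκ⟩ := exists_isQuotEmbedding ho hq hd
  have hu := hκ.valid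
  obtain ⟨e, he⟩ := hκ.exists_isometryEquiv (hu := hu)
  have hh : ∀ (w : (unionExp hu).Val) j, Cmdu.height A _ (e (w none j)) ∈ Set.Icc (0 : ℝ) 1 :=
    fun w j => Cmdu.height_mem _
  refine ⟨⟨trivial, hq, hu, trivial⟩, e, fun q => ?_, fun n w => ?_, fun n w x hx => ?_⟩
  · rcases q with _ | ⟨p, i, hi⟩
    · intro w
      refine (Formula.lim_eval (heightApprox o m 0) (unionExp hu) w (hh w 0) fun N =>
        hκ.abs_eval_heightApprox_sub_le he w 0 N).trans ?_
      exact (Cmdu.dist_star _).symm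
    · intro w
      exact Formula.lim_eval (extApprox o m c p i) (unionExp hu) w (Cmdu.extPred_mem (A := A)
        (O := fun k => o (2 * k + 1)) (p := p) (i := i) hi _) fun k =>
        hκ.abs_eval_extApprox_sub_le he hc p i hi w k
  · have h0 : ∀ (w : (unionExp hu).Val) N,
        |(RFormula.absDiff (heightApprox o m 0 N) (.halfPow n)).eval (unionExp hu) w -
          abs (Cmdu.height A _ (e (w none 0)) - (1 / 2) ^ n)| ≤ (1 / 2) ^ N := fun w N => by
      rw [RFormula.eval_absDiff, RFormula.eval_halfPow]
      refine (abs_abs_sub_abs_le_abs_sub _ _).trans ?_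
      rw [sub_sub_sub_cancel_right]
      exact hκ.abs_eval_heightApprox_sub_le he w 0 N
    have h1 : (Formula.lim fun N => .absDiff (heightApprox o m 0 N) (.halfPow n)).eval
        (unionExp hu) w = |Cmdu.height A _ (e (w none 0)) - (1 / 2) ^ n| := by
      exact Formula.lim_eval _ _ _ ⟨abs_nonneg _, abs_sub_le_one (hh w 0)
        ⟨(half_pow_pos n).le, half_pow_le_one n⟩⟩ fun N => h0 w N
    refine h1.trans ((Cmdu.infDist_part n _).symm.trans ?_)
    -- The distance to O_n was computed in the union; the isometry carries it to the imaginary sort.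
    have h2 := Metric.infDist_image (Φ := e) e.isometry (x := w none 0)
      (t := e ⁻¹' Cmdu.part A (fun k => o (2 * k + 1)) n)
    rw [Set.image_preimage_eq _ e.surjective] at h2
    exact h2
  · have h1 : (Formula.lim (pointApprox o m n 0 1)).eval (unionExp hu) w =
        dist (.pt n (w (some (some (some (o (2 * n + 1))))) 0)) (e (w none 1)) :=
      Formula.lim_eval _ _ _ ⟨dist_nonneg, Cmdu.dist_le_one _ _ _ _⟩ fun N =>
        hκ.abs_eval_pointApprox_sub_le he w n 0 1 N
    refine h1.trans ?_
    have hx' : (w (some (some (some (o (2 * n + 1))))) 0 : A.sort (o (2 * n + 1))) = x := hx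
    refine (congrArg (fun z => dist z (e (w none 1))) ?_).trans (e.dist_eq _ _)
    exact (congrArg (Cmdu.pt n) hx').trans (e.apply_symm_apply _).symm

end eval

variable {m c}

theorem unionInterp_predFreeIn (ho : ∀ k, o (2 * k + 2) = o 0)
    (q : (cmduVocab V fun k => o (2 * k + 1)).Preds) :
    ((unionInterp o m c).predForm q).FreeIn (Set.range fun k :
      Fin ((cmduVocab V fun k => o (2 * k + 1)).ar q) => ((unionInterp o m c).imag, (k : ℕ))) := by
  rcases q with _ | ⟨p, i, hi⟩
  · refine Formula.lim_free fun N => (free_heightApprox m ho 0 N).trans ?_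
    rintro _ rfl
    exact ⟨(0 : Fin 1), rfl⟩
  · exact Formula.lim_free fun k => free_extApprox m c ho p i hi k

theorem unionInterp_partFreeIn (ho : ∀ k, o (2 * k + 2) = o 0) (n : ℕ) :
    Formula.FreeIn (.lim fun N => .absDiff (heightApprox o m 0 N) (.halfPow n)) {(none, 0)} :=
  have h N : (RFormula.absDiff (heightApprox o m 0 N) (.halfPow n)).free ⊆ {(none, 0)} := by
    rw [RFormula.free_absDiff, RFormula.free_halfPow, Set.union_empty]
    exact free_heightApprox m ho 0 N
  Formula.lim_free h

end interp

/-- Since 2^-m < r, every structure in the class has two points of H at distance more than 2^-m. The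
points depend on the structure, but m and the formulas do not. -/
theorem unionInterp_correct {L : MetricSignature.{v}} {o : ℕ → L.Sorts} {m : ℕ}
    {c : L.Preds → ℕ → ℕ} (ho : ∀ k, o (2 * k + 2) = o 0) {r : ℝ} (hm : (1 / 2 : ℝ) ^ m < r)
    (hc : ∀ p k (s : unitInterval), (s : ℝ) ≤ (1 / 2) ^ c p k →
      (L.modulus p s : ℝ) ≤ (1 / 2) ^ k) :
    Interp.Correct.{u, v} (unionInterp (V := L.toVocab) o m c) (o 0) r := by
  refine ⟨unionInterp_predFreeIn (V := L.toVocab) ho, unionInterp_partFreeIn (V := L.toVocab) ho,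
    fun n => Formula.lim_free fun N => free_pointApprox (V := L.toVocab) m ho n 0 1 N,
    fun A hA => unionInterp_correctIn ho A.toPreStructure ?_ fun p k x y h => ?_⟩
  · by_contra! hcon
    have h1 : Metric.diam (Set.univ : Set (A.sort (o 0))) ≤ (1 / 2) ^ m :=
      Metric.diam_le_of_forall_dist_le (half_pow_pos m).le fun a _ b _ => hcon a b
    exact absurd (hA.trans h1) (not_le.2 hm)
  · exact (A.respects p ⟨(1 / 2) ^ c p k, (half_pow_pos _).le, half_pow_le_one _⟩ x y h).trans
      (hc p k _ le_rfl)

/-! ## Codes of the formulas of the interpretation -/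

namespace Code

/-- Code of `RFormula.blend`. -/
def blend (k η t : ℕ) : ℕ :=
  max (min (half^[k] t) (plus (absDiff η (halfPow k)) (sub (halfPow k)
      (double (absDiff η (halfPow k))))))
    (sub (absDiff η (halfPow k)) (sub (halfPow k) (double (absDiff η (halfPow k)))))

/-- Code of `RFormula.triple`. -/
def triple (a : ℕ) : ℕ := plus a (plus a a)

/-- Code of `Frame.atom`. -/
def atom (b v i j : ℕ) : ℕ := pred (b * (2 * i + 1)) [v, j]

section frame

variable (s : ℕ → ℕ) (a b : ℕ)

/-- Code of `Frame.gap`. -/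
def gap (v k : ℕ) : ℕ := sup (s 0 + a + 1) 0 (absDiff (atom b v (2 * k + 2) 0) (atom b v 0 0))

/-- Code of `Frame.level`. -/
def level (m v N : ℕ) : ℕ :=
  maxs ((List.range N).map fun k => min (halfPow k) (double^[m] (gap s a b v k)))

/-- Code of `Frame.profileDist`. -/
def profileDist (m N : ℕ) : ℕ :=
  max (absDiff (level s a b m 0 N) (level s a b m 1 N))
    (maxs ((List.range N).map fun k => sup (s (2 * k + 1) + a + 1) 0
      (absDiff (blend k (level s a b m 0 N) (atom b 0 (2 * k + 1) 0))
        (blend k (level s a b m 1 N) (atom b 1 (2 * k + 1) 0)))))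

/-- Code of `Frame.starBound`. -/
def starBound (m v N : ℕ) : ℕ := triple (level s a b m v (N + 2))

/-- Code of `Frame.pointBound`. -/
def pointBound (m v n j N : ℕ) : ℕ :=
  plus (triple (absDiff (level s a b m v (N + 2)) (halfPow n))) (atom b v (2 * n + 1) j)

/-- Code of `Frame.unionBound`. -/
def unionBound (m v N : ℕ) : ℕ :=
  triple (mins ((List.range (N + 4)).map fun n => absDiff (level s a b m v (N + 3)) (halfPow n)))

end frame

variable (s : ℕ → ℕ)

/-- Code of `clsDist`. -/
def clsDist (v j : ℕ) : ℕ := pred 1 [v, j]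

/-- Code of an approximation of `unionFormula`. -/
def unionApprox (m N : ℕ) : ℕ := inf 1 0 (plus (clsDist 0 0) (unionBound s 1 2 m 0 N))

/-- Code of `imagDist`. -/
def imagDist (v j : ℕ) : ℕ := sup 1 0 (absDiff (pred 1 [j, 0]) (pred 2 [v, 0]))

/-- Code of `heightApprox`. -/
def heightApprox (m j N : ℕ) : ℕ := inf 2 0 (plus (imagDist 0 j) (starBound s 2 4 m 0 N))

/-- Code of `pointApprox`. -/
def pointApprox (m n jx jy N : ℕ) : ℕ :=
  inf 2 0 (plus (imagDist 0 jy) (pointBound s 2 4 m 0 n jx N))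

end Code

section frame

variable {V V' : Vocab.{v}} {o : ℕ → V.Sorts}

/-- The numbers `a` and `b` determine the codes of the symbols of a frame. -/
structure Frame.HasCodes (F : Frame V o V') (ν : Numbering V) (ν' : Numbering V') (a b : ℕ) :
    Prop where
  sort : ∀ s, ν'.sortCode (F.inj s) = ν.sortCode s + a + 1
  atom : ∀ v i j, (F.atom v i j).code ν' = Code.atom b v i j

theorem RFormula.code_blend (ν : Numbering V) (k : ℕ) (η t : RFormula V) :
    (blend k η t).code ν = Code.blend k (η.code ν) (t.code ν) := by
  simp [blend, Code.blend]

theorem RFormula.code_triple (ν : Numbering V) (φ : RFormula V) :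
    φ.triple.code ν = Code.triple (φ.code ν) := by
  simp [triple, Code.triple]

namespace Frame.HasCodes

variable {F : Frame V o V'} {ν : Numbering V} {ν' : Numbering V'} {a b : ℕ}
  {s : ℕ → ℕ}

theorem code_gap (hF : F.HasCodes ν ν' a b) (hs : ∀ i, s i = ν.sortCode (o i)) (v k : ℕ) :
    (F.gap v k).code ν' = Code.gap s a b v k := by
  simp [gap, Code.gap, hF.sort, hF.atom, hs]

theorem code_level (hF : F.HasCodes ν ν' a b) (hs : ∀ i, s i = ν.sortCode (o i)) (m v N : ℕ) :
    (F.level m v N).code ν' = Code.level s a b m v N := by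
  simp [level, Code.level, hF.code_gap hs, Function.comp_def]

theorem code_profileDist (hF : F.HasCodes ν ν' a b) (hs : ∀ i, s i = ν.sortCode (o i))
    (m N : ℕ) : (F.profileDist m N).code ν' = Code.profileDist s a b m N := by
  simp [profileDist, Code.profileDist, hF.code_level hs, hF.sort, hF.atom, hs,
    RFormula.code_blend, Function.comp_def]

theorem code_starBound (hF : F.HasCodes ν ν' a b) (hs : ∀ i, s i = ν.sortCode (o i))
    (m v N : ℕ) : (F.starBound m v N).code ν' = Code.starBound s a b m v N := by
  simp [starBound, Code.starBound, hF.code_level hs, RFormula.code_triple]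

theorem code_pointBound (hF : F.HasCodes ν ν' a b) (hs : ∀ i, s i = ν.sortCode (o i))
    (m v n j N : ℕ) : (F.pointBound m v n j N).code ν' = Code.pointBound s a b m v n j N := by
  simp [pointBound, Code.pointBound, hF.code_level hs, hF.atom, RFormula.code_triple]

theorem code_unionBound (hF : F.HasCodes ν ν' a b) (hs : ∀ i, s i = ν.sortCode (o i))
    (m v N : ℕ) : (F.unionBound m v N).code ν' = Code.unionBound s a b m v N := by
  simp [unionBound, Code.unionBound, hF.code_level hs, RFormula.code_triple, Function.comp_def]

end Frame.HasCodes

end frame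

section chain

variable {V : Vocab.{v}} (ν : Numbering V) (o : ℕ → V.Sorts) (m : ℕ)

/-- The numbering of the vocabulary with the product. -/
abbrev prodNumbering : Numbering (prodVocab o) := ν.extend (.omegaProd o)

/-- The numbering of the vocabulary with the quotient. -/
abbrev quotNumbering : Numbering (quotVocab o m) :=
  (prodNumbering ν o).extend (.quot none (quotFormula o m))

/-- The numbering of the vocabulary with the disjoint union. -/
abbrev unionNumbering : Numbering (unionVocab o m) :=
  (quotNumbering ν o m).extend (.defSet none (unionFormula o m))

/-- Every expansion adds 1 to the codes of the old sorts and doubles the codes of the old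
predicates. In the three successive expansions the projection number i thus has the codes 2i + 1,
2(2i + 1) and 4(2i + 1), and the sorts are shifted by 1, 2 and 3. -/
theorem prodFrame_hasCodes : (prodFrame o).HasCodes ν (prodNumbering ν o) 0 1 where
  sort _ := rfl
  atom v i j := congrArg (Code.pred · [v, j]) (show 2 * i + 1 = 1 * (2 * i + 1) by omega)

theorem quotFrame_hasCodes : (quotFrame o m).HasCodes ν (quotNumbering ν o m) 1 2 where
  sort _ := rfl
  atom _ _ _ := rfl

theorem unionFrame_hasCodes : (unionFrame o m).HasCodes ν (unionNumbering ν o m) 2 4 where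
  sort _ := rfl
  atom v i j := congrArg (Code.pred · [v, j])
    (show 2 * (2 * (2 * i + 1)) = 4 * (2 * i + 1) by omega)

theorem code_clsDist (v j : ℕ) :
    (clsDist o m v j).code (quotNumbering ν o m) = Code.clsDist v j := rfl

theorem code_imagDist (v j : ℕ) :
    (imagDist o m v j).code (unionNumbering ν o m) = Code.imagDist v j := rfl

variable {o} {s : ℕ → ℕ}

theorem code_quotFormula (hs : ∀ i, s i = ν.sortCode (o i)) (n : ℕ) :
    (quotFormula o m n).code (prodNumbering ν o) =
      Code.lim (fun N => Code.profileDist s 0 1 m (N + 3)) n := by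
  refine (Formula.lim_code _ _ n).trans ?_
  simp only [(prodFrame_hasCodes ν o).code_profileDist hs]

theorem code_unionFormula (hs : ∀ i, s i = ν.sortCode (o i)) (n : ℕ) :
    (unionFormula o m n).code (quotNumbering ν o m) = Code.lim (Code.unionApprox s m) n := by
  refine (Formula.lim_code _ _ n).trans (congrArg (Code.lim · n) (funext fun N => ?_))
  rw [RFormula.code_inf, RFormula.code_plus, code_clsDist,
    (quotFrame_hasCodes ν o m).code_unionBound hs]
  rfl

theorem code_heightApprox (hs : ∀ i, s i = ν.sortCode (o i)) (j N : ℕ) :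
    (heightApprox o m j N).code (unionNumbering ν o m) = Code.heightApprox s m j N := by
  rw [heightApprox, RFormula.code_inf, RFormula.code_plus, code_imagDist,
    (unionFrame_hasCodes ν o m).code_starBound hs]
  rfl

theorem code_pointApprox (hs : ∀ i, s i = ν.sortCode (o i)) (n jx jy N : ℕ) :
    (pointApprox o m n jx jy N).code (unionNumbering ν o m) = Code.pointApprox s m n jx jy N := by
  rw [pointApprox, RFormula.code_inf, RFormula.code_plus, code_imagDist,
    (unionFrame_hasCodes ν o m).code_pointBound hs]
  rfl

end chain

/-! ### Recursiveness of the codes of the interpretation -/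

namespace RelRec

variable {α : Type} [Primcodable α] {f g k l n : (ℕ → ℕ) → α → ℕ} {s : (ℕ → ℕ) → ℕ → ℕ}

theorem codeBlend (hf : RelRec f) (hg : RelRec g) (hk : RelRec k) :
    RelRec fun h a => Code.blend (f h a) (g h a) (k h a) :=
  have h1 := hg.codeAbsDiff hf.codeHalfPow
  have h2 := hf.codeHalfPow.codeSub h1.codeDouble
  ((hf.codeHalf_iterate hk).codeMin (h1.codePlus h2)).codeMax (h1.codeSub h2)

theorem codeTriple (hf : RelRec f) : RelRec fun h a => Code.triple (f h a) :=
  hf.codePlus (hf.codePlus hf)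

theorem list_pair (hf : RelRec f) (hg : RelRec g) : RelRec fun h a => [f h a, g h a] :=
  comp₂ Primrec.list_cons hf (comp₂ Primrec.list_cons hg (.const []))

theorem codeAtom (b : ℕ) (hf : RelRec f) (hg : RelRec g) (hk : RelRec k) :
    RelRec fun h a => Code.atom b (f h a) (g h a) (k h a) :=
  ((RelRec.const b).mul (((RelRec.const 2).mul hg).add (.const 1))).codePred (hf.list_pair hk)

theorem codeGap (a b : ℕ) (hs : RelRec s) (hf : RelRec f) (hg : RelRec g) :
    RelRec fun h x => Code.gap (s h) a b (f h x) (g h x) :=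
  (((hs.comp (.const 0)).add (.const a)).add (.const 1)).codeSup (.const 0)
    ((hf.codeAtom b (((RelRec.const 2).mul hg).add (.const 2)) (.const 0)).codeAbsDiff
      (hf.codeAtom b (.const 0) (.const 0)))

theorem codeLevel (a b : ℕ) (hs : RelRec s) (hf : RelRec f) (hg : RelRec g) (hk : RelRec k) :
    RelRec fun h x => Code.level (s h) a b (f h x) (g h x) (k h x) :=
  (list_map (f := fun h x i =>
      Code.min (Code.halfPow i) (Code.double^[f h x] (Code.gap (s h) a b (g h x) i)))
    hk.list_range (RelRec.snd.codeHalfPow.codeMin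
      ((hf.comp .fst).codeDouble_iterate (codeGap a b hs (hg.comp .fst) .snd)))).codeMaxs

theorem codeProfileDist (a b : ℕ) (hs : RelRec s) (hf : RelRec f) (hg : RelRec g) :
    RelRec fun h x => Code.profileDist (s h) a b (f h x) (g h x) := by
  have h0 := codeLevel a b hs hf (.const 0) hg
  have h1 := codeLevel a b hs hf (.const 1) hg
  have h2 : RelRec fun _ (q : α × ℕ) => 2 * q.2 + 1 := ((RelRec.const 2).mul .snd).add (.const 1)
  exact (h0.codeAbsDiff h1).codeMax (list_map (f := fun h x i =>
      Code.sup (s h (2 * i + 1) + a + 1) 0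
        (Code.absDiff (Code.blend i (Code.level (s h) a b (f h x) 0 (g h x))
            (Code.atom b 0 (2 * i + 1) 0))
          (Code.blend i (Code.level (s h) a b (f h x) 1 (g h x)) (Code.atom b 1 (2 * i + 1) 0))))
    hg.list_range ((((hs.comp h2).add (.const a)).add (.const 1)).codeSup (.const 0)
      ((RelRec.snd.codeBlend (h0.comp .fst) (codeAtom b (.const 0) h2 (.const 0))).codeAbsDiff
        (RelRec.snd.codeBlend (h1.comp .fst)
          (codeAtom b (.const 1) h2 (.const 0)))))).codeMaxs

theorem codeUnionBound (a b : ℕ) (hs : RelRec s) (hf : RelRec f) (hg : RelRec g) (hk : RelRec k) :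
    RelRec fun h x => Code.unionBound (s h) a b (f h x) (g h x) (k h x) :=
  (list_map (f := fun h x i =>
      Code.absDiff (Code.level (s h) a b (f h x) (g h x) (k h x + 3)) (Code.halfPow i))
    (hk.add (.const 4)).list_range (((codeLevel a b hs hf hg (hk.add (.const 3))).comp
      .fst).codeAbsDiff RelRec.snd.codeHalfPow)).codeMins.codeTriple

theorem codeUnionApprox (hs : RelRec s) (hf : RelRec f) (hg : RelRec g) :
    RelRec fun h x => Code.unionApprox (s h) (f h x) (g h x) :=
  (RelRec.const 1).codeInf (.const 0)
    ((RelRec.const _).codePlus (codeUnionBound 1 2 hs hf (.const 0) hg))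

theorem codeImagDist (hf : RelRec f) (hg : RelRec g) :
    RelRec fun h x => Code.imagDist (f h x) (g h x) :=
  (RelRec.const 1).codeSup (.const 0) (((RelRec.const 1).codePred
    (hg.list_pair (.const 0))).codeAbsDiff ((RelRec.const 2).codePred (hf.list_pair (.const 0))))

theorem codeHeightApprox (hs : RelRec s) (hf : RelRec f) (hg : RelRec g) (hk : RelRec k) :
    RelRec fun h x => Code.heightApprox (s h) (f h x) (g h x) (k h x) :=
  (RelRec.const 2).codeInf (.const 0) (((RelRec.const 0).codeImagDist hg).codePlus
    (codeLevel 2 4 hs hf (.const 0) (hk.add (.const 2))).codeTriple)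

theorem codePointApprox (hs : RelRec s) (hf : RelRec f) (hg : RelRec g) (hk : RelRec k)
    (hl : RelRec l) (hn : RelRec n) :
    RelRec fun h x => Code.pointApprox (s h) (f h x) (g h x) (k h x) (l h x) (n h x) :=
  (RelRec.const 2).codeInf (.const 0) (((RelRec.const 0).codeImagDist hl).codePlus
    (((codeLevel 2 4 hs hf (.const 0) (hn.add (.const 2))).codeAbsDiff
      hg.codeHalfPow).codeTriple.codePlus
        (codeAtom 4 (.const 0) (((RelRec.const 2).mul hg).add (.const 1)) hk)))

end RelRec

/-! ## Names of the interpretation -/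

/-- Code of `scale`, in terms of a name of the signature. -/
def Code.scale (h : ℕ → ℕ) (c k : ℕ) : ℕ :=
  maxIndex c + sigModulusCont h (Nat.pair c.unpair.1 k) + 3

/-- Code of `extApprox`, in terms of a name of the signature. -/
def Code.extApprox (h s : ℕ → ℕ) (m c k : ℕ) : ℕ :=
  infs ((List.range (listOf (sigArity h c.unpair.1)).length).map fun l =>
      ((listOf (sigArity h c.unpair.1)).getD l 0 + 3, l))
    (plus (pred (8 * c.unpair.1)
        ((List.range (listOf (sigArity h c.unpair.1)).length).map fun l => l))
      (double^[scale h c k]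
        (maxs ((List.range (listOf (sigArity h c.unpair.1)).length).map fun l =>
          pointApprox s m ((listOf c.unpair.2).getD l 0) l l
            (scale h c k + k)))))

/-- A sequence with a new first term. -/
def consSeq (a : ℕ) (f : ℕ → ℕ) (n : ℕ) : ℕ := if n = 0 then a else f (n - 1)

/-- The name of a chain of expansions, in terms of the names of the first step and of the rest. -/
def consChain (f g : ℕ → ℕ) (n : ℕ) : ℕ :=
  consSeq 1 (fun n => if n.unpair.1 = 0 then f n.unpair.2 else g n.unpair.2) n

/-- Components of the name of the interpretation. -/
def unionName (h s : ℕ → ℕ) (m : ℕ) (i : Fin 5) (c : ℕ) : ℕ :=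
  match i with
  | 0 => consChain (consSeq (Nat.pair 1 0) s)
      (consChain (consSeq (Nat.pair 3 0) (Code.lim fun N => Code.profileDist s 0 1 m (N + 3)))
        (consChain (consSeq (Nat.pair 2 0) (Code.lim (Code.unionApprox s m))) fun _ => 0)) c
  | 1 => 0
  | 2 => if c.unpair.1 = 0 then Code.lim (Code.heightApprox s m 0) c.unpair.2
      else Code.lim (Code.extApprox h s m (c.unpair.1 - 1)) c.unpair.2
  | 3 => Code.lim (fun N => Code.absDiff (Code.heightApprox s m 0 N) (Code.halfPow c.unpair.1))
      c.unpair.2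
  | 4 => Code.lim (Code.pointApprox s m c.unpair.1 0 1) c.unpair.2

@[simp] theorem consSeq_zero (a : ℕ) (f : ℕ → ℕ) : consSeq a f 0 = a := rfl

@[simp] theorem consSeq_succ (a : ℕ) (f : ℕ → ℕ) (n : ℕ) : consSeq a f (n + 1) = f n := rfl

theorem Chain.HasName.cons {V W : Vocab.{v}} {ν : Numbering V} {st : Step V}
    {c : Chain (V.extend st) W} {f g : ℕ → ℕ} (hf : st.HasName ν f)
    (hg : c.HasName (ν.extend st) g) : (Chain.cons st c).HasName ν (consChain f g) := by
  refine ⟨rfl, ?_, ?_⟩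
  · simpa [consChain] using hf
  · simpa [consChain] using hg

section names

variable {V : Vocab.{v}} {ν : Numbering V} {o : ℕ → V.Sorts} {h s : ℕ → ℕ} {c : V.Preds → ℕ → ℕ}

theorem code_scale {p : V.Preds} (i : Fin (V.ar p) → ℕ) {k : ℕ}
    (hc : c p k = sigModulusCont h (Nat.pair (ν.predCode p) k)) :
    scale c p i k = Code.scale h (Nat.pair (ν.predCode p) (tupleCode i)) k := by
  rw [Code.scale, maxIndex_pair, Nat.unpair_pair, ← hc, scale]

theorem code_sortVars (m : ℕ) {n : ℕ} (d : Fin n → V.Sorts) :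
    (sortVars o m d).map (fun x => ((unionNumbering ν o m).sortCode x.1, x.2)) =
      (List.range n).map fun l => ((List.ofFn fun l => ν.sortCode (d l)).getD l 0 + 3, l) :=
  List.map_ofFn.trans (ofFn_eq_map_range _ _ fun l =>
    (congrArg (fun a => (a + 3, (l : ℕ))) (getD_ofFn (fun l => ν.sortCode (d l)) l)).symm)

/-- The factor 8 comes from the three expansions, each of which doubles the codes of the old
predicates. -/
theorem code_oldPred (m : ℕ) (p : V.Preds) :
    (RFormula.pred (V := unionVocab o m) (.inl (.inl (.inl p)))
      fun l : Fin (V.ar p) => (l : ℕ)).code (unionNumbering ν o m) =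
      Code.pred (8 * ν.predCode p) ((List.range (V.ar p)).map fun l => l) := by
  have h3 := ofFn_eq_map_range (fun l : Fin (V.ar p) => (l : ℕ)) (fun l => l) fun _ => rfl
  rw [← h3, show 8 * ν.predCode p = 2 * (2 * (2 * ν.predCode p)) by omega]
  rfl

theorem RFormula.code_maxs_ofFn {n : ℕ} {f : Fin n → RFormula V} {g : ℕ → ℕ}
    (hg : ∀ l : Fin n, (f l).code ν = g l) :
    (RFormula.maxs (List.ofFn f)).code ν = Code.maxs ((List.range n).map g) := by
  rw [RFormula.code_maxs, List.map_ofFn]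
  exact congrArg Code.maxs (ofFn_eq_map_range _ g hg)

theorem code_infs_plus {φ ψ : RFormula V} {x a b : ℕ} {l : List (V.Sorts × ℕ)} {l' : List (ℕ × ℕ)}
    (hl : l.map (fun x => (ν.sortCode x.1, x.2)) = l') (hφ : φ.code ν = a) (hψ : ψ.code ν = b) :
    (RFormula.infs l (.plus φ (RFormula.double^[x] ψ))).code ν =
      Code.infs l' (Code.plus a (Code.double^[x] b)) := by
  rw [RFormula.code_infs, RFormula.code_plus, RFormula.code_double_iterate, hl, hφ, hψ]

theorem code_extApprox (hs : ∀ i, s i = ν.sortCode (o i)) (m : ℕ) (p : V.Preds)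
    (ha : sigArity h (ν.predCode p) = tupleCode fun l => ν.sortCode (V.dom p l))
    (i : Fin (V.ar p) → ℕ) {k : ℕ}
    (hc : c p k = sigModulusCont h (Nat.pair (ν.predCode p) k)) :
    (extApprox o m c p i k).code (unionNumbering ν o m) =
      Code.extApprox h s m (Nat.pair (ν.predCode p) (tupleCode i)) k := by
  have h1 : ∀ N, (RFormula.maxs (List.ofFn fun l => pointApprox o m (i l) l l N)).code
      (unionNumbering ν o m) = Code.maxs ((List.range (V.ar p)).map fun l =>
        Code.pointApprox s m ((List.ofFn i).getD l 0) l l N) := fun N =>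
    RFormula.code_maxs_ofFn fun l => by
      rw [getD_ofFn, code_pointApprox ν m hs]
  have h2 := code_infs_plus (x := scale c p i k) (code_sortVars (ν := ν) m (V.dom p))
    (code_oldPred m p) (h1 (scale c p i k + k))
  refine h2.trans ?_
  rw [code_scale i hc, Code.extApprox]
  simp only [Nat.unpair_pair, ha, listOf_tupleCode, List.length_ofFn]

theorem unionChain_hasName (hs : ∀ i, s i = ν.sortCode (o i)) (m : ℕ) :
    (unionChain o m).HasName ν (consChain (consSeq (Nat.pair 1 0) s)
      (consChain (consSeq (Nat.pair 3 0) (Code.lim fun N => Code.profileDist s 0 1 m (N + 3)))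
        (consChain (consSeq (Nat.pair 2 0) (Code.lim (Code.unionApprox s m))) fun _ => 0))) := by
  have h1 : Step.HasName ν (.omegaProd o) (consSeq (Nat.pair 1 0) s) :=
    ⟨consSeq_zero _ _, fun i => (consSeq_succ _ _ i).trans (hs i)⟩
  have h2 : Step.HasName (prodNumbering ν o) (.quot none (quotFormula o m))
      (consSeq (Nat.pair 3 0) (Code.lim fun N => Code.profileDist s 0 1 m (N + 3))) :=
    ⟨consSeq_zero _ _, fun n => (consSeq_succ _ _ n).trans (code_quotFormula ν m hs n).symm⟩
  have h3 : Step.HasName (quotNumbering ν o m) (.defSet none (unionFormula o m))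
      (consSeq (Nat.pair 2 0) (Code.lim (Code.unionApprox s m))) :=
    ⟨consSeq_zero _ _, fun n => (consSeq_succ _ _ n).trans (code_unionFormula ν m hs n).symm⟩
  exact .cons h1 (.cons h2 (.cons h3 rfl))

theorem code_lim {φ : ℕ → RFormula V} {f : ℕ → ℕ} (hf : ∀ N, (φ N).code ν = f N) :
    (Formula.lim φ).HasName ν (Code.lim f) := fun n =>
  (congrArg (Code.lim · n) (funext hf).symm).trans (Formula.lim_code ν φ n).symm

theorem unionInterp_hasName (hs : ∀ i, s i = ν.sortCode (o i)) (m : ℕ)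
    (ha : ∀ p, sigArity h (ν.predCode p) = tupleCode fun l => ν.sortCode (V.dom p l))
    (hc : ∀ p k, c p k = sigModulusCont h (Nat.pair (ν.predCode p) k)) :
    (unionInterp o m c).HasName ν (assemble (unionName h s m)) := by
  have h0 : comp 0 (assemble (unionName h s m)) = _ := comp_assemble _ 0
  have h1 : comp 1 (assemble (unionName h s m)) = _ := comp_assemble _ 1
  have h2 : comp 2 (assemble (unionName h s m)) = _ := comp_assemble _ 2
  have h3 : comp 3 (assemble (unionName h s m)) = _ := comp_assemble _ 3
  have h4 : comp 4 (assemble (unionName h s m)) = _ := comp_assemble _ 4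
  refine ⟨h0 ▸ unionChain_hasName hs m, h1 ▸ rfl, fun q => ?_, fun n => ?_, fun n => ?_⟩
  · rcases q with _ | ⟨p, i, hi⟩
    · have hq : comp 0 (comp 2 (assemble (unionName h s m))) =
          Code.lim (Code.heightApprox s m 0) := by
        rw [h2]
        funext N
        simp [comp, unionName]
      have h3 := code_lim (ν := unionNumbering ν o m) (code_heightApprox ν m hs 0)
      rw [← hq] at h3
      exact h3
    · have hq : comp (Nat.pair (ν.predCode p) (tupleCode i) + 1)
          (comp 2 (assemble (unionName h s m))) =
          Code.lim (Code.extApprox h s m (Nat.pair (ν.predCode p) (tupleCode i))) := by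
        rw [h2]
        funext N
        simp [comp, unionName]
      have h3 := code_lim (ν := unionNumbering ν o m) fun k =>
        code_extApprox hs m p (ha p) i (hc p k)
      rw [← hq] at h3
      exact h3
  · have hq : comp n (comp 3 (assemble (unionName h s m))) = Code.lim fun N =>
        Code.absDiff (Code.heightApprox s m 0 N) (Code.halfPow n) := by
      rw [h3]
      funext N
      simp [comp, unionName]
    have h5 : ∀ N, (RFormula.absDiff (heightApprox o m 0 N) (.halfPow n)).code
        (unionNumbering ν o m) = Code.absDiff (Code.heightApprox s m 0 N) (Code.halfPow n) :=
      fun N => by rw [RFormula.code_absDiff, code_heightApprox ν m hs, RFormula.code_halfPow]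
    have h6 := code_lim h5
    rw [← hq] at h6
    exact h6
  · have hq : comp n (comp 4 (assemble (unionName h s m))) = Code.lim
        (Code.pointApprox s m n 0 1) := by
      rw [h4]
      funext N
      simp [comp, unionName]
    have h5 := code_lim (ν := unionNumbering ν o m) (code_pointApprox ν m hs n 0 1)
    rw [← hq] at h5
    exact h5

end names

/-! ### Moduli obtained from a name -/

section cont

variable {L : MetricSignature.{v}} {ν : Numbering L.toVocab} {h : ℕ → ℕ}

/-- The moduli of continuity of the moduli of the signature named by `h`. -/
def namedCont (ν : Numbering L.toVocab) (h : ℕ → ℕ) (p : L.Preds) (k : ℕ) : ℕ :=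
  sigModulusCont h (Nat.pair (ν.predCode p) k)

/-- The modulus vanishes at 0, so its named modulus of continuity, applied to t and 0, bounds the
value at t. -/
theorem modulus_le_of_le_namedCont (hh : IsSigName L ν (comp 0 h)) (p : L.Preds) (k : ℕ)
    (t : unitInterval) (ht : (t : ℝ) ≤ (1 / 2) ^ namedCont ν h p k) :
    (L.modulus p t : ℝ) ≤ (1 / 2) ^ k := by
  have h1 := hh.modulus_cont p k t 0 (by
    rw [Set.Icc.coe_zero, sub_zero, abs_of_nonneg t.2.1, ← one_div_pow]
    exact ht)
  rw [L.modulus_zero, Set.Icc.coe_zero, sub_zero, ← one_div_pow] at h1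
  exact (le_abs_self _).trans h1

end cont

namespace RelRec

variable {α : Type} [Primcodable α] {f g k : (ℕ → ℕ) → α → ℕ} {s : (ℕ → ℕ) → ℕ → ℕ}

theorem codeExtApprox (hs : RelRec s) (hf : RelRec f) (hg : RelRec g) (hk : RelRec k) :
    RelRec fun h x => Code.extApprox h (s h) (f h x) (g h x) (k h x) := by
  have ha : RelRec fun h x => MetricLogic.listOf (MetricLogic.sigArity h (g h x).unpair.1) :=
    hg.unpair_fst.sigArity.listOf
  have hr := ha.list_length.list_range
  have hJ : RelRec fun h x => Code.scale h (g h x) (k h x) :=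
    (hg.maxIndex.add (hg.unpair_fst.natPair hk).sigModulusCont).add (.const 3)
  refine codeInfs (list_map (f := fun h x l => ((MetricLogic.listOf
      (MetricLogic.sigArity h (g h x).unpair.1)).getD l 0 + 3, l)) hr
      ((((ha.comp .fst).list_getD .snd).add (.const 3)).pair .snd))
    ((((RelRec.const 8).mul hg.unpair_fst).codePred
      (list_map (f := fun _ _ l => l) hr .snd)).codePlus (hJ.codeDouble_iterate
        (list_map (f := fun h x l => Code.pointApprox (s h) (f h x)
          ((MetricLogic.listOf (g h x).unpair.2).getD l 0) l l
          (Code.scale h (g h x) (k h x) + k h x)) hr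
          (codePointApprox hs (hf.comp .fst) ((hg.unpair_snd.listOf.comp .fst).list_getD .snd)
            .snd .snd ((hJ.add hk).comp .fst))).codeMaxs))

theorem consSeq {a : ℕ} {F : (ℕ → ℕ) → α → ℕ → ℕ} (hF : RelRec fun h (q : α × ℕ) => F h q.1 q.2)
    (hf : RelRec f) : RelRec fun h x => MetricLogic.consSeq a (F h x) (f h x) :=
  ite_eq hf (.const 0) (.const a) (hF.comp (RelRec.id.pair (hf.sub (.const 1))))

theorem consChain {F G : (ℕ → ℕ) → α → ℕ → ℕ} (hF : RelRec fun h (q : α × ℕ) => F h q.1 q.2)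
    (hG : RelRec fun h (q : α × ℕ) => G h q.1 q.2) (hf : RelRec f) :
    RelRec fun h x => MetricLogic.consChain (F h x) (G h x) (f h x) :=
  consSeq (F := fun h x n => if n.unpair.1 = 0 then F h x n.unpair.2 else G h x n.unpair.2)
    (ite_eq RelRec.snd.unpair_fst (.const 0) (hF.comp (RelRec.fst.pair RelRec.snd.unpair_snd))
      (hG.comp (RelRec.fst.pair RelRec.snd.unpair_snd))) hf

theorem consSeq_snd {a : ℕ} {F : (ℕ → ℕ) → ℕ → ℕ → ℕ}
    (hF : RelRec fun h (q : ℕ × ℕ) => F h q.1 q.2) :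
    RelRec fun h (q : ℕ × ℕ) => MetricLogic.consSeq a (F h q.1) q.2 :=
  consSeq (F := fun h (q : ℕ × ℕ) => F h q.1) (f := fun _ q => q.2)
    (hF.comp ((RelRec.fst.comp .fst).pair .snd)) .snd

theorem consChain_snd {F G : (ℕ → ℕ) → ℕ → ℕ → ℕ} (hF : RelRec fun h (q : ℕ × ℕ) => F h q.1 q.2)
    (hG : RelRec fun h (q : ℕ × ℕ) => G h q.1 q.2) :
    RelRec fun h (q : ℕ × ℕ) => MetricLogic.consChain (F h q.1) (G h q.1) q.2 :=
  consChain (F := fun h (q : ℕ × ℕ) => F h q.1) (G := fun h (q : ℕ × ℕ) => G h q.1)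
    (f := fun _ q => q.2) (hF.comp ((RelRec.fst.comp .fst).pair .snd))
    (hG.comp ((RelRec.fst.comp .fst).pair .snd)) .snd

theorem codeChain (hs : RelRec s) : RelRec fun h (q : ℕ × ℕ) => MetricLogic.consChain
    (MetricLogic.consSeq (Nat.pair 1 0) (s h)) (MetricLogic.consChain
      (MetricLogic.consSeq (Nat.pair 3 0)
        (Code.lim fun N => Code.profileDist (s h) 0 1 q.1 (N + 3)))
      (MetricLogic.consChain
        (MetricLogic.consSeq (Nat.pair 2 0) (Code.lim (Code.unionApprox (s h) q.1)))
        fun _ => 0)) q.2 := by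
  have hm : RelRec fun _ (q : (ℕ × ℕ) × ℕ) => q.1.1 := RelRec.fst.comp .fst
  have hA : RelRec fun h (q : ℕ × ℕ) =>
      Code.lim (fun N => Code.profileDist (s h) 0 1 q.1 (N + 3)) q.2 :=
    codeLim (ψ := fun h (q : ℕ × ℕ) N => Code.profileDist (s h) 0 1 q.1 (N + 3))
      (codeProfileDist 0 1 hs hm (RelRec.snd.add (.const 3))) .snd
  have hB : RelRec fun h (q : ℕ × ℕ) => Code.lim (Code.unionApprox (s h) q.1) q.2 :=
    codeLim (ψ := fun h (q : ℕ × ℕ) N => Code.unionApprox (s h) q.1 N)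
      (codeUnionApprox hs hm .snd) .snd
  generalize hf : (fun h m => Code.lim fun N => Code.profileDist (s h) 0 1 m (N + 3)) = f
  generalize hg : (fun h m => Code.lim (Code.unionApprox (s h) m)) = g
  have hf' : RelRec fun h (q : ℕ × ℕ) => f h q.1 q.2 := hf ▸ hA
  have hg' : RelRec fun h (q : ℕ × ℕ) => g h q.1 q.2 := hg ▸ hB
  have h1 : RelRec fun h (q : ℕ × ℕ) => MetricLogic.consChain
      (MetricLogic.consSeq (Nat.pair 1 0) (s h)) (MetricLogic.consChain
        (MetricLogic.consSeq (Nat.pair 3 0) (f h q.1))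
        (MetricLogic.consChain (MetricLogic.consSeq (Nat.pair 2 0) (g h q.1)) fun _ => 0)) q.2 :=
    consChain_snd (F := fun h _ => MetricLogic.consSeq (Nat.pair 1 0) (s h))
      (G := fun h m => MetricLogic.consChain (MetricLogic.consSeq (Nat.pair 3 0) (f h m))
        (MetricLogic.consChain (MetricLogic.consSeq (Nat.pair 2 0) (g h m)) fun _ => 0))
      (consSeq_snd (F := fun h _ => s h) (hs.comp .snd)) <|
    consChain_snd (F := fun h m => MetricLogic.consSeq (Nat.pair 3 0) (f h m))
      (G := fun h m => MetricLogic.consChain (MetricLogic.consSeq (Nat.pair 2 0) (g h m))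
        fun _ => 0) (consSeq_snd hf') <|
    consChain_snd (F := fun h m => MetricLogic.consSeq (Nat.pair 2 0) (g h m))
      (G := fun _ _ _ => 0) (consSeq_snd hg') (.const 0)
  subst hf hg
  exact h1

theorem codePredForm (hs : RelRec s) : RelRec fun h (q : ℕ × ℕ) =>
    if q.2.unpair.1 = 0 then Code.lim (Code.heightApprox (s h) q.1 0) q.2.unpair.2
      else Code.lim (Code.extApprox h (s h) q.1 (q.2.unpair.1 - 1)) q.2.unpair.2 := by
  have hm : RelRec fun _ (q : (ℕ × ℕ) × ℕ) => q.1.1 := RelRec.fst.comp .fst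
  have hc : RelRec fun _ (q : ℕ × ℕ) => q.2 := .snd
  have hc' : RelRec fun _ (q : (ℕ × ℕ) × ℕ) => q.1.2 := hc.comp .fst
  exact ite_eq hc.unpair_fst (.const 0)
    (codeLim (ψ := fun h (q : ℕ × ℕ) N => Code.heightApprox (s h) q.1 0 N)
      (codeHeightApprox hs hm (.const 0) .snd) hc.unpair_snd)
    (codeLim (ψ := fun h (q : ℕ × ℕ) N => Code.extApprox h (s h) q.1 (q.2.unpair.1 - 1) N)
      (codeExtApprox hs hm (hc'.unpair_fst.sub (.const 1)) .snd) hc.unpair_snd)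

theorem codePartForm (hs : RelRec s) : RelRec fun h (q : ℕ × ℕ) =>
    Code.lim (fun N => Code.absDiff (Code.heightApprox (s h) q.1 0 N)
      (Code.halfPow q.2.unpair.1)) q.2.unpair.2 := by
  have hm : RelRec fun _ (q : (ℕ × ℕ) × ℕ) => q.1.1 := RelRec.fst.comp .fst
  have hc : RelRec fun _ (q : ℕ × ℕ) => q.2 := .snd
  exact codeLim (ψ := fun h (q : ℕ × ℕ) N =>
      Code.absDiff (Code.heightApprox (s h) q.1 0 N) (Code.halfPow q.2.unpair.1))
    ((codeHeightApprox hs hm (.const 0) .snd).codeAbsDiff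
      (hc.comp .fst).unpair_fst.codeHalfPow) hc.unpair_snd

theorem codeBijForm (hs : RelRec s) : RelRec fun h (q : ℕ × ℕ) =>
    Code.lim (Code.pointApprox (s h) q.1 q.2.unpair.1 0 1) q.2.unpair.2 := by
  have hm : RelRec fun _ (q : (ℕ × ℕ) × ℕ) => q.1.1 := RelRec.fst.comp .fst
  have hc : RelRec fun _ (q : ℕ × ℕ) => q.2 := .snd
  exact codeLim (ψ := fun h (q : ℕ × ℕ) N => Code.pointApprox (s h) q.1 q.2.unpair.1 0 1 N)
    (codePointApprox hs hm (hc.comp .fst).unpair_fst (.const 0) (.const 1) .snd) hc.unpair_snd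

theorem unionName (hs : RelRec s) (i : Fin 5) :
    RelRec fun h (q : ℕ × ℕ) => MetricLogic.unionName h (s h) q.1 i q.2 := by
  fin_cases i
  · exact codeChain hs
  · exact .const 0
  · exact codePredForm hs
  · exact codePartForm hs
  · exact codeBijForm hs

end RelRec

/-! ## The interpretation for a home sort and a sequence of sorts -/

/-- The sequence `H, O 0, H, O 1, …`. -/
def interleave {α : Type*} (H : α) (O : ℕ → α) (i : ℕ) : α := if i % 2 = 0 then H else O (i / 2)

theorem interleave_even {α : Type*} (H : α) (O : ℕ → α) (k : ℕ) :
    interleave H O (2 * k + 2) = H := by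
  rw [interleave, if_pos (by omega)]

theorem interleave_odd {α : Type*} (H : α) (O : ℕ → α) (k : ℕ) :
    interleave H O (2 * k + 1) = O k := by
  rw [interleave, if_neg (by omega), show (2 * k + 1) / 2 = k by omega]

/-- A function `c` with `Δ_p (2 ^ -(c p k)) ≤ 2 ^ -k`. -/
theorem exists_modulus_le (L : MetricSignature.{v}) : ∃ c : L.Preds → ℕ → ℕ,
    ∀ p k (t : unitInterval), (t : ℝ) ≤ (1 / 2) ^ c p k → (L.modulus p t : ℝ) ≤ (1 / 2) ^ k := by
  have : ∀ p k, ∃ n : ℕ, ∀ t : unitInterval, (t : ℝ) ≤ (1 / 2) ^ n →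
      (L.modulus p t : ℝ) ≤ (1 / 2) ^ k := fun p k => by
    obtain ⟨δ, hδ, h⟩ := Metric.continuousAt_iff.1 ((L.modulus_continuous p).continuousAt (x := 0))
      ((1 / 2) ^ k) (half_pow_pos k)
    obtain ⟨n, hn⟩ := exists_pow_lt_of_lt_one hδ (by norm_num : (1 / 2 : ℝ) < 1)
    refine ⟨n, fun t ht => ?_⟩
    have h1 : dist t 0 < δ := by
      rw [Subtype.dist_eq, Real.dist_eq, Set.Icc.coe_zero, sub_zero, abs_of_nonneg t.2.1]
      exact ht.trans_lt hn
    have h2 := h h1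
    rw [L.modulus_zero, Subtype.dist_eq, Real.dist_eq, Set.Icc.coe_zero, sub_zero] at h2
    exact (le_abs_self _).trans h2.le
  choose c hc using this
  exact ⟨c, hc⟩

/-- The odd terms of the interleaved sequence equal the given sorts, but not by definition. The
equations are therefore hypotheses about an arbitrary sequence `o`, to be substituted. The clause on
names is included so that the interpretation that is correct is also the one that is named. -/
theorem exists_interp {L : MetricSignature.{v}} {O : ℕ → L.Sorts} {H : L.Sorts}
    {o : ℕ → L.Sorts} (hO : O = fun k => o (2 * k + 1)) (hH : H = o 0)
    (ho : ∀ k, o (2 * k + 2) = o 0) {r : ℝ} {m : ℕ} (hm : (1 / 2 : ℝ) ^ m < r)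
    {c : L.Preds → ℕ → ℕ} (hc : ∀ p k (t : unitInterval), (t : ℝ) ≤ (1 / 2) ^ c p k →
      (L.modulus p t : ℝ) ≤ (1 / 2) ^ k) :
    ∃ I : Interp.{v} L.toVocab O, I.Correct.{u, v} H r ∧
      ∀ (ν : Numbering L.toVocab) (h s : ℕ → ℕ), (∀ i, s i = ν.sortCode (o i)) →
        (∀ p, sigArity h (ν.predCode p) = tupleCode fun l => ν.sortCode (L.dom p l)) →
        (∀ p k, c p k = sigModulusCont h (Nat.pair (ν.predCode p) k)) →
        I.HasName ν (assemble (unionName h s m)) := by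
  subst hO hH
  exact ⟨_, unionInterp_correct ho hm hc, fun ν h s hs ha hc =>
    unionInterp_hasName (V := L.toVocab) hs m ha hc⟩

theorem exists_interp_correct (L : MetricSignature.{v}) (O : ℕ → L.Sorts) (H : L.Sorts) (r : ℝ)
    (hr : 0 < r) : ∃ I : Interp.{v} L.toVocab O, I.Correct.{u, v} H r := by
  obtain ⟨m, hm⟩ := exists_pow_lt_of_lt_one hr (by norm_num : (1 / 2 : ℝ) < 1)
  obtain ⟨c, hc⟩ := exists_modulus_le L
  obtain ⟨I, hI, -⟩ := exists_interp (o := interleave H O)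
    (funext fun k => (interleave_odd H O k).symm) rfl (interleave_even H O) hm hc
  exact ⟨I, hI⟩

/-- Codes of the sorts in `interleave`. -/
def interleaveCode (h : ℕ → ℕ) (i : ℕ) : ℕ :=
  if i % 2 = 0 then h (Nat.pair 2 0) else seqCode h (i / 2)

theorem RelRec.interleaveCode : RelRec MetricLogic.interleaveCode :=
  ite_eq (comp₂ Primrec.nat_mod .id (.const 2)) (.const 0) (RelRec.const (Nat.pair 2 0)).oracle
    (RelRec.id.div (.const 2)).seqCode

theorem RelRec.assemble_unionName {s : (ℕ → ℕ) → ℕ → ℕ} (hs : RelRec s) :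
    RelRec fun h (q : ℕ × ℕ) =>
      MetricLogic.assemble (MetricLogic.unionName h (s h) (q.1 + 1)) q.2 := by
  have h1 : ∀ i, RelRec fun h (q : (ℕ × ℕ) × ℕ) =>
      MetricLogic.unionName h (s h) (q.1.1 + 1) i q.2 := fun i =>
    RelRec.comp (g := fun _ (q : (ℕ × ℕ) × ℕ) => (q.1.1 + 1, q.2)) (RelRec.unionName hs i)
      (((RelRec.fst.comp .fst).add (.const 1)).pair .snd)
  exact RelRec.assemble (f := fun h i (q : ℕ × ℕ) c => MetricLogic.unionName h (s h) (q.1 + 1) i c)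
    (g := fun _ (q : ℕ × ℕ) => q.2) h1 .snd

/-- From r only a number m with 2^-m < r is needed, but it cannot be read off from a single
approximation of fixed precision. The search stops at the first k whose numerator is at least 2:
then r ≥ 2^-k, and m = k + 1 is suitable. -/
theorem uniformlyComputable_interp : UniformlyComputable (ι := Setting.{v} × ℝ)
      (fun i h => 0 < i.2 ∧ i.2 ≤ 1 ∧ i.1.FullName i.2 h)
      (fun i g => ∃ I : Interp.{v} i.1.L.toVocab i.1.seq,
        I.Correct.{u, v} i.1.home i.2 ∧ I.HasName i.1.ν g) := by
  have ht : RelRec fun h (k : ℕ) => 2 - h (Nat.pair 3 k) :=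
    RelRec.sub (f := fun _ _ => 2) (.const 2)
      (RelRec.oracle (f := fun _ k => Nat.pair 3 k) (RelRec.natPair (.const 3) .id))
  refine .of_search
    (f := fun h (q : ℕ × ℕ) => assemble (unionName h (interleaveCode h) (q.1 + 1)) q.2)
    (t := fun h k => 2 - h (Nat.pair 3 k))
    (RelRec.assemble_unionName RelRec.interleaveCode) ht ?_
  rintro ⟨D, r⟩ h ⟨hr, -, hD, hH, ha⟩
  have hapx : ∀ k, |(h (Nat.pair 3 k) : ℝ) / 2 ^ k - r| ≤ 1 / 2 ^ k := ha
  refine ⟨?_, fun k hk => ?_⟩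
  -- If 2^-k < r/3, the numerator is at least 2^k r - 1 > 2, so the search terminates.
  · obtain ⟨k, hk⟩ := exists_pow_lt_of_lt_one (show 0 < r / 3 by positivity)
      (by norm_num : (1 / 2 : ℝ) < 1)
    refine ⟨k, Nat.sub_eq_zero_of_le ?_⟩
    have h1 := (abs_le.1 (hapx k)).1
    have h2 : (0 : ℝ) < 2 ^ k := by positivity
    rw [one_div_pow, div_lt_div_iff₀ h2 (by norm_num)] at hk
    rw [neg_le_sub_iff_le_add, ← add_div, le_div_iff₀ h2] at h1
    have h3 : (2 : ℝ) ≤ h (Nat.pair 3 k) := by linarith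
    exact_mod_cast h3
  -- The approximation exceeds r by at most 2^-k and is at least 2·2^-k, so r ≥ 2^-k > 2^-(k+1).
  · have h0 : (2 : ℝ) ≤ h (Nat.pair 3 k) := by exact_mod_cast Nat.sub_eq_zero_iff_le.1 hk
    have h1 := (abs_le.1 (hapx k)).2
    have h2 : (0 : ℝ) < 2 ^ k := by positivity
    have hm : (1 / 2 : ℝ) ^ (k + 1) < r := by
      have h3 : (2 : ℝ) / 2 ^ k ≤ h (Nat.pair 3 k) / 2 ^ k := by gcongr
      have h4 : (2 : ℝ) / 2 ^ k = 2 * (1 / 2 ^ k) := by ring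
      have h5 : (0 : ℝ) < 1 / 2 ^ k := by positivity
      rw [pow_succ, one_div_pow]
      linarith
    obtain ⟨I, hI, hN⟩ := exists_interp (o := interleave D.home D.seq)
      (funext fun k => (interleave_odd D.home D.seq k).symm) rfl
      (interleave_even D.home D.seq) hm (modulus_le_of_le_namedCont hD.1)
    refine ⟨I, hI, hN D.ν h _ (fun i => ?_) hD.1.arity fun _ _ => rfl⟩
    unfold interleaveCode interleave
    split_ifs
    · exact hH
    · exact hD.2 _

end MetricLogic

theorem proposition4p2 :
    -- (i) the distance of the disjoint union is a complete metric
    (∀ (V : Vocab.{v}) (A : PreStructure.{u, v} V) (O : ℕ → V.Sorts),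
      IsMetric (Cmdu.d A O) ∧ IsCompleteMetric (Cmdu.d A O)) ∧
    -- (ii) its predicates are uniformly continuous, with moduli that depend on the signature and
    -- the sequence of sorts only, and they are Lipschitz if they originally were
    (∀ (L : MetricSignature.{v}) (O : ℕ → L.Sorts),
      (∀ A : LStructure.{u, v} L,
        (cmdu A.toPreStructure O).Respects (cmduSig L O) ∧
        (∀ q, UniformContinuous ((cmdu A.toPreStructure O).pred q)) ∧
        LipschitzWith 1 ((cmdu A.toPreStructure O).pred none)) ∧
      ∀ (p : L.Preds) (i : Fin (L.ar p) → ℕ) (hi : ∀ k, O (i k) = L.dom p k) (K : NNReal),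
        ∃ K' : NNReal,
          (∀ A : LStructure.{u, v} L, LipschitzWith K (A.pred p) →
            LipschitzWith K' ((cmdu A.toPreStructure O).pred (some ⟨p, i, hi⟩))) ∧
          ((∀ t : unitInterval, (L.modulus p t : ℝ) ≤ K * t) →
            ∀ t : unitInterval, ((cmduSig L O).modulus (some ⟨p, i, hi⟩) t : ℝ) ≤ K' * t)) ∧
    -- (iii), (iv) it is a uniformly definable imaginary in which each `O n` is a definable subset
    -- in definable bijection with the sort `O n`
    (∀ (L : MetricSignature.{v}) (O : ℕ → L.Sorts) (H : L.Sorts) (r : ℝ), 0 < r → r ≤ 1 →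
      ∃ I : Interp.{v} L.toVocab O, I.Correct.{u, v} H r) ∧
    -- and the formulas are uniformly computable
    UniformlyComputable (ι := Setting.{v} × ℝ)
      (fun i h => 0 < i.2 ∧ i.2 ≤ 1 ∧ i.1.FullName i.2 h)
      (fun i g => ∃ I : Interp.{v} i.1.L.toVocab i.1.seq,
        I.Correct.{u, v} i.1.home i.2 ∧ I.HasName i.1.ν g) ∧
    -- (iii) presentations of the disjoint union are uniformly computable
    UniformlyComputable (ι := Σ D : Setting.{v}, Σ A : LStructure.{u, v} D.L, A.Val)
      (fun i h => i.1.SeqName h ∧ IsPresentation i.1.ν i.2.1.toPreStructure i.2.2 (comp 2 h))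
      (fun i g => IsPresentation (i.1.ν.cmdu i.1.seq) (cmdu i.2.1.toPreStructure i.1.seq)
        (cmduPts i.2.1.toPreStructure i.1.seq i.2.2) g) ∧
    -- (iii) for computable data, the map of presentations is computable
    (∀ (D : Setting.{v}) (h : ℕ → ℕ), D.SeqName h → Computable h →
      ∃ F, RecFunctional F ∧ ∀ (A : LStructure.{u, v} D.L) (pts : A.Val) (f : ℕ → ℕ),
        IsPresentation D.ν A.toPreStructure pts f → ∃ g, Outputs F f g ∧
          IsPresentation (D.ν.cmdu D.seq) (cmdu A.toPreStructure D.seq)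
            (cmduPts A.toPreStructure D.seq pts) g) ∧
    -- (iv) each `O n` is definable in the disjoint union as a structure of its own
    (∀ (L : MetricSignature.{v}) (O : ℕ → L.Sorts), ∃ φ : ℕ → Formula (cmduVocab L.toVocab O), DefinesParts.{u, v} O φ) ∧
    UniformlyComputable (ι := Setting.{v}) (fun D h => D.SeqName h)
      (fun D g => ∃ φ : ℕ → Formula (cmduVocab D.L.toVocab D.seq), DefinesParts.{u, v} D.seq φ ∧
        ∀ n, (φ n).HasName (D.ν.cmdu D.seq) (comp n g)) ∧
    -- (v) the disjoint unions of structures in `C_{L,r}` are axiomatized by `T ∪ {Ξ ≥ r}`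
    (∀ (L : MetricSignature.{v}) (O : ℕ → L.Sorts) (H : L.Sorts), Function.Injective O →
      O 0 = H → ∃ T Ξ, Axiomatizes.{u, v} H O T Ξ) ∧
    -- with uniformly computable signature and theory
    UniformlyComputable (ι := Setting.{v}) (fun D h => D.SeqName h)
      (fun D g => IsSigName (cmduSig D.L D.seq) (D.ν.cmdu D.seq) g) ∧
    UniformlyComputable (ι := Setting.{v})
      (fun D h => Function.Injective D.seq ∧ D.seq 0 = D.home ∧ D.SeqName h)
      (fun D g => ∃ (T : ℕ → Formula (cmduVocab D.L.toVocab D.seq))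
        (Ξ : Formula (cmduVocab D.L.toVocab D.seq)),
        Axiomatizes.{u, v} D.home D.seq (Set.range T) Ξ ∧
        ∀ i, (T i).HasName (D.ν.cmdu D.seq) (comp i g)) :=
  ⟨fun _ A O => ⟨Cmdu.isMetric A O, Cmdu.isCompleteMetric A O⟩,
    fun _ O => ⟨fun A => ⟨cmdu_respects A, (cmduStructure A O).uniformContinuous_pred,
      cmdu_lipschitz_height _⟩, cmdu_lipschitz_extPred⟩,
    fun L O H r hr _ => exists_interp_correct L O H r hr,
    uniformlyComputable_interp, uniformlyComputable_presentation,
    fun D _ hD hh => computable_presentation D hD hh, fun _ O => ⟨_, definesParts O⟩,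
    uniformlyComputable_definesParts, fun _ _ _ hO hH => exists_axiomatizes hO hH,
    uniformlyComputable_cmduSig, uniformlyComputable_theory⟩
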